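/- Let $r\ge 2$ be an integer, let $f:(\mathbb R^d)^5\to\mathbb R^d$ be $C^r$ with $f(u_\pm,u_\pm,u_\pm,u_\pm,u_\pm)=0$ for two (possibly equal) points $u_\pm\in\mathbb R^d$, and let $(\sigma_A,\sigma_B)\in\mathbb Z^2$ with $\gcd(\sigma_A,\sigma_B)=1$. Suppose there are $c_*\neq 0$ and $\Phi_*\in C^{r+1}(\mathbb R,\mathbb R^d)$ with $\Phi_*(\xi)\to u_\pm$ as $\xi\to\pm\infty$ such that $u_{ij}(t)=\Phi_*(i\sigma_A+j\sigma_B+c_*t)$ solves $$\dot u_{ij}=f(u_{i+1,j},u_{i,j+1},u_{i-1,j},u_{i,j-1},u_{ij}),\qquad (i,j)\in\mathbb Z^2,\ t\in\mathbb R. $$ Write $(r_1,\dots,r_5)=(\sigma_A,\sigma_B,-\sigma_A,-\sigma_B,0)$, $(s_1,\dots,s_5)=(-\sigma_B,\sigma_A,\sigma_B,-\sigma_A,0)$, $[\tau p](\xi)=(p(\xi+r_j))_{j=1}^5$, $A_{z,j}(\xi)=e^{s_jz}D_jf([\tau\Phi_*](\xi))$ and, for $z\in\mathbb C$, $$[\mathcal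 L_zp](\xi)=-c_*p'(\xi)+\sum_{j=1}^5A_{z,j}(\xi)p(\xi+r_j),\qquad \mathcal L_z:W^{1,\infty}(\mathbb R;\mathbb C^d)\to L^\infty(\mathbb R;\mathbb C^d),$$ $$[\mathcal L^{\mathrm{adj}}_zq](\xi)=c_*q'(\xi)+\sum_{j=1}^5A_{z,j}(\xi-r_j)^*q(\xi-r_j),\qquad \Delta^\pm_z(s)=-c_*sI+\sum_{j=1}^5\big[\lim_{\xi\to\pm\infty}A_{z,j}(\xi)\big]e^{sr_j}.$$ Assume the following. * (HS1) $\det\Delta^\pm_{i\omega}(i\nu)\ne0$ for all $\omega\in[-\pi,\pi]$, $\nu\in\mathbb R$. * (HS2) $\mathcal L_{i\omega}$ is invertible from $W^{1,\infty}$ onto $L^\infty$ for all $\omega\in[-\pi,\pi]\setminus\{0\}$. * (HS3) $\operatorname{Ker}\mathcal L_0=\operatorname{span}\{\Phi_*'\}$ and $\Phi_*'\notin\operatorname{Range}\mathcal L_0$. Then there is a unique $\psi_*\in W^{1,\infty}(\mathbb R,\mathbb R^d)$ that spans $\operatorname{Ker}\mathcal L_0^{\mathrm{adj}}$ and has $\langle\psi_*,\Phi_*'\rangle=1$,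 where $\langle q,p\rangle=\int_{\mathbb R}\langle q(\xi),p(\xi)\rangle\,d\xi$; moreover $\psi_*\in L^1$. There are $\delta_z>0$ and maps $z\mapsto\lambda_z\in\mathbb C$, $z\mapsto\phi_z\in W^{1,\infty}(\mathbb R;\mathbb C^d)$, analytic on $|z|<\delta_z$, with $\lambda_0=0$, $\phi_0=\Phi_*'$ and, for all $|z|<\delta_z$, $\operatorname{Ker}(\mathcal L_z-\lambda_z)=\operatorname{span}\{\phi_z\}$, $\phi_z\notin\operatorname{Range}(\mathcal L_z-\lambda_z)$ and $\langle\psi_*,\phi_z\rangle=1$. Furthermore, let $\sigma_*=\sqrt{\sigma_A^2+\sigma_B^2}$, $(\sigma_A,\sigma_B)=\sigma_*(\cos\zeta_*,\sin\zeta_*)$ and $$[\tau_\varphi p](\xi)=\big(p(\xi+\sigma_*\cos(\varphi+\zeta_*)),\,p(\xi+\sigma_*\sin(\varphi+\zeta_*)),\,p(\xi-\sigma_*\cos(\varphi+\zeta_*)),\,p(\xi-\sigma_*\sin(\varphi+\zeta_*)),\,p(\xi)\big).$$ There exist $\delta_\varphi>0$ and pairs $(c_\varphi,\Phi_\varphi)\in\mathbb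 R\times W^{1,\infty}(\mathbb R,\mathbb R^d)$, $\varphi\in(-\delta_\varphi,\delta_\varphi)$, such that: 1. For every such $\varphi$, $\Phi_\varphi$ is differentiable with $c_\varphi\Phi_\varphi'(\xi)=f([\tau_\varphi\Phi_\varphi](\xi))$ for all $\xi\in\mathbb R$, and $u_{nl}(t)=\Phi_\varphi(n\cos\varphi+l\sin\varphi+c_\varphi t)$ satisfies, for all $n,l\in\mathbb Z$ and $t\in\mathbb R$, $$\dot u_{nl}=f(u_{n+\sigma_A,l-\sigma_B},u_{n+\sigma_B,l+\sigma_A},u_{n-\sigma_A,l+\sigma_B},u_{n-\sigma_B,l-\sigma_A},u_{nl}).$$ 2. $\varphi\mapsto c_\varphi\in\mathbb R$ and $\varphi\mapsto\Phi_\varphi\in W^{1,\infty}$ are $C^{r-1}$, with $c_0=c_*$ and $\Phi_0=\Phi_*$. 3. $\langle\psi_*,\Phi_\varphi\rangle=\langle\psi_*,\Phi_*\rangle$ for every such $\varphi$. 4. $[\partial_\varphi c_\varphi]_{\varphi=0}=[\partial_z\lambda_z]_{z=0}$ and $[\partial_\varphi\Phi_\varphi]_{\varphi=0}=[\partial_z\phi_z]_{z=0}$,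 for every branch $(\lambda_z,\phi_z)$ as above. 5. The second derivatives of $c_\varphi$ and $\Phi_\varphi$ at $\varphi=0$ exist. Write $\dot c,\ddot c,\dot\Phi,\ddot\Phi$ for the first and second $\varphi$-derivatives at $\varphi=0$, $A_k=[\partial_z^k\mathcal L_z]_{z=0}$, $[B_1p](\xi)=-\sum_{j=1}^{5}r_jD_jf([\tau\Phi_*](\xi))p(\xi+r_j)$ and $X(\xi)=\big(s_j\Phi_*'(\xi+r_j)+\dot\Phi(\xi+r_j)\big)_{j=1}^5$. Then $$\mathcal L_0\dot\Phi=-A_1\Phi_*'+\dot c\,\Phi_*',$$ $$\mathcal L_0\ddot\Phi=\ddot c\,\Phi_*'+2\dot c\,\dot\Phi'-D^2f(\tau\Phi_*)[X,X]-A_2\Phi_*''-B_1\Phi_*'-2A_1\dot\Phi',$$ $$\dot c=\langle\psi_*,A_1\Phi_*'\rangle,$$ $$\ddot c=\langle\psi_*,D^2f(\tau\Phi_*)[X,X]\rangle+\langle\psi_*,A_2\Phi_*''\rangle+\langle\psi_*,B_1\Phi_*'\rangle+2\langle\psi_*,A_1\dot\Phi'\rangle-2\dot c\,\langle\psi_*,\dot\Phi'\rangle.$$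 -/

import Mathlib

open MeasureTheory Filter Topology Matrix
open scoped ENNReal

noncomputable section

/-! ### Function spaces

`ℝ^d` and `ℂ^d` are `Fin d → ℝ` and `Fin d → ℂ`; only topological notions (continuity, smoothness,
boundedness) are used on them, so the choice among the equivalent norms plays no role. -/

/-- The Sobolev space `W^{1,∞}(ℝ; 𝕜^d)`, as a subspace of a product: an element is a pair `(p, p')` consisting of a bounded
continuous function `p` (the continuous representative of the class) and its weak derivative
`p' ∈ L^∞`, in the sense that `p` is a primitive of `p'`. The norm is
`max (‖p‖_∞, ‖p'‖_∞)`, inherited from the product. -/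
def sobolevSubmodule (𝕜 : Type) [RCLike 𝕜] (d : ℕ) :
    Submodule 𝕜 (BoundedContinuousFunction ℝ (Fin d → 𝕜) ×
      Lp (Fin d → 𝕜) ∞ (volume : Measure ℝ)) where
  carrier := {p | ∀ a b : ℝ, ∫ x in a..b, p.2 x = p.1 b - p.1 a}
  zero_mem' := by
    intro a b
    have h : ∀ᵐ x ∂(volume : Measure ℝ),
        (((0 : BoundedContinuousFunction ℝ (Fin d → 𝕜) ×
          Lp (Fin d → 𝕜) ∞ (volume : Measure ℝ)).2 : ℝ → Fin d → 𝕜)) x = 0 := by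
      exact Lp.coeFn_zero _ _ _
    rw [intervalIntegral.integral_congr_ae (g := fun _ => (0 : Fin d → 𝕜))
      (h.mono fun x hx _ => hx)]
    simp
  add_mem' := by
    intro p q hp hq a b
    have hi : ∀ g : Lp (Fin d → 𝕜) ∞ (volume : Measure ℝ),
        IntervalIntegrable g volume a b := fun g =>
      (((Lp.memLp g).locallyIntegrable le_top).integrableOn_isCompact
        isCompact_uIcc).intervalIntegrable
    have h : ∀ᵐ x ∂(volume : Measure ℝ), (p + q).2 x = p.2 x + q.2 x :=
      Lp.coeFn_add p.2 q.2
    rw [intervalIntegral.integral_congr_ae (g := fun x => p.2 x + q.2 x)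
      (h.mono fun x hx _ => hx), intervalIntegral.integral_add (hi _) (hi _), hp a b, hq a b]
    simp only [Prod.fst_add, BoundedContinuousFunction.coe_add, Pi.add_apply]
    abel
  smul_mem' := by
    intro k p hp a b
    have h : ∀ᵐ x ∂(volume : Measure ℝ), (k • p).2 x = k • p.2 x :=
      Lp.coeFn_smul k p.2
    rw [intervalIntegral.integral_congr_ae (g := fun x => k • p.2 x)
      (h.mono fun x hx _ => hx), intervalIntegral.integral_smul, hp a b]
    simp [smul_sub]

/-- The Sobolev space `W^{1,∞}(ℝ; 𝕜^d)`, a normed space over `𝕜`. -/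
abbrev W1inf (𝕜 : Type) [RCLike 𝕜] (d : ℕ) : Type := sobolevSubmodule 𝕜 d

/-- The continuous representative of an element of `W^{1,∞}`. -/
def W1inf.fn {𝕜 : Type} [RCLike 𝕜] {d : ℕ} (p : W1inf 𝕜 d) : ℝ → Fin d → 𝕜 := p.1.1

/-- (A representative of) the weak derivative of an element of `W^{1,∞}`. -/
def W1inf.der {𝕜 : Type} [RCLike 𝕜] {d : ℕ} (p : W1inf 𝕜 d) : ℝ → Fin d → 𝕜 := p.1.2

/-- A real vector-valued function, regarded as a complex vector-valued function. -/
def cplx {d : ℕ} (p : ℝ → Fin d → ℝ) : ℝ → Fin d → ℂ := fun ξ a => (p ξ a : ℂ)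

/-- The `L²` pairing `⟨q, p⟩ = ∫ ⟨q(ξ), p(ξ)⟩ dξ`, conjugate linear in `q`. -/
def pairing {𝕜 : Type} [RCLike 𝕜] {d : ℕ} (q p : ℝ → Fin d → 𝕜) : 𝕜 :=
  ∫ ξ : ℝ, star (q ξ) ⬝ᵥ p ξ

/-! ### The lattice differential equation -/

/-- `u_{ij}(t) = u t i j` solves
`u̇_{ij} = f(u_{i+1,j}, u_{i,j+1}, u_{i-1,j}, u_{i,j-1}, u_{ij})` on `ℤ²`, for all `t ∈ ℝ`. -/
def SolvesLDE {d : ℕ} (f : (Fin 5 → Fin d → ℝ) → Fin d → ℝ) (u : ℝ → ℤ → ℤ → Fin d → ℝ) : Prop :=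
  ∀ (t : ℝ) (i j : ℤ), HasDerivAt (fun s => u s i j)
    (f ![u t (i + 1) j, u t i (j + 1), u t (i - 1) j, u t i (j - 1), u t i j]) t

/-- The same equation in the coordinates `n = σ_A i + σ_B j`, `l = σ_A j - σ_B i`;
here `u_{nl}(t) = u t n l`. -/
def SolvesCrossLDE {d : ℕ} (f : (Fin 5 → Fin d → ℝ) → Fin d → ℝ) (σA σB : ℤ)
    (u : ℝ → ℤ → ℤ → Fin d → ℝ) : Prop :=
  ∀ (t : ℝ) (n l : ℤ), HasDerivAt (fun s => u s n l)
    (f ![u t (n + σA) (l - σB), u t (n + σB) (l + σA),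
      u t (n - σA) (l + σB), u t (n - σB) (l - σA), u t n l]) t

/-- The shifts `r_1, …, r_5`. -/
def shiftN (σA σB : ℤ) : Fin 5 → ℤ := ![σA, σB, -σA, -σB, 0]

/-- The transverse shifts `(-σ_B, σ_A, σ_B, -σ_A, 0)`: the exponents in the coefficients
`A_{z,j}`, and also the vector `s^⋄_0`. -/
def shiftL (σA σB : ℤ) : Fin 5 → ℤ := ![-σB, σA, σB, -σA, 0]

/-- `[τ p](ξ) = (p(ξ+σ_A), p(ξ+σ_B), p(ξ-σ_A), p(ξ-σ_B), p(ξ))`. -/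
def stencil {d : ℕ} (σA σB : ℤ) (p : ℝ → Fin d → ℝ) (ξ : ℝ) : Fin 5 → Fin d → ℝ :=
  fun j => p (ξ + shiftN σA σB j)

/-- `σ_* = √(σ_A² + σ_B²)`. -/
def sigmaStar (σA σB : ℤ) : ℝ := Real.sqrt ((σA : ℝ) ^ 2 + (σB : ℝ) ^ 2)

/-- The angle `ζ_*` with `(σ_A, σ_B) = σ_* (cos ζ_*, sin ζ_*)`. -/
def zetaStar (σA σB : ℤ) : ℝ := Complex.arg ⟨(σA : ℝ), (σB : ℝ)⟩

theorem sigmaStar_mul_cos (σA σB : ℤ) :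
    sigmaStar σA σB * Real.cos (zetaStar σA σB) = σA := by
  have h := Complex.norm_mul_cos_arg ⟨(σA : ℝ), (σB : ℝ)⟩
  rwa [Complex.norm_def, Complex.normSq_mk, ← sq, ← sq] at h

theorem sigmaStar_mul_sin (σA σB : ℤ) :
    sigmaStar σA σB * Real.sin (zetaStar σA σB) = σB := by
  have h := Complex.norm_mul_sin_arg ⟨(σA : ℝ), (σB : ℝ)⟩
  rwa [Complex.norm_def, Complex.normSq_mk, ← sq, ← sq] at h

/-- The rotated stencil `[τ_φ p](ξ)`. -/
def rotStencil {d : ℕ} (σA σB : ℤ) (φ : ℝ) (p : ℝ → Fin d → ℝ) (ξ : ℝ) : Fin 5 → Fin d → ℝ :=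
  ![p (ξ + sigmaStar σA σB * Real.cos (φ + zetaStar σA σB)),
    p (ξ + sigmaStar σA σB * Real.sin (φ + zetaStar σA σB)),
    p (ξ - sigmaStar σA σB * Real.cos (φ + zetaStar σA σB)),
    p (ξ - sigmaStar σA σB * Real.sin (φ + zetaStar σA σB)),
    p ξ]

/-- `(c, p)` satisfies the travelling wave equation `c p'(ξ) = f([τ_φ p](ξ))` for all `ξ`. -/
def SolvesMFDE {d : ℕ} (f : (Fin 5 → Fin d → ℝ) → Fin d → ℝ) (σA σB : ℤ) (φ c : ℝ)
    (p : ℝ → Fin d → ℝ) : Prop :=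
  ∀ ξ : ℝ, DifferentiableAt ℝ p ξ ∧ c • deriv p ξ = f (rotStencil σA σB φ p ξ)

/-! ### The linearized operators -/

/-- The Jacobian matrix `D_j f(U)` of `f` with respect to its `j`-th argument. -/
def jac {d : ℕ} (f : (Fin 5 → Fin d → ℝ) → Fin d → ℝ) (U : Fin 5 → Fin d → ℝ) (j : Fin 5) :
    Matrix (Fin d) (Fin d) ℝ :=
  Matrix.of fun a b => fderiv ℝ f U (Pi.single j (Pi.single b 1)) a

/-- The coefficients `A_{z,j}(ξ)`. -/
def coefA {d : ℕ} (f : (Fin 5 → Fin d → ℝ) → Fin d → ℝ) (σA σB : ℤ) (Φs : ℝ → Fin d → ℝ)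
    (z : ℂ) (j : Fin 5) (ξ : ℝ) : Matrix (Fin d) (Fin d) ℂ :=
  Complex.exp (z * (shiftL σA σB j : ℂ)) •
    (jac f (stencil σA σB Φs ξ) j).map (fun x : ℝ => (x : ℂ))

/-- `[𝓛_z p](ξ) = -c_* p'(ξ) + ∑_j A_{z,j}(ξ) p(ξ + r_j)`, where `p'` is passed separately. -/
def opL {d : ℕ} (f : (Fin 5 → Fin d → ℝ) → Fin d → ℝ) (σA σB : ℤ) (cs : ℝ)
    (Φs : ℝ → Fin d → ℝ) (z : ℂ) (p p' : ℝ → Fin d → ℂ) (ξ : ℝ) : Fin d → ℂ :=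
  -((cs : ℂ) • p' ξ) + ∑ j : Fin 5, coefA f σA σB Φs z j ξ *ᵥ p (ξ + shiftN σA σB j)

/-- `[𝓛^adj_z q](ξ) = c_* q'(ξ) + ∑_j A_{z,j}(ξ - r_j)^* q(ξ - r_j)`. -/
def opLadj {d : ℕ} (f : (Fin 5 → Fin d → ℝ) → Fin d → ℝ) (σA σB : ℤ) (cs : ℝ)
    (Φs : ℝ → Fin d → ℝ) (z : ℂ) (q q' : ℝ → Fin d → ℂ) (ξ : ℝ) : Fin d → ℂ :=
  (cs : ℂ) • q' ξ + ∑ j : Fin 5,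
    (coefA f σA σB Φs z j (ξ - shiftN σA σB j))ᴴ *ᵥ q (ξ - shiftN σA σB j)

/-- The operator `A_k = [∂_z^k 𝓛_z]_{z=0}`, `k ≥ 1`, on real functions; see `iteratedDeriv_opL`. -/
def opA {d : ℕ} (f : (Fin 5 → Fin d → ℝ) → Fin d → ℝ) (σA σB : ℤ) (Φs : ℝ → Fin d → ℝ) (k : ℕ)
    (p : ℝ → Fin d → ℝ) (ξ : ℝ) : Fin d → ℝ :=
  ∑ j : Fin 5, (shiftL σA σB j : ℝ) ^ k •
    (jac f (stencil σA σB Φs ξ) j *ᵥ p (ξ + shiftN σA σB j))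

/-- `B_1 p = Df(τ Φ_*) (-σ_A, -σ_B, σ_A, σ_B, 0) [τ p]`. -/
def opB {d : ℕ} (f : (Fin 5 → Fin d → ℝ) → Fin d → ℝ) (σA σB : ℤ) (Φs : ℝ → Fin d → ℝ)
    (p : ℝ → Fin d → ℝ) (ξ : ℝ) : Fin d → ℝ :=
  ∑ j : Fin 5, (![-σA, -σB, σA, σB, 0] j : ℝ) •
    (jac f (stencil σA σB Φs ξ) j *ᵥ p (ξ + shiftN σA σB j))

/-- `D²f(τ Φ_*)[X, X]` with `X = s^⋄_0 τ Φ_*' + τ w`. -/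
def quadTerm {d : ℕ} (f : (Fin 5 → Fin d → ℝ) → Fin d → ℝ) (σA σB : ℤ) (Φs : ℝ → Fin d → ℝ)
    (w : ℝ → Fin d → ℝ) (ξ : ℝ) : Fin d → ℝ :=
  fderiv ℝ (fderiv ℝ f) (stencil σA σB Φs ξ)
    (fun j => (shiftL σA σB j : ℝ) • stencil σA σB (deriv Φs) ξ j + stencil σA σB w ξ j)
    (fun j => (shiftL σA σB j : ℝ) • stencil σA σB (deriv Φs) ξ j + stencil σA σB w ξ j)

/-- The characteristic matrix `Δ_z(s)` of the limiting equation at the equilibrium `u`; the limits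
of the `A_{z,j}(ξ)` at infinity are `e^{z (shiftL j)} D_j f(u,u,u,u,u)`. -/
def charMat {d : ℕ} (f : (Fin 5 → Fin d → ℝ) → Fin d → ℝ) (σA σB : ℤ) (cs : ℝ)
    (u : Fin d → ℝ) (z s : ℂ) : Matrix (Fin d) (Fin d) ℂ :=
  -(((cs : ℂ) * s) • (1 : Matrix (Fin d) (Fin d) ℂ)) +
    ∑ j : Fin 5, Complex.exp (s * (shiftN σA σB j : ℂ)) •
      Complex.exp (z * (shiftL σA σB j : ℂ)) •
        (jac f (fun _ => u) j).map (fun x : ℝ => (x : ℂ))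

/-- The operators `opA` are the derivatives of `𝓛_z` at `z = 0`. -/
theorem iteratedDeriv_opL {d : ℕ} (f : (Fin 5 → Fin d → ℝ) → Fin d → ℝ) (σA σB : ℤ) (cs : ℝ)
    (Φs p p' : ℝ → Fin d → ℝ) (ξ : ℝ) (k : ℕ) (hk : 1 ≤ k) :
    iteratedDeriv k (fun z => opL f σA σB cs Φs z (cplx p) (cplx p') ξ) 0 =
      cplx (opA f σA σB Φs k p) ξ := by
  set V : Fin 5 → Fin d → ℂ := fun j =>
    (jac f (stencil σA σB Φs ξ) j).map (fun x : ℝ => (x : ℂ)) *ᵥ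
      cplx p (ξ + shiftN σA σB j) with hV
  have hfun : (fun z => opL f σA σB cs Φs z (cplx p) (cplx p') ξ) = fun z : ℂ =>
      -((cs : ℂ) • cplx p' ξ) + ∑ j : Fin 5, Complex.exp (z * (shiftL σA σB j : ℂ)) • V j := by
    funext z
    simp only [opL, coefA, hV, Matrix.smul_mulVec]
  have hexp : ∀ (j : Fin 5) (z : ℂ),
      HasDerivAt (fun z : ℂ => Complex.exp (z * (shiftL σA σB j : ℂ)))
        ((shiftL σA σB j : ℂ) * Complex.exp (z * (shiftL σA σB j : ℂ))) z := by
    intro j z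
    have := ((hasDerivAt_id z).mul_const (shiftL σA σB j : ℂ)).cexp
    simpa [mul_comm] using this
  have key : iteratedDeriv k (fun z : ℂ =>
      -((cs : ℂ) • cplx p' ξ) + ∑ j : Fin 5, Complex.exp (z * (shiftL σA σB j : ℂ)) • V j) =
      fun z : ℂ => ∑ j : Fin 5,
        ((shiftL σA σB j : ℂ) ^ k * Complex.exp (z * (shiftL σA σB j : ℂ))) • V j := by
    induction k, hk using Nat.le_induction with
    | base =>
      funext z
      rw [iteratedDeriv_one]
      have h := (HasDerivAt.fun_sum (u := Finset.univ)
        fun j _ => (hexp j z).smul_const (V j)).const_add (-((cs : ℂ) • cplx p' ξ))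
      rw [h.deriv]
      simp
    | succ k _ ih =>
      funext z
      rw [iteratedDeriv_succ, ih]
      have h := HasDerivAt.fun_sum (u := Finset.univ)
        fun j _ => ((hexp j z).const_mul ((shiftL σA σB j : ℂ) ^ k)).smul_const (V j)
      rw [h.deriv]
      refine Finset.sum_congr rfl fun j _ => ?_
      rw [← mul_assoc, pow_succ]
  rw [hfun, key]
  funext a
  simp [cplx, opA, hV, Matrix.mulVec, dotProduct, Finset.sum_apply]

/-! ### The assumptions -/

/-- (Hf). -/
def HypF {d : ℕ} (r : ℕ) (f : (Fin 5 → Fin d → ℝ) → Fin d → ℝ) (um up : Fin d → ℝ) : Prop :=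
  2 ≤ r ∧ ContDiff ℝ r f ∧ f (fun _ => um) = 0 ∧ f (fun _ => up) = 0

/-- (HΦ). -/
def HypPhi {d : ℕ} (r : ℕ) (f : (Fin 5 → Fin d → ℝ) → Fin d → ℝ) (um up : Fin d → ℝ)
    (σA σB : ℤ) (cs : ℝ) (Φs : ℝ → Fin d → ℝ) : Prop :=
  cs ≠ 0 ∧ ContDiff ℝ (r + 1) Φs ∧
    SolvesLDE f (fun t i j => Φs (i * σA + j * σB + cs * t)) ∧
    Tendsto Φs atBot (𝓝 um) ∧ Tendsto Φs atTop (𝓝 up)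

/-- (HS1). -/
def HypS1 {d : ℕ} (f : (Fin 5 → Fin d → ℝ) → Fin d → ℝ) (um up : Fin d → ℝ)
    (σA σB : ℤ) (cs : ℝ) : Prop :=
  ∀ ω ∈ Set.Icc (-Real.pi) Real.pi, ∀ ν : ℝ,
    (charMat f σA σB cs um (Complex.I * ω) (Complex.I * ν)).det ≠ 0 ∧
    (charMat f σA σB cs up (Complex.I * ω) (Complex.I * ν)).det ≠ 0

/-- (HS2): `𝓛_{iω}` is a bijection from `W^{1,∞}` onto `L^∞` for `ω ∈ [-π, π] \ {0}`.
(The family `ω ↦ 𝓛_{iω}` is `2π`-periodic.) -/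
def HypS2 {d : ℕ} (f : (Fin 5 → Fin d → ℝ) → Fin d → ℝ) (σA σB : ℤ) (cs : ℝ)
    (Φs : ℝ → Fin d → ℝ) : Prop :=
  ∀ ω ∈ Set.Icc (-Real.pi) Real.pi, ω ≠ 0 →
    ∀ g : Lp (Fin d → ℂ) ∞ (volume : Measure ℝ), ∃! p : W1inf ℂ d,
      opL f σA σB cs Φs (Complex.I * ω) p.fn p.der =ᵐ[volume] g

/-- (HS3): `Ker 𝓛_0 = span {Φ_*'}` and `Φ_*' ∉ Range 𝓛_0`. -/
def HypS3 {d : ℕ} (f : (Fin 5 → Fin d → ℝ) → Fin d → ℝ) (σA σB : ℤ) (cs : ℝ)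
    (Φs : ℝ → Fin d → ℝ) : Prop :=
  (∀ p : W1inf ℂ d, opL f σA σB cs Φs 0 p.fn p.der =ᵐ[volume] 0 ↔
    ∃ a : ℂ, p.fn = a • cplx (deriv Φs)) ∧
  ¬ ∃ p : W1inf ℂ d, opL f σA σB cs Φs 0 p.fn p.der =ᵐ[volume] cplx (deriv Φs)

/-! ### The adjoint kernel element and the eigenvalue branch -/

/-- `ψ = ψ_*`: the real function in `W^{1,∞}` that spans `Ker 𝓛^adj_0` and is normalized by
`∫ ⟨ψ_*, Φ_*'⟩ = 1`. -/
def IsPsiStar {d : ℕ} (f : (Fin 5 → Fin d → ℝ) → Fin d → ℝ) (σA σB : ℤ) (cs : ℝ)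
    (Φs : ℝ → Fin d → ℝ) (ψ : W1inf ℝ d) : Prop :=
  (∀ q : W1inf ℂ d, opLadj f σA σB cs Φs 0 q.fn q.der =ᵐ[volume] 0 ↔
    ∃ a : ℂ, q.fn = a • cplx ψ.fn) ∧
  pairing ψ.fn (deriv Φs) = 1

/-- `(lam, ph) = (λ_z, φ_z)` is the branch of simple eigenvalues and eigenfunctions of `𝓛_z` for
`|z| < δ` with `λ_0 = 0`, `φ_0 = Φ_*'`, `⟨ψ_*, φ_z⟩ = 1`, analytic in `z` as a map into
`ℂ × W^{1,∞}`. -/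
def IsEigenBranch {d : ℕ} (f : (Fin 5 → Fin d → ℝ) → Fin d → ℝ) (σA σB : ℤ) (cs : ℝ)
    (Φs : ℝ → Fin d → ℝ) (ψ : W1inf ℝ d) (δ : ℝ) (lam : ℂ → ℂ) (ph : ℂ → W1inf ℂ d) : Prop :=
  0 < δ ∧
  (∀ z : ℂ, ‖z‖ < δ →
    (∀ p : W1inf ℂ d,
      opL f σA σB cs Φs z p.fn p.der - lam z • p.fn =ᵐ[volume] 0 ↔ ∃ a : ℂ, p = a • ph z) ∧
    (¬ ∃ p : W1inf ℂ d,
      opL f σA σB cs Φs z p.fn p.der - lam z • p.fn =ᵐ[volume] (ph z).fn) ∧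
    pairing (cplx ψ.fn) (ph z).fn = 1) ∧
  lam 0 = 0 ∧ (ph 0).fn = cplx (deriv Φs) ∧
  AnalyticOnNhd ℂ lam (Metric.ball 0 δ) ∧ AnalyticOnNhd ℂ ph (Metric.ball 0 δ)

end

/-!
The linearization `𝓛₀` at the wave `Φ` and its modulations `𝓛_z` are operators of the form
`p ↦ -c p' + ∑ j, a_j(ξ) p(ξ + ρ_j)` from `W^{1,∞}` to `L^∞`, with coefficients that converge at
`±∞` to hyperbolic ones. Since `0` is a simple eigenvalue of `𝓛₀`, everything can be made to rest on
the bordered operator `(p, γ) ↦ (𝓛₀ p - γ Φ', ⟨ψ, p⟩)` being bijective, with `ψ` the normalized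
kernel element of the adjoint.

*Compactness.* A hyperbolic equation with constant coefficients has no nonzero bounded solution
(`eq_zero_of_hyperbolic`): a bounded solution would produce, as a limit of translated approximate
eigenvectors of `d/dξ`, a solution `e^{iνξ} w`. By limits of translates, bounded solutions of
`𝓛₀ p = 0` and of the adjoint equation decay exponentially (`exists_exp_bound`), and injective
rank one perturbations of `𝓛₀` are bounded below (`bordL_bounded_below`). As `𝓛₀` is the limit of
the invertible operators `𝓛_{iω}`, `ω → 0`, a suitable rank one perturbation is invertible
(`SimpleKer.bordL_bijective`). Thus no Fredholm theory is needed: the range of `𝓛₀` is the kernel of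
a continuous functional `m` on `L^∞` with `m(Φ') = 1` (`SimpleKer.exists_functional`).

*The adjoint kernel.* A functional on `L^∞` need not be an integral. Vanishing on the range, however,
`m` is bounded in the norm of `L¹` on integrable functions (`exists_L1_bound`), has a Lipschitz
density there (`functional_indL`), and this density solves the adjoint equation
(`isSol_density`). Conversely every bounded solution of the adjoint equation annihilates the
range, which gives uniqueness (`SimpleKer.adjoint_unique`). The coefficients at `z = 0` being real,
`ψ` is real (`IsWave.exists_psi`).

*The branches.* Both the eigenvalue problem `𝓛_z p = λ p`, `⟨ψ, p⟩ = 1`, and the equation for the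
rotated waves, `c p' = f(τ_φ p)`, `⟨ψ, p⟩ = ⟨ψ, Φ⟩`, have the bordered operator as their linearization
at the known solution. The first is analytic in `z`. In the second, `τ_φ p` is translated by amounts
that depend on `φ`, hence is not differentiable in `φ` for fixed `p ∈ W^{1,∞}`; as an operator from
`W^{1,∞}` to bounded continuous functions, `τ_φ` is still continuous in `φ`. Accordingly the implicit
function theorem is used in a version with a merely continuous parameter
(`PartialStrict.exists_implicit`), which yields `IsWave.exists_eigenBranch` and, by
`exists_waveFam`, a continuous branch of rotated waves.

*Smoothness.* The loss of derivatives is recovered from the equation, which expresses `Φ_φ'` through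
`Φ_φ`. Families of functions are measured by `SmoothTr`: the translates `V_φ(· + t)` are of class
`C^k` jointly in `φ` and `t`. This class is stable under translation by `φ`-dependent amounts, and
`V` is in the class for `k + 1` if its `φ`-derivative and its spatial derivative are in the class for
`k`. Since `∂_φ Φ_φ` solves a bordered linear equation whose data are built from `Φ_φ` and
`Φ_φ'`, induction gives smoothness for the linear equations (`LinFam.smooth`) and then for the waves
(`WaveFam.smooth`).

*Expansion.* Differentiating the bordered equations at `φ = 0` gives the equations for the first and
second derivatives (`IsWave.bordSol_one`, `IsWave.bordSol_two`), where the terms with `A₁`, `A₂`, `B₁`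
come from the derivatives `s_j` and `-r_j` of the shifts. Pairing with `ψ`, which annihilates the
range of `𝓛₀`, gives the formulas for the derivatives of the speed (`IsWave.eq_neg_pairing`). The
derivative of `(φ_z, λ_z)` at `z = 0` solves the same uniquely solvable bordered equation as that of
`(Φ_φ, c_φ)`, so the two agree (`IsWave.eigenBranch_deriv`).
-/

open scoped BoundedContinuousFunction

noncomputable section

namespace LatticeWave

/-! ### Bounded functions and `W^{1,∞}` -/

/-! Instances on `W^{1,∞}` routed through its normed group structure, so that the algebraic
structures on spaces of operators are found. -/

scoped instance instNormedAddCommGroupW1inf {𝕜 : Type} [RCLike 𝕜] {d : ℕ} :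
    NormedAddCommGroup (W1inf 𝕜 d) :=
  inferInstance

scoped instance instAddCommGroupW1inf {𝕜 : Type} [RCLike 𝕜] {d : ℕ} : AddCommGroup (W1inf 𝕜 d) :=
  NormedAddCommGroup.toAddCommGroup

scoped instance instAddCommMonoidW1inf {𝕜 : Type} [RCLike 𝕜] {d : ℕ} :
    AddCommMonoid (W1inf 𝕜 d) :=
  AddCommGroup.toAddCommMonoid

scoped instance instNormedSpaceW1inf {𝕜 : Type} [RCLike 𝕜] {d : ℕ} : NormedSpace 𝕜 (W1inf 𝕜 d) :=
  inferInstance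

scoped instance instModuleW1inf {𝕜 : Type} [RCLike 𝕜] {d : ℕ} : Module 𝕜 (W1inf 𝕜 d) :=
  NormedSpace.toModule

section Basics

variable {𝕜 : Type} [RCLike 𝕜] {d : ℕ}

/-- `L^∞(ℝ; 𝕜^d)`. -/
abbrev Linf (𝕜 : Type) [RCLike 𝕜] (d : ℕ) : Type := Lp (Fin d → 𝕜) ∞ (volume : Measure ℝ)

theorem Linf.ae_norm_le (g : Linf 𝕜 d) : ∀ᵐ x, ‖g x‖ ≤ ‖g‖ := by
  have h := ae_le_eLpNormEssSup (f := (g : ℝ → Fin d → 𝕜)) (μ := volume)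
  filter_upwards [h] with x hx
  rw [← eLpNorm_exponent_top] at hx
  rw [Lp.norm_def, ← toReal_enorm]
  exact ENNReal.toReal_mono (Lp.eLpNorm_ne_top g) hx

theorem Linf.norm_le (g : Linf 𝕜 d) {C : ℝ} (hC : 0 ≤ C) (h : ∀ᵐ x, ‖g x‖ ≤ C) : ‖g‖ ≤ C := by
  rw [Lp.norm_def, eLpNorm_exponent_top]
  refine ENNReal.toReal_le_of_le_ofReal hC ?_
  refine eLpNormEssSup_le_of_ae_bound h

theorem Linf.intervalIntegrable (g : Linf 𝕜 d) (a b : ℝ) : IntervalIntegrable g volume a b :=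
  (((Lp.memLp g).locallyIntegrable le_top).integrableOn_isCompact isCompact_uIcc).intervalIntegrable

/-- The class in `L^∞` of a bounded measurable function (and `0` for any other function). -/
def toLinf (g : ℝ → Fin d → 𝕜) : Linf 𝕜 d :=
  open Classical in if h : MemLp g ∞ volume then h.toLp else 0

theorem memLp_top {g : ℝ → Fin d → 𝕜} (hg : AEStronglyMeasurable g volume) {C : ℝ}
    (hC : ∀ x, ‖g x‖ ≤ C) : MemLp g ∞ volume :=
  memLp_top_of_bound hg C (Eventually.of_forall hC)

theorem coe_toLinf {g : ℝ → Fin d → 𝕜} (hg : MemLp g ∞ volume) : toLinf g =ᵐ[volume] g := by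
  rw [toLinf, dif_pos hg]
  exact hg.coeFn_toLp

theorem toLinf_eq_iff {g : ℝ → Fin d → 𝕜} (hg : MemLp g ∞ volume) (h : Linf 𝕜 d) :
    toLinf g = h ↔ g =ᵐ[volume] h :=
  ⟨fun e => (coe_toLinf hg).symm.trans (by rw [e]), fun e => Lp.ext ((coe_toLinf hg).trans e)⟩

theorem norm_toLinf_le {g : ℝ → Fin d → 𝕜} {C : ℝ} (h0 : 0 ≤ C) (hC : ∀ x, ‖g x‖ ≤ C) :
    ‖toLinf g‖ ≤ C := by
  by_cases hg : MemLp g ∞ volume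
  · exact Linf.norm_le _ h0 ((coe_toLinf hg).mono fun x hx => hx ▸ hC x)
  · rw [toLinf, dif_neg hg, norm_zero]; exact h0

theorem memLp_bcf (p : ℝ →ᵇ (Fin d → 𝕜)) : MemLp p ∞ volume :=
  memLp_top p.continuous.aestronglyMeasurable p.norm_coe_le_norm

/-- The inclusion of the bounded continuous functions into `L^∞`. -/
def bcfToLinf : (ℝ →ᵇ (Fin d → 𝕜)) →L[𝕜] Linf 𝕜 d :=
  LinearMap.mkContinuous
    { toFun := fun p => toLinf p
      map_add' := fun p q => by
        rw [toLinf_eq_iff (memLp_bcf _)]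
        refine EventuallyEq.symm ((Lp.coeFn_add _ _).trans ?_)
        filter_upwards [coe_toLinf (memLp_bcf p), coe_toLinf (memLp_bcf q)] with x h1 h2
        simp [h1, h2]
      map_smul' := fun k p => by
        rw [toLinf_eq_iff (memLp_bcf _)]
        refine EventuallyEq.symm ((Lp.coeFn_smul _ _).trans ?_)
        filter_upwards [coe_toLinf (memLp_bcf p)] with x h1
        simp [h1] }
    1 fun p => by
      rw [one_mul]
      exact norm_toLinf_le (norm_nonneg _) p.norm_coe_le_norm

theorem coe_bcfToLinf (p : ℝ →ᵇ (Fin d → 𝕜)) : bcfToLinf p =ᵐ[volume] p :=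
  coe_toLinf (memLp_bcf p)

theorem bcf_ae_eq {p q : ℝ → Fin d → 𝕜} (hp : Continuous p) (hq : Continuous q)
    (h : p =ᵐ[volume] q) : p = q :=
  Continuous.ae_eq_iff_eq volume hp hq |>.1 h

theorem bcfToLinf_injective : Function.Injective (bcfToLinf (𝕜 := 𝕜) (d := d)) := by
  intro p q h
  apply DFunLike.coe_injective
  refine bcf_ae_eq p.continuous q.continuous ?_
  exact (coe_bcfToLinf p).symm.trans (h ▸ coe_bcfToLinf q)

/-- Integration over `[a, b]` as a functional on `L^∞`. -/
def integralCLM (a b : ℝ) : Linf 𝕜 d →L[𝕜] (Fin d → 𝕜) :=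
  LinearMap.mkContinuous
    { toFun := fun g => ∫ x in a..b, g x
      map_add' := fun g h => by
        rw [← intervalIntegral.integral_add (g.intervalIntegrable a b) (h.intervalIntegrable a b)]
        exact intervalIntegral.integral_congr_ae ((Lp.coeFn_add g h).mono fun x hx _ => hx)
      map_smul' := fun k g => by
        rw [RingHom.id_apply, ← intervalIntegral.integral_smul]
        exact intervalIntegral.integral_congr_ae ((Lp.coeFn_smul k g).mono fun x hx _ => hx) }
    |b - a| fun g => by
      rw [mul_comm]
      exact intervalIntegral.norm_integral_le_of_norm_le_const_ae
        (g.ae_norm_le.mono fun x hx _ => hx)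

theorem integralCLM_apply (a b : ℝ) (g : Linf 𝕜 d) : integralCLM a b g = ∫ x in a..b, g x := rfl

instance : CompleteSpace (W1inf 𝕜 d) := by
  have h : IsClosed ((sobolevSubmodule 𝕜 d :
      Submodule 𝕜 ((ℝ →ᵇ (Fin d → 𝕜)) × Linf 𝕜 d)) : Set ((ℝ →ᵇ (Fin d → 𝕜)) × Linf 𝕜 d)) := by
    have : ((sobolevSubmodule 𝕜 d :
        Submodule 𝕜 ((ℝ →ᵇ (Fin d → 𝕜)) × Linf 𝕜 d)) : Set ((ℝ →ᵇ (Fin d → 𝕜)) × Linf 𝕜 d)) =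
        ⋂ a : ℝ, ⋂ b : ℝ, {p | integralCLM a b p.2 = p.1 b - p.1 a} := by
      ext p
      simp only [Set.mem_iInter]
      rfl
    rw [this]
    refine isClosed_iInter fun a => isClosed_iInter fun b => isClosed_eq ?_ ?_
    · exact (integralCLM a b).continuous.comp continuous_snd
    · exact ((continuous_eval_const (F := ℝ →ᵇ (Fin d → 𝕜)) _).comp continuous_fst).sub
        ((continuous_eval_const (F := ℝ →ᵇ (Fin d → 𝕜)) _).comp continuous_fst)
  exact h.completeSpace_coe

/-- The inclusion of `W^{1,∞}` into the bounded continuous functions. -/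
def toBCF : W1inf 𝕜 d →L[𝕜] (ℝ →ᵇ (Fin d → 𝕜)) :=
  (ContinuousLinearMap.fst 𝕜 (ℝ →ᵇ (Fin d → 𝕜)) (Linf 𝕜 d)).comp (sobolevSubmodule 𝕜 d).subtypeL

/-- The weak derivative `W^{1,∞} → L^∞`. -/
def derCLM : W1inf 𝕜 d →L[𝕜] Linf 𝕜 d :=
  (ContinuousLinearMap.snd 𝕜 (ℝ →ᵇ (Fin d → 𝕜)) (Linf 𝕜 d)).comp (sobolevSubmodule 𝕜 d).subtypeL

@[simp] theorem toBCF_apply (p : W1inf 𝕜 d) (x : ℝ) : toBCF p x = p.fn x := rfl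

theorem coe_derCLM (p : W1inf 𝕜 d) : (derCLM p : ℝ → Fin d → 𝕜) = p.der := rfl

theorem W1inf.integral_der (p : W1inf 𝕜 d) (a b : ℝ) :
    ∫ x in a..b, p.der x = p.fn b - p.fn a := p.2 a b

theorem W1inf.continuous_fn (p : W1inf 𝕜 d) : Continuous p.fn := (toBCF p).continuous

theorem W1inf.norm_eq (p : W1inf 𝕜 d) : ‖p‖ = max ‖toBCF p‖ ‖derCLM p‖ := rfl

theorem W1inf.norm_toBCF_le (p : W1inf 𝕜 d) : ‖toBCF p‖ ≤ ‖p‖ := le_max_left _ _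

theorem W1inf.norm_derCLM_le (p : W1inf 𝕜 d) : ‖derCLM p‖ ≤ ‖p‖ := le_max_right _ _

theorem W1inf.norm_fn_le (p : W1inf 𝕜 d) (x : ℝ) : ‖p.fn x‖ ≤ ‖p‖ :=
  ((toBCF p).norm_coe_le_norm x).trans (W1inf.norm_toBCF_le p)

theorem W1inf.norm_fn_sub_le (p : W1inf 𝕜 d) (a b : ℝ) : ‖p.fn b - p.fn a‖ ≤ ‖p‖ * |b - a| := by
  rw [← W1inf.integral_der]
  exact intervalIntegral.norm_integral_le_of_norm_le_const_ae
    ((Linf.ae_norm_le (derCLM p)).mono fun x hx _ => hx.trans (W1inf.norm_derCLM_le p))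

theorem W1inf.intervalIntegrable_der (p : W1inf 𝕜 d) (a b : ℝ) :
    IntervalIntegrable p.der volume a b := Linf.intervalIntegrable (derCLM p) a b

/-- A class in `L^∞` is determined by its integrals over intervals, by Lebesgue's differentiation
theorem. -/
theorem Linf.eq_of_integral_eq {g h : Linf 𝕜 d}
    (H : ∀ a b : ℝ, ∫ x in a..b, g x = ∫ x in a..b, h x) : g = h := by
  have hl : ∀ g : Linf 𝕜 d, LocallyIntegrable g volume := fun g =>
    (Lp.memLp g).locallyIntegrable le_top
  have hd : ∀ g : Linf 𝕜 d, ∀ᵐ x, HasDerivAt (fun y => ∫ t in (0 : ℝ)..y, g t) (g x) x := by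
    intro g
    filter_upwards [LocallyIntegrable.ae_hasDerivAt_integral (hl g)] with x hx
    exact hx 0
  apply Lp.ext
  filter_upwards [hd g, hd h] with x h1 h2
  have : (fun y => ∫ t in (0 : ℝ)..y, g t) = fun y => ∫ t in (0 : ℝ)..y, h t :=
    funext fun y => H 0 y
  rw [this] at h1
  exact h1.unique h2

theorem W1inf.ext_fn {p q : W1inf 𝕜 d} (h : p.fn = q.fn) : p = q := by
  have h1 : p.1.1 = q.1.1 := DFunLike.coe_injective h
  have h2 : p.1.2 = q.1.2 := by
    refine Linf.eq_of_integral_eq fun a b => ?_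
    rw [p.2 a b, q.2 a b, h1]
  exact Subtype.ext (Prod.ext h1 h2)

/-- Elements of `W^{1,∞}` from a bounded function and a bounded weak derivative. -/
theorem W1inf.exists_of_integral {p g : ℝ → Fin d → 𝕜} {C K : ℝ} (hp : ∀ x, ‖p x‖ ≤ C)
    (hg : MemLp g ∞ volume) (hK : ∀ᵐ x, ‖g x‖ ≤ K)
    (h : ∀ a b : ℝ, ∫ x in a..b, g x = p b - p a) :
    ∃ w : W1inf 𝕜 d, w.fn = p ∧ w.der =ᵐ[volume] g := by
  have hcont : Continuous p := by
    have : LipschitzWith K.toNNReal p := by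
      refine LipschitzWith.of_dist_le_mul fun x y => ?_
      rw [dist_eq_norm, ← h y x, Real.dist_eq]
      refine (intervalIntegral.norm_integral_le_of_norm_le_const_ae
        (hK.mono fun x hx _ => hx)).trans ?_
      exact mul_le_mul_of_nonneg_right (Real.le_coe_toNNReal K) (abs_nonneg _)
    exact this.continuous
  refine ⟨⟨(BoundedContinuousFunction.ofNormedAddCommGroup p hcont C hp, toLinf g), ?_⟩, rfl,
    coe_toLinf hg⟩
  intro a b
  rw [intervalIntegral.integral_congr_ae ((coe_toLinf hg).mono fun x hx _ => hx)]
  exact h a b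

/-- A bounded function with a bounded continuous derivative belongs to `W^{1,∞}`. -/
theorem W1inf.exists_of_hasDerivAt {p : ℝ → Fin d → 𝕜} {C : ℝ} (hp : ∀ x, ‖p x‖ ≤ C)
    (g : ℝ →ᵇ (Fin d → 𝕜)) (h : ∀ x, HasDerivAt p (g x) x) :
    ∃ w : W1inf 𝕜 d, w.fn = p ∧ derCLM w = bcfToLinf g := by
  obtain ⟨w, hw, hw'⟩ := W1inf.exists_of_integral hp (memLp_bcf g)
    (Eventually.of_forall g.norm_coe_le_norm) fun a b =>
      intervalIntegral.integral_eq_sub_of_hasDerivAt (fun x _ => h x)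
        (g.continuous.intervalIntegrable a b)
  exact ⟨w, hw, Lp.ext (hw'.trans (coe_bcfToLinf g).symm)⟩

/-- If the weak derivative has a continuous representative, it is the classical derivative. -/
theorem W1inf.hasDerivAt_of_der {w : W1inf 𝕜 d} {g : ℝ → Fin d → 𝕜} (hg : Continuous g)
    (h : w.der =ᵐ[volume] g) (x : ℝ) : HasDerivAt w.fn (g x) x := by
  have h1 : w.fn = fun y => w.fn 0 + ∫ t in (0 : ℝ)..y, g t := by
    funext y
    rw [← intervalIntegral.integral_congr_ae (h.mono fun x hx _ => hx), W1inf.integral_der]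
    abel
  rw [h1]
  exact (intervalIntegral.integral_hasDerivAt_right (hg.intervalIntegrable 0 x)
    hg.stronglyMeasurable.stronglyMeasurableAtFilter hg.continuousAt).const_add _

end Basics

/-! ### Translations, multiplication operators, and the linear operators -/

section Operators

variable {𝕜 : Type} [RCLike 𝕜] {d : ℕ}

/-- Translation `p ↦ p(· + t)` on bounded continuous functions. -/
def shift {E : Type*} [NormedAddCommGroup E] (𝕜 : Type) [RCLike 𝕜] [NormedSpace 𝕜 E] (t : ℝ) :
    (ℝ →ᵇ E) →L[𝕜] (ℝ →ᵇ E) :=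
  BoundedContinuousFunction.compContinuousCLM E 𝕜 ⟨fun x => x + t, by fun_prop⟩

@[simp] theorem shift_apply {E : Type*} [NormedAddCommGroup E] [NormedSpace 𝕜 E] (t : ℝ)
    (p : ℝ →ᵇ E) (x : ℝ) : shift 𝕜 t p x = p (x + t) := rfl

theorem norm_shift_le {E : Type*} [NormedAddCommGroup E] [NormedSpace 𝕜 E] (t : ℝ) (p : ℝ →ᵇ E) :
    ‖shift 𝕜 t p‖ ≤ ‖p‖ :=
  BoundedContinuousFunction.norm_compContinuous_le _ _

/-- The pointwise application of a bounded bilinear map to bounded continuous functions. -/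
def bilinBCF {E F G : Type*} [NormedAddCommGroup E] [NormedSpace 𝕜 E] [NormedAddCommGroup F]
    [NormedSpace 𝕜 F] [NormedAddCommGroup G] [NormedSpace 𝕜 G] (B : E →L[𝕜] F →L[𝕜] G) :
    (ℝ →ᵇ E) →L[𝕜] (ℝ →ᵇ F) →L[𝕜] (ℝ →ᵇ G) :=
  LinearMap.mkContinuous₂
    (LinearMap.mk₂ 𝕜 (fun (p : ℝ →ᵇ E) (q : ℝ →ᵇ F) =>
      (BoundedContinuousFunction.ofNormedAddCommGroup (fun x => B (p x) (q x))
        ((B.continuous.comp p.continuous).clm_apply q.continuous) (‖B‖ * ‖p‖ * ‖q‖)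
        (fun x => (B.le_opNorm₂ _ _).trans (by gcongr <;>
          exact BoundedContinuousFunction.norm_coe_le_norm _ _)) : ℝ →ᵇ G))
      (fun p p' q => by ext; simp) (fun k p q => by ext; simp)
      (fun p q q' => by ext; simp) (fun k p q => by ext; simp))
    ‖B‖ fun p q => BoundedContinuousFunction.norm_ofNormedAddCommGroup_le _ (by positivity) fun x =>
      (B.le_opNorm₂ _ _).trans (by gcongr <;>
        exact BoundedContinuousFunction.norm_coe_le_norm _ _)

/-- The operators on `𝕜^d`. -/
abbrev Mat (𝕜 : Type) [RCLike 𝕜] (d : ℕ) : Type := (Fin d → 𝕜) →L[𝕜] (Fin d → 𝕜)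

variable (𝕜 d) in
/-- The multiplication operator by an operator-valued function. -/
def mulOp : (ℝ →ᵇ Mat 𝕜 d) →L[𝕜] (ℝ →ᵇ (Fin d → 𝕜)) →L[𝕜] (ℝ →ᵇ (Fin d → 𝕜)) :=
  bilinBCF (ContinuousLinearMap.id 𝕜 (Mat 𝕜 d))

@[simp] theorem mulOp_apply (a : ℝ →ᵇ Mat 𝕜 d) (p : ℝ →ᵇ (Fin d → 𝕜)) (x : ℝ) :
    mulOp 𝕜 d a p x = a x (p x) := rfl

/-- The zeroth order part `p ↦ ∑ j, a_j(ξ) p(ξ + ρ_j)` of a linear operator. -/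
def lowL (ρ : Fin 5 → ℝ) (a : Fin 5 → ℝ →ᵇ Mat 𝕜 d) :
    (ℝ →ᵇ (Fin d → 𝕜)) →L[𝕜] (ℝ →ᵇ (Fin d → 𝕜)) :=
  ∑ j, (mulOp 𝕜 d (a j)).comp (shift 𝕜 (ρ j))

theorem lowL_apply (ρ : Fin 5 → ℝ) (a : Fin 5 → ℝ →ᵇ Mat 𝕜 d) (p : ℝ →ᵇ (Fin d → 𝕜)) (x : ℝ) :
    lowL ρ a p x = ∑ j, a j x (p (x + ρ j)) := by
  simp [lowL, _root_.sum_apply]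

/-- The linear operator `p ↦ -c p' + ∑ j, a_j(ξ) p(ξ + ρ_j)` from `W^{1,∞}` to `L^∞`. -/
def genL (c : 𝕜) (ρ : Fin 5 → ℝ) (a : Fin 5 → ℝ →ᵇ Mat 𝕜 d) : W1inf 𝕜 d →L[𝕜] Linf 𝕜 d :=
  -(c • derCLM) + bcfToLinf.comp ((lowL ρ a).comp toBCF)

theorem coe_genL (c : 𝕜) (ρ : Fin 5 → ℝ) (a : Fin 5 → ℝ →ᵇ Mat 𝕜 d) (p : W1inf 𝕜 d) :
    genL c ρ a p =ᵐ[volume] fun x => -(c • p.der x) + ∑ j, a j x (p.fn (x + ρ j)) := by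
  have h1 : genL c ρ a p = -(c • derCLM p) + bcfToLinf (lowL ρ a (toBCF p)) := rfl
  rw [h1]
  filter_upwards [Lp.coeFn_add (-(c • derCLM p)) (bcfToLinf (lowL ρ a (toBCF p))),
    Lp.coeFn_neg (c • derCLM p), Lp.coeFn_smul c (derCLM p),
    coe_bcfToLinf (lowL ρ a (toBCF p))] with x h2 h3 h4 h5
  rw [h2, Pi.add_apply, h3, Pi.neg_apply, h4, Pi.smul_apply, h5, lowL_apply, coe_derCLM]
  rfl

end Operators

end LatticeWave

namespace LatticeWave

/-! ### Compactness for bounded solutions -/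

section Compactness

/-- A sequence of functions that is eventually bounded and eventually equi-Lipschitz has a
pointwise convergent subsequence. -/
theorem exists_subseq_tendsto {E : Type*} [NormedAddCommGroup E] [ProperSpace E]
    (u : ℕ → ℝ → E) {M K : ℝ} (hM : 0 ≤ M) (h1 : ∀ x, ∀ᶠ n in atTop, ‖u n x‖ ≤ M)
    (h2 : ∀ x y, ∀ᶠ n in atTop, ‖u n x - u n y‖ ≤ K * |x - y|) :
    ∃ (φ : ℕ → ℕ) (p : ℝ → E), StrictMono φ ∧
      (∀ x, Tendsto (fun n => u (φ n) x) atTop (𝓝 (p x))) ∧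
      (∀ x, ‖p x‖ ≤ M) ∧ ∀ x y, ‖p x - p y‖ ≤ K * |x - y| := by
  classical
  -- Tychonoff's theorem on the countable dense set of rational points
  set v : ℕ → ℚ → E := fun n q => if ‖u n q‖ ≤ M then u n q else 0 with hv
  have hmem : ∀ n, v n ∈ Set.pi Set.univ fun _ : ℚ => Metric.closedBall (0 : E) M := by
    intro n q _
    rw [mem_closedBall_zero_iff, hv]
    dsimp only
    split_ifs with h
    · exact h
    · simpa using hM
  obtain ⟨g, -, φ, hφ, hg⟩ :=
    (isCompact_univ_pi fun _ : ℚ => isCompact_closedBall (0 : E) M).isSeqCompact hmem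
  rw [tendsto_pi_nhds] at hg
  have hq : ∀ q : ℚ, Tendsto (fun n => u (φ n) q) atTop (𝓝 (g q)) := by
    intro q
    refine (hg q).congr' ?_
    filter_upwards [hφ.tendsto_atTop.eventually (h1 q)] with n hn
    simp [hv, hn]
  have hc : ∀ x, ∃ y, Tendsto (fun n => u (φ n) x) atTop (𝓝 y) := by
    intro x
    apply cauchySeq_tendsto_of_complete
    rw [Metric.cauchySeq_iff']
    intro ε hε
    obtain ⟨q, hq1⟩ : ∃ q : ℚ, |x - q| < ε / (4 * (|K| + 1)) := by
      obtain ⟨q, h, h'⟩ := exists_rat_btwn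
        (show x - ε / (4 * (|K| + 1)) < x by linarith [show 0 < ε / (4 * (|K| + 1)) by positivity])
      have h' : 0 < ε / (4 * (|K| + 1)) := by positivity
      exact ⟨q, by rw [abs_lt]; constructor <;> linarith⟩
    have hK : K * |x - q| < ε / 4 := by
      have h3 : K * |x - q| ≤ (|K| + 1) * |x - q| :=
        mul_le_mul_of_nonneg_right (by linarith [le_abs_self K]) (abs_nonneg _)
      have h4 : (|K| + 1) * |x - q| < (|K| + 1) * (ε / (4 * (|K| + 1))) :=
        mul_lt_mul_of_pos_left hq1 (by positivity)
      have h5 : (|K| + 1) * (ε / (4 * (|K| + 1))) = ε / 4 := by field_simp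
      linarith
    obtain ⟨N1, hN1⟩ := (Metric.cauchySeq_iff'.1 (hq q).cauchySeq) (ε / 4) (by positivity)
    obtain ⟨N2, hN2⟩ := eventually_atTop.1 (hφ.tendsto_atTop.eventually (h2 x q))
    refine ⟨max N1 N2, fun n hn => ?_⟩
    have e1 := hN2 n (le_of_max_le_right hn)
    have e2 := hN2 (max N1 N2) (le_max_right _ _)
    have e3 := hN1 n (le_of_max_le_left hn)
    have e4 := hN1 (max N1 N2) (le_max_left _ _)
    rw [← dist_eq_norm] at e1 e2
    have := dist_triangle (u (φ n) x) (u (φ n) q) (u (φ (max N1 N2)) x)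
    have := dist_triangle (u (φ n) q) (u (φ N1) q) (u (φ (max N1 N2)) x)
    have := dist_triangle (u (φ N1) q) (u (φ (max N1 N2)) q) (u (φ (max N1 N2)) x)
    rw [dist_comm] at e2
    rw [dist_comm] at e4
    linarith
  choose p hp using hc
  refine ⟨φ, p, hφ, hp, fun x => ?_, fun x y => ?_⟩
  · exact le_of_tendsto (hp x).norm (hφ.tendsto_atTop.eventually (h1 x))
  · exact le_of_tendsto ((hp x).sub (hp y)).norm (hφ.tendsto_atTop.eventually (h2 x y))

variable {𝕜 : Type} [RCLike 𝕜] {d : ℕ}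

/-- `p` solves `c p' = ∑ j, A_j(ξ) p(ξ + ρ_j) - h`, in integrated form. -/
def IsSol (c : 𝕜) (ρ : Fin 5 → ℝ) (A : Fin 5 → ℝ → Mat 𝕜 d) (h p : ℝ → Fin d → 𝕜) : Prop :=
  ∀ a b : ℝ, c • (p b - p a) = ∫ x in a..b, (∑ j, A j x (p (x + ρ j)) - h x)

theorem continuous_sum_apply {A : Fin 5 → ℝ → Mat 𝕜 d} {p : ℝ → Fin d → 𝕜} (ρ : Fin 5 → ℝ)
    (hA : ∀ j, Continuous (A j)) (hp : Continuous p) :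
    Continuous fun x => ∑ j, A j x (p (x + ρ j)) :=
  continuous_finsetSum _ fun j _ => (hA j).clm_apply (hp.comp (by fun_prop))

theorem norm_sum_apply_le {A : Fin 5 → Mat 𝕜 d} {v : Fin 5 → Fin d → 𝕜} {K M : ℝ}
    (hK : ∀ j, ‖A j‖ ≤ K) (hM : ∀ j, ‖v j‖ ≤ M) : ‖∑ j, A j (v j)‖ ≤ 5 * (K * M) := by
  refine (norm_sum_le_of_le _ fun j _ => (A j).le_of_opNorm_le_of_le (hK j) (hM j)).trans ?_
  simp

theorem abs_shift_le {a b x R : ℝ} (ha : |a| ≤ R) (hb : |b| ≤ R) (ρ : Fin 5 → ℝ)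
    (hx : x ∈ Set.uIoc a b) (j : Fin 5) : |x + ρ j| ≤ R + ‖ρ‖ := by
  have h1 : |x| ≤ R := by
    have := Set.uIoc_subset_uIcc hx
    rw [Set.mem_uIcc] at this
    rw [abs_le] at ha hb ⊢
    rcases this with h | h <;> constructor <;> linarith [h.1, h.2, ha.1, ha.2, hb.1, hb.2]
  have h2 : |ρ j| ≤ ‖ρ‖ := norm_le_pi_norm ρ j
  exact (abs_add_le _ _).trans (add_le_add h1 h2)

/-- Solutions of the integrated equation are stable under bounded pointwise convergence. -/
theorem isSol_of_tendsto {c : 𝕜} {ρ : Fin 5 → ℝ} {A : ℕ → Fin 5 → ℝ → Mat 𝕜 d}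
    {A' : Fin 5 → ℝ → Mat 𝕜 d} {h : ℕ → ℝ → Fin d → 𝕜} {h' : ℝ → Fin d → 𝕜}
    {p : ℕ → ℝ → Fin d → 𝕜} {p' : ℝ → Fin d → 𝕜} {K M H : ℝ}
    (hloc : ∀ R : ℝ, ∀ᶠ n in atTop, ∀ x, |x| ≤ R → ‖p n x‖ ≤ M)
    (hpc : ∀ n, Continuous (p n)) (hAc : ∀ n j, Continuous (A n j))
    (hAK : ∀ n j x, ‖A n j x‖ ≤ K)
    (hA : ∀ j x, Tendsto (fun n => A n j x) atTop (𝓝 (A' j x)))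
    (hhm : ∀ n, AEStronglyMeasurable (h n) volume) (hhH : ∀ n, ∀ᵐ x, ‖h n x‖ ≤ H)
    (hh : ∀ᵐ x, Tendsto (fun n => h n x) atTop (𝓝 (h' x)))
    (hp : ∀ x, Tendsto (fun n => p n x) atTop (𝓝 (p' x)))
    (hsol : ∀ n, IsSol c ρ (A n) (h n) (p n)) : IsSol c ρ A' h' p' := by
  intro a b
  have h1 : Tendsto (fun n => c • (p n b - p n a)) atTop (𝓝 (c • (p' b - p' a))) :=
    ((hp b).sub (hp a)).const_smul c
  refine tendsto_nhds_unique h1 ?_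
  simp_rw [fun n => hsol n a b]
  have hb := hloc (max |a| |b| + ‖ρ‖)
  refine intervalIntegral.tendsto_integral_filter_of_dominated_convergence
    (fun _ => 5 * (K * M) + H) ?_ ?_ (by simp) ?_
  · refine Eventually.of_forall fun n => ?_
    exact (((continuous_sum_apply ρ (hAc n) (hpc n)).aestronglyMeasurable.sub (hhm n)).mono_measure
      Measure.restrict_le_self)
  · filter_upwards [hb] with n hn
    filter_upwards [hhH n] with x hx hxab
    refine (norm_sub_le _ _).trans (add_le_add ?_ hx)
    exact norm_sum_apply_le (fun j => hAK n j x)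
      fun j => hn _ (abs_shift_le (le_max_left _ _) (le_max_right _ _) ρ hxab j)
  · filter_upwards [hh] with x hx _
    refine Tendsto.sub (tendsto_finsetSum _ fun j _ => ?_) hx
    exact ((isBoundedBilinearMap_apply (𝕜 := 𝕜) (E := Fin d → 𝕜)
      (F := Fin d → 𝕜)).continuous.tendsto (A' j x, p' (x + ρ j))).comp
        ((hA j x).prodMk_nhds (hp _))

/-- Compactness: eventually locally bounded solutions subconverge to a bounded solution of the
limiting equation. -/
theorem exists_limit_sol {c : 𝕜} (hc : c ≠ 0) {ρ : Fin 5 → ℝ} {A : ℕ → Fin 5 → ℝ → Mat 𝕜 d}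
    {A' : Fin 5 → ℝ → Mat 𝕜 d} {h : ℕ → ℝ → Fin d → 𝕜} {h' : ℝ → Fin d → 𝕜}
    {p : ℕ → ℝ → Fin d → 𝕜} {K M H : ℝ} (hM : 0 ≤ M)
    (hloc : ∀ R : ℝ, ∀ᶠ n in atTop, ∀ x, |x| ≤ R → ‖p n x‖ ≤ M)
    (hpc : ∀ n, Continuous (p n)) (hAc : ∀ n j, Continuous (A n j))
    (hAK : ∀ n j x, ‖A n j x‖ ≤ K)
    (hA : ∀ j x, Tendsto (fun n => A n j x) atTop (𝓝 (A' j x)))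
    (hhm : ∀ n, AEStronglyMeasurable (h n) volume) (hhH : ∀ n, ∀ᵐ x, ‖h n x‖ ≤ H)
    (hh : ∀ᵐ x, Tendsto (fun n => h n x) atTop (𝓝 (h' x)))
    (hsol : ∀ n, IsSol c ρ (A n) (h n) (p n)) :
    ∃ (φ : ℕ → ℕ) (p' : ℝ → Fin d → 𝕜), StrictMono φ ∧
      (∀ x, Tendsto (fun n => p (φ n) x) atTop (𝓝 (p' x))) ∧
      (∀ x, ‖p' x‖ ≤ M) ∧ Continuous p' ∧ IsSol c ρ A' h' p' := by
  obtain ⟨φ, p', hφ, h1, h2, h3⟩ := exists_subseq_tendsto p (M := M)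
    (K := ‖c‖⁻¹ * (5 * (K * M) + H)) hM
    (fun x => (hloc |x|).mono fun n hn => hn x le_rfl) (fun x y => by
      filter_upwards [hloc (max |y| |x| + ‖ρ‖)] with n hn
      have e1 : ‖c • (p n x - p n y)‖ ≤ (5 * (K * M) + H) * |x - y| := by
        rw [hsol n y x]
        refine intervalIntegral.norm_integral_le_of_norm_le_const_ae ?_
        filter_upwards [hhH n] with t ht htab
        refine (norm_sub_le _ _).trans (add_le_add ?_ ht)
        exact norm_sum_apply_le (fun j => hAK n j t)
          fun j => hn _ (abs_shift_le (le_max_left _ _) (le_max_right _ _) ρ htab j)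
      rw [norm_smul] at e1
      have : 0 < ‖c‖ := norm_pos_iff.2 hc
      rw [mul_assoc, ← div_eq_inv_mul, le_div_iff₀ this, mul_comm]
      exact e1)
  refine ⟨φ, p', hφ, h1, h2, ?_, ?_⟩
  · have : LipschitzWith (‖c‖⁻¹ * (5 * (K * M) + H)).toNNReal p' := by
      refine LipschitzWith.of_dist_le_mul fun x y => ?_
      rw [dist_eq_norm, Real.dist_eq]
      exact (h3 x y).trans (mul_le_mul_of_nonneg_right (Real.le_coe_toNNReal _) (abs_nonneg _))
    exact this.continuous
  · exact isSol_of_tendsto (A := fun n => A (φ n)) (h := fun n => h (φ n))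
      (p := fun n => p (φ n)) (fun R => hφ.tendsto_atTop.eventually (hloc R))
      (fun n => hpc _) (fun n => hAc _) (fun n => hAK _)
      (fun j x => (hA j x).comp hφ.tendsto_atTop) (fun n => hhm _) (fun n => hhH _)
      (hh.mono fun x hx => hx.comp hφ.tendsto_atTop) h1 fun n => hsol _

theorem IsSol.translate {c : 𝕜} {ρ : Fin 5 → ℝ} {A : Fin 5 → ℝ → Mat 𝕜 d}
    {h p : ℝ → Fin d → 𝕜} (hs : IsSol c ρ A h p) (t : ℝ) :
    IsSol c ρ (fun j x => A j (x + t)) (fun x => h (x + t)) (fun x => p (x + t)) := by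
  intro a b
  rw [hs (a + t) (b + t), ← intervalIntegral.integral_comp_add_right]
  simp only [add_right_comm]

theorem IsSol.smul {c : 𝕜} {ρ : Fin 5 → ℝ} {A : Fin 5 → ℝ → Mat 𝕜 d}
    {h p : ℝ → Fin d → 𝕜} (hs : IsSol c ρ A h p) (k : 𝕜) :
    IsSol c ρ A (fun x => k • h x) (fun x => k • p x) := by
  intro a b
  rw [← smul_sub, smul_comm, hs a b, ← intervalIntegral.integral_smul]
  simp only [map_smul, smul_sub, Finset.smul_sum]

theorem IsSol.hasDerivAt {c : 𝕜} (hc : c ≠ 0) {ρ : Fin 5 → ℝ} {A : Fin 5 → ℝ → Mat 𝕜 d}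
    {h p : ℝ → Fin d → 𝕜} (hs : IsSol c ρ A h p) (hA : ∀ j, Continuous (A j))
    (hp : Continuous p) (hh : Continuous h) (x : ℝ) :
    HasDerivAt p (c⁻¹ • (∑ j, A j x (p (x + ρ j)) - h x)) x := by
  obtain ⟨g, hg⟩ : ∃ g : ℝ → Fin d → 𝕜, g = fun x => ∑ j, A j x (p (x + ρ j)) - h x := ⟨_, rfl⟩
  have hcont : Continuous g := hg ▸ (continuous_sum_apply ρ hA hp).sub hh
  have h1 : p = fun y => p 0 + c⁻¹ • ∫ x in (0 : ℝ)..y, g x := by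
    funext y
    rw [hg, ← hs 0 y, inv_smul_smul₀ hc]
    abel
  have h2 := (intervalIntegral.integral_hasDerivAt_right (hcont.intervalIntegrable 0 x)
    hcont.stronglyMeasurable.stronglyMeasurableAtFilter hcont.continuousAt).const_smul c⁻¹
  have h3 : ∑ j, A j x (p (x + ρ j)) - h x = g x := by rw [hg]
  rw [h3, h1]
  exact h2.const_add (p 0)

end Compactness

end LatticeWave

namespace LatticeWave

/-! ### Bounded solutions of hyperbolic equations with constant coefficients -/

section Uniqueness

/-- An operator that is bounded below and close to a surjective one is bijective. -/
theorem bijective_of_norm_sub_lt {𝕜 X Y : Type*} [NontriviallyNormedField 𝕜]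
    [NormedAddCommGroup X] [NormedSpace 𝕜 X] [CompleteSpace X]
    [NormedAddCommGroup Y] [NormedSpace 𝕜 Y] [CompleteSpace Y] {T S : X →L[𝕜] Y} {ε : ℝ}
    (hε : 0 < ε) (hT : ∀ x, ε * ‖x‖ ≤ ‖T x‖) (hTS : ‖T - S‖ < ε / 2)
    (hS : Function.Surjective S) : Function.Bijective T := by
  have hinj : ∀ {U : X →L[𝕜] Y} {η : ℝ}, 0 < η → (∀ x, η * ‖x‖ ≤ ‖U x‖) →
      Function.Injective U := by
    intro U η hη hU
    rw [injective_iff_map_eq_zero]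
    intro x hx
    have := hU x
    rw [hx, norm_zero] at this
    exact norm_le_zero_iff.1 (nonpos_of_mul_nonpos_right this hη)
  have hSb : ∀ x, ε / 2 * ‖x‖ ≤ ‖S x‖ := by
    intro x
    have h1 := (T - S).le_opNorm x
    have h2 : ‖T x‖ ≤ ‖(T - S) x‖ + ‖S x‖ := by
      have := norm_add_le ((T - S) x) (S x)
      simpa using this
    have h3 : ‖T - S‖ * ‖x‖ ≤ ε / 2 * ‖x‖ := mul_le_mul_of_nonneg_right hTS.le (norm_nonneg _)
    linarith [hT x]
  refine ⟨hinj hε hT, ?_⟩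
  set e : X ≃L[𝕜] Y := ContinuousLinearEquiv.ofBijective S
    (LinearMap.ker_eq_bot.2 (hinj (half_pos hε) hSb)) (LinearMap.range_eq_top.2 hS) with he
  have hex : ∀ x, e x = S x := fun x => rfl
  have happ : ApproximatesLinearOn T (e : X →L[𝕜] Y) Set.univ ‖T - S‖₊ := by
    intro x _ y _
    have : T x - T y - (e : X →L[𝕜] Y) (x - y) = (T - S) (x - y) := by
      simp [hex]
    rw [this]
    exact (T - S).le_opNorm _
  refine happ.surjective ?_
  by_cases hX : Subsingleton X
  · exact Or.inl hX
  right
  have hN : ‖(e.symm : Y →L[𝕜] X)‖ ≤ 2 / ε := by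
    refine ContinuousLinearMap.opNorm_le_bound _ (by positivity) fun y => ?_
    have := hSb (e.symm y)
    rw [← hex, e.apply_symm_apply] at this
    rw [div_mul_eq_mul_div, le_div_iff₀ hε]
    change ‖e.symm y‖ * ε ≤ 2 * ‖y‖
    linarith
  have hpos : 0 < ‖(e.symm : Y →L[𝕜] X)‖ := by
    rw [not_subsingleton_iff_nontrivial] at hX
    exact e.norm_symm_pos
  rw [← NNReal.coe_lt_coe, NNReal.coe_inv, coe_nnnorm, coe_nnnorm]
  refine hTS.trans_le ?_
  rw [le_inv_comm₀ (by positivity) hpos]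
  simpa using hN

variable {d : ℕ}

/-- The equation `c p' = ∑ j, A_j p(· + ρ_j)` with constant coefficients is hyperbolic: its
characteristic equation has no roots on the imaginary axis. -/
def Hyperbolic (c : ℂ) (ρ : Fin 5 → ℝ) (A : Fin 5 → Mat ℂ d) : Prop :=
  ∀ (ν : ℝ) (v : Fin d → ℂ),
    (c * (Complex.I * ν)) • v = ∑ j, Complex.exp (Complex.I * ν * ρ j) • A j v → v = 0

/-- An operator on a nonzero complex Banach space has an approximate eigenvalue: the boundary
points of its spectrum are such. -/
theorem exists_approx_eigenvalue {X : Type*} [NormedAddCommGroup X] [NormedSpace ℂ X]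
    [CompleteSpace X] [Nontrivial X] (D : X →L[ℂ] X) :
    ∃ μ : ℂ, ∀ ε > 0, ∃ x : X, ‖D x - μ • x‖ < ε * ‖x‖ := by
  have hne : (spectrum ℂ D).Nonempty := spectrum.nonempty D
  have hcpt : IsCompact (spectrum ℂ D) := spectrum.isCompact D
  have huniv : spectrum ℂ D ≠ Set.univ := by
    intro h
    rw [h] at hcpt
    exact noncompact_univ ℂ hcpt
  obtain ⟨μ, hμ⟩ := nonempty_frontier_iff.2 ⟨hne, huniv⟩
  refine ⟨μ, fun ε hε => ?_⟩
  by_contra! hcon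
  have hμs : μ ∈ spectrum ℂ D := hcpt.isClosed.frontier_subset hμ
  have hμc : μ ∈ closure (spectrum ℂ D)ᶜ := by
    rw [frontier_eq_closure_inter_closure] at hμ
    exact hμ.2
  obtain ⟨μ', hμ', hdist⟩ := Metric.mem_closure_iff.1 hμc (ε / 2) (half_pos hε)
  have hb : ∀ m : ℂ, m ∉ spectrum ℂ D ↔
      Function.Bijective (algebraMap ℂ (X →L[ℂ] X) m - D) := by
    intro m
    rw [spectrum.notMem_iff, ContinuousLinearMap.isUnit_iff_bijective]
  refine (hb μ).2 ?_ hμs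
  refine bijective_of_norm_sub_lt (S := algebraMap ℂ (X →L[ℂ] X) μ' - D) hε ?_ ?_
    ((hb μ').1 hμ').2
  · intro x
    have h1 : (algebraMap ℂ (X →L[ℂ] X) μ - D) x = -(D x - μ • x) := by
      simp [ContinuousLinearMap.algebraMap_apply]
    rw [h1, norm_neg]
    exact hcon x
  · have h1 : algebraMap ℂ (X →L[ℂ] X) μ - D - (algebraMap ℂ (X →L[ℂ] X) μ' - D) =
        algebraMap ℂ (X →L[ℂ] X) (μ - μ') := by
      rw [map_sub]; abel
    rw [h1]
    rw [dist_eq_norm] at hdist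
    refine lt_of_le_of_lt ?_ hdist
    refine ContinuousLinearMap.opNorm_le_bound _ (norm_nonneg _) fun x => ?_
    rw [ContinuousLinearMap.algebraMap_apply, norm_smul]

/-- The same for the restriction of an operator to an invariant closed subspace `N ≠ 0`. -/
theorem exists_approx_eigenvalue_mem {X : Type*} [NormedAddCommGroup X] [NormedSpace ℂ X]
    [CompleteSpace X] (D : X →L[ℂ] X) (N : Set X) (hcl : IsClosed N) (h0 : (0 : X) ∈ N)
    (hadd : ∀ x ∈ N, ∀ y ∈ N, x + y ∈ N) (hsmul : ∀ (k : ℂ), ∀ x ∈ N, k • x ∈ N)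
    (hD : ∀ x ∈ N, D x ∈ N) {x₀ : X} (hx₀ : x₀ ∈ N) (hne : x₀ ≠ 0) :
    ∃ μ : ℂ, ∀ ε > 0, ∃ x ∈ N, ‖D x - μ • x‖ < ε * ‖x‖ := by
  let S : Submodule ℂ X :=
    { carrier := N
      zero_mem' := h0
      add_mem' := fun hx hy => hadd _ hx _ hy
      smul_mem' := fun k x hx => hsmul k x hx }
  have : IsClosed (S : Set X) := hcl
  have : CompleteSpace S := this.completeSpace_coe
  have : Nontrivial S := ⟨⟨⟨x₀, hx₀⟩, 0, fun h => hne (congrArg Subtype.val h)⟩⟩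
  obtain ⟨μ, hμ⟩ := exists_approx_eigenvalue
    ((D.comp S.subtypeL).codRestrict S fun q => hD q q.2)
  refine ⟨μ, fun ε hε => ?_⟩
  obtain ⟨⟨x, hx⟩, h⟩ := hμ ε hε
  exact ⟨x, hx, h⟩

/-- A bounded solution of `p' = μ p` with `p 0 ≠ 0` is an exponential with imaginary exponent. -/
theorem eq_exp_of_bounded {μ : ℂ} {p : ℝ → Fin d → ℂ} (h : ∀ x, HasDerivAt p (μ • p x) x)
    {M : ℝ} (hM : ∀ x, ‖p x‖ ≤ M) (h0 : p 0 ≠ 0) :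
    μ.re = 0 ∧ ∀ x : ℝ, p x = Complex.exp (μ * x) • p 0 := by
  have hexp : ∀ (m : ℂ) (x : ℝ), HasDerivAt (fun x : ℝ => Complex.exp (m * x))
      (m * Complex.exp (m * x)) x := by
    intro m x
    have h1 : HasDerivAt (fun x : ℝ => m * (x : ℂ)) (m * 1) x :=
      (Complex.ofRealCLM.hasDerivAt (x := x)).const_mul m
    have := h1.cexp
    simpa [mul_comm] using this
  have hconst : ∀ x : ℝ, Complex.exp (-μ * x) • p x = p 0 := by
    intro x
    have hd : ∀ y : ℝ, HasDerivAt (fun y : ℝ => Complex.exp (-μ * y) • p y) 0 y := by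
      intro y
      refine ((hexp (-μ) y).smul (h y)).congr_deriv ?_
      rw [smul_smul, ← add_smul]
      ring_nf
      simp
    have := is_const_of_deriv_eq_zero (fun y => (hd y).differentiableAt)
      (fun y => (hd y).deriv) x 0
    simpa using this
  have hform : ∀ x : ℝ, p x = Complex.exp (μ * x) • p 0 := by
    intro x
    rw [← hconst x, smul_smul, ← Complex.exp_add]
    simp
  refine ⟨?_, hform⟩
  by_contra hre
  have hn : 0 < ‖p 0‖ := norm_pos_iff.2 h0
  have hb : ∀ t : ℝ, Real.exp t * ‖p 0‖ ≤ M := by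
    intro t
    have := hM (t / μ.re)
    rw [hform, norm_smul, Complex.norm_exp] at this
    have h2 : (μ * ((t / μ.re : ℝ) : ℂ)).re = t := by
      rw [Complex.re_mul_ofReal]
      field_simp
    rwa [h2] at this
  have h1 := hb (M / ‖p 0‖)
  have h2 := Real.add_one_le_exp (M / ‖p 0‖)
  have h3 : (M / ‖p 0‖ + 1) * ‖p 0‖ ≤ M := (mul_le_mul_of_nonneg_right h2 hn.le).trans h1
  rw [add_mul, div_mul_cancel₀ _ hn.ne'] at h3
  linarith

/-- For every nonzero bounded continuous function there is a point where half of the supremum is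
attained. -/
theorem exists_half_norm_lt {E : Type*} [NormedAddCommGroup E] (p : ℝ →ᵇ E) (hp : p ≠ 0) :
    ∃ x, ‖p‖ / 2 < ‖p x‖ := by
  by_contra! h
  have h1 := (BoundedContinuousFunction.norm_le (f := p) (by positivity)).2 h
  have : 0 < ‖p‖ := norm_pos_iff.2 hp
  linarith

/-- A hyperbolic equation with constant coefficients has no nonzero bounded solution. The bounded
solutions form a Banach space on which `d/dξ` is bounded; an approximate eigenvector, translated
so that it does not vanish in the limit, produces an exponential solution, whose exponent is
imaginary by boundedness. -/
theorem eq_zero_of_hyperbolic {c : ℂ} (hc : c ≠ 0) {ρ : Fin 5 → ℝ} {A : Fin 5 → Mat ℂ d}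
    (hA : Hyperbolic c ρ A) {p : ℝ → Fin d → ℂ} (hp : Continuous p) {M : ℝ}
    (hM : ∀ x, ‖p x‖ ≤ M) (hs : IsSol c ρ (fun j _ => A j) 0 p) : p = 0 := by
  set a : Fin 5 → ℝ →ᵇ Mat ℂ d := fun j => BoundedContinuousFunction.const ℝ (A j) with ha
  set D : (ℝ →ᵇ (Fin d → ℂ)) →L[ℂ] (ℝ →ᵇ (Fin d → ℂ)) := c⁻¹ • lowL ρ a with hD
  have hDx : ∀ (q : ℝ →ᵇ (Fin d → ℂ)) x, D q x = c⁻¹ • ∑ j, A j (q (x + ρ j)) := by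
    intro q x
    simp [hD, lowL_apply, ha]
  set N : Set (ℝ →ᵇ (Fin d → ℂ)) := {q | ∀ a b : ℝ, q b - q a = ∫ x in a..b, D q x} with hN
  have hNmem : ∀ q, q ∈ N ↔ ∀ a b : ℝ, q b - q a = ∫ x in a..b, D q x := fun q => Iff.rfl
  have hNadd : ∀ q ∈ N, ∀ q' ∈ N, q + q' ∈ N := by
    intro q h q' h' a b
    simp only [map_add, BoundedContinuousFunction.add_apply]
    rw [intervalIntegral.integral_add ((D q).continuous.intervalIntegrable _ _)
      ((D q').continuous.intervalIntegrable _ _), ← h, ← h']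
    abel
  have hNsmul : ∀ (k : ℂ), ∀ q ∈ N, k • q ∈ N := by
    intro k q h a b
    simp only [map_smul, BoundedContinuousFunction.smul_apply]
    rw [intervalIntegral.integral_smul, ← h, smul_sub]
  have hNcl : IsClosed N := by
    have : N =
        ⋂ a : ℝ, ⋂ b : ℝ, {q | q b - q a = integralCLM a b (bcfToLinf (D q))} := by
      ext q
      simp only [Set.mem_iInter, hNmem, Set.mem_ofPred_eq, integralCLM_apply]
      refine forall_congr' fun a => forall_congr' fun b => ?_
      rw [intervalIntegral.integral_congr_ae ((coe_bcfToLinf (D q)).mono fun x hx _ => hx)]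
    rw [this]
    refine isClosed_iInter fun a => isClosed_iInter fun b => isClosed_eq ?_ ?_
    · exact (continuous_eval_const (F := ℝ →ᵇ (Fin d → ℂ)) _).sub
        (continuous_eval_const (F := ℝ →ᵇ (Fin d → ℂ)) _)
    · exact (integralCLM a b).continuous.comp (bcfToLinf.continuous.comp D.continuous)
  have hDN : ∀ q ∈ N, D q ∈ N := by
    intro q hq a b
    have e1 : ∀ x, D q x = c⁻¹ • ∑ j, A j (q (x + ρ j)) := hDx q
    rw [hDx q, hDx q, ← smul_sub, ← Finset.sum_sub_distrib]
    have e2 : ∀ j, A j (q (b + ρ j)) - A j (q (a + ρ j)) =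
        ∫ x in a..b, A j (D q (x + ρ j)) := by
      intro j
      rw [← map_sub, hq (a + ρ j) (b + ρ j), ← intervalIntegral.integral_comp_add_right]
      refine ((A j).intervalIntegral_comp_comm ?_).symm
      exact ((D q).continuous.comp (by fun_prop)).intervalIntegrable _ _
    simp_rw [e2]
    rw [← intervalIntegral.integral_finsetSum, ← intervalIntegral.integral_smul]
    · simp only [hDx (D q)]
    · intro j _
      exact ((A j).continuous.comp ((D q).continuous.comp (by fun_prop))).intervalIntegrable _ _
  by_contra hp0
  set P : ℝ →ᵇ (Fin d → ℂ) := BoundedContinuousFunction.ofNormedAddCommGroup p hp M hM with hP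
  have hPN : P ∈ N := by
    intro a b
    have := hs a b
    rw [← inv_smul_smul₀ hc (P b - P a)]
    change c⁻¹ • c • (p b - p a) = _
    rw [this, ← intervalIntegral.integral_smul]
    refine intervalIntegral.integral_congr fun x _ => ?_
    simp only [hDx P, Pi.zero_apply, sub_zero]
    rfl
  have hPne : P ≠ 0 := by
    intro h1
    apply hp0
    funext x
    have : P x = 0 := by rw [h1]; rfl
    exact this
  obtain ⟨μ, hμ⟩ := exists_approx_eigenvalue_mem D N hNcl (by intro a b; simp) hNadd hNsmul hDN
    hPN hPne
  have hseq : ∀ n : ℕ, ∃ (q : ℝ →ᵇ (Fin d → ℂ)), q ∈ N ∧ ‖q‖ ≤ 1 ∧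
      (∀ x, ‖D q x - μ • q x‖ ≤ 1 / ((n : ℝ) + 1)) ∧ 1 / 2 ≤ ‖q 0‖ := by
    intro n
    obtain ⟨q, hqN, hq'⟩ := hμ (1 / ((n : ℝ) + 1)) (by positivity)
    have hqpos : 0 < ‖q‖ := by
      by_contra h
      have h0 : ‖q‖ = 0 := le_antisymm (not_lt.1 h) (norm_nonneg _)
      rw [h0, mul_zero] at hq'
      exact absurd hq' (not_lt.2 (norm_nonneg _))
    obtain ⟨x₀, hx₀⟩ := exists_half_norm_lt q (norm_pos_iff.1 hqpos)
    have hDshift : D (shift ℂ x₀ q) = shift ℂ x₀ (D q) := by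
      ext x : 1
      rw [shift_apply, hDx, hDx]
      simp only [shift_apply, add_right_comm]
    have hsN : shift ℂ x₀ q ∈ N := by
      intro a b
      rw [hDshift]
      simp only [shift_apply]
      rw [hqN (a + x₀) (b + x₀), ← intervalIntegral.integral_comp_add_right]
    set k : ℂ := ((‖q‖⁻¹ : ℝ) : ℂ) with hk
    have hkn : ‖k‖ = ‖q‖⁻¹ := by
      rw [hk, Complex.norm_real, Real.norm_of_nonneg (by positivity)]
    refine ⟨k • shift ℂ x₀ q, hNsmul _ _ hsN, ?_, fun x => ?_, ?_⟩
    · rw [norm_smul, hkn]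
      calc ‖q‖⁻¹ * ‖shift ℂ x₀ q‖ ≤ ‖q‖⁻¹ * ‖q‖ := by gcongr; exact norm_shift_le _ _
        _ = 1 := inv_mul_cancel₀ hqpos.ne'
    · rw [map_smul, hDshift]
      simp only [BoundedContinuousFunction.smul_apply, shift_apply]
      rw [smul_comm μ k, ← smul_sub, norm_smul, hkn]
      have h1 : ‖D q (x + x₀) - μ • q (x + x₀)‖ ≤ 1 / ((n : ℝ) + 1) * ‖q‖ :=
        ((D q - μ • q).norm_coe_le_norm (x + x₀)).trans hq'.le
      calc ‖q‖⁻¹ * ‖D q (x + x₀) - μ • q (x + x₀)‖ ≤ ‖q‖⁻¹ * (1 / ((n : ℝ) + 1) * ‖q‖) := by gcongr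
        _ = 1 / ((n : ℝ) + 1) := by field_simp
    · simp only [BoundedContinuousFunction.smul_apply, shift_apply, zero_add]
      rw [norm_smul, hkn, inv_mul_eq_div, le_div_iff₀ hqpos]
      linarith
  choose q hqN hq1 hqD hq0 using hseq
  obtain ⟨K, hK⟩ : ∃ K : ℝ, ∀ j, ‖A j‖ ≤ K :=
    ⟨∑ j, ‖A j‖, fun j => Finset.single_le_sum (f := fun j => ‖A j‖)
      (fun _ _ => norm_nonneg _) (Finset.mem_univ j)⟩
  have hqsol : ∀ n, IsSol c ρ (fun j _ => A j) 0 (q n) := by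
    intro n a b
    rw [hqN n a b, ← intervalIntegral.integral_smul]
    refine intervalIntegral.integral_congr fun x _ => ?_
    simp only [hDx (q n), smul_inv_smul₀ hc, Pi.zero_apply, sub_zero]
  obtain ⟨φ, p', hφ, hlim, hp'1, hp'c, hp's⟩ := exists_limit_sol hc (ρ := ρ)
    (A := fun _ j _ => A j) (A' := fun j _ => A j) (h := fun _ => 0) (h' := 0)
    (p := fun n => q n) (K := K) (H := 0) zero_le_one
    (fun R => Eventually.of_forall fun n x _ => ((q n).norm_coe_le_norm x).trans (hq1 n))
    (fun n => (q n).continuous) (fun _ _ => continuous_const) (fun _ j _ => hK j)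
    (fun j x => tendsto_const_nhds) (fun _ => aestronglyMeasurable_const)
    (fun _ => Eventually.of_forall fun x => by simp)
    (Eventually.of_forall fun x => tendsto_const_nhds) hqsol
  have hsum : ∀ v : Fin d → ℂ, (∑ j : Fin 5,
      (if j = 0 then μ • ContinuousLinearMap.id ℂ (Fin d → ℂ) else 0) v) = μ • v := by
    intro v
    rw [Finset.sum_eq_single 0]
    · simp
    · intro j _ hj
      simp [hj]
    · simp
  -- the limit also solves `p' = μ p`, written as an equation of the same form
  have hp'2 : IsSol (1 : ℂ) (0 : Fin 5 → ℝ)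
      (fun j _ => if j = 0 then μ • ContinuousLinearMap.id ℂ (Fin d → ℂ) else 0) 0 p' := by
    refine isSol_of_tendsto (A := fun _ j _ =>
      if j = 0 then μ • ContinuousLinearMap.id ℂ (Fin d → ℂ) else 0)
      (h := fun n x => μ • q (φ n) x - D (q (φ n)) x) (p := fun n => q (φ n))
      (K := ‖μ • ContinuousLinearMap.id ℂ (Fin d → ℂ)‖) (M := 1) (H := 1)
      (fun R => Eventually.of_forall fun n x _ => ((q _).norm_coe_le_norm x).trans (hq1 _))
      (fun n => (q _).continuous) (fun _ _ => continuous_const) ?_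
      (fun j x => tendsto_const_nhds) ?_ ?_ ?_ hlim ?_
    · intro n j x
      split_ifs
      · exact le_rfl
      · rw [norm_zero]; positivity
    · intro n
      exact (((q _).continuous.const_smul μ).sub (D (q _)).continuous).aestronglyMeasurable
    · intro n
      refine Eventually.of_forall fun x => ?_
      rw [norm_sub_rev]
      refine (hqD (φ n) x).trans ?_
      rw [div_le_one (by positivity)]
      linarith [(Nat.cast_nonneg (φ n) : (0 : ℝ) ≤ _)]
    · refine Eventually.of_forall fun x => ?_
      refine squeeze_zero_norm (a := fun n => 1 / (((φ n : ℕ) : ℝ) + 1)) (fun n => ?_) ?_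
      · rw [norm_sub_rev]
        exact hqD (φ n) x
      · exact tendsto_one_div_add_atTop_nhds_zero_nat.comp hφ.tendsto_atTop
    · intro n a b
      rw [one_smul, hqN (φ n) a b]
      refine intervalIntegral.integral_congr fun x _ => ?_
      simp only [Pi.zero_apply, add_zero, hsum, sub_sub_cancel]
  have hd1 : ∀ x, HasDerivAt p' (μ • p' x) x := by
    intro x
    have := IsSol.hasDerivAt one_ne_zero hp'2 (fun _ => continuous_const) hp'c continuous_const x
    simpa only [Pi.zero_apply, add_zero, hsum, sub_zero, inv_one, one_smul] using this
  have hp'0 : p' 0 ≠ 0 := by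
    have : 1 / 2 ≤ ‖p' 0‖ := ge_of_tendsto (hlim 0).norm (Eventually.of_forall fun n => hq0 _)
    intro h
    rw [h, norm_zero] at this
    norm_num at this
  obtain ⟨hre, hform⟩ := eq_exp_of_bounded hd1 hp'1 hp'0
  have hμI : μ = Complex.I * (μ.im : ℂ) := by
    apply Complex.ext <;> simp [hre]
  apply hp'0
  apply hA μ.im
  have hd2 := IsSol.hasDerivAt hc hp's (fun _ => continuous_const) hp'c continuous_const 0
  have := (hd1 0).unique hd2
  rw [← hμI, mul_smul, this, smul_inv_smul₀ hc]
  simp only [zero_add, Pi.zero_apply, sub_zero]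
  refine Finset.sum_congr rfl fun j _ => ?_
  rw [hform (ρ j), map_smul]

end Uniqueness

end LatticeWave

namespace LatticeWave

/-! ### Asymptotically hyperbolic operators: exponential decay and a priori bounds -/

section Asymptotic

variable {d : ℕ}

/-- The coefficients converge at `±∞` to the coefficients of hyperbolic equations. -/
structure AsympHyp (c : ℂ) (ρ : Fin 5 → ℝ) (a : Fin 5 → ℝ →ᵇ Mat ℂ d) : Prop where
  ne_zero : c ≠ 0
  top : ∃ A : Fin 5 → Mat ℂ d, (∀ j, Tendsto (a j) atTop (𝓝 (A j))) ∧ Hyperbolic c ρ A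
  bot : ∃ A : Fin 5 → Mat ℂ d, (∀ j, Tendsto (a j) atBot (𝓝 (A j))) ∧ Hyperbolic c ρ A

theorem isSol_of_ae {𝕜 : Type} [RCLike 𝕜] {c : 𝕜} {ρ : Fin 5 → ℝ} {a : Fin 5 → ℝ →ᵇ Mat 𝕜 d}
    {p : W1inf 𝕜 d} {h : ℝ → Fin d → 𝕜} (hh : genL c ρ a p =ᵐ[volume] h) :
    IsSol c ρ (fun j => a j) h p.fn := by
  intro s t
  rw [← W1inf.integral_der, ← intervalIntegral.integral_smul]
  refine intervalIntegral.integral_congr_ae ?_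
  filter_upwards [hh, coe_genL c ρ a p] with x h1 h2 _
  rw [← h1, h2]
  abel

theorem exists_genL_eq {𝕜 : Type} [RCLike 𝕜] {c : 𝕜} (hc : c ≠ 0) {ρ : Fin 5 → ℝ}
    {a : Fin 5 → ℝ →ᵇ Mat 𝕜 d} {p : ℝ → Fin d → 𝕜} (hp : Continuous p) {M : ℝ}
    (hM : ∀ x, ‖p x‖ ≤ M) {h : Linf 𝕜 d} (hs : IsSol c ρ (fun j => a j) h p) :
    ∃ w : W1inf 𝕜 d, w.fn = p ∧ genL c ρ a w = h := by
  set P : ℝ →ᵇ (Fin d → 𝕜) := BoundedContinuousFunction.ofNormedAddCommGroup p hp M hM with hP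
  set g : Linf 𝕜 d := c⁻¹ • (bcfToLinf (lowL ρ a P) - h) with hg
  have hgae : g =ᵐ[volume] fun x => c⁻¹ • (∑ j, a j x (p (x + ρ j)) - h x) := by
    filter_upwards [Lp.coeFn_smul c⁻¹ (bcfToLinf (lowL ρ a P) - h),
      Lp.coeFn_sub (bcfToLinf (lowL ρ a P)) h, coe_bcfToLinf (lowL ρ a P)] with x h1 h2 h3
    rw [h1, Pi.smul_apply, h2, Pi.sub_apply, h3, lowL_apply]
    rfl
  obtain ⟨w, hw, hw'⟩ := W1inf.exists_of_integral hM (Lp.memLp g) g.ae_norm_le (fun s t => by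
    rw [← inv_smul_smul₀ hc (p t - p s), hs s t, ← intervalIntegral.integral_smul]
    exact intervalIntegral.integral_congr_ae (hgae.mono fun x hx _ => hx))
  refine ⟨w, hw, ?_⟩
  apply Lp.ext
  filter_upwards [coe_genL c ρ a w, hw', hgae] with x h1 h2 h3
  rw [h1, h2, h3, smul_inv_smul₀ hc, hw]
  abel

theorem exists_norm_le_all {𝕜 : Type} [RCLike 𝕜] (a : Fin 5 → ℝ →ᵇ Mat 𝕜 d) :
    ∃ K : ℝ, 0 ≤ K ∧ ∀ j x, ‖a j x‖ ≤ K :=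
  ⟨∑ j, ‖a j‖, Finset.sum_nonneg fun j _ => norm_nonneg (a j), fun j x =>
    ((a j).norm_coe_le_norm x).trans (Finset.single_le_sum (f := fun j => ‖a j‖)
      (fun j _ => norm_nonneg (a j)) (Finset.mem_univ j))⟩

/-- Far to the right, a bounded solution is at most half of its supremum over a suitable larger
half line; otherwise translates would converge to a nonzero solution of the limiting equation. -/
theorem exists_half_bound {c : ℂ} (hc : c ≠ 0) {ρ : Fin 5 → ℝ} {a : Fin 5 → ℝ →ᵇ Mat ℂ d}
    {A : Fin 5 → Mat ℂ d} (hA : ∀ j, Tendsto (a j) atTop (𝓝 (A j))) (hyp : Hyperbolic c ρ A)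
    {p : ℝ → Fin d → ℂ} (hp : Continuous p) (hs : IsSol c ρ (fun j => a j) 0 p) :
    ∃ m : ℕ, ∀ ξ : ℝ, m ≤ ξ → ∀ B : ℝ, (∀ η, ξ - m ≤ η → ‖p η‖ ≤ B) → ‖p ξ‖ ≤ B / 2 := by
  by_contra! hcon
  choose ξ hξ B hB hlt using hcon
  have hBpos : ∀ n, 0 < B n := fun n => by
    have h1 := hB n (ξ n) (by linarith [(Nat.cast_nonneg n : (0 : ℝ) ≤ n)])
    linarith [hlt n]
  obtain ⟨K, -, hK⟩ := exists_norm_le_all a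
  have hξtop : Tendsto ξ atTop atTop := tendsto_atTop_mono hξ tendsto_natCast_atTop_atTop
  set k : ℕ → ℂ := fun n => (((B n)⁻¹ : ℝ) : ℂ) with hk
  have hkn : ∀ n, ‖k n‖ = (B n)⁻¹ := fun n => by
    rw [hk, Complex.norm_real, Real.norm_of_nonneg (inv_nonneg.2 (hBpos n).le)]
  obtain ⟨φ, p', hφ, hlim, hp'1, hp'c, hp's⟩ := exists_limit_sol hc (ρ := ρ)
    (A := fun n j x => a j (x + ξ n)) (A' := fun j _ => A j) (h := fun _ => 0) (h' := 0)
    (p := fun n x => k n • p (x + ξ n)) (K := K) (H := 0) zero_le_one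
    (fun R => by
      filter_upwards [eventually_ge_atTop ⌈R⌉₊] with n hn x hx
      rw [norm_smul, hkn, inv_mul_le_iff₀ (hBpos n), mul_one]
      apply hB n
      have h1 : R ≤ n := (Nat.le_ceil R).trans (by exact_mod_cast hn)
      have h2 := (abs_le.1 hx).1
      linarith)
    (fun n => (hp.comp (continuous_add_const (ξ n))).const_smul (k n))
    (fun n j => (a j).continuous.comp (by fun_prop)) (fun n j x => hK j _)
    (fun j x => (hA j).comp (tendsto_atTop_add_const_left _ x hξtop))
    (fun _ => aestronglyMeasurable_const)
    (fun _ => Eventually.of_forall fun x => by simp)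
    (Eventually.of_forall fun x => tendsto_const_nhds)
    (fun n => by
      have := (hs.translate (ξ n)).smul (k n)
      simpa using! this)
  have h0 : p' = 0 := eq_zero_of_hyperbolic hc hyp hp'c hp'1 hp's
  have h1 : 1 / 2 ≤ ‖p' 0‖ := by
    refine ge_of_tendsto (hlim 0).norm (Eventually.of_forall fun n => ?_)
    rw [norm_smul, hkn, zero_add, inv_mul_eq_div, le_div_iff₀ (hBpos _)]
    linarith [hlt (φ n)]
  rw [h0] at h1
  norm_num at h1

/-- Iteration of the halving estimate gives exponential decay at `+∞`. -/
theorem exists_exp_bound_top {c : ℂ} (hc : c ≠ 0) {ρ : Fin 5 → ℝ} {a : Fin 5 → ℝ →ᵇ Mat ℂ d}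
    {A : Fin 5 → Mat ℂ d} (hA : ∀ j, Tendsto (a j) atTop (𝓝 (A j))) (hyp : Hyperbolic c ρ A)
    {p : ℝ → Fin d → ℂ} (hp : Continuous p) {M : ℝ} (hM : ∀ x, ‖p x‖ ≤ M)
    (hs : IsSol c ρ (fun j => a j) 0 p) :
    ∃ C κ : ℝ, 0 < κ ∧ ∀ x, 0 ≤ x → ‖p x‖ ≤ C * Real.exp (-κ * x) := by
  obtain ⟨m, hm⟩ := exists_half_bound hc hA hyp hp hs
  have hM0 : 0 ≤ M := (norm_nonneg _).trans (hM 0)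
  set m' : ℝ := (m : ℝ) + 1 with hm'
  have hm'pos : 0 < m' := by positivity
  have hind : ∀ k : ℕ, ∀ x, k * m' ≤ x → ‖p x‖ ≤ M / 2 ^ k := by
    intro k
    induction k with
    | zero => intro x _; simpa using hM x
    | succ k ih =>
      intro x hx
      push_cast at hx
      have hk0 : 0 ≤ (k : ℝ) * m' := by positivity
      have := hm x (by linarith) (M / 2 ^ k) (fun η hη => ih η (by linarith))
      rw [pow_succ, ← div_div]
      exact this
  refine ⟨2 * M, Real.log 2 / m', div_pos (Real.log_pos one_lt_two) hm'pos, fun x hx => ?_⟩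
  have h1 := hind ⌊x / m'⌋₊ x (by
    have := Nat.floor_le (div_nonneg hx hm'pos.le)
    rwa [le_div_iff₀ hm'pos] at this)
  refine h1.trans ?_
  have h2 := Nat.lt_floor_add_one (x / m')
  have h3 : Real.exp (-(Real.log 2 / m') * x) = (2 : ℝ) ^ (-(x / m')) := by
    rw [Real.rpow_def_of_pos two_pos]
    congr 1
    ring
  rw [h3, div_eq_mul_inv, mul_comm 2 M, mul_assoc]
  refine mul_le_mul_of_nonneg_left ?_ hM0
  rw [← Real.rpow_natCast, ← Real.rpow_neg two_pos.le]
  have h4 : (2 : ℝ) * 2 ^ (-(x / m')) = 2 ^ (1 + -(x / m')) := by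
    rw [Real.rpow_add two_pos, Real.rpow_one]
  rw [h4]
  exact Real.rpow_le_rpow_of_exponent_le one_le_two (by linarith)

theorem IsSol.reflect {𝕜 : Type} [RCLike 𝕜] {c : 𝕜} {ρ : Fin 5 → ℝ} {A : Fin 5 → ℝ → Mat 𝕜 d}
    {h p : ℝ → Fin d → 𝕜} (hs : IsSol c ρ A h p) :
    IsSol (-c) (-ρ) (fun j x => A j (-x)) (fun x => h (-x)) (fun x => p (-x)) := by
  intro a b
  have h1 := hs (-b) (-a)
  rw [← intervalIntegral.integral_comp_neg] at h1
  simp only [Pi.neg_apply]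
  rw [neg_smul, ← smul_neg, neg_sub, h1]
  simp only [neg_add_rev, neg_neg, add_comm]

theorem Hyperbolic.reflect {c : ℂ} {ρ : Fin 5 → ℝ} {A : Fin 5 → Mat ℂ d}
    (hA : Hyperbolic c ρ A) : Hyperbolic (-c) (-ρ) A := by
  intro ν v h
  refine hA (-ν) v ?_
  have e1 : c * (Complex.I * ((-ν : ℝ) : ℂ)) = -c * (Complex.I * ν) := by push_cast; ring
  rw [e1, h]
  refine Finset.sum_congr rfl fun j _ => ?_
  congr 2
  simp

/-- Bounded solutions of an asymptotically hyperbolic homogeneous equation decay exponentially. -/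
theorem exists_exp_bound {c : ℂ} {ρ : Fin 5 → ℝ} {a : Fin 5 → ℝ →ᵇ Mat ℂ d}
    (ha : AsympHyp c ρ a) {p : ℝ → Fin d → ℂ} (hp : Continuous p) {M : ℝ} (hM : ∀ x, ‖p x‖ ≤ M)
    (hs : IsSol c ρ (fun j => a j) 0 p) :
    ∃ C κ : ℝ, 0 ≤ C ∧ 0 < κ ∧ ∀ x, ‖p x‖ ≤ C * Real.exp (-κ * |x|) := by
  obtain ⟨A, hA, hyp⟩ := ha.top
  obtain ⟨A', hA', hyp'⟩ := ha.bot
  obtain ⟨C, κ, hκ, h1⟩ := exists_exp_bound_top ha.ne_zero hA hyp hp hM hs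
  obtain ⟨C', κ', hκ', h1'⟩ := exists_exp_bound_top (neg_ne_zero.2 ha.ne_zero)
    (a := fun j => (a j).compContinuous ⟨fun x => -x, continuous_neg⟩)
    (fun j => (hA' j).comp tendsto_neg_atTop_atBot) hyp'.reflect
    (hp.comp continuous_neg) (fun x => hM (-x)) (by simpa using! hs.reflect)
  have hC : 0 ≤ C := by
    have := (norm_nonneg _).trans (h1 0 le_rfl)
    simpa using this
  have hC' : 0 ≤ C' := by
    have := (norm_nonneg _).trans (h1' 0 le_rfl)
    simpa using this
  refine ⟨max C C', min κ κ', hC.trans (le_max_left _ _), lt_min hκ hκ', fun x => ?_⟩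
  rcases le_total 0 x with hx | hx
  · refine (h1 x hx).trans ?_
    rw [abs_of_nonneg hx]
    gcongr
    · exact le_max_left _ _
    · exact min_le_left _ _
  · have := h1' (-x) (by linarith)
    rw [Function.comp_apply, neg_neg] at this
    refine this.trans ?_
    rw [abs_of_nonpos hx]
    have hx' : 0 ≤ -x := by linarith
    gcongr
    · exact le_max_right _ _
    · exact min_le_right _ _

theorem integrable_exp_neg_mul_abs {κ : ℝ} (hκ : 0 < κ) :
    Integrable fun x : ℝ => Real.exp (-κ * |x|) := by
  have h1 : IntegrableOn (fun x : ℝ => Real.exp (-κ * |x|)) (Set.Ioi 0) := by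
    refine (integrableOn_exp_mul_Ioi (neg_lt_zero.2 hκ) 0).congr_fun ?_ measurableSet_Ioi
    intro x hx
    simp only [abs_of_pos (Set.mem_Ioi.1 hx)]
  have h2 : IntegrableOn (fun x : ℝ => Real.exp (-κ * |x|)) (Set.Iic 0) := by
    refine (integrableOn_exp_mul_Iic hκ 0).congr_fun ?_ measurableSet_Iic
    intro x hx
    simp only [abs_of_nonpos (Set.mem_Iic.1 hx)]
    ring_nf
  have := h2.union h1
  rwa [Set.Iic_union_Ioi, integrableOn_univ] at this

theorem tendsto_exp_neg_mul_abs {κ : ℝ} (hκ : 0 < κ) :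
    Tendsto (fun x : ℝ => Real.exp (-κ * |x|)) (cocompact ℝ) (𝓝 0) := by
  refine Real.tendsto_exp_atBot.comp ?_
  have : Tendsto (fun x : ℝ => |x|) (cocompact ℝ) atTop := tendsto_norm_cocompact_atTop
  exact this.const_mul_atTop_of_neg (neg_lt_zero.2 hκ)

theorem tendsto_zero_of_exp_bound {E : Type*} [NormedAddCommGroup E] {p : ℝ → E} {C κ : ℝ}
    (hκ : 0 < κ) (h : ∀ x, ‖p x‖ ≤ C * Real.exp (-κ * |x|)) :
    Tendsto p (cocompact ℝ) (𝓝 0) := by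
  refine squeeze_zero_norm h ?_
  simpa using (tendsto_exp_neg_mul_abs hκ).const_mul C

theorem integrable_of_exp_bound {E : Type*} [NormedAddCommGroup E] {p : ℝ → E} {C κ : ℝ}
    (hp : Continuous p) (hκ : 0 < κ) (h : ∀ x, ‖p x‖ ≤ C * Real.exp (-κ * |x|)) :
    Integrable p :=
  ((integrable_exp_neg_mul_abs hκ).const_mul C).mono' hp.aestronglyMeasurable
    (Eventually.of_forall h)

/-- Evaluation of the `k`-th component at the point `x₀`. -/
def evalAt {𝕜 : Type} [RCLike 𝕜] (x₀ : ℝ) (k : Fin d) : W1inf 𝕜 d →L[𝕜] 𝕜 :=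
  ((ContinuousLinearMap.proj (R := 𝕜) (φ := fun _ : Fin d => 𝕜) k).comp
    (BoundedContinuousFunction.evalCLM 𝕜 x₀)).comp toBCF

/-- A rank one perturbation of a linear operator, in the direction `v`. -/
def bordL (c : ℂ) (ρ : Fin 5 → ℝ) (a : Fin 5 → ℝ →ᵇ Mat ℂ d) (x₀ : ℝ) (k : Fin d)
    (v : ℝ →ᵇ (Fin d → ℂ)) : W1inf ℂ d →L[ℂ] Linf ℂ d :=
  genL c ρ a + (evalAt x₀ k).smulRight (bcfToLinf v)

theorem bordL_apply (c : ℂ) (ρ : Fin 5 → ℝ) (a : Fin 5 → ℝ →ᵇ Mat ℂ d) (x₀ : ℝ) (k : Fin d)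
    (v : ℝ →ᵇ (Fin d → ℂ)) (p : W1inf ℂ d) :
    bordL c ρ a x₀ k v p = genL c ρ a p + p.fn x₀ k • bcfToLinf v := rfl

/-- Every sequence of reals has a subsequence that converges to a real number or to `±∞`. -/
theorem exists_subseq_trichotomy (x : ℕ → ℝ) : ∃ φ : ℕ → ℕ, StrictMono φ ∧
    ((∃ y, Tendsto (x ∘ φ) atTop (𝓝 y)) ∨ Tendsto (x ∘ φ) atTop atTop ∨
      Tendsto (x ∘ φ) atTop atBot) := by
  obtain ⟨y, φ, hφ, hy⟩ := CompactSpace.tendsto_subseq (fun n => (x n : EReal))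
  refine ⟨φ, hφ, ?_⟩
  induction y with
  | bot => exact Or.inr (Or.inr (EReal.tendsto_coe_nhds_bot_iff.1 hy))
  | top => exact Or.inr (Or.inl (EReal.tendsto_coe_nhds_top_iff.1 hy))
  | coe y => exact Or.inl ⟨y, EReal.tendsto_coe.1 hy⟩

theorem norm_le_of_bordL (c : ℂ) (hc : c ≠ 0) (ρ : Fin 5 → ℝ) (a : Fin 5 → ℝ →ᵇ Mat ℂ d) (x₀ : ℝ)
    (k : Fin d) (v : ℝ →ᵇ (Fin d → ℂ)) : ∃ C : ℝ, 0 < C ∧ ∀ p : W1inf ℂ d,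
      ‖p‖ ≤ C * (‖toBCF p‖ + ‖bordL c ρ a x₀ k v p‖) := by
  set B : (ℝ →ᵇ (Fin d → ℂ)) →L[ℂ] Linf ℂ d := bcfToLinf.comp (lowL ρ a) with hB
  have hcn : 0 < ‖c‖ := norm_pos_iff.2 hc
  refine ⟨1 + ‖c‖⁻¹ * (1 + ‖B‖ + ‖(bcfToLinf v : Linf ℂ d)‖), by positivity, fun p => ?_⟩
  have h1 : c • derCLM p = B (toBCF p) + p.fn x₀ k • bcfToLinf v - bordL c ρ a x₀ k v p := by
    have : bordL c ρ a x₀ k v p = -(c • derCLM p) + B (toBCF p) + p.fn x₀ k • bcfToLinf v := rfl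
    rw [this]; abel
  have hk : ‖p.fn x₀ k‖ ≤ ‖toBCF p‖ :=
    (norm_le_pi_norm (p.fn x₀) k).trans ((toBCF p).norm_coe_le_norm x₀)
  have h2 : ‖c‖ * ‖derCLM p‖ ≤ ‖B‖ * ‖toBCF p‖ + ‖toBCF p‖ * ‖(bcfToLinf v : Linf ℂ d)‖ +
      ‖bordL c ρ a x₀ k v p‖ := by
    have e1 : ‖c • derCLM p‖ = ‖c‖ * ‖derCLM p‖ := norm_smul _ _
    have e2 : ‖p.fn x₀ k • (bcfToLinf v : Linf ℂ d)‖ ≤ ‖toBCF p‖ * ‖(bcfToLinf v : Linf ℂ d)‖ := by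
      rw [norm_smul]
      exact mul_le_mul_of_nonneg_right hk (norm_nonneg _)
    have e3 := B.le_opNorm (toBCF p)
    have e4 := norm_sub_le (B (toBCF p) + p.fn x₀ k • bcfToLinf v) (bordL c ρ a x₀ k v p)
    have e5 := norm_add_le (B (toBCF p)) (p.fn x₀ k • (bcfToLinf v : Linf ℂ d))
    rw [← h1, e1] at e4
    linarith
  have h3 : ‖derCLM p‖ ≤ ‖c‖⁻¹ * (‖B‖ * ‖toBCF p‖ + ‖toBCF p‖ * ‖(bcfToLinf v : Linf ℂ d)‖ +
      ‖bordL c ρ a x₀ k v p‖) := by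
    rw [← div_eq_inv_mul, le_div_iff₀ hcn, mul_comm]; exact h2
  rw [W1inf.norm_eq]
  have n1 := norm_nonneg (toBCF p)
  have n2 := norm_nonneg (bordL c ρ a x₀ k v p)
  have n3 := norm_nonneg (bcfToLinf v : Linf ℂ d)
  have n4 := norm_nonneg B
  have n5 : 0 < ‖c‖⁻¹ := inv_pos.2 hcn
  generalize ‖derCLM p‖ = D at *
  generalize ‖toBCF p‖ = P at *
  generalize ‖bordL c ρ a x₀ k v p‖ = T at *
  generalize ‖(bcfToLinf v : Linf ℂ d)‖ = V at *
  generalize ‖B‖ = b at *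
  generalize ‖c‖⁻¹ = e at *
  refine max_le ?_ (h3.trans ?_)
  · have : 0 ≤ e * (1 + b + V) * (P + T) := by positivity
    linarith
  · have : 0 ≤ P + T + e * (P + b * T + V * T) := by positivity
    linarith

/-- An injective rank one perturbation of an asymptotically hyperbolic operator, in a direction
vanishing at infinity, is bounded below. -/
theorem bordL_bounded_below {c : ℂ} {ρ : Fin 5 → ℝ} {a : Fin 5 → ℝ →ᵇ Mat ℂ d}
    (ha : AsympHyp c ρ a) {x₀ : ℝ} {k : Fin d} {v : ℝ →ᵇ (Fin d → ℂ)}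
    (hv : Tendsto v (cocompact ℝ) (𝓝 0))
    (hinj : ∀ p : W1inf ℂ d, bordL c ρ a x₀ k v p = 0 → p = 0) :
    ∃ ε : ℝ, 0 < ε ∧ ∀ p : W1inf ℂ d, ε * ‖p‖ ≤ ‖bordL c ρ a x₀ k v p‖ := by
  obtain ⟨C, hC, hCb⟩ := norm_le_of_bordL c ha.ne_zero ρ a x₀ k v
  set T := bordL c ρ a x₀ k v with hT
  suffices h : ∃ ε : ℝ, 0 < ε ∧ ∀ p : W1inf ℂ d, ε * ‖toBCF p‖ ≤ ‖T p‖ by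
    obtain ⟨ε, hε, h⟩ := h
    refine ⟨(C * (ε⁻¹ + 1))⁻¹, by positivity, fun p => ?_⟩
    rw [inv_mul_le_iff₀ (by positivity), mul_assoc]
    refine (hCb p).trans (mul_le_mul_of_nonneg_left ?_ hC.le)
    have : ‖toBCF p‖ ≤ ε⁻¹ * ‖T p‖ := by
      rw [← div_eq_inv_mul, le_div_iff₀ hε, mul_comm]; exact h p
    rw [add_mul, one_mul]
    linarith
  by_contra! hcon
  -- normalized approximate kernel elements
  have hq : ∀ n : ℕ, ∃ q : W1inf ℂ d, ‖toBCF q‖ = 1 ∧ ‖T q‖ ≤ 1 / ((n : ℝ) + 1) := by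
    intro n
    obtain ⟨p, hp⟩ := hcon (1 / ((n : ℝ) + 1)) (by positivity)
    have hpos : 0 < ‖toBCF p‖ := by
      by_contra h
      have h0 : ‖toBCF p‖ = 0 := le_antisymm (not_lt.1 h) (norm_nonneg _)
      rw [h0, mul_zero] at hp
      exact absurd hp (not_lt.2 (norm_nonneg _))
    have hkn : ‖((‖toBCF p‖⁻¹ : ℝ) : ℂ)‖ = ‖toBCF p‖⁻¹ := by
      rw [Complex.norm_real, Real.norm_of_nonneg (by positivity)]
    refine ⟨((‖toBCF p‖⁻¹ : ℝ) : ℂ) • p, ?_, ?_⟩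
    · rw [map_smul, norm_smul, hkn, inv_mul_cancel₀ hpos.ne']
    · rw [map_smul, norm_smul, hkn, inv_mul_le_iff₀ hpos, mul_comm]
      exact hp.le
  choose q hq1 hqT using hq
  have hq1' : ∀ n x, ‖(q n).fn x‖ ≤ 1 := fun n x =>
    ((toBCF (q n)).norm_coe_le_norm x).trans (hq1 n).le
  have hone : ∀ n : ℕ, 1 / ((n : ℝ) + 1) ≤ 1 := fun n => by
    rw [div_le_one (by positivity)]
    linarith [(Nat.cast_nonneg n : (0 : ℝ) ≤ n)]
  have hqW : ∀ n, ‖q n‖ ≤ C * 2 := fun n => by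
    refine (hCb (q n)).trans (mul_le_mul_of_nonneg_left ?_ hC.le)
    rw [hq1]
    linarith [hqT n, hone n]
  have hx : ∀ n, ∃ x, 1 / 2 < ‖(q n).fn x‖ := fun n => by
    have hne : toBCF (q n) ≠ 0 := by rw [← norm_pos_iff, hq1]; exact one_pos
    obtain ⟨x, hx⟩ := exists_half_norm_lt _ hne
    rw [hq1] at hx
    exact ⟨x, hx⟩
  choose x hx using hx
  obtain ⟨K, -, hK⟩ := exists_norm_le_all a
  -- the limit of the translates
  have tail : ∀ (σ : ℕ → ℕ) (t : ℕ → ℝ) (y : ℝ) (A' : Fin 5 → ℝ → Mat ℂ d)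
      (v' : ℝ → Fin d → ℂ) (l : ℂ), Tendsto σ atTop atTop →
      (∀ j x, Tendsto (fun n => a j (x + t n)) atTop (𝓝 (A' j x))) →
      (∀ x, Tendsto (fun n => v (x + t n)) atTop (𝓝 (v' x))) →
      Tendsto (fun n => (q (σ n)).fn x₀ k) atTop (𝓝 l) →
      (∀ᶠ n in atTop, 1 / 4 ≤ ‖(q (σ n)).fn (y + t n)‖) →
      ∃ (φ : ℕ → ℕ) (p' : ℝ → Fin d → ℂ), StrictMono φ ∧
        (∀ x, Tendsto (fun n => (q (σ (φ n))).fn (x + t (φ n))) atTop (𝓝 (p' x))) ∧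
        1 / 4 ≤ ‖p' y‖ ∧ (∀ x, ‖p' x‖ ≤ 1) ∧ Continuous p' ∧
        IsSol c ρ A' (fun x => -(l • v' x)) p' := by
    intro σ t y A' v' l hσ hA' hv' hl hy
    set G : ℕ → ℝ → Fin d → ℂ := fun n x => T (q (σ n)) x - (q (σ n)).fn x₀ k • v x with hG
    have hGae : ∀ n, genL c ρ a (q (σ n)) =ᵐ[volume] G n := by
      intro n
      have e : genL c ρ a (q (σ n)) = T (q (σ n)) - (q (σ n)).fn x₀ k • bcfToLinf v := by
        rw [hT, bordL_apply]; abel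
      rw [e]
      filter_upwards [Lp.coeFn_sub (T (q (σ n))) ((q (σ n)).fn x₀ k • bcfToLinf v),
        Lp.coeFn_smul ((q (σ n)).fn x₀ k) (bcfToLinf v : Linf ℂ d), coe_bcfToLinf v]
        with x h1 h2 h3
      rw [h1, Pi.sub_apply, h2, Pi.smul_apply, h3]
    have hTae : ∀ n, ∀ᵐ x, ‖T (q (σ n)) (x + t n)‖ ≤ 1 / ((σ n : ℝ) + 1) := fun n =>
      (measurePreserving_add_right volume (t n)).quasiMeasurePreserving.ae
        ((Linf.ae_norm_le (T (q (σ n)))).mono fun x hx => hx.trans (hqT (σ n)))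
    have hkb : ∀ n, ‖(q (σ n)).fn x₀ k‖ ≤ 1 := fun n =>
      (norm_le_pi_norm ((q (σ n)).fn x₀) k).trans (hq1' _ _)
    have hmeas : ∀ n, AEStronglyMeasurable (fun x => G n (x + t n)) volume := by
      intro n
      have h1 : AEStronglyMeasurable (G n) volume :=
        ((Lp.stronglyMeasurable _).aestronglyMeasurable).sub
          (show Continuous fun x => (q (σ n)).fn x₀ k • v x from by
            fun_prop).aestronglyMeasurable
      exact h1.comp_quasiMeasurePreserving
        (measurePreserving_add_right volume (t n)).quasiMeasurePreserving
    have hbd : ∀ n, ∀ᵐ x, ‖G n (x + t n)‖ ≤ 1 + 1 * ‖v‖ := by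
      intro n
      filter_upwards [hTae n] with x hx
      refine (norm_sub_le _ _).trans (add_le_add (hx.trans (hone _)) ?_)
      rw [norm_smul]
      exact mul_le_mul (hkb n) (v.norm_coe_le_norm _) (norm_nonneg _) zero_le_one
    have hlm : ∀ᵐ x, Tendsto (fun n => G n (x + t n)) atTop (𝓝 (-(l • v' x))) := by
      filter_upwards [ae_all_iff.2 hTae] with x hx
      rw [show -(l • v' x) = 0 - l • v' x by rw [zero_sub]]
      refine Tendsto.sub ?_ (hl.smul (hv' x))
      exact squeeze_zero_norm hx (tendsto_one_div_add_atTop_nhds_zero_nat.comp hσ)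
    obtain ⟨φ, p', hφ, hlim, hp'1, hp'c, hp's⟩ := exists_limit_sol ha.ne_zero (ρ := ρ)
      (A := fun n j x => a j (x + t n)) (A' := A') (h := fun n x => G n (x + t n))
      (h' := fun x => -(l • v' x))
      (p := fun n x => (q (σ n)).fn (x + t n)) (K := K) (H := 1 + 1 * ‖v‖) zero_le_one
      (fun R => Eventually.of_forall fun n x _ => hq1' _ _)
      (fun n => (W1inf.continuous_fn _).comp (by fun_prop))
      (fun n j => (a j).continuous.comp (by fun_prop)) (fun n j x => hK j _) hA'
      hmeas hbd hlm (fun n => (isSol_of_ae (hGae n)).translate (t n))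
    refine ⟨φ, p', hφ, hlim, ?_, hp'1, hp'c, hp's⟩
    exact ge_of_tendsto (hlim y).norm (hφ.tendsto_atTop.eventually hy)
  obtain ⟨φ₁, hφ₁, htri⟩ := exists_subseq_trichotomy x
  obtain ⟨l, -, φ₂, hφ₂, hl⟩ := tendsto_subseq_of_bounded
    (Metric.isBounded_closedBall (x := (0 : ℂ)) (r := 1))
    (x := fun n => (q (φ₁ n)).fn x₀ k) (fun n => by
      rw [mem_closedBall_zero_iff]
      exact (norm_le_pi_norm ((q (φ₁ n)).fn x₀) k).trans (hq1' _ _))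
  have hσ : Tendsto (φ₁ ∘ φ₂) atTop atTop := (hφ₁.comp hφ₂).tendsto_atTop
  -- escape of mass to infinity leads to a solution of a limiting equation
  have escape : ∀ A : Fin 5 → Mat ℂ d, Hyperbolic c ρ A →
      (∀ j x', Tendsto (fun n => a j (x' + x (φ₁ (φ₂ n)))) atTop (𝓝 (A j))) →
      (∀ x', Tendsto (fun n => v (x' + x (φ₁ (φ₂ n)))) atTop (𝓝 0)) → False := by
    intro A hyp h1 h2
    obtain ⟨φ, p', -, -, hy, hp'1, hp'c, hp's⟩ := tail (φ₁ ∘ φ₂) (fun n => x (φ₁ (φ₂ n))) 0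
      (fun j _ => A j) 0 l hσ h1 h2 hl (Eventually.of_forall fun n => by
        rw [zero_add]
        have := hx ((φ₁ ∘ φ₂) n)
        simp only [Function.comp_apply] at this ⊢
        linarith)
    have h0 : p' = 0 := eq_zero_of_hyperbolic ha.ne_zero hyp hp'c hp'1 (by simpa using! hp's)
    rw [h0] at hy
    norm_num at hy
  rcases htri with ⟨y, hy⟩ | hy | hy
  · have hy2 : Tendsto (fun n => x (φ₁ (φ₂ n))) atTop (𝓝 y) := hy.comp hφ₂.tendsto_atTop
    obtain ⟨φ, p', hφ, hlim, hlow, hp'1, hp'c, hp's⟩ := tail (φ₁ ∘ φ₂) (fun _ => 0) y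
      (fun j => a j) v l hσ (fun j x => by simp)
      (fun x => by simp) hl (by
        have h0 : Tendsto (fun n => C * 2 * |y - x (φ₁ (φ₂ n))|) atTop (𝓝 0) := by
          have := ((tendsto_const_nhds (x := y)).sub hy2).abs.const_mul (C * 2)
          simpa using this
        filter_upwards [h0.eventually (gt_mem_nhds (show (0 : ℝ) < 1 / 4 by norm_num))] with n hn
        have e1 := W1inf.norm_fn_sub_le (q (φ₁ (φ₂ n))) (x (φ₁ (φ₂ n))) y
        have e2 : ‖q (φ₁ (φ₂ n))‖ * |y - x (φ₁ (φ₂ n))| ≤ C * 2 * |y - x (φ₁ (φ₂ n))| :=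
          mul_le_mul_of_nonneg_right (hqW _) (abs_nonneg _)
        have e3 := hx (φ₁ (φ₂ n))
        have e4 := norm_sub_norm_le ((q (φ₁ (φ₂ n))).fn (x (φ₁ (φ₂ n)))) ((q (φ₁ (φ₂ n))).fn y)
        rw [norm_sub_rev] at e4
        simp only [Function.comp_apply, add_zero]
        linarith)
    have hl' : l = p' x₀ k := by
      refine tendsto_nhds_unique (hl.comp hφ.tendsto_atTop) ?_
      have := (tendsto_pi_nhds.1 (hlim x₀)) k
      simpa using! this
    have hs' : IsSol c ρ (fun j => a j) ((-(l • bcfToLinf v) : Linf ℂ d)) p' := by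
      intro s t
      rw [hp's s t]
      refine intervalIntegral.integral_congr_ae ?_
      filter_upwards [Lp.coeFn_neg (l • bcfToLinf v : Linf ℂ d),
        Lp.coeFn_smul l (bcfToLinf v : Linf ℂ d), coe_bcfToLinf v] with x h1 h2 h3 _
      rw [h1, Pi.neg_apply, h2, Pi.smul_apply, h3]
    obtain ⟨w, hw, hw'⟩ := exists_genL_eq ha.ne_zero hp'c hp'1 hs'
    have : w = 0 := by
      apply hinj
      rw [hT, bordL_apply, hw', hw, hl', neg_add_cancel]
    have hz : p' y = 0 := by
      rw [← hw, this]; rfl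
    rw [hz] at hlow
    norm_num at hlow
  · have hy2 : Tendsto (fun n => x (φ₁ (φ₂ n))) atTop atTop := hy.comp hφ₂.tendsto_atTop
    obtain ⟨A, hA, hyp⟩ := ha.top
    exact escape A hyp (fun j x' => (hA j).comp (tendsto_atTop_add_const_left _ x' hy2))
      (fun x' => (hv.mono_left atTop_le_cocompact).comp (tendsto_atTop_add_const_left _ x' hy2))
  · have hy2 : Tendsto (fun n => x (φ₁ (φ₂ n))) atTop atBot := hy.comp hφ₂.tendsto_atTop
    obtain ⟨A, hA, hyp⟩ := ha.bot
    exact escape A hyp (fun j x' => (hA j).comp (tendsto_atBot_add_const_left _ x' hy2))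
      (fun x' => (hv.mono_left atBot_le_cocompact).comp (tendsto_atBot_add_const_left _ x' hy2))

end Asymptotic

end LatticeWave

namespace LatticeWave

/-! ### The spectral functional of a simple eigenvalue -/

variable {d : ℕ}

/-- `0` is a simple eigenvalue with eigenfunction `v` of the asymptotically hyperbolic operator
`p ↦ -c p' + ∑ j, a_j p(· + ρ_j)`, and this operator is a limit of invertible ones. -/
structure SimpleKer (c : ℂ) (ρ : Fin 5 → ℝ) (a : Fin 5 → ℝ →ᵇ Mat ℂ d) (v : W1inf ℂ d) :
    Prop where
  hyp : AsympHyp c ρ a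
  ker : ∀ p, genL c ρ a p = 0 ↔ ∃ k : ℂ, p = k • v
  notRange : ¬ ∃ p, genL c ρ a p = bcfToLinf (toBCF v)
  approx : ∀ ε > 0, ∃ S : W1inf ℂ d →L[ℂ] Linf ℂ d, Function.Bijective S ∧ ‖genL c ρ a - S‖ < ε

variable {c : ℂ} {ρ : Fin 5 → ℝ} {a : Fin 5 → ℝ →ᵇ Mat ℂ d} {v : W1inf ℂ d}

theorem SimpleKer.genL_self (h : SimpleKer c ρ a v) : genL c ρ a v = 0 :=
  (h.ker v).2 ⟨1, (one_smul _ _).symm⟩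

theorem SimpleKer.ne_zero (h : SimpleKer c ρ a v) : v ≠ 0 := by
  rintro rfl
  exact h.notRange ⟨0, by rw [map_zero, map_zero, map_zero]⟩

theorem SimpleKer.exists_apply_ne_zero (h : SimpleKer c ρ a v) : ∃ x k, v.fn x k ≠ 0 := by
  by_contra! h0
  exact h.ne_zero (W1inf.ext_fn (funext fun x => funext fun k => h0 x k))

theorem isSol_of_genL_eq_zero {p : W1inf ℂ d} (hp : genL c ρ a p = 0) :
    IsSol c ρ (fun j => a j) 0 p.fn :=
  isSol_of_ae (by rw [hp]; exact Lp.coeFn_zero _ _ _)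

theorem SimpleKer.exists_exp_bound (h : SimpleKer c ρ a v) :
    ∃ C κ : ℝ, 0 ≤ C ∧ 0 < κ ∧ ∀ x, ‖v.fn x‖ ≤ C * Real.exp (-κ * |x|) :=
  LatticeWave.exists_exp_bound h.hyp (W1inf.continuous_fn v) (W1inf.norm_fn_le v)
    (isSol_of_genL_eq_zero h.genL_self)

theorem SimpleKer.bordL_injective (h : SimpleKer c ρ a v) {x₀ : ℝ} {k : Fin d}
    (hx : v.fn x₀ k ≠ 0) (p : W1inf ℂ d) (hp : bordL c ρ a x₀ k (toBCF v) p = 0) : p = 0 := by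
  rw [bordL_apply] at hp
  have hk : p.fn x₀ k = 0 := by
    by_contra hk
    refine h.notRange ⟨-(p.fn x₀ k)⁻¹ • p, ?_⟩
    rw [map_smul, eq_neg_of_add_eq_zero_left hp, smul_neg, neg_smul, neg_neg, smul_smul,
      inv_mul_cancel₀ hk, one_smul]
  rw [hk, zero_smul, add_zero] at hp
  obtain ⟨l, rfl⟩ := (h.ker p).1 hp
  have : l * v.fn x₀ k = 0 := hk
  rw [(mul_eq_zero.1 this).resolve_right hx, zero_smul]

/-- A rank one perturbation of a bijective operator that is injective is surjective. -/
theorem surjective_add_smulRight {X Y : Type*} [NormedAddCommGroup X] [NormedSpace ℂ X]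
    [NormedAddCommGroup Y] [NormedSpace ℂ Y] {S : X →L[ℂ] Y} (hS : Function.Bijective S)
    (l : X →L[ℂ] ℂ) (y : Y) (hinj : ∀ x, S x + l x • y = 0 → x = 0) :
    Function.Surjective (S + l.smulRight y) := by
  intro g
  obtain ⟨x, hx⟩ := hS.2 g
  obtain ⟨w, hw⟩ := hS.2 y
  have hne : 1 + l w ≠ 0 := by
    intro h0
    have h1 : l w = -1 := by linear_combination h0
    have hw0 : w = 0 := hinj w (by rw [hw, h1, neg_one_smul, add_neg_cancel])
    rw [hw0, map_zero, add_zero] at h0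
    exact one_ne_zero h0
  refine ⟨x - (l x / (1 + l w)) • w, ?_⟩
  simp only [_root_.add_apply, ContinuousLinearMap.smulRight_apply, map_sub, map_smul, hx, hw]
  have h1 : y + l w • y = (1 + l w) • y := by rw [add_smul, one_smul]
  rw [h1, smul_smul, div_mul_cancel₀ _ hne, add_sub_cancel_right]

/-- The rank one perturbation is injective because the eigenvalue is simple. It is bounded below by
compactness, and surjective because it is close to an injective rank one perturbation of an
invertible operator. -/
theorem SimpleKer.bordL_bijective (h : SimpleKer c ρ a v) {x₀ : ℝ} {k : Fin d}
    (hx : v.fn x₀ k ≠ 0) : Function.Bijective (bordL c ρ a x₀ k (toBCF v)) := by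
  obtain ⟨C, κ, -, hκ, hv⟩ := h.exists_exp_bound
  obtain ⟨ε, hε, hlow⟩ := bordL_bounded_below (v := toBCF v) h.hyp
    (tendsto_zero_of_exp_bound hκ hv) (h.bordL_injective hx)
  obtain ⟨S, hS, hSn⟩ := h.approx (ε / 2) (half_pos hε)
  have hsub : bordL c ρ a x₀ k (toBCF v) - (S + (evalAt x₀ k).smulRight (bcfToLinf (toBCF v))) =
      genL c ρ a - S := by
    rw [bordL]; abel
  refine bijective_of_norm_sub_lt hε hlow (hsub ▸ hSn) (surjective_add_smulRight hS _ _ ?_)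
  intro p hp
  -- `S` is so close to the operator that the perturbed operator is still bounded below
  have h1 : ‖bordL c ρ a x₀ k (toBCF v) p‖ ≤ ε / 2 * ‖p‖ := by
    have : bordL c ρ a x₀ k (toBCF v) p = (genL c ρ a - S) p := by
      rw [← hsub, _root_.sub_apply, _root_.add_apply,
        ContinuousLinearMap.smulRight_apply, hp, sub_zero]
    rw [this]
    exact (ContinuousLinearMap.le_opNorm _ _).trans
      (mul_le_mul_of_nonneg_right hSn.le (norm_nonneg _))
  have h2 := hlow p
  have h3 : ‖p‖ ≤ 0 := by nlinarith
  exact norm_le_zero_iff.1 h3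

/-- The spectral functional `m`: it vanishes on the range of the operator, and `g - m(g) v` always
lies in that range. -/
theorem SimpleKer.exists_functional (h : SimpleKer c ρ a v) : ∃ m : Linf ℂ d →L[ℂ] ℂ,
    (∀ p, m (genL c ρ a p) = 0) ∧ m (bcfToLinf (toBCF v)) = 1 ∧
      ∀ g, ∃ p, genL c ρ a p = g - m g • bcfToLinf (toBCF v) := by
  obtain ⟨x₀, k, hx⟩ := h.exists_apply_ne_zero
  have hbij := h.bordL_bijective hx
  let e := ContinuousLinearEquiv.ofBijective (bordL c ρ a x₀ k (toBCF v))
    (LinearMap.ker_eq_bot.2 hbij.1) (LinearMap.range_eq_top.2 hbij.2)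
  have he : ∀ p, e.symm (bordL c ρ a x₀ k (toBCF v) p) = p := fun p => e.symm_apply_apply p
  have he' : ∀ g, bordL c ρ a x₀ k (toBCF v) (e.symm g) = g := fun g => e.apply_symm_apply g
  let m : Linf ℂ d →L[ℂ] ℂ := (evalAt x₀ k).comp (e.symm : Linf ℂ d →L[ℂ] W1inf ℂ d)
  have hm : ∀ g, m g = (e.symm g).fn x₀ k := fun g => rfl
  have hrange : ∀ g, genL c ρ a (e.symm g) = g - m g • bcfToLinf (toBCF v) := fun g => by
    have := he' g
    rw [bordL_apply] at this
    rw [hm]; exact eq_sub_of_add_eq this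
  refine ⟨m, fun p => ?_, ?_, fun g => ⟨_, hrange g⟩⟩
  · by_contra hne
    refine h.notRange ⟨(m (genL c ρ a p))⁻¹ • (p - e.symm (genL c ρ a p)), ?_⟩
    rw [map_smul, map_sub, hrange, sub_sub_cancel, smul_smul, inv_mul_cancel₀ hne, one_smul]
  · have h1 : bordL c ρ a x₀ k (toBCF v) ((v.fn x₀ k)⁻¹ • v) = bcfToLinf (toBCF v) := by
      rw [map_smul, bordL_apply, h.genL_self, zero_add, smul_smul, inv_mul_cancel₀ hx, one_smul]
    rw [hm, ← h1, he]
    exact inv_mul_cancel₀ hx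

/-- The spectral functional is bounded in the norm of `L¹`: up to an element of the range, an
integrable function can be replaced by its image under an operator that involves its primitive
only. -/
theorem exists_L1_bound (hc : c ≠ 0) {m : Linf ℂ d →L[ℂ] ℂ} (hm : ∀ p, m (genL c ρ a p) = 0) :
    ∃ C : ℝ, 0 ≤ C ∧ ∀ g : Linf ℂ d, Integrable g → ‖m g‖ ≤ C * ∫ x, ‖g x‖ := by
  refine ⟨‖m‖ * (‖bcfToLinf (𝕜 := ℂ) (d := d)‖ * (‖lowL ρ a‖ * ‖c⁻¹‖)), by positivity,
    fun g hg => ?_⟩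
  have hgi : ∀ x y : ℝ, ‖∫ t in x..y, g t‖ ≤ ∫ t, ‖g t‖ := fun x y =>
    intervalIntegral.norm_integral_le_integral_norm_uIoc.trans
      (setIntegral_le_integral hg.norm (Eventually.of_forall fun _ => norm_nonneg _))
  have hP : ∀ x : ℝ, ‖-(c⁻¹ • ∫ t in (0 : ℝ)..x, g t)‖ ≤ ‖c⁻¹‖ * ∫ t, ‖g t‖ := fun x => by
    rw [norm_neg, norm_smul]
    exact mul_le_mul_of_nonneg_left (hgi 0 x) (norm_nonneg _)
  obtain ⟨w, hw, hwd⟩ := W1inf.exists_of_integral (p := fun x => -(c⁻¹ • ∫ t in (0 : ℝ)..x, g t))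
    (g := ⇑(-(c⁻¹ • g))) hP (Lp.memLp _) (Linf.ae_norm_le _) (by
      intro x y
      have h1 : ∫ t in x..y, (-(c⁻¹ • g)) t = ∫ t in x..y, -(c⁻¹ • g t) := by
        refine intervalIntegral.integral_congr_ae ?_
        filter_upwards [Lp.coeFn_neg (c⁻¹ • g), Lp.coeFn_smul c⁻¹ g] with t h1 h2 _
        rw [h1, Pi.neg_apply, h2, Pi.smul_apply]
      rw [h1, intervalIntegral.integral_neg, intervalIntegral.integral_smul,
        ← intervalIntegral.integral_interval_sub_left (Linf.intervalIntegrable g 0 y)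
          (Linf.intervalIntegrable g 0 x), smul_sub]
      abel)
  have hder : derCLM w = -(c⁻¹ • g) := Lp.ext hwd
  have hL : genL c ρ a w = g + bcfToLinf (lowL ρ a (toBCF w)) := by
    change -(c • derCLM w) + bcfToLinf (lowL ρ a (toBCF w)) = _
    rw [hder, smul_neg, neg_neg, smul_smul, mul_inv_cancel₀ hc, one_smul]
  have h0 := hm w
  rw [hL, map_add] at h0
  rw [eq_neg_of_add_eq_zero_left h0, norm_neg]
  have hwn : ‖toBCF w‖ ≤ ‖c⁻¹‖ * ∫ t, ‖g t‖ :=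
    (BoundedContinuousFunction.norm_le
      (mul_nonneg (norm_nonneg _) (integral_nonneg fun _ => norm_nonneg _))).2 fun x => by
        rw [toBCF_apply, hw]; exact hP x
  have h1 := (lowL ρ a).le_opNorm_of_le hwn
  have h2 := (bcfToLinf (𝕜 := ℂ) (d := d)).le_opNorm_of_le h1
  have h3 := m.le_opNorm_of_le h2
  exact h3.trans_eq (by ring)

/-- An `L¹`-bounded functional is small on bounded functions supported near finitely many short
intervals. -/
theorem norm_le_of_support {m : Linf ℂ d →L[ℂ] ℂ} {C : ℝ} (hC : 0 ≤ C)
    (hm : ∀ g : Linf ℂ d, Integrable g → ‖m g‖ ≤ C * ∫ x, ‖g x‖) {ι : Type} [Fintype ι]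
    (t : ι → ℝ) {x y B : ℝ} (hxy : x ≤ y) {g : Linf ℂ d}
    (hg : ∀ᵐ ξ, ‖g ξ‖ ≤ ∑ i, (Set.Ioc (x - t i) (y - t i)).indicator (fun _ => B) ξ) :
    ‖m g‖ ≤ C * (Fintype.card ι * (B * (y - x))) := by
  have hi : ∀ i, Integrable ((Set.Ioc (x - t i) (y - t i)).indicator fun _ : ℝ => B) := fun i =>
    (integrableOn_const (by simp) (by simp)).integrable_indicator measurableSet_Ioc
  have hs : Integrable fun ξ => ∑ i, (Set.Ioc (x - t i) (y - t i)).indicator (fun _ => B) ξ :=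
    integrable_finsetSum _ fun i _ => hi i
  have hgi : Integrable g := hs.mono' (Lp.stronglyMeasurable g).aestronglyMeasurable hg
  refine (hm g hgi).trans (mul_le_mul_of_nonneg_left ?_ hC)
  refine (integral_mono_ae hgi.norm hs hg).trans_eq ?_
  rw [integral_finsetSum _ fun i _ => hi i]
  have : ∀ i, ∫ ξ, (Set.Ioc (x - t i) (y - t i)).indicator (fun _ => B) ξ = B * (y - x) := by
    intro i
    rw [integral_indicator_const _ measurableSet_Ioc, Real.volume_real_Ioc_of_le (by linarith),
      smul_eq_mul]
    ring
  simp [this]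

end LatticeWave

namespace LatticeWave

/-! ### Transposed coefficients -/

/-- The transpose of a linear map, with respect to the bilinear dot product. -/
def trMat (𝕜 : Type) [RCLike 𝕜] (d : ℕ) : Mat 𝕜 d →L[𝕜] Mat 𝕜 d :=
  LinearMap.toContinuousLinearMap
    { toFun := fun A => LinearMap.toContinuousLinearMap
        { toFun := fun w k => w ⬝ᵥ A (Pi.single k 1)
          map_add' := fun w w' => funext fun k => add_dotProduct _ _ _
          map_smul' := fun t w => funext fun k => smul_dotProduct _ _ _ }
      map_add' := fun A B => by
        ext w k
        exact dotProduct_add w (A (Pi.single k 1)) (B (Pi.single k 1))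
      map_smul' := fun t A => by
        ext w k
        exact dotProduct_smul t w (A (Pi.single k 1)) }

section trMat

variable {𝕜 : Type} [RCLike 𝕜] {d : ℕ}

theorem trMat_apply (A : Mat 𝕜 d) (w : Fin d → 𝕜) (k : Fin d) :
    trMat 𝕜 d A w k = w ⬝ᵥ A (Pi.single k 1) := rfl

theorem trMat_dotProduct (A : Mat 𝕜 d) (w x : Fin d → 𝕜) :
    trMat 𝕜 d A w ⬝ᵥ x = w ⬝ᵥ A x := by
  have hx : x = ∑ k, x k • (Pi.single k (1 : 𝕜) : Fin d → 𝕜) := by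
    funext i
    simp [Finset.sum_apply, Pi.single_apply]
  conv_rhs => rw [hx, map_sum, dotProduct_sum]
  rw [dotProduct]
  refine Finset.sum_congr rfl fun k _ => ?_
  rw [map_smul, dotProduct_smul, smul_eq_mul, trMat_apply, mul_comm]

theorem continuous_dotProduct {X : Type*} [TopologicalSpace X] {p q : X → Fin d → 𝕜}
    (hp : Continuous p) (hq : Continuous q) : Continuous fun x => p x ⬝ᵥ q x :=
  hp.dotProduct hq

theorem norm_dotProduct_le (p q : Fin d → 𝕜) : ‖p ⬝ᵥ q‖ ≤ d * (‖p‖ * ‖q‖) := by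
  rw [dotProduct]
  refine (norm_sum_le_of_le _ (f := fun k => p k * q k) (n := fun _ => ‖p‖ * ‖q‖)
    fun k _ => ?_).trans (by simp)
  rw [norm_mul]
  exact mul_le_mul (norm_le_pi_norm _ _) (norm_le_pi_norm _ _) (norm_nonneg _) (norm_nonneg _)

/-- The coefficients of the adjoint operator. -/
def adjCoef (ρ : Fin 5 → ℝ) (a : Fin 5 → ℝ →ᵇ Mat 𝕜 d) (j : Fin 5) : ℝ →ᵇ Mat 𝕜 d :=
  (trMat 𝕜 d).compLeftContinuousBounded ℝ (shift 𝕜 (-ρ j) (a j))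

theorem adjCoef_apply (ρ : Fin 5 → ℝ) (a : Fin 5 → ℝ →ᵇ Mat 𝕜 d) (j : Fin 5) (x : ℝ) :
    adjCoef ρ a j x = trMat 𝕜 d (a j (x - ρ j)) := rfl

end trMat

variable {d : ℕ} {c : ℂ} {ρ : Fin 5 → ℝ} {a : Fin 5 → ℝ →ᵇ Mat ℂ d} {v : W1inf ℂ d}

/-- A square matrix is injective if and only if its transpose is. -/
theorem Hyperbolic.transpose {A : Fin 5 → Mat ℂ d} (hA : Hyperbolic c ρ A) :
    Hyperbolic (-c) (-ρ) fun j => trMat ℂ d (A j) := by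
  intro ν w hw
  let M : Mat ℂ d := (c * (Complex.I * (-ν : ℝ))) • ContinuousLinearMap.id ℂ (Fin d → ℂ) -
    ∑ j, Complex.exp (Complex.I * (-ν : ℝ) * ρ j) • A j
  have hM : ∀ x, M x = (c * (Complex.I * (-ν : ℝ))) • x -
      ∑ j, Complex.exp (Complex.I * (-ν : ℝ) * ρ j) • A j x := fun x => by
    simp [M, _root_.sub_apply, _root_.sum_apply]
  have hinj : Function.Injective (M : (Fin d → ℂ) →ₗ[ℂ] Fin d → ℂ) := by
    rw [← LinearMap.ker_eq_bot, LinearMap.ker_eq_bot']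
    intro x hx
    have : M x = 0 := hx
    rw [hM, sub_eq_zero] at this
    exact hA (-ν) x this
  have hdot : ∀ x, w ⬝ᵥ M x = 0 := by
    intro x
    have h1 := congrArg (· ⬝ᵥ x) hw
    simp only [smul_dotProduct, sum_dotProduct, trMat_dotProduct] at h1
    rw [hM, dotProduct_sub, dotProduct_smul, dotProduct_sum]
    simp only [dotProduct_smul]
    rw [sub_eq_zero]
    convert h1 using 2
    · push_cast; ring
    · push_cast; congr 2; ring_nf; simp
  funext k
  obtain ⟨x, hx⟩ := LinearMap.injective_iff_surjective.1 hinj (Pi.single k 1)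
  have h2 := hdot x
  rw [show M x = Pi.single k 1 from hx] at h2
  simpa using h2

theorem AsympHyp.adjoint (h : AsympHyp c ρ a) : AsympHyp (-c) (-ρ) (adjCoef ρ a) := by
  refine ⟨neg_ne_zero.2 h.ne_zero, ?_, ?_⟩
  · obtain ⟨A, hA, hyp⟩ := h.top
    exact ⟨_, fun j => ((trMat ℂ d).continuous.tendsto _).comp
      ((hA j).comp (tendsto_atTop_add_const_right _ _ tendsto_id)), hyp.transpose⟩
  · obtain ⟨A, hA, hyp⟩ := h.bot
    exact ⟨_, fun j => ((trMat ℂ d).continuous.tendsto _).comp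
      ((hA j).comp (tendsto_atBot_add_const_right _ _ tendsto_id)), hyp.transpose⟩

/-! ### The density of the spectral functional -/

/-- The product of a bounded continuous function with the indicator of a set, in `L^∞`. -/
def indL (s : Set ℝ) (h : ℝ →ᵇ (Fin d → ℂ)) : Linf ℂ d := toLinf (s.indicator h)

theorem coe_indL {s : Set ℝ} (hs : MeasurableSet s) (h : ℝ →ᵇ (Fin d → ℂ)) :
    indL s h =ᵐ[volume] s.indicator h := coe_toLinf ((memLp_bcf h).indicator hs)

/-- The function `ξ ↦ ∑ j, a_j(ξ) w` with the sum over those `j` for which `ξ + ρ_j > y`: the image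
of the unit step at `y` under the zeroth order part of the operator. -/
def stepL (ρ : Fin 5 → ℝ) (a : Fin 5 → ℝ →ᵇ Mat ℂ d) (y : ℝ) (w : Fin d → ℂ) : Linf ℂ d :=
  ∑ j, indL (Set.Ioi (y - ρ j)) (mulOp ℂ d (a j) (BoundedContinuousFunction.const ℝ w))

theorem coe_sum_Linf {ι : Type*} (s : Finset ι) (g : ι → Linf ℂ d) :
    (∑ i ∈ s, g i : Linf ℂ d) =ᵐ[volume] fun x => ∑ i ∈ s, g i x := by
  classical
  induction s using Finset.induction_on with
  | empty =>
    simp only [Finset.sum_empty]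
    exact Lp.coeFn_zero _ _ _
  | insert i s hi ih =>
    rw [Finset.sum_insert hi]
    filter_upwards [Lp.coeFn_add (g i) (∑ i ∈ s, g i), ih] with x h1 h2
    rw [h1, Pi.add_apply, h2, Finset.sum_insert hi]

theorem coe_stepL (y : ℝ) (w : Fin d → ℂ) : stepL ρ a y w =ᵐ[volume]
    fun x => ∑ j, (Set.Ioi (y - ρ j)).indicator (fun x => a j x w) x := by
  have h1 : ∀ j, indL (Set.Ioi (y - ρ j)) (mulOp ℂ d (a j) (BoundedContinuousFunction.const ℝ w))
      =ᵐ[volume] (Set.Ioi (y - ρ j)).indicator (fun x => a j x w) := fun j =>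
    coe_indL measurableSet_Ioi _
  filter_upwards [coe_sum_Linf Finset.univ fun j => indL (Set.Ioi (y - ρ j))
    (mulOp ℂ d (a j) (BoundedContinuousFunction.const ℝ w)), ae_all_iff.2 h1] with x h2 h3
  rw [stepL, h2]
  exact Finset.sum_congr rfl fun j _ => h3 j

theorem stepL_add (y : ℝ) (w w' : Fin d → ℂ) :
    stepL ρ a y (w + w') = stepL ρ a y w + stepL ρ a y w' := by
  refine Lp.ext ?_
  filter_upwards [coe_stepL (ρ := ρ) (a := a) y w, coe_stepL (ρ := ρ) (a := a) y w',
    coe_stepL (ρ := ρ) (a := a) y (w + w'), Lp.coeFn_add (stepL ρ a y w) (stepL ρ a y w')]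
    with x h1 h2 h3 h4
  rw [h4, Pi.add_apply, h1, h2, h3, ← Finset.sum_add_distrib]
  refine Finset.sum_congr rfl fun j _ => ?_
  by_cases hx : x ∈ Set.Ioi (y - ρ j) <;> simp [hx]

theorem stepL_smul (y : ℝ) (t : ℂ) (w : Fin d → ℂ) :
    stepL ρ a y (t • w) = t • stepL ρ a y w := by
  refine Lp.ext ?_
  filter_upwards [coe_stepL (ρ := ρ) (a := a) y w, coe_stepL (ρ := ρ) (a := a) y (t • w),
    Lp.coeFn_smul t (stepL ρ a y w)] with x h1 h2 h3
  rw [h3, Pi.smul_apply, h1, h2, Finset.smul_sum]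
  refine Finset.sum_congr rfl fun j _ => ?_
  by_cases hx : x ∈ Set.Ioi (y - ρ j) <;> simp [hx]

theorem indicator_Ioi_sub {E : Type*} [AddCommGroup E] {x y : ℝ} (hxy : x ≤ y) (h : ℝ → E)
    (ξ : ℝ) :
    (Set.Ioi x).indicator h ξ - (Set.Ioi y).indicator h ξ = (Set.Ioc x y).indicator h ξ := by
  simp only [Set.indicator_apply, Set.mem_Ioi, Set.mem_Ioc]
  by_cases h1 : x < ξ
  · by_cases h2 : y < ξ
    · simp [h1, h2, not_le.2 h2]
    · simp [h1, h2, not_lt.1 h2]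
  · have h2 : ¬ y < ξ := fun h => h1 (hxy.trans_lt h)
    simp [h1, h2]

theorem stepL_sub {x y : ℝ} (hxy : x ≤ y) (w : Fin d → ℂ) :
    stepL ρ a x w - stepL ρ a y w = ∑ j, indL (Set.Ioc (x - ρ j) (y - ρ j))
      (mulOp ℂ d (a j) (BoundedContinuousFunction.const ℝ w)) := by
  refine Lp.ext ?_
  have h1 : ∀ j, indL (Set.Ioc (x - ρ j) (y - ρ j))
      (mulOp ℂ d (a j) (BoundedContinuousFunction.const ℝ w))
      =ᵐ[volume] (Set.Ioc (x - ρ j) (y - ρ j)).indicator (fun x => a j x w) := fun j =>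
    coe_indL measurableSet_Ioc _
  filter_upwards [coe_sum_Linf Finset.univ fun j => indL (Set.Ioc (x - ρ j) (y - ρ j))
    (mulOp ℂ d (a j) (BoundedContinuousFunction.const ℝ w)), ae_all_iff.2 h1,
    coe_stepL (ρ := ρ) (a := a) x w, coe_stepL (ρ := ρ) (a := a) y w,
    Lp.coeFn_sub (stepL ρ a x w) (stepL ρ a y w)] with ξ h2 h3 h4 h5 h6
  rw [h6, Pi.sub_apply, h4, h5, h2, ← Finset.sum_sub_distrib]
  refine Finset.sum_congr rfl fun j _ => ?_
  rw [h3 j, indicator_Ioi_sub (by linarith)]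

theorem integral_indicator_Ioc_const (w : Fin d → ℂ) {x y : ℝ} (hxy : x ≤ y) (η : ℝ) :
    ‖(∫ t in x..η, (Set.Ioc x y).indicator (fun _ => w) t) -
      (Set.Ioi x).indicator (fun _ => (y - x) • w) η‖ ≤
      (Set.Ioc x y).indicator (fun _ => (y - x) * ‖w‖) η := by
  rcases le_or_gt η x with h1 | h1
  · have : ∫ t in x..η, (Set.Ioc x y).indicator (fun _ => w) t = ∫ t in x..η, (0 : Fin d → ℂ) := by
      refine intervalIntegral.integral_congr_ae (Eventually.of_forall fun t ht => ?_)
      rw [Set.uIoc_of_ge h1] at ht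
      exact Set.indicator_of_notMem (fun h => (h.1.trans_le ht.2).false) _
    rw [this, Set.indicator_of_notMem (show η ∉ Set.Ioi x from not_lt.2 h1),
      Set.indicator_of_notMem (show η ∉ Set.Ioc x y from fun h => (h.1.trans_le h1).false)]
    simp
  · have hi : ∀ a b : ℝ, IntervalIntegrable ((Set.Ioc x y).indicator fun _ => w) volume a b :=
      fun a b => ((integrableOn_const (by simp) (by simp)).integrable_indicator
        measurableSet_Ioc).intervalIntegrable
    have hin : ∀ η, x ≤ η → η ≤ y →
        ∫ t in x..η, (Set.Ioc x y).indicator (fun _ => w) t = (η - x) • w := by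
      intro η h h'
      rw [← intervalIntegral.integral_const]
      refine intervalIntegral.integral_congr_ae (Eventually.of_forall fun t ht => ?_)
      rw [Set.uIoc_of_le h] at ht
      exact Set.indicator_of_mem (show t ∈ Set.Ioc x y from ⟨ht.1, ht.2.trans h'⟩) _
    rw [Set.indicator_of_mem (show η ∈ Set.Ioi x from h1)]
    rcases le_or_gt η y with h2 | h2
    · rw [hin η h1.le h2, Set.indicator_of_mem (show η ∈ Set.Ioc x y from ⟨h1, h2⟩), ← sub_smul,
        norm_smul]
      refine mul_le_mul_of_nonneg_right ?_ (norm_nonneg _)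
      rw [Real.norm_eq_abs, abs_le]
      constructor <;> linarith
    · rw [Set.indicator_of_notMem (show η ∉ Set.Ioc x y from fun h => (h.2.trans_lt h2).false),
        ← intervalIntegral.integral_add_adjacent_intervals (hi x y) (hi y η), hin y hxy le_rfl]
      have : ∫ t in y..η, (Set.Ioc x y).indicator (fun _ => w) t =
          ∫ t in y..η, (0 : Fin d → ℂ) := by
        refine intervalIntegral.integral_congr_ae (Eventually.of_forall fun t ht => ?_)
        rw [Set.uIoc_of_le h2.le] at ht
        exact Set.indicator_of_notMem (fun h => (h.2.trans_lt ht.1).false) _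
      rw [this]
      simp

/-- The spectral functional on a short block: to first order in its length, it is given by the
image of the unit step. -/
theorem norm_functional_block_le (hc : c ≠ 0) {m : Linf ℂ d →L[ℂ] ℂ}
    (hm : ∀ p, m (genL c ρ a p) = 0) {C : ℝ} (hC : 0 ≤ C)
    (hmC : ∀ g : Linf ℂ d, Integrable g → ‖m g‖ ≤ C * ∫ x, ‖g x‖) {K : ℝ}
    (hK : ∀ j x, ‖a j x‖ ≤ K) (w : Fin d → ℂ) {x y : ℝ} (hxy : x ≤ y) :
    ‖m (indL (Set.Ioc x y) (BoundedContinuousFunction.const ℝ w)) -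
      (y - x) • (c⁻¹ * m (stepL ρ a x w))‖ ≤
      C * (5 * (K * (‖c⁻¹‖ * ((y - x) * ‖w‖)) * (y - x))) := by
  have hK0 : 0 ≤ K := (norm_nonneg _).trans (hK 0 0)
  set I := indL (Set.Ioc x y) (BoundedContinuousFunction.const ℝ w) with hI
  have hIc : I =ᵐ[volume] (Set.Ioc x y).indicator fun _ => w := coe_indL measurableSet_Ioc _
  let R : ℝ → Fin d → ℂ := fun η => ∫ t in x..η, (Set.Ioc x y).indicator (fun _ => w) t
  have hR : ∀ η, ‖R η - (Set.Ioi x).indicator (fun _ => (y - x) • w) η‖ ≤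
      (Set.Ioc x y).indicator (fun _ => (y - x) * ‖w‖) η :=
    integral_indicator_Ioc_const w hxy
  have hyx : 0 ≤ y - x := sub_nonneg.2 hxy
  have hRb : ∀ η, ‖R η‖ ≤ 2 * ((y - x) * ‖w‖) := by
    intro η
    have h1 : (Set.Ioc x y).indicator (fun _ => (y - x) * ‖w‖) η ≤ (y - x) * ‖w‖ :=
      Set.indicator_le_self' (fun _ _ => by positivity) _
    have h2 : ‖(Set.Ioi x).indicator (fun _ => (y - x) • w) η‖ ≤ (y - x) * ‖w‖ := by
      refine (norm_indicator_le_norm_self _ _).trans_eq ?_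
      rw [norm_smul, Real.norm_of_nonneg hyx]
    have h3 := norm_le_insert' (R η) ((Set.Ioi x).indicator (fun _ => (y - x) • w) η)
    linarith [hR η]
  have hi : ∀ a b : ℝ, IntervalIntegrable ((Set.Ioc x y).indicator fun _ => w) volume a b :=
    fun a b => ((integrableOn_const (by simp) (by simp)).integrable_indicator
      measurableSet_Ioc).intervalIntegrable
  obtain ⟨p, hp, hpd⟩ := W1inf.exists_of_integral (p := fun η => -(c⁻¹ • R η))
    (g := ⇑(-(c⁻¹ • I))) (C := ‖c⁻¹‖ * (2 * ((y - x) * ‖w‖))) (fun η => by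
      rw [norm_neg, norm_smul]
      exact mul_le_mul_of_nonneg_left (hRb η) (norm_nonneg _))
    (Lp.memLp _) (Linf.ae_norm_le _) (by
      intro s t
      have h1 : ∫ η in s..t, (-(c⁻¹ • I)) η =
          ∫ η in s..t, -(c⁻¹ • (Set.Ioc x y).indicator (fun _ => w) η) := by
        refine intervalIntegral.integral_congr_ae ?_
        filter_upwards [Lp.coeFn_neg (c⁻¹ • I), Lp.coeFn_smul c⁻¹ I, hIc] with t h1 h2 h3 _
        rw [h1, Pi.neg_apply, h2, Pi.smul_apply, h3]
      rw [h1, intervalIntegral.integral_neg, intervalIntegral.integral_smul,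
        ← intervalIntegral.integral_interval_sub_left (hi x t) (hi x s), smul_sub]
      simp only [R]
      rw [neg_sub_neg, neg_sub])
  have hder : derCLM p = -(c⁻¹ • I) := Lp.ext hpd
  have hL : genL c ρ a p = I + bcfToLinf (lowL ρ a (toBCF p)) := by
    change -(c • derCLM p) + bcfToLinf (lowL ρ a (toBCF p)) = _
    rw [hder, smul_neg, neg_neg, smul_smul, mul_inv_cancel₀ hc, one_smul]
  have h0 := hm p
  rw [hL, map_add] at h0
  set G := bcfToLinf (lowL ρ a (toBCF p)) + ((y - x : ℝ) * c⁻¹ : ℂ) • stepL ρ a x w with hG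
  have hmG : m I - (y - x) • (c⁻¹ * m (stepL ρ a x w)) = -m G := by
    rw [hG, map_add, map_smul, eq_neg_of_add_eq_zero_left h0, Complex.real_smul, smul_eq_mul]
    ring
  rw [hmG, norm_neg]
  have := norm_le_of_support (g := G) hC hmC ρ (B := K * (‖c⁻¹‖ * ((y - x) * ‖w‖))) hxy ?_
  · refine this.trans_eq ?_
    simp
  filter_upwards [Lp.coeFn_add (bcfToLinf (lowL ρ a (toBCF p)))
    (((y - x : ℝ) * c⁻¹ : ℂ) • stepL ρ a x w), Lp.coeFn_smul ((y - x : ℝ) * c⁻¹ : ℂ)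
      (stepL ρ a x w), coe_bcfToLinf (lowL ρ a (toBCF p)), coe_stepL (ρ := ρ) (a := a) x w]
    with ξ h1 h2 h3 h4
  rw [hG, h1, Pi.add_apply, h2, Pi.smul_apply, h3, h4, lowL_apply, Finset.smul_sum,
    ← Finset.sum_add_distrib]
  refine norm_sum_le_of_le _ fun j _ => ?_
  have h5 : a j ξ (toBCF p (ξ + ρ j)) + ((y - x : ℝ) * c⁻¹ : ℂ) •
      (Set.Ioi (x - ρ j)).indicator (fun ξ => a j ξ w) ξ =
      a j ξ (-(c⁻¹ • (R (ξ + ρ j) -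
        (Set.Ioi x).indicator (fun _ => (y - x) • w) (ξ + ρ j)))) := by
    have h6 : (Set.Ioi (x - ρ j)).indicator (fun ξ => a j ξ w) ξ =
        a j ξ ((Set.Ioi x).indicator (fun _ => w) (ξ + ρ j)) := by
      simp only [Set.indicator_apply, Set.mem_Ioi, sub_lt_iff_lt_add]
      split_ifs <;> simp
    have h7 : (Set.Ioi x).indicator (fun _ => (y - x) • w) (ξ + ρ j) =
        ((y - x : ℝ) : ℂ) • (Set.Ioi x).indicator (fun _ => w) (ξ + ρ j) := by
      simp only [Set.indicator_apply]
      split_ifs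
      · funext i
        rw [Pi.smul_apply, Pi.smul_apply, Complex.real_smul, smul_eq_mul]
      · rw [smul_zero]
    rw [h6, h7, toBCF_apply, hp, ← map_smul, ← map_add]
    congr 1
    rw [smul_sub, smul_smul, mul_comm c⁻¹]
    exact (neg_add_eq_sub _ _).trans (neg_sub _ _).symm
  rw [h5]
  refine ((a j ξ).le_opNorm _).trans ?_
  rw [norm_neg, norm_smul]
  have h6 : (Set.Ioc (x - ρ j) (y - ρ j)).indicator
      (fun _ => K * (‖c⁻¹‖ * ((y - x) * ‖w‖))) ξ =
      K * (‖c⁻¹‖ * (Set.Ioc x y).indicator (fun _ => (y - x) * ‖w‖) (ξ + ρ j)) := by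
    simp only [Set.indicator_apply, Set.mem_Ioc, sub_lt_iff_lt_add, le_sub_iff_add_le]
    split_ifs <;> simp
  rw [h6]
  exact mul_le_mul (hK j ξ) (mul_le_mul_of_nonneg_left (hR _) (norm_nonneg _))
    (by positivity) hK0

end LatticeWave

namespace LatticeWave

variable {d : ℕ} {c : ℂ} {ρ : Fin 5 → ℝ} {a : Fin 5 → ℝ →ᵇ Mat ℂ d} {v : W1inf ℂ d}

/-- The density of the functional `m` with respect to Lebesgue measure. If `m` vanishes on the range
of the operator, then `c m` agrees on the indicator of `(y, y + t]` with `m` applied to the zeroth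
order part of the operator at a ramp of height `t`, which is `t` times a unit step at `y` up to
`O(t²)`. -/
def density (c : ℂ) (ρ : Fin 5 → ℝ) (a : Fin 5 → ℝ →ᵇ Mat ℂ d) (m : Linf ℂ d →L[ℂ] ℂ) (y : ℝ) :
    Fin d → ℂ := fun k => c⁻¹ * m (stepL ρ a y (Pi.single k 1))

theorem density_dotProduct (m : Linf ℂ d →L[ℂ] ℂ) (y : ℝ) (w : Fin d → ℂ) :
    density c ρ a m y ⬝ᵥ w = c⁻¹ * m (stepL ρ a y w) := by
  let S : (Fin d → ℂ) →ₗ[ℂ] ℂ :=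
    { toFun := fun w => c⁻¹ * m (stepL ρ a y w)
      map_add' := fun w w' => by rw [stepL_add, map_add, mul_add]
      map_smul' := fun t w => by
        rw [stepL_smul, map_smul, RingHom.id_apply, smul_eq_mul, smul_eq_mul]; ring }
  have hw : w = ∑ k, w k • (Pi.single k (1 : ℂ) : Fin d → ℂ) := by
    funext i
    simp [Finset.sum_apply, Pi.single_apply]
  have : S w = ∑ k, w k • S (Pi.single k 1) := by
    conv_lhs => rw [hw, map_sum]
    exact Finset.sum_congr rfl fun k _ => map_smul _ _ _
  change _ = S w
  rw [this, dotProduct]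
  exact Finset.sum_congr rfl fun k _ => mul_comm _ _

theorem norm_single_one (k : Fin d) : ‖(Pi.single k (1 : ℂ) : Fin d → ℂ)‖ = 1 := by
  rw [Pi.norm_single, norm_one]

theorem ae_norm_stepL_sub_le {K : ℝ} (hK : ∀ j x, ‖a j x‖ ≤ K) {x y : ℝ} (hxy : x ≤ y)
    (w : Fin d → ℂ) : ∀ᵐ ξ, ‖(stepL ρ a x w - stepL ρ a y w) ξ‖ ≤
      ∑ j, (Set.Ioc (x - ρ j) (y - ρ j)).indicator (fun _ => K * ‖w‖) ξ := by
  filter_upwards [coe_stepL (ρ := ρ) (a := a) x w, coe_stepL (ρ := ρ) (a := a) y w,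
    Lp.coeFn_sub (stepL ρ a x w) (stepL ρ a y w)] with ξ h4 h5 h6
  rw [h6, Pi.sub_apply, h4, h5, ← Finset.sum_sub_distrib]
  refine norm_sum_le_of_le _ fun j _ => ?_
  rw [indicator_Ioi_sub (by linarith), Set.indicator_apply, Set.indicator_apply]
  split_ifs
  · exact (a j ξ).le_of_opNorm_le (hK j ξ) w
  · rw [norm_zero]

theorem exists_density_lipschitz {m : Linf ℂ d →L[ℂ] ℂ} {C : ℝ} (hC : 0 ≤ C)
    (hmC : ∀ g : Linf ℂ d, Integrable g → ‖m g‖ ≤ C * ∫ x, ‖g x‖) :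
    ∃ L : ℝ, 0 ≤ L ∧ ∀ x y, ‖density c ρ a m x - density c ρ a m y‖ ≤ L * |x - y| := by
  obtain ⟨K, hK0, hK⟩ := exists_norm_le_all a
  refine ⟨‖c⁻¹‖ * (C * (5 * K)), by positivity, ?_⟩
  have key : ∀ x y, x ≤ y →
      ‖density c ρ a m x - density c ρ a m y‖ ≤ ‖c⁻¹‖ * (C * (5 * K)) * |x - y| := by
    intro x y hxy
    refine (pi_norm_le_iff_of_nonneg (by positivity)).2 fun k => ?_
    rw [Pi.sub_apply, density, density, ← mul_sub, ← map_sub, norm_mul, mul_assoc]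
    refine mul_le_mul_of_nonneg_left ?_ (norm_nonneg _)
    refine (norm_le_of_support hC hmC ρ hxy (ae_norm_stepL_sub_le hK hxy _)).trans_eq ?_
    rw [norm_single_one, abs_sub_comm, abs_of_nonneg (sub_nonneg.2 hxy)]
    simp only [Fintype.card_fin, Nat.cast_ofNat]
    ring
  intro x y
  rcases le_total x y with h | h
  · exact key x y h
  · rw [norm_sub_rev, abs_sub_comm]; exact key y x h

theorem continuous_of_lipschitz {E : Type*} [SeminormedAddCommGroup E] {f : ℝ → E} {L : ℝ}
    (h : ∀ x y, ‖f x - f y‖ ≤ L * |x - y|) : Continuous f := by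
  refine (LipschitzWith.of_dist_le_mul (K := L.toNNReal) fun x y => ?_).continuous
  rw [dist_eq_norm, Real.dist_eq]
  exact (h x y).trans (mul_le_mul_of_nonneg_right (Real.le_coe_toNNReal L) (abs_nonneg _))

theorem exists_density_bound (m : Linf ℂ d →L[ℂ] ℂ) :
    ∃ M : ℝ, ∀ x, ‖density c ρ a m x‖ ≤ M := by
  obtain ⟨K, hK0, hK⟩ := exists_norm_le_all a
  refine ⟨‖c⁻¹‖ * (‖m‖ * (5 * K)), fun x =>
    (pi_norm_le_iff_of_nonneg (by positivity)).2 fun k => ?_⟩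
  rw [density, norm_mul]
  refine mul_le_mul_of_nonneg_left (m.le_opNorm_of_le ?_) (norm_nonneg _)
  refine Linf.norm_le _ (by positivity) ?_
  filter_upwards [coe_stepL (ρ := ρ) (a := a) x (Pi.single k 1)] with ξ h1
  rw [h1]
  refine (norm_sum_le_of_le _ (n := fun _ => K) fun j _ => ?_).trans (by simp)
  refine (norm_indicator_le_norm_self _ _).trans ?_
  simpa [norm_single_one] using (a j ξ).le_of_opNorm_le (hK j ξ) (Pi.single k (1 : ℂ))

theorem indL_Ioc_sub (h : ℝ →ᵇ (Fin d → ℂ)) {s x y : ℝ} (hsx : s ≤ x) (hxy : x ≤ y) :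
    indL (Set.Ioc s y) h - indL (Set.Ioc s x) h = indL (Set.Ioc x y) h := by
  refine Lp.ext ?_
  filter_upwards [coe_indL measurableSet_Ioc (s := Set.Ioc s y) h,
    coe_indL measurableSet_Ioc (s := Set.Ioc s x) h,
    coe_indL measurableSet_Ioc (s := Set.Ioc x y) h,
    Lp.coeFn_sub (indL (Set.Ioc s y) h) (indL (Set.Ioc s x) h)] with ξ h1 h2 h3 h4
  rw [h4, Pi.sub_apply, h1, h2, h3]
  simp only [Set.indicator_apply, Set.mem_Ioc]
  by_cases hs : s < ξ <;> by_cases hx : x < ξ <;> by_cases hy : ξ ≤ y <;>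
    by_cases hx' : ξ ≤ x <;> simp [hs, hx, hy, hx'] <;> exfalso <;> linarith

/-- The functional `m` is integration against its density, on functions of compact support. -/
theorem functional_indL (hc : c ≠ 0) {m : Linf ℂ d →L[ℂ] ℂ}
    (hm : ∀ p, m (genL c ρ a p) = 0) (h : ℝ →ᵇ (Fin d → ℂ)) {s t : ℝ} (hst : s ≤ t) :
    m (indL (Set.Ioc s t) h) = ∫ x in s..t, density c ρ a m x ⬝ᵥ h x := by
  obtain ⟨C, hC, hmC⟩ := exists_L1_bound hc hm
  obtain ⟨K, hK0, hK⟩ := exists_norm_le_all a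
  obtain ⟨L, hL, hlip⟩ := exists_density_lipschitz (c := c) (ρ := ρ) (a := a) hC hmC
  have hcont : Continuous fun x => density c ρ a m x ⬝ᵥ h x :=
    continuous_dotProduct (continuous_of_lipschitz hlip) h.continuous
  set F : ℝ → ℂ := fun y => m (indL (Set.Ioc s y) h) with hF
  have hFsub : ∀ x y, s ≤ x → x ≤ y → F y - F x = m (indL (Set.Ioc x y) h) := fun x y h1 h2 => by
    rw [hF, ← indL_Ioc_sub h h1 h2, map_sub]
  -- a block on which the function is close to a constant
  have hblock : ∀ (w : Fin d → ℂ) (x y δ : ℝ), x ≤ y → 0 ≤ δ →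
      (∀ ξ ∈ Set.Ioc x y, ‖h ξ - w‖ ≤ δ) →
      ‖m (indL (Set.Ioc x y) h - indL (Set.Ioc x y) (BoundedContinuousFunction.const ℝ w))‖ ≤
        C * (δ * (y - x)) := by
    intro w x y δ hxy hδ hw
    refine (norm_le_of_support hC hmC (fun _ : Unit => 0) (B := δ) hxy ?_).trans_eq (by simp)
    filter_upwards [coe_indL measurableSet_Ioc (s := Set.Ioc x y) h,
      coe_indL measurableSet_Ioc (s := Set.Ioc x y) (BoundedContinuousFunction.const ℝ w),
      Lp.coeFn_sub (indL (Set.Ioc x y) h)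
        (indL (Set.Ioc x y) (BoundedContinuousFunction.const ℝ w))] with ξ h1 h2 h3
    rw [h3, Pi.sub_apply, h1, h2, Finset.univ_unique, Finset.sum_singleton, sub_zero, sub_zero]
    by_cases hξ : ξ ∈ Set.Ioc x y
    · rw [Set.indicator_of_mem hξ, Set.indicator_of_mem hξ, Set.indicator_of_mem hξ]
      exact hw ξ hξ
    · rw [Set.indicator_of_notMem hξ, Set.indicator_of_notMem hξ, Set.indicator_of_notMem hξ]
      simp
  have hzero : ∀ x y,
      indL (Set.Ioc x y) (BoundedContinuousFunction.const ℝ (0 : Fin d → ℂ)) = 0 := by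
    intro x y
    refine Lp.ext ?_
    filter_upwards [coe_indL measurableSet_Ioc (s := Set.Ioc x y)
      (BoundedContinuousFunction.const ℝ (0 : Fin d → ℂ)), Lp.coeFn_zero (Fin d → ℂ) ∞ volume]
      with ξ h1 h2
    rw [h1, h2]
    simp [Set.indicator_apply]
  have hFlip : ∀ x y, s ≤ x → x ≤ y → ‖F y - F x‖ ≤ C * (‖h‖ * (y - x)) := by
    intro x y h1 h2
    have := hblock 0 x y ‖h‖ h2 (norm_nonneg _) fun ξ _ => by
      rw [sub_zero]; exact h.norm_coe_le_norm ξ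
    rwa [hzero, sub_zero, ← hFsub x y h1 h2] at this
  have hFc : ContinuousOn F (Set.uIcc s t) := by
    rw [Set.uIcc_of_le hst]
    have : LipschitzOnWith (C * ‖h‖).toNNReal F (Set.Icc s t) := by
      refine LipschitzOnWith.of_dist_le_mul fun x hx y hy => ?_
      rw [Real.coe_toNNReal _ (by positivity), dist_eq_norm, Real.dist_eq]
      rcases le_total x y with hxy | hxy
      · rw [norm_sub_rev, abs_sub_comm, abs_of_nonneg (sub_nonneg.2 hxy), mul_assoc]
        exact hFlip x y hx.1 hxy
      · rw [abs_of_nonneg (sub_nonneg.2 hxy), mul_assoc]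
        exact hFlip y x hy.1 hxy
    exact this.continuousOn
  have hder : ∀ x ∈ Set.Ioo (min s t) (max s t),
      HasDerivWithinAt F (density c ρ a m x ⬝ᵥ h x) (Set.Ioi x) x := by
    intro x hx
    rw [min_eq_left hst] at hx
    rw [hasDerivWithinAt_iff_isLittleO, Asymptotics.isLittleO_iff]
    intro ε hε
    set D := C * (5 * (K * (‖c⁻¹‖ * ‖h x‖))) with hD
    have hD0 : 0 ≤ D := by positivity
    obtain ⟨η, hη, hclose⟩ := Metric.continuous_iff.1 h.continuous x (ε / (2 * (C + 1)))
      (by positivity)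
    have hnear : ∀ᶠ y in 𝓝[>] x, y < x + min η (ε / (2 * (D + 1))) :=
      mem_nhdsWithin_of_mem_nhds (Iio_mem_nhds (lt_add_of_pos_right x (by positivity)))
    filter_upwards [hnear, self_mem_nhdsWithin] with y hy hxy
    have hxy' : x ≤ y := le_of_lt hxy
    have hy1 : y - x < η := by have := min_le_left η (ε / (2 * (D + 1))); linarith
    have hy2 : y - x < ε / (2 * (D + 1)) := by
      have := min_le_right η (ε / (2 * (D + 1))); linarith
    have e1 := hblock (h x) x y (ε / (2 * (C + 1))) hxy' (by positivity) fun ξ hξ => by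
      rw [← dist_eq_norm]
      refine (hclose ξ ?_).le
      rw [Real.dist_eq, abs_of_pos (sub_pos.2 hξ.1)]
      linarith [hξ.2]
    have e2 := norm_functional_block_le hc hm hC hmC hK (h x) hxy'
    rw [hFsub x y hx.1.le hxy', density_dotProduct, Real.norm_of_nonneg (sub_nonneg.2 hxy')]
    rw [map_sub] at e1
    refine (norm_sub_le_norm_sub_add_norm_sub _
      (m (indL (Set.Ioc x y) (BoundedContinuousFunction.const ℝ (h x)))) _).trans ?_
    have hyx : 0 ≤ y - x := sub_nonneg.2 hxy'
    have e3 : C * (ε / (2 * (C + 1)) * (y - x)) ≤ ε / 2 * (y - x) := by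
      rw [← mul_assoc]
      refine mul_le_mul_of_nonneg_right ?_ hyx
      rw [mul_div_assoc', div_le_div_iff₀ (by positivity) two_pos]
      nlinarith
    have e4 : C * (5 * (K * (‖c⁻¹‖ * ((y - x) * ‖h x‖)) * (y - x))) ≤ ε / 2 * (y - x) := by
      rw [show C * (5 * (K * (‖c⁻¹‖ * ((y - x) * ‖h x‖)) * (y - x))) = D * (y - x) * (y - x) by
        rw [hD]; ring]
      refine mul_le_mul_of_nonneg_right ?_ hyx
      have : (D + 1) * (y - x) ≤ ε / 2 := by
        rw [lt_div_iff₀ (by positivity)] at hy2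
        linarith
      nlinarith
    linarith
  have := intervalIntegral.integral_eq_sub_of_hasDeriv_right hFc hder
    (hcont.intervalIntegrable s t)
  rw [this]
  have h0 : F s = 0 := by
    have : indL (Set.Ioc s s) h = 0 := by
      rw [← indL_Ioc_sub h le_rfl le_rfl, sub_self]
    rw [hF]
    simp only [this, map_zero]
  rw [h0, sub_zero]

/-- The density solves the adjoint equation. -/
theorem isSol_density (hc : c ≠ 0) {m : Linf ℂ d →L[ℂ] ℂ}
    (hm : ∀ p, m (genL c ρ a p) = 0) :
    IsSol (-c) (-ρ) (fun j => adjCoef ρ a j) 0 (density c ρ a m) := by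
  obtain ⟨C, hC, hmC⟩ := exists_L1_bound hc hm
  obtain ⟨L, hL, hlip⟩ := exists_density_lipschitz (c := c) (ρ := ρ) (a := a) hC hmC
  have hdc := continuous_of_lipschitz hlip
  have hint : Continuous fun x =>
      ∑ j, adjCoef ρ a j x (density c ρ a m (x + (-ρ) j)) - (0 : ℝ → Fin d → ℂ) x := by
    refine Continuous.sub (continuous_sum_apply (-ρ) (fun j => (adjCoef ρ a j).continuous) hdc) ?_
    exact continuous_const
  have key : ∀ s t : ℝ, s ≤ t → (-c) • (density c ρ a m t - density c ρ a m s) =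
      ∫ x in s..t, (∑ j, adjCoef ρ a j x (density c ρ a m (x + (-ρ) j)) -
        (0 : ℝ → Fin d → ℂ) x) := by
    intro s t hst
    funext k
    have hproj := (ContinuousLinearMap.proj (R := ℂ) (φ := fun _ : Fin d => ℂ)
      k).intervalIntegral_comp_comm (hint.intervalIntegrable (μ := volume) s t)
    rw [ContinuousLinearMap.proj_apply] at hproj
    rw [← hproj]
    have h1 : ∀ x, (ContinuousLinearMap.proj (R := ℂ) (φ := fun _ : Fin d => ℂ) k)
        (∑ j, adjCoef ρ a j x (density c ρ a m (x + (-ρ) j)) - (0 : ℝ → Fin d → ℂ) x) =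
        ∑ j, density c ρ a m (x - ρ j) ⬝ᵥ (mulOp ℂ d (a j)
          (BoundedContinuousFunction.const ℝ (Pi.single k 1))) (x - ρ j) := by
      intro x
      rw [Pi.zero_apply, sub_zero, map_sum]
      exact Finset.sum_congr rfl fun j _ => rfl
    simp only [h1]
    rw [intervalIntegral.integral_finsetSum]
    · have h2 : ∀ j, ∫ x in s..t, density c ρ a m (x - ρ j) ⬝ᵥ (mulOp ℂ d (a j)
          (BoundedContinuousFunction.const ℝ (Pi.single k 1))) (x - ρ j) =
          m (indL (Set.Ioc (s - ρ j) (t - ρ j)) (mulOp ℂ d (a j)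
            (BoundedContinuousFunction.const ℝ (Pi.single k 1)))) := by
        intro j
        rw [intervalIntegral.integral_comp_sub_right (fun x => density c ρ a m x ⬝ᵥ
          (mulOp ℂ d (a j) (BoundedContinuousFunction.const ℝ (Pi.single k 1))) x),
          functional_indL hc hm _ (by linarith)]
      simp only [h2]
      rw [← map_sum, ← stepL_sub hst, Pi.smul_apply, Pi.sub_apply, density, density, ← mul_sub,
        ← map_sub, smul_eq_mul, neg_mul, ← mul_assoc, mul_inv_cancel₀ hc, one_mul, ← map_neg,
        neg_sub]
    · intro j _
      exact (continuous_dotProduct (hdc.comp (continuous_id.sub continuous_const))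
        ((BoundedContinuousFunction.continuous _).comp
          (continuous_id.sub continuous_const))).intervalIntegrable _ _
  intro s t
  rcases le_total s t with h | h
  · exact key s t h
  · rw [intervalIntegral.integral_symm, ← key t s h, ← smul_neg, neg_sub]

end LatticeWave

namespace LatticeWave

/-! ### The adjoint kernel -/

variable {d : ℕ} {c : ℂ} {ρ : Fin 5 → ℝ} {a : Fin 5 → ℝ →ᵇ Mat ℂ d} {v : W1inf ℂ d}

theorem integrable_dotProduct {𝕜 : Type} [RCLike 𝕜] {q p : ℝ → Fin d → 𝕜} (hq : Integrable q)
    (hqc : Continuous q) (hp : Continuous p) {M : ℝ} (hM : ∀ x, ‖p x‖ ≤ M) :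
    Integrable fun x => q x ⬝ᵥ p x := by
  refine (hq.norm.const_mul (d * M)).mono'
    (continuous_dotProduct hqc hp).aestronglyMeasurable (Eventually.of_forall fun x => ?_)
  refine (norm_dotProduct_le _ _).trans ?_
  rw [mul_assoc, mul_comm M]
  exact mul_le_mul_of_nonneg_left (mul_le_mul_of_nonneg_left (hM x) (norm_nonneg _))
    (Nat.cast_nonneg _)

theorem hasDerivAt_dotProduct {𝕜 : Type} [RCLike 𝕜] {q p : ℝ → Fin d → 𝕜} {q' p' : Fin d → 𝕜}
    {x : ℝ} (hq : HasDerivAt q q' x) (hp : HasDerivAt p p' x) :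
    HasDerivAt (fun x => q x ⬝ᵥ p x) (q' ⬝ᵥ p x + q x ⬝ᵥ p') x := by
  simp only [dotProduct]
  rw [← Finset.sum_add_distrib]
  exact HasDerivAt.fun_sum fun k _ => (hasDerivAt_pi.1 hq k).mul (hasDerivAt_pi.1 hp k)

/-- A solution `q` of the adjoint equation annihilates the continuous functions in the range of the
operator. -/
theorem integral_dotProduct_eq_zero (ha : AsympHyp c ρ a) {q : ℝ → Fin d → ℂ}
    (hq : Continuous q) {M : ℝ} (hM : ∀ x, ‖q x‖ ≤ M)
    (hs : IsSol (-c) (-ρ) (fun j => adjCoef ρ a j) 0 q) {p : W1inf ℂ d} {h : ℝ → Fin d → ℂ}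
    (hh : Continuous h) {H : ℝ} (hH : ∀ x, ‖h x‖ ≤ H) (hp : genL c ρ a p =ᵐ[volume] h) :
    ∫ x, q x ⬝ᵥ h x = 0 := by
  obtain ⟨C, κ, -, hκ, hdec⟩ := exists_exp_bound ha.adjoint hq hM hs
  obtain ⟨K, hK0, hK⟩ := exists_norm_le_all a
  have hqi : Integrable q := integrable_of_exp_bound hq hκ hdec
  have hpc := W1inf.continuous_fn p
  have hq' := fun x => hs.hasDerivAt (neg_ne_zero.2 ha.ne_zero)
    (fun j => (adjCoef ρ a j).continuous) hq continuous_const x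
  have hp' := fun x => (isSol_of_ae hp).hasDerivAt ha.ne_zero (fun j => (a j).continuous) hpc hh x
  let T : Fin 5 → ℝ → ℂ := fun j x => q x ⬝ᵥ a j x (p.fn (x + ρ j))
  have hT : ∀ j, Integrable (T j) := fun j =>
    integrable_dotProduct hqi hq ((a j).continuous.clm_apply (hpc.comp (by fun_prop)))
      (M := K * ‖p‖) fun x => ((a j x).le_of_opNorm_le (hK j x) _).trans
        (mul_le_mul_of_nonneg_left (W1inf.norm_fn_le p _) hK0)
  have hQ : Integrable fun x => q x ⬝ᵥ h x := integrable_dotProduct hqi hq hh hH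
  have hder : ∀ x, HasDerivAt (fun x => c * (q x ⬝ᵥ p.fn x))
      (∑ j, T j x - ∑ j, T j (x - ρ j) - q x ⬝ᵥ h x) x := by
    intro x
    refine ((hasDerivAt_dotProduct (hq' x) (hp' x)).const_mul c).congr_deriv ?_
    rw [smul_dotProduct, dotProduct_smul, mul_add, smul_eq_mul, smul_eq_mul, ← mul_assoc,
      ← mul_assoc, mul_inv_cancel₀ ha.ne_zero, inv_neg, mul_neg, mul_inv_cancel₀ ha.ne_zero,
      one_mul, neg_mul, one_mul, Pi.zero_apply, sub_zero, sum_dotProduct, dotProduct_sub,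
      dotProduct_sum]
    have h1 : ∀ j, adjCoef ρ a j x (q (x + (-ρ) j)) ⬝ᵥ p.fn x = T j (x - ρ j) := fun j => by
      rw [adjCoef_apply, trMat_dotProduct, Pi.neg_apply, ← sub_eq_add_neg]
      simp only [T, sub_add_cancel]
    simp only [h1]
    ring
  have hi1 : Integrable fun x => ∑ j, T j x := integrable_finsetSum _ fun j _ => hT j
  have hi2 : Integrable fun x => ∑ j, T j (x - ρ j) :=
    integrable_finsetSum _ fun j _ => (hT j).comp_sub_right (ρ j)
  have hi12 : Integrable fun x => ∑ j, T j x - ∑ j, T j (x - ρ j) := hi1.sub hi2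
  have hlim : Tendsto (fun x => c * (q x ⬝ᵥ p.fn x)) (cocompact ℝ) (𝓝 0) := by
    rw [← mul_zero c]
    refine Tendsto.const_mul c ?_
    refine squeeze_zero_norm (a := fun x => d * (‖q x‖ * ‖p‖)) (fun x =>
      (norm_dotProduct_le _ _).trans (mul_le_mul_of_nonneg_left (mul_le_mul_of_nonneg_left
        (W1inf.norm_fn_le p x) (norm_nonneg _)) (Nat.cast_nonneg _))) ?_
    have := (((tendsto_zero_of_exp_bound hκ hdec).norm.mul_const ‖p‖).const_mul (d : ℝ))
    rw [norm_zero, zero_mul, mul_zero] at this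
    exact this
  have hI := integral_of_hasDerivAt_of_tendsto hder (hi12.sub hQ)
    (hlim.mono_left atBot_le_cocompact) (hlim.mono_left atTop_le_cocompact)
  rw [integral_sub hi12 hQ, integral_sub hi1 hi2, integral_finsetSum _ fun j _ => hT j,
    integral_finsetSum _ fun j _ => (hT j).comp_sub_right (ρ j)] at hI
  simp only [integral_sub_right_eq_self] at hI
  rw [sub_self, zero_sub, sub_zero] at hI
  exact neg_eq_zero.1 hI

/-- A continuous function is determined by its integrals against bounded continuous functions. -/
theorem eq_zero_of_integral_dotProduct {q : ℝ → Fin d → ℂ} (hqc : Continuous q)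
    (hqi : Integrable q) {M : ℝ} (hM : ∀ x, ‖q x‖ ≤ M)
    (h : ∀ g : ℝ →ᵇ (Fin d → ℂ), ∫ x, q x ⬝ᵥ g x = 0) : q = 0 := by
  have hsc : Continuous fun x => star (q x) := continuous_star.comp hqc
  have h1 := h (BoundedContinuousFunction.ofNormedAddCommGroup (fun x => star (q x)) hsc M
    fun x => by rw [norm_star]; exact hM x)
  have h2 : ∀ x, q x ⬝ᵥ star (q x) = ((∑ k, ‖q x k‖ ^ 2 : ℝ) : ℂ) := by
    intro x
    rw [dotProduct]
    push_cast
    exact Finset.sum_congr rfl fun k _ => Complex.mul_conj' _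
  have h3 : ∫ x, ∑ k, ‖q x k‖ ^ 2 = 0 := by
    have : ∫ x, ((∑ k, ‖q x k‖ ^ 2 : ℝ) : ℂ) = 0 := by
      rw [← h1]
      exact integral_congr_ae (Eventually.of_forall fun x => (h2 x).symm)
    rw [integral_complex_ofReal] at this
    exact_mod_cast this
  have hcont : Continuous fun x => ∑ k, ‖q x k‖ ^ 2 :=
    continuous_finsetSum _ fun k _ => ((continuous_pi_iff.1 hqc k).norm.pow 2)
  have hint : Integrable fun x => ∑ k, ‖q x k‖ ^ 2 := by
    have := (integrable_dotProduct hqi hqc hsc (M := M) fun x => by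
      rw [norm_star]; exact hM x).re
    refine this.congr (Eventually.of_forall fun x => ?_)
    simp only [h2]
    exact Complex.ofReal_re _
  have h4 := (integral_eq_zero_iff_of_nonneg
    (fun x => Finset.sum_nonneg fun k _ => by positivity) hint).1 h3
  have h5 : (fun x => ∑ k, ‖q x k‖ ^ 2) = 0 := Continuous.ae_eq_iff_eq volume hcont
    continuous_const |>.1 h4
  funext x k
  have h6 := (Finset.sum_eq_zero_iff_of_nonneg fun k _ => by positivity).1 (congrFun h5 x) k
    (Finset.mem_univ k)
  simpa using h6

/-- An integrable bounded solution of the adjoint equation, normalized against the kernel of the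
operator: the density of the spectral functional. -/
theorem SimpleKer.exists_adjoint (h : SimpleKer c ρ a v) : ∃ s : ℝ → Fin d → ℂ,
    Continuous s ∧ (∃ M, ∀ x, ‖s x‖ ≤ M) ∧ Integrable s ∧
      IsSol (-c) (-ρ) (fun j => adjCoef ρ a j) 0 s ∧ ∫ x, s x ⬝ᵥ v.fn x = 1 := by
  obtain ⟨m, hm, hmv, -⟩ := h.exists_functional
  have hc := h.hyp.ne_zero
  obtain ⟨C, hC, hmC⟩ := exists_L1_bound hc hm
  obtain ⟨L, hL, hlip⟩ := exists_density_lipschitz (c := c) (ρ := ρ) (a := a) hC hmC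
  have hdc := continuous_of_lipschitz hlip
  obtain ⟨M, hM⟩ := exists_density_bound (c := c) (ρ := ρ) (a := a) m
  have hs := isSol_density hc hm
  obtain ⟨C', κ', -, hκ', hdec'⟩ := LatticeWave.exists_exp_bound h.hyp.adjoint hdc hM hs
  have hsi := integrable_of_exp_bound hdc hκ' hdec'
  refine ⟨density c ρ a m, hdc, ⟨M, hM⟩, hsi, hs, ?_⟩
  obtain ⟨Cv, κ, -, hκ, hv⟩ := h.exists_exp_bound
  have hvi : Integrable v.fn := integrable_of_exp_bound (W1inf.continuous_fn v) hκ hv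
  -- both sides are the limit of the functional at the truncations of `v`
  have hlim1 : Tendsto (fun n : ℕ => ∫ x in (-(n : ℝ))..n, density c ρ a m x ⬝ᵥ toBCF v x) atTop
      (𝓝 (∫ x, density c ρ a m x ⬝ᵥ v.fn x)) :=
    intervalIntegral_tendsto_integral
      (integrable_dotProduct hsi hdc (W1inf.continuous_fn v) (W1inf.norm_fn_le v))
      (tendsto_neg_atTop_atBot.comp tendsto_natCast_atTop_atTop) tendsto_natCast_atTop_atTop
  have hlim2 : Tendsto (fun n : ℕ => ∫ x in (-(n : ℝ))..n, density c ρ a m x ⬝ᵥ toBCF v x) atTop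
      (𝓝 1) := by
    have heq : ∀ n : ℕ, ∫ x in (-(n : ℝ))..n, density c ρ a m x ⬝ᵥ toBCF v x =
        m (indL (Set.Ioc (-(n : ℝ)) n) (toBCF v)) := fun n =>
      (functional_indL hc hm _ (neg_le_self (Nat.cast_nonneg n))).symm
    simp only [heq]
    rw [← hmv, tendsto_iff_norm_sub_tendsto_zero]
    have hae : ∀ n : ℕ, (indL (Set.Ioc (-(n : ℝ)) n) (toBCF v) - bcfToLinf (toBCF v))
        =ᵐ[volume] fun x => (Set.Ioc (-(n : ℝ)) n).indicator v.fn x - v.fn x := by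
      intro n
      filter_upwards [Lp.coeFn_sub (indL (Set.Ioc (-(n : ℝ)) n) (toBCF v)) (bcfToLinf (toBCF v)),
        coe_indL measurableSet_Ioc (s := Set.Ioc (-(n : ℝ)) n) (toBCF v), coe_bcfToLinf (toBCF v)]
        with x h1 h2 h3
      rw [h1, Pi.sub_apply, h2, h3]
      rfl
    have hint : ∀ n : ℕ, Integrable fun x => (Set.Ioc (-(n : ℝ)) n).indicator v.fn x - v.fn x :=
      fun n => (hvi.indicator measurableSet_Ioc).sub hvi
    have hto : Tendsto (fun n : ℕ => ∫ x, ‖(Set.Ioc (-(n : ℝ)) n).indicator v.fn x - v.fn x‖)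
        atTop (𝓝 (∫ _ : ℝ, (0 : ℝ))) := by
      refine tendsto_integral_of_dominated_convergence (fun x => ‖v.fn x‖)
        (fun n => (hint n).norm.aestronglyMeasurable) hvi.norm (fun n => ?_) ?_
      · refine Eventually.of_forall fun x => ?_
        rw [norm_norm]
        by_cases hx : x ∈ Set.Ioc (-(n : ℝ)) n
        · rw [Set.indicator_of_mem hx, sub_self, norm_zero]; exact norm_nonneg _
        · rw [Set.indicator_of_notMem hx, zero_sub, norm_neg]
      · refine Eventually.of_forall fun x => tendsto_const_nhds.congr' ?_
        obtain ⟨N, hN⟩ := exists_nat_gt |x|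
        filter_upwards [eventually_ge_atTop N] with n hn
        have hn' : (N : ℝ) ≤ n := Nat.cast_le.2 hn
        have hx := abs_lt.1 (hN.trans_le hn')
        rw [Set.indicator_of_mem (show x ∈ Set.Ioc (-(n : ℝ)) n from ⟨hx.1, hx.2.le⟩), sub_self,
          norm_zero]
    rw [integral_zero] at hto
    refine squeeze_zero (fun _ => norm_nonneg _) (fun n => ?_) (by simpa using hto.const_mul C)
    rw [← map_sub]
    refine (hmC _ ((hint n).congr (hae n).symm)).trans_eq ?_
    congr 1
    exact integral_congr_ae ((hae n).mono fun x hx => by simp only [hx])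
  exact tendsto_nhds_unique hlim1 hlim2

/-- The functional given by a bounded solution of the adjoint equation vanishes on the range, hence
is determined by its value at `v`. -/
theorem SimpleKer.adjoint_unique (h : SimpleKer c ρ a v) {s q : ℝ → Fin d → ℂ}
    (hsc : Continuous s) {M : ℝ} (hsM : ∀ x, ‖s x‖ ≤ M)
    (hs : IsSol (-c) (-ρ) (fun j => adjCoef ρ a j) 0 s) (hsv : ∫ x, s x ⬝ᵥ v.fn x = 1)
    (hqc : Continuous q) {N : ℝ} (hqN : ∀ x, ‖q x‖ ≤ N)
    (hq : IsSol (-c) (-ρ) (fun j => adjCoef ρ a j) 0 q) :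
    q = (∫ x, q x ⬝ᵥ v.fn x) • s := by
  obtain ⟨m, hm, hmv, hrange⟩ := h.exists_functional
  obtain ⟨C, κ, -, hκ, hdec⟩ := LatticeWave.exists_exp_bound h.hyp.adjoint hsc hsM hs
  have hsi := integrable_of_exp_bound hsc hκ hdec
  obtain ⟨C', κ', -, hκ', hdec'⟩ := LatticeWave.exists_exp_bound h.hyp.adjoint hqc hqN hq
  have hqi := integrable_of_exp_bound hqc hκ' hdec'
  have hvc := W1inf.continuous_fn v
  have key : ∀ q : ℝ → Fin d → ℂ, Continuous q → Integrable q → ∀ N : ℝ, (∀ x, ‖q x‖ ≤ N) →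
      IsSol (-c) (-ρ) (fun j => adjCoef ρ a j) 0 q → ∀ g : ℝ →ᵇ (Fin d → ℂ),
      ∫ x, q x ⬝ᵥ g x = m (bcfToLinf g) * ∫ x, q x ⬝ᵥ v.fn x := by
    intro q hqc hqi N hqN hq g
    obtain ⟨p, hp⟩ := hrange (bcfToLinf g)
    have hp' : genL c ρ a p =ᵐ[volume] ⇑(g - m (bcfToLinf g) • toBCF v) := by
      rw [hp, ← map_smul, ← map_sub]
      exact coe_bcfToLinf _
    have h0 := integral_dotProduct_eq_zero h.hyp hqc hqN hq
      (BoundedContinuousFunction.continuous _) (BoundedContinuousFunction.norm_coe_le_norm _) hp'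
    have h1 : ∀ x, q x ⬝ᵥ (g - m (bcfToLinf g) • toBCF v) x =
        q x ⬝ᵥ g x - m (bcfToLinf g) * (q x ⬝ᵥ v.fn x) := fun x => by
      rw [BoundedContinuousFunction.sub_apply, dotProduct_sub, BoundedContinuousFunction.smul_apply,
        dotProduct_smul, smul_eq_mul, toBCF_apply]
    simp only [h1] at h0
    rw [integral_sub (integrable_dotProduct hqi hqc g.continuous g.norm_coe_le_norm)
      ((integrable_dotProduct hqi hqc hvc (W1inf.norm_fn_le v)).const_mul _),
      integral_const_mul, sub_eq_zero] at h0
    exact h0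
  set α := ∫ x, q x ⬝ᵥ v.fn x with hα
  have hz := eq_zero_of_integral_dotProduct (q := q - α • s) (hqc.sub (continuous_const.smul hsc))
    (hqi.sub (hsi.smul α)) (M := N + ‖α‖ * M) (fun x => by
      rw [Pi.sub_apply, Pi.smul_apply]
      refine (norm_sub_le _ _).trans (add_le_add (hqN x) ?_)
      rw [norm_smul]
      exact mul_le_mul_of_nonneg_left (hsM x) (norm_nonneg _)) (fun g => by
      have h1 : ∀ x, (q - α • s) x ⬝ᵥ g x = q x ⬝ᵥ g x - α * (s x ⬝ᵥ g x) := fun x => by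
        rw [Pi.sub_apply, sub_dotProduct, Pi.smul_apply, smul_dotProduct, smul_eq_mul]
      simp only [h1]
      rw [integral_sub (integrable_dotProduct hqi hqc g.continuous g.norm_coe_le_norm)
        ((integrable_dotProduct hsi hsc g.continuous g.norm_coe_le_norm).const_mul _),
        integral_const_mul, key q hqc hqi N hqN hq g, key s hsc hsi M hsM hs g, hsv, ← hα]
      ring)
  exact sub_eq_zero.1 hz

end LatticeWave

namespace LatticeWave

/-! ### An implicit function theorem with a merely continuous parameter -/

section Implicit

variable {𝕜 Z Y G : Type*} [RCLike 𝕜] [TopologicalSpace Z] [NormedAddCommGroup Y] [NormedSpace 𝕜 Y]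
  [NormedAddCommGroup G] [NormedSpace 𝕜 G]

/-- `F(z, ·)` is strictly differentiable at `y₀` with derivative `B`, uniformly for `z` near `z₀`;
no regularity in `z` is required. -/
def PartialStrict (F : Z × Y → G) (B : Y →L[𝕜] G) (z₀ : Z) (y₀ : Y) : Prop :=
  (fun q : Z × Y × Y => F (q.1, q.2.1) - F (q.1, q.2.2) - B (q.2.1 - q.2.2)) =o[𝓝 (z₀, y₀, y₀)]
    fun q => q.2.1 - q.2.2

theorem PartialStrict.exists_approx {F : Z × Y → G} {B : Y →L[𝕜] G} {z₀ : Z} {y₀ : Y}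
    (h : PartialStrict F B z₀ y₀) {ε : NNReal} (hε : 0 < ε) :
    ∃ R > 0, ∀ᶠ z in 𝓝 z₀,
      ApproximatesLinearOn (fun y => F (z, y)) B (Metric.closedBall y₀ R) ε := by
  have h1 := h.def (show (0 : ℝ) < ε from hε)
  rw [nhds_prod_eq, nhds_prod_eq, eventually_prod_iff] at h1
  obtain ⟨P, hP, Q, hQ, hPQ⟩ := h1
  rw [eventually_prod_iff] at hQ
  obtain ⟨Q1, hQ1, Q2, hQ2, hQQ⟩ := hQ
  obtain ⟨R, hR, hball⟩ := Metric.eventually_nhds_iff_ball.1 (hQ1.and hQ2)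
  refine ⟨R / 2, half_pos hR, hP.mono fun z hz => ?_⟩
  intro y1 hy1 y2 hy2
  have hsub := Metric.closedBall_subset_ball (x := y₀) (half_lt_self hR)
  exact hPQ hz (y := (y1, y2)) (hQQ (hball y1 (hsub hy1)).1 (hball y2 (hsub hy2)).2)

/-- The implicit function theorem with a continuous parameter. -/
theorem PartialStrict.exists_implicit [CompleteSpace Y] {F : Z × Y → G} {B : Y ≃L[𝕜] G} {z₀ : Z}
    {y₀ : Y} (h : PartialStrict F (B : Y →L[𝕜] G) z₀ y₀) (h0 : F (z₀, y₀) = 0)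
    (hF : ∀ y, Continuous fun z => F (z, y)) :
    ∃ y : Z → Y, y z₀ = y₀ ∧ ∀ᶠ z in 𝓝 z₀, F (z, y z) = 0 ∧ ContinuousAt y z := by
  classical
  set M : NNReal := ‖(B.symm : G →L[𝕜] Y)‖₊ + 1 with hM
  have hM0 : 0 < M := by positivity
  set ε : NNReal := (2 * M)⁻¹ with hε
  have hε0 : 0 < ε := by positivity
  have hεM : (M : ℝ) * ε = 1 / 2 := by
    have : (M : ℝ) ≠ 0 := (NNReal.coe_pos.2 hM0).ne'
    rw [hε]; push_cast; field_simp
  obtain ⟨R, hR, hW⟩ := h.exists_approx hε0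
  have hBM : ∀ g, ‖B.symm g‖ ≤ M * ‖g‖ := fun g =>
    ((B.symm : G →L[𝕜] Y).le_opNorm g).trans
      (mul_le_mul_of_nonneg_right (by rw [hM]; push_cast; simp) (norm_nonneg _))
  let Binv : (B : Y →L[𝕜] G).NonlinearRightInverse :=
    { toFun := B.symm
      nnnorm := M
      bound' := hBM
      right_inv' := fun g => B.apply_symm_apply g }
  have hsmall : ∀ᶠ z in 𝓝 z₀, ‖F (z, y₀)‖ < ε * R := by
    have h1 : Tendsto (fun z => ‖F (z, y₀)‖) (𝓝 z₀) (𝓝 0) := by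
      have := ((hF y₀).tendsto z₀).norm
      rwa [h0, norm_zero] at this
    exact h1.eventually (gt_mem_nhds (mul_pos (NNReal.coe_pos.2 hε0) hR))
  have hsol : ∀ᶠ z in 𝓝 z₀, ∃ y ∈ Metric.closedBall y₀ R, F (z, y) = 0 := by
    filter_upwards [hW, hsmall] with z hz hz'
    have hs := hz.surjOn_closedBall_of_nonlinearRightInverse Binv hR.le subset_rfl
    have hmem : (0 : G) ∈ Metric.closedBall (F (z, y₀))
        ((((Binv.nnnorm : NNReal) : ℝ)⁻¹ - ε) * R) := by
      have h2 : ((Binv.nnnorm : NNReal) : ℝ)⁻¹ - ε = ε := by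
        change (M : ℝ)⁻¹ - ε = ε
        rw [hε]; push_cast
        have : (M : ℝ) ≠ 0 := (NNReal.coe_pos.2 hM0).ne'
        field_simp; norm_num
      rw [h2, mem_closedBall_iff_norm, zero_sub, norm_neg]
      exact hz'.le
    exact hs hmem
  have hlow : ∀ z, ApproximatesLinearOn (fun y => F (z, y)) (B : Y →L[𝕜] G)
      (Metric.closedBall y₀ R) ε → ∀ y1 ∈ Metric.closedBall y₀ R, ∀ y2 ∈ Metric.closedBall y₀ R,
      ‖y1 - y2‖ ≤ 2 * M * ‖F (z, y1) - F (z, y2)‖ := by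
    intro z hz y1 h1 y2 h2
    have h3 := hz y1 h1 y2 h2
    have h4 : ‖y1 - y2‖ ≤ M * ‖B (y1 - y2)‖ := by simpa using hBM (B (y1 - y2))
    have h5 : ‖B (y1 - y2)‖ ≤ ‖F (z, y1) - F (z, y2)‖ + ε * ‖y1 - y2‖ := by
      refine (norm_le_insert (F (z, y1) - F (z, y2)) _).trans (add_le_add_right h3 _)
    have h6 := h4.trans (mul_le_mul_of_nonneg_left h5 M.coe_nonneg)
    rw [mul_add, ← mul_assoc, hεM] at h6
    linarith
  let y : Z → Y := fun z =>
    if h : ∃ y ∈ Metric.closedBall y₀ R, F (z, y) = 0 then h.choose else y₀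
  have hy : ∀ z, y z ∈ Metric.closedBall y₀ R := by
    intro z
    by_cases hz : ∃ y ∈ Metric.closedBall y₀ R, F (z, y) = 0
    · simp only [y, dif_pos hz]; exact hz.choose_spec.1
    · simp only [y, dif_neg hz]; exact Metric.mem_closedBall_self hR.le
  have hyF : ∀ z, (∃ y ∈ Metric.closedBall y₀ R, F (z, y) = 0) → F (z, y z) = 0 := by
    intro z hz
    simp only [y, dif_pos hz]; exact hz.choose_spec.2
  refine ⟨y, ?_, ?_⟩
  · have h1 := hlow z₀ hW.self_of_nhds (y z₀) (hy z₀) y₀ (Metric.mem_closedBall_self hR.le)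
    rw [hyF z₀ hsol.self_of_nhds, h0, sub_zero, norm_zero, mul_zero] at h1
    exact sub_eq_zero.1 (norm_le_zero_iff.1 h1)
  · filter_upwards [hW.eventually_nhds, hsol.eventually_nhds] with z hz hz'
    refine ⟨hyF z hz'.self_of_nhds, ?_⟩
    rw [ContinuousAt, tendsto_iff_norm_sub_tendsto_zero]
    have h1 : Tendsto (fun w => 2 * M * ‖F (w, y z)‖) (𝓝 z) (𝓝 0) := by
      have := (((hF (y z)).tendsto z).norm).const_mul (2 * M : ℝ)
      rwa [hyF z hz'.self_of_nhds, norm_zero, mul_zero] at this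
    refine squeeze_zero' (Eventually.of_forall fun _ => norm_nonneg _) ?_ h1
    filter_upwards [hz, hz'] with w hw hw'
    have h2 := hlow w hw (y w) (hy w) (y z) (hy z)
    rwa [hyF w hw', zero_sub, norm_neg] at h2

end Implicit

/-- The derivative of an implicit function. -/
theorem PartialStrict.hasDerivAt {𝕜 Y G : Type*} [RCLike 𝕜] [NormedAddCommGroup Y]
    [NormedSpace 𝕜 Y] [NormedAddCommGroup G] [NormedSpace 𝕜 G] {F : 𝕜 × Y → G} {B : Y ≃L[𝕜] G}
    {z₀ : 𝕜} {y : 𝕜 → Y} (h : PartialStrict F (B : Y →L[𝕜] G) z₀ (y z₀)) (hy : ContinuousAt y z₀)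
    (h0 : ∀ᶠ z in 𝓝 z₀, F (z, y z) = 0) {D : G}
    (hD : HasDerivAt (fun z => F (z, y z₀)) D z₀) : HasDerivAt y (-B.symm D) z₀ := by
  have hF0 : F (z₀, y z₀) = 0 := h0.self_of_nhds
  have ht : Tendsto (fun z => (z, y z, y z₀)) (𝓝 z₀) (𝓝 (z₀, y z₀, y z₀)) :=
    tendsto_id.prodMk_nhds (hy.prodMk_nhds tendsto_const_nhds)
  have h1 : (fun z => -F (z, y z₀) - B (y z - y z₀)) =o[𝓝 z₀] fun z => y z - y z₀ := by
    refine (h.comp_tendsto ht).congr' (h0.mono fun z hz => ?_) EventuallyEq.rfl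
    simp [hz]
  have h2 := hasDerivAt_iff_isLittleO.1 hD
  simp only [hF0, sub_zero] at h2
  have hB : ∀ {f : 𝕜 → G} {k : 𝕜 → 𝕜}, f =o[𝓝 z₀] k → (fun z => B.symm (f z)) =o[𝓝 z₀] k :=
    fun {f} {k} hf => ((B.symm : G →L[𝕜] Y).isBigO_comp f _).trans_isLittleO hf
  have h3 : (fun z => -B.symm (F (z, y z₀)) - (y z - y z₀)) =o[𝓝 z₀] fun z => y z - y z₀ := by
    refine (((B.symm : G →L[𝕜] Y).isBigO_comp _ _).trans_isLittleO h1).congr_left fun z => ?_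
    simp
  have h4 : (fun z => F (z, y z₀)) =O[𝓝 z₀] fun z => z - z₀ := by
    have h5 : (fun z => (z - z₀) • D) =O[𝓝 z₀] fun z => z - z₀ :=
      Asymptotics.IsBigO.of_bound ‖D‖ (Eventually.of_forall fun z => by
        rw [norm_smul, mul_comm])
    simpa using h2.isBigO.add h5
  have h6 : (fun z => y z - y z₀) =O[𝓝 z₀] fun z => z - z₀ := by
    have h7 := h3.right_isBigO_add
    simp only [sub_add_cancel] at h7
    exact h7.trans (((B.symm : G →L[𝕜] Y).isBigO_comp _ _).trans h4 |>.neg_left)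
  rw [hasDerivAt_iff_isLittleO]
  have h8 := ((h3.trans_isBigO h6).add (hB h2)).neg_left
  refine h8.congr_left fun z => ?_
  simp only [map_sub, map_smul, smul_neg]
  abel

end LatticeWave

namespace LatticeWave

/-! ### Superposition operators and real coefficients -/

section Tools

/-- The superposition operator `p ↦ G ∘ p` on bounded continuous functions. -/
def nem {X Y : Type*} [NormedAddCommGroup X] [ProperSpace X] [NormedAddCommGroup Y] (G : X → Y)
    (hG : Continuous G) (p : ℝ →ᵇ X) : ℝ →ᵇ Y :=
  BoundedContinuousFunction.mkOfBound ⟨fun x => G (p x), hG.comp p.continuous⟩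
    (Metric.diam (G '' Metric.closedBall 0 ‖p‖)) fun x y => by
      refine Metric.dist_le_diam_of_mem ((isCompact_closedBall 0 ‖p‖).image hG).isBounded ?_ ?_
      · exact ⟨p x, mem_closedBall_zero_iff.2 (p.norm_coe_le_norm x), rfl⟩
      · exact ⟨p y, mem_closedBall_zero_iff.2 (p.norm_coe_le_norm y), rfl⟩

@[simp] theorem nem_apply {X Y : Type*} [NormedAddCommGroup X] [ProperSpace X]
    [NormedAddCommGroup Y] (G : X → Y) (hG : Continuous G) (p : ℝ →ᵇ X) (x : ℝ) :
    nem G hG p x = G (p x) := rfl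

/-- Five bounded continuous functions as one function with values in a product. -/
def piBCF {E : Type*} [NormedAddCommGroup E] [NormedSpace ℝ E] :
    (Fin 5 → (ℝ →ᵇ E)) →L[ℝ] (ℝ →ᵇ (Fin 5 → E)) :=
  ∑ j, ((ContinuousLinearMap.single ℝ (fun _ : Fin 5 => E) j).compLeftContinuousBounded ℝ).comp
    (ContinuousLinearMap.proj j)

theorem piBCF_apply {E : Type*} [NormedAddCommGroup E] [NormedSpace ℝ E]
    (V : Fin 5 → (ℝ →ᵇ E)) (x : ℝ) (j : Fin 5) : piBCF V x j = V j x := by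
  have : piBCF V = ∑ i, ((ContinuousLinearMap.single ℝ (fun _ : Fin 5 => E)
      i).compLeftContinuousBounded ℝ) (V i) := by
    rw [piBCF, _root_.sum_apply]; rfl
  rw [this, BoundedContinuousFunction.sum_apply, Finset.sum_apply, Finset.sum_eq_single j]
  · exact Pi.single_eq_same (M := fun _ : Fin 5 => E) j (V j x)
  · intro i _ hij
    exact Pi.single_eq_of_ne (M := fun _ : Fin 5 => E) hij.symm (V i x)
  · simp

/-- The stencil `ξ ↦ (V(ξ + ρ_j))_j`. -/
def stencilB {E : Type*} [NormedAddCommGroup E] [NormedSpace ℝ E] (ρ : Fin 5 → ℝ) (V : ℝ →ᵇ E) :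
    ℝ →ᵇ (Fin 5 → E) := piBCF fun j => shift ℝ (ρ j) V

theorem stencilB_apply {E : Type*} [NormedAddCommGroup E] [NormedSpace ℝ E] (ρ : Fin 5 → ℝ)
    (V : ℝ →ᵇ E) (x : ℝ) : stencilB ρ V x = fun j => V (x + ρ j) := by
  funext j
  rw [stencilB, piBCF_apply, shift_apply]

variable {d : ℕ}

/-- The derivative of `f` with respect to its `j`-th argument. -/
def pderiv (f : (Fin 5 → Fin d → ℝ) → Fin d → ℝ) (j : Fin 5) (U : Fin 5 → Fin d → ℝ) : Mat ℝ d :=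
  (fderiv ℝ f U).comp (ContinuousLinearMap.single ℝ (fun _ : Fin 5 => Fin d → ℝ) j)

theorem continuous_pderiv {f : (Fin 5 → Fin d → ℝ) → Fin d → ℝ} (hf : Continuous (fderiv ℝ f))
    (j : Fin 5) : Continuous (pderiv f j) := by
  unfold pderiv
  fun_prop

theorem pderiv_apply (f : (Fin 5 → Fin d → ℝ) → Fin d → ℝ) (j : Fin 5) (U : Fin 5 → Fin d → ℝ)
    (w : Fin d → ℝ) : pderiv f j U w = jac f U j *ᵥ w := by
  have hw : w = ∑ b, w b • (Pi.single b (1 : ℝ) : Fin d → ℝ) := by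
    funext i
    simp [Finset.sum_apply, Pi.single_apply]
  funext k
  conv_lhs => rw [hw]
  rw [map_sum, Finset.sum_apply, mulVec, dotProduct]
  refine Finset.sum_congr rfl fun b _ => ?_
  rw [map_smul, Pi.smul_apply, smul_eq_mul, mul_comm]
  rfl

theorem fderiv_eq_sum_pderiv (f : (Fin 5 → Fin d → ℝ) → Fin d → ℝ) (U W : Fin 5 → Fin d → ℝ) :
    fderiv ℝ f U W = ∑ j, pderiv f j U (W j) := by
  have hW : W = ∑ j, Pi.single j (W j) := (Finset.univ_sum_single W).symm
  conv_lhs => rw [hW]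
  rw [map_sum]
  rfl

/-- The coefficient `D_j f(τV)` of the linearization at `V`. -/
def jacB {f : (Fin 5 → Fin d → ℝ) → Fin d → ℝ} (hf : Continuous (fderiv ℝ f)) (ρ : Fin 5 → ℝ)
    (V : ℝ →ᵇ (Fin d → ℝ)) (j : Fin 5) : ℝ →ᵇ Mat ℝ d :=
  nem (pderiv f j) (continuous_pderiv hf j) (stencilB ρ V)

theorem jacB_apply {f : (Fin 5 → Fin d → ℝ) → Fin d → ℝ} (hf : Continuous (fderiv ℝ f))
    (ρ : Fin 5 → ℝ) (V : ℝ →ᵇ (Fin d → ℝ)) (j : Fin 5) (x : ℝ) :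
    jacB hf ρ V j x = pderiv f j (fun i => V (x + ρ i)) := by
  rw [jacB, nem_apply, stencilB_apply]

/-- The complexification of a real linear map. -/
def cxMat (d : ℕ) : Mat ℝ d →L[ℝ] Mat ℂ d :=
  LinearMap.toContinuousLinearMap
    { toFun := fun A => LinearMap.toContinuousLinearMap
        { toFun := fun w k => ∑ b, (A (Pi.single b 1) k : ℂ) * w b
          map_add' := fun w w' => funext fun k => by
            simp only [Pi.add_apply, mul_add, Finset.sum_add_distrib]
          map_smul' := fun t w => funext fun k => by
            simp only [Pi.smul_apply, smul_eq_mul, RingHom.id_apply, Finset.mul_sum]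
            exact Finset.sum_congr rfl fun b _ => by ring }
      map_add' := fun A B => by
        ext w k
        simp [add_mul, Finset.sum_add_distrib]
      map_smul' := fun t A => by
        ext w k
        simp [Finset.mul_sum, mul_assoc] }

theorem cxMat_apply (A : Mat ℝ d) (w : Fin d → ℂ) (k : Fin d) :
    cxMat d A w k = ∑ b, (A (Pi.single b 1) k : ℂ) * w b := rfl

/-- The entrywise complexification of a real vector. -/
def cvec (w : Fin d → ℝ) : Fin d → ℂ := fun k => (w k : ℂ)

theorem cplx_apply (p : ℝ → Fin d → ℝ) (x : ℝ) : cplx p x = cvec (p x) := rfl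

theorem sum_smul_single (w : Fin d → ℝ) : w = ∑ b, w b • (Pi.single b (1 : ℝ) : Fin d → ℝ) := by
  funext i
  simp [Finset.sum_apply, Pi.single_apply]

theorem cxMat_cvec (A : Mat ℝ d) (w : Fin d → ℝ) : cxMat d A (cvec w) = cvec (A w) := by
  funext k
  rw [cxMat_apply, cvec, sum_smul_single (A w), sum_smul_single w]
  conv_rhs => rw [← sum_smul_single (A _), map_sum, Finset.sum_apply]
  push_cast
  refine Finset.sum_congr rfl fun b _ => ?_
  rw [map_smul, Pi.smul_apply, smul_eq_mul, ← sum_smul_single w, cvec, mul_comm]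
  push_cast
  rfl

theorem re_cxMat (A : Mat ℝ d) (w : Fin d → ℂ) :
    (fun k => (cxMat d A w k).re) = A fun k => (w k).re := by
  funext k
  conv_rhs => rw [sum_smul_single fun k => (w k).re, map_sum, Finset.sum_apply]
  rw [cxMat_apply, Complex.re_sum]
  refine Finset.sum_congr rfl fun b _ => ?_
  rw [map_smul, Pi.smul_apply, smul_eq_mul, Complex.re_ofReal_mul, mul_comm]

theorem conj_cxMat (A : Mat ℝ d) (w : Fin d → ℂ) : star (cxMat d A w) = cxMat d A (star w) := by
  funext k
  rw [Pi.star_apply, cxMat_apply, cxMat_apply, star_sum]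
  refine Finset.sum_congr rfl fun b _ => ?_
  rw [star_mul', Pi.star_apply]
  congr 1
  exact Complex.conj_ofReal _

theorem cvec_injective : Function.Injective (cvec (d := d)) := fun _ _ h =>
  funext fun k => Complex.ofReal_injective (congrFun h k)

theorem norm_cvec (w : Fin d → ℝ) : ‖cvec w‖ = ‖w‖ := by
  simp only [Pi.norm_def, cvec]
  congr 2
  funext k
  exact NNReal.eq (Complex.norm_real _)

theorem continuous_cvec : Continuous (cvec (d := d)) :=
  continuous_pi fun k => Complex.continuous_ofReal.comp (continuous_apply k)

/-- The complexification `W^{1,∞}(ℝ; ℝ^d) → W^{1,∞}(ℝ; ℂ^d)`. -/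
theorem W1inf.exists_cplx (p : W1inf ℝ d) :
    ∃ P : W1inf ℂ d, P.fn = cplx p.fn ∧ P.der =ᵐ[volume] cplx p.der := by
  have hm : MemLp (cplx p.der) ∞ volume := by
    refine memLp_top_of_bound (continuous_cvec.comp_aestronglyMeasurable
      (Lp.stronglyMeasurable (derCLM p)).aestronglyMeasurable) ‖derCLM p‖ ?_
    filter_upwards [Linf.ae_norm_le (derCLM p)] with x hx
    rw [cplx_apply, norm_cvec]; exact hx
  refine W1inf.exists_of_integral (C := ‖p‖) (K := ‖derCLM p‖) (fun x => ?_) hm ?_ ?_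
  · rw [cplx_apply, norm_cvec]; exact W1inf.norm_fn_le p x
  · filter_upwards [Linf.ae_norm_le (derCLM p)] with x hx
    rw [cplx_apply, norm_cvec]; exact hx
  · intro a b
    let e : (Fin d → ℝ) →L[ℝ] (Fin d → ℂ) :=
      ContinuousLinearMap.pi fun k => Complex.ofRealCLM.comp (ContinuousLinearMap.proj k)
    have := e.intervalIntegral_comp_comm (W1inf.intervalIntegrable_der p a b)
    rw [W1inf.integral_der, map_sub] at this
    exact this

/-- The real part `W^{1,∞}(ℝ; ℂ^d) → W^{1,∞}(ℝ; ℝ^d)`. -/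
theorem W1inf.exists_re (P : W1inf ℂ d) :
    ∃ p : W1inf ℝ d, (p.fn = fun x k => (P.fn x k).re) ∧
      p.der =ᵐ[volume] fun x k => (P.der x k).re := by
  let e : (Fin d → ℂ) →L[ℝ] (Fin d → ℝ) :=
    ContinuousLinearMap.pi fun k => Complex.reCLM.comp (ContinuousLinearMap.proj k)
  have he : ∀ w, ‖e w‖ ≤ ‖w‖ := fun w =>
    (pi_norm_le_iff_of_nonneg (norm_nonneg _)).2 fun k =>
      (Complex.abs_re_le_norm _).trans (norm_le_pi_norm w k)
  have hae : ∀ᵐ x, ‖e (P.der x)‖ ≤ ‖derCLM P‖ := by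
    filter_upwards [Linf.ae_norm_le (derCLM P)] with x hx
    exact (he _).trans hx
  refine W1inf.exists_of_integral (p := fun x => e (P.fn x)) (g := fun x => e (P.der x))
    (C := ‖P‖) (K := ‖derCLM P‖) (fun x => (he _).trans (W1inf.norm_fn_le P x))
    (memLp_top_of_bound (e.continuous.comp_aestronglyMeasurable
      (Lp.stronglyMeasurable (derCLM P)).aestronglyMeasurable) _ hae) hae ?_
  intro a b
  have := e.intervalIntegral_comp_comm (W1inf.intervalIntegrable_der P a b)
  rw [W1inf.integral_der, map_sub] at this
  exact this

end Tools

end LatticeWave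

namespace LatticeWave

/-! ### The linearization at the wave -/

variable {d : ℕ} {f : (Fin 5 → Fin d → ℝ) → Fin d → ℝ} {σA σB : ℤ} {cs : ℝ}

/-- The shifts `r_j` as real numbers. -/
def rN (σA σB : ℤ) : Fin 5 → ℝ := fun j => (shiftN σA σB j : ℝ)

/-- The coefficients `A_{z,j}` as bounded continuous functions. -/
def coefB (hf : Continuous (fderiv ℝ f)) (σA σB : ℤ) (Φ : ℝ →ᵇ (Fin d → ℝ)) (z : ℂ) (j : Fin 5) :
    ℝ →ᵇ Mat ℂ d :=
  Complex.exp (z * (shiftL σA σB j : ℂ)) •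
    (cxMat d).compLeftContinuousBounded ℝ (jacB hf (rN σA σB) Φ j)

theorem coefB_apply (hf : Continuous (fderiv ℝ f)) (Φ : ℝ →ᵇ (Fin d → ℝ)) (z : ℂ) (j : Fin 5)
    (x : ℝ) : coefB hf σA σB Φ z j x = Complex.exp (z * (shiftL σA σB j : ℂ)) •
      cxMat d (pderiv f j (stencil σA σB Φ x)) := by
  change Complex.exp _ • cxMat d (jacB hf (rN σA σB) Φ j x) = _
  rw [jacB_apply]
  rfl

theorem cxMat_pderiv_apply (U : Fin 5 → Fin d → ℝ) (j : Fin 5) (w : Fin d → ℂ) :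
    cxMat d (pderiv f j U) w = (jac f U j).map (fun x : ℝ => (x : ℂ)) *ᵥ w := rfl

theorem coefB_eq_mulVec (hf : Continuous (fderiv ℝ f)) (Φ : ℝ →ᵇ (Fin d → ℝ)) (z : ℂ) (j : Fin 5)
    (x : ℝ) (w : Fin d → ℂ) : coefB hf σA σB Φ z j x w = coefA f σA σB Φ z j x *ᵥ w := by
  rw [coefB_apply, coefA, smul_mulVec, ← cxMat_pderiv_apply]
  rfl

theorem coefB_zero_apply (hf : Continuous (fderiv ℝ f)) (Φ : ℝ →ᵇ (Fin d → ℝ)) (j : Fin 5)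
    (x : ℝ) : coefB hf σA σB Φ 0 j x = cxMat d (jacB hf (rN σA σB) Φ j x) := by
  change Complex.exp _ • cxMat d (jacB hf (rN σA σB) Φ j x) = _
  rw [zero_mul, Complex.exp_zero, one_smul]

/-- The operator `𝓛_z`. -/
def Lz (hf : Continuous (fderiv ℝ f)) (σA σB : ℤ) (cs : ℝ) (Φ : ℝ →ᵇ (Fin d → ℝ)) (z : ℂ) :
    W1inf ℂ d →L[ℂ] Linf ℂ d := genL (cs : ℂ) (rN σA σB) (coefB hf σA σB Φ z)

theorem coe_Lz (hf : Continuous (fderiv ℝ f)) (Φ : ℝ →ᵇ (Fin d → ℝ)) (z : ℂ) (p : W1inf ℂ d) :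
    Lz hf σA σB cs Φ z p =ᵐ[volume] opL f σA σB cs Φ z p.fn p.der := by
  refine (coe_genL _ _ _ p).trans (Eventually.of_forall fun x => ?_)
  simp only [coefB_eq_mulVec]
  rfl

/-- The part of the linearization that involves the `j`-th shift. -/
def partL (hf : Continuous (fderiv ℝ f)) (σA σB : ℤ) (Φ : ℝ →ᵇ (Fin d → ℝ)) (j : Fin 5) :
    W1inf ℂ d →L[ℂ] Linf ℂ d :=
  bcfToLinf.comp ((((mulOp ℂ d ((cxMat d).compLeftContinuousBounded ℝ
    (jacB hf (rN σA σB) Φ j))).comp (shift ℂ (rN σA σB j)))).comp toBCF)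

theorem Lz_eq (hf : Continuous (fderiv ℝ f)) (Φ : ℝ →ᵇ (Fin d → ℝ)) (z : ℂ) :
    Lz hf σA σB cs Φ z = -((cs : ℂ) • derCLM) +
      ∑ j, Complex.exp (z * (shiftL σA σB j : ℂ)) • partL hf σA σB Φ j := by
  rw [Lz, genL]
  congr 1
  ext1 p
  rw [_root_.sum_apply, ContinuousLinearMap.comp_apply, ContinuousLinearMap.comp_apply, lowL,
    _root_.sum_apply, map_sum]
  refine Finset.sum_congr rfl fun j _ => ?_
  rw [_root_.smul_apply, coefB, map_smul]
  exact map_smul (bcfToLinf (𝕜 := ℂ) (d := d)) _ _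

theorem hasDerivAt_Lz (hf : Continuous (fderiv ℝ f)) (Φ : ℝ →ᵇ (Fin d → ℝ)) (z : ℂ) :
    HasDerivAt (Lz hf σA σB cs Φ) (∑ j, ((shiftL σA σB j : ℂ) *
      Complex.exp (z * (shiftL σA σB j : ℂ))) • partL hf σA σB Φ j) z := by
  have : Lz hf σA σB cs Φ = fun z => -((cs : ℂ) • derCLM) +
      ∑ j, Complex.exp (z * (shiftL σA σB j : ℂ)) • partL hf σA σB Φ j :=
    funext fun z => Lz_eq hf Φ z
  rw [this]
  refine HasDerivAt.const_add _ (HasDerivAt.fun_sum fun j _ => ?_)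
  have h1 := ((hasDerivAt_id z).mul_const (shiftL σA σB j : ℂ)).cexp
  refine (h1.smul_const (partL hf σA σB Φ j)).congr_deriv ?_
  simp [mul_comm]

/-- The hypotheses on the nonlinearity and on the wave `Φ`. -/
structure IsWave (r : ℕ) (f : (Fin 5 → Fin d → ℝ) → Fin d → ℝ) (um up : Fin d → ℝ) (σA σB : ℤ)
    (cs : ℝ) (Φ : ℝ →ᵇ (Fin d → ℝ)) : Prop where
  hypF : HypF r f um up
  hypPhi : HypPhi r f um up σA σB cs Φ
  hypS1 : HypS1 f um up σA σB cs
  hypS2 : HypS2 f σA σB cs Φ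
  hypS3 : HypS3 f σA σB cs Φ

/-- A continuous function with limits at `±∞` is bounded. -/
theorem exists_bcf_of_tendsto {E : Type*} [NormedAddCommGroup E] {p : ℝ → E} (hp : Continuous p)
    {a b : E} (ha : Tendsto p atBot (𝓝 a)) (hb : Tendsto p atTop (𝓝 b)) :
    ∃ P : ℝ →ᵇ E, ⇑P = p := by
  obtain ⟨s, hs⟩ := eventually_atBot.1 (ha.norm.eventually (gt_mem_nhds (lt_add_one ‖a‖)))
  obtain ⟨t, ht⟩ := eventually_atTop.1 (hb.norm.eventually (gt_mem_nhds (lt_add_one ‖b‖)))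
  obtain ⟨M, hM⟩ := (isCompact_Icc (a := s) (b := t)).exists_bound_of_continuousOn hp.continuousOn
  refine ⟨BoundedContinuousFunction.ofNormedAddCommGroup p hp (max M (max (‖a‖ + 1) (‖b‖ + 1)))
    fun x => ?_, rfl⟩
  rcases le_total x s with h | h
  · exact (hs x h).le.trans ((le_max_left _ _).trans (le_max_right _ _))
  rcases le_total t x with h' | h'
  · exact (ht x h').le.trans ((le_max_right _ _).trans (le_max_right _ _))
  · exact (hM x ⟨h, h'⟩).trans (le_max_left _ _)

variable {r : ℕ} {um up : Fin d → ℝ} {Φ : ℝ →ᵇ (Fin d → ℝ)}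

namespace IsWave

theorem cs_ne (h : IsWave r f um up σA σB cs Φ) : cs ≠ 0 := h.hypPhi.1

theorem cs_ne' (h : IsWave r f um up σA σB cs Φ) : (cs : ℂ) ≠ 0 := Complex.ofReal_ne_zero.2 h.cs_ne

theorem contDiff (h : IsWave r f um up σA σB cs Φ) : ContDiff ℝ r f := h.hypF.2.1

theorem hf (h : IsWave r f um up σA σB cs Φ) : Continuous (fderiv ℝ f) :=
  h.contDiff.continuous_fderiv (by have := h.hypF.1; exact_mod_cast (by omega : r ≠ 0))

theorem fcont (h : IsWave r f um up σA σB cs Φ) : Continuous f := h.contDiff.continuous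

theorem fdiff (h : IsWave r f um up σA σB cs Φ) : Differentiable ℝ f :=
  h.contDiff.differentiable (by have := h.hypF.1; exact_mod_cast (by omega : r ≠ 0))

/-- The derivative `Φ'` of the wave, as given by the travelling wave equation. -/
def dPhi (h : IsWave r f um up σA σB cs Φ) : ℝ →ᵇ (Fin d → ℝ) :=
  cs⁻¹ • nem f h.fcont (stencilB (rN σA σB) Φ)

theorem dPhi_apply (h : IsWave r f um up σA σB cs Φ) (x : ℝ) :
    h.dPhi x = cs⁻¹ • f (stencil σA σB Φ x) := by
  rw [dPhi, BoundedContinuousFunction.smul_apply, nem_apply, stencilB_apply]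
  rfl

theorem hasDerivAt (h : IsWave r f um up σA σB cs Φ) (x : ℝ) : HasDerivAt Φ (h.dPhi x) x := by
  have h1 := h.hypPhi.2.2.1 (cs⁻¹ * x) 0 0
  have hx : cs * (cs⁻¹ * x) = x := mul_inv_cancel_left₀ h.cs_ne x
  have h2 : HasDerivAt (fun y : ℝ => cs⁻¹ * y) cs⁻¹ x := by
    simpa using (hasDerivAt_id x).const_mul cs⁻¹
  have h3 := HasDerivAt.scomp x h1 h2
  have h4 : (fun s : ℝ => Φ (((0 : ℤ) : ℝ) * σA + ((0 : ℤ) : ℝ) * σB + cs * s)) ∘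
      (fun y => cs⁻¹ * y) = Φ := by
    funext y
    simp [mul_inv_cancel_left₀ h.cs_ne]
  rw [h4] at h3
  rw [h.dPhi_apply]
  refine h3.congr_deriv (congrArg (fun U => cs⁻¹ • f U) (funext fun j => ?_))
  simp only [hx]
  fin_cases j <;> simp [stencil, shiftN] <;> ring_nf

theorem deriv_eq (h : IsWave r f um up σA σB cs Φ) : deriv Φ = h.dPhi :=
  funext fun x => (h.hasDerivAt x).deriv

/-- The second derivative of the wave. -/
def ddPhi (h : IsWave r f um up σA σB cs Φ) : ℝ →ᵇ (Fin d → ℝ) :=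
  cs⁻¹ • lowL (rN σA σB) (jacB h.hf (rN σA σB) Φ) h.dPhi

theorem hasDerivAt_dPhi (h : IsWave r f um up σA σB cs Φ) (x : ℝ) :
    HasDerivAt h.dPhi (h.ddPhi x) x := by
  have h1 : HasDerivAt (stencil σA σB Φ) (fun j => h.dPhi (x + rN σA σB j)) x :=
    hasDerivAt_pi.2 fun j => (h.hasDerivAt (x + shiftN σA σB j)).comp_add_const x _
  have h2 := ((h.fdiff (stencil σA σB Φ x)).hasFDerivAt.comp_hasDerivAt x h1).const_smul cs⁻¹
  have h3 : ⇑h.dPhi = fun x => cs⁻¹ • f (stencil σA σB Φ x) := funext h.dPhi_apply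
  rw [h3]
  refine h2.congr_deriv ?_
  rw [ddPhi, BoundedContinuousFunction.smul_apply, lowL_apply, fderiv_eq_sum_pderiv]
  simp only [jacB_apply]
  rfl

theorem deriv_dPhi (h : IsWave r f um up σA σB cs Φ) : deriv h.dPhi = h.ddPhi :=
  funext fun x => (h.hasDerivAt_dPhi x).deriv

theorem exists_wave (h : IsWave r f um up σA σB cs Φ) :
    ∃ p : W1inf ℝ d, p.fn = Φ ∧ derCLM p = bcfToLinf h.dPhi :=
  W1inf.exists_of_hasDerivAt Φ.norm_coe_le_norm h.dPhi h.hasDerivAt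

theorem exists_dwave (h : IsWave r f um up σA σB cs Φ) :
    ∃ p : W1inf ℝ d, p.fn = h.dPhi ∧ derCLM p = bcfToLinf h.ddPhi :=
  W1inf.exists_of_hasDerivAt h.dPhi.norm_coe_le_norm h.ddPhi h.hasDerivAt_dPhi

theorem Lz_zero_iff (h : IsWave r f um up σA σB cs Φ) (z : ℂ) (p : W1inf ℂ d) :
    Lz h.hf σA σB cs Φ z p = 0 ↔ opL f σA σB cs Φ z p.fn p.der =ᵐ[volume] 0 := by
  constructor
  · intro h0
    refine (coe_Lz h.hf Φ z p).symm.trans ?_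
    rw [h0]
    exact Lp.coeFn_zero _ _ _
  · intro h0
    exact Lp.ext (((coe_Lz h.hf Φ z p).trans h0).trans (Lp.coeFn_zero _ _ _).symm)

theorem hyperbolic {u : Fin d → ℝ}
    (hu : ∀ ν : ℝ, (charMat f σA σB cs u (Complex.I * (0 : ℝ)) (Complex.I * ν)).det ≠ 0) :
    Hyperbolic (cs : ℂ) (rN σA σB) fun j => cxMat d (pderiv f j fun _ => u) := by
  intro ν w hw
  refine eq_zero_of_mulVec_eq_zero (hu ν) ?_
  rw [charMat, add_mulVec, neg_mulVec, smul_mulVec, one_mulVec, sum_mulVec, hw, neg_add_eq_zero]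
  refine Finset.sum_congr rfl fun j _ => ?_
  rw [smul_mulVec, smul_mulVec, ← cxMat_pderiv_apply]
  simp only [Complex.ofReal_zero, mul_zero, zero_mul, Complex.exp_zero, one_smul]
  simp only [rN]
  push_cast
  rfl

theorem asympHyp (h : IsWave r f um up σA σB cs Φ) :
    AsympHyp (cs : ℂ) (rN σA σB) (coefB h.hf σA σB Φ 0) := by
  have h0 : (0 : ℝ) ∈ Set.Icc (-Real.pi) Real.pi :=
    ⟨neg_nonpos.2 Real.pi_pos.le, Real.pi_pos.le⟩
  have hlim : ∀ (l : Filter ℝ) (u : Fin d → ℝ), Tendsto Φ l (𝓝 u) →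
      (∀ t : ℝ, Tendsto (fun x => x + t) l l) → ∀ j,
      Tendsto (coefB h.hf σA σB Φ 0 j) l (𝓝 (cxMat d (pderiv f j fun _ => u))) := by
    intro l u hu hl j
    have h1 : Tendsto (fun x => fun i => Φ (x + rN σA σB i)) l (𝓝 fun _ => u) :=
      tendsto_pi_nhds.2 fun i => hu.comp (hl _)
    have h2 := ((cxMat d).continuous.comp (continuous_pderiv h.hf j)).tendsto (fun _ => u)
    refine (h2.comp h1).congr fun x => ?_
    rw [coefB_zero_apply, jacB_apply]
    rfl
  exact ⟨h.cs_ne', ⟨_, hlim _ _ h.hypPhi.2.2.2.2 fun t =>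
      tendsto_atTop_add_const_right _ t tendsto_id,
    hyperbolic fun ν => (h.hypS1 0 h0 ν).2⟩, ⟨_, hlim _ _ h.hypPhi.2.2.2.1 fun t =>
      tendsto_atBot_add_const_right _ t tendsto_id, hyperbolic fun ν => (h.hypS1 0 h0 ν).1⟩⟩

theorem bijective_Lz (h : IsWave r f um up σA σB cs Φ) {ω : ℝ}
    (hω : ω ∈ Set.Icc (-Real.pi) Real.pi) (h0 : ω ≠ 0) :
    Function.Bijective (Lz h.hf σA σB cs Φ (Complex.I * ω)) := by
  have key : ∀ g : Linf ℂ d, ∃! p : W1inf ℂ d, Lz h.hf σA σB cs Φ (Complex.I * ω) p = g := by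
    intro g
    obtain ⟨p, hp, hu⟩ := h.hypS2 ω hω h0 g
    refine ⟨p, Lp.ext ((coe_Lz h.hf Φ _ p).trans hp), fun q hq => hu q ?_⟩
    rw [← hq]
    exact (coe_Lz h.hf Φ _ q).symm
  exact Function.bijective_iff_existsUnique _ |>.2 key

theorem exists_kernel (h : IsWave r f um up σA σB cs Φ) : ∃ v : W1inf ℂ d,
    v.fn = cplx h.dPhi ∧ SimpleKer (cs : ℂ) (rN σA σB) (coefB h.hf σA σB Φ 0) v := by
  obtain ⟨p, hp, -⟩ := h.exists_dwave
  obtain ⟨v, hv, -⟩ := W1inf.exists_cplx p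
  rw [hp] at hv
  refine ⟨v, hv, h.asympHyp, fun q => ?_, ?_, fun ε hε => ?_⟩
  · refine (h.Lz_zero_iff 0 q).trans ((h.hypS3.1 q).trans (exists_congr fun k => ?_))
    rw [h.deriv_eq, ← hv]
    exact ⟨fun e => W1inf.ext_fn e, fun e => by rw [e]; rfl⟩
  · rintro ⟨q, hq⟩
    refine h.hypS3.2 ⟨q, (coe_Lz h.hf Φ 0 q).symm.trans ?_⟩
    rw [show Lz h.hf σA σB cs Φ 0 q = bcfToLinf (toBCF v) from hq, h.deriv_eq, ← hv]
    exact coe_bcfToLinf _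
  · have hc : Tendsto (fun ω : ℝ => Lz h.hf σA σB cs Φ (Complex.I * ω)) (𝓝 0)
        (𝓝 (Lz h.hf σA σB cs Φ 0)) := by
      have h1 := (hasDerivAt_Lz (σA := σA) (σB := σB) (cs := cs) h.hf Φ 0).continuousAt.tendsto
      refine h1.comp ?_
      have h2 : Continuous fun ω : ℝ => Complex.I * (ω : ℂ) := by fun_prop
      simpa using h2.tendsto 0
    have h1 := Metric.tendsto_nhds.1 hc ε hε
    have h2 : ∀ᶠ ω : ℝ in 𝓝[>] 0, ω < Real.pi :=
      mem_nhdsWithin_of_mem_nhds (Iio_mem_nhds Real.pi_pos)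
    obtain ⟨ω, ⟨h3, h4⟩, h5⟩ := (((h1.filter_mono nhdsWithin_le_nhds).and h2).and
      self_mem_nhdsWithin).exists
    have h5' : 0 < ω := h5
    refine ⟨_, h.bijective_Lz (ω := ω) ⟨by linarith [Real.pi_pos], h4.le⟩ h5'.ne', ?_⟩
    rw [dist_eq_norm, norm_sub_rev] at h3
    exact h3

end IsWave

end LatticeWave

namespace LatticeWave

/-! ### The adjoint eigenfunction -/

variable {d : ℕ} {f : (Fin 5 → Fin d → ℝ) → Fin d → ℝ} {σA σB : ℤ} {cs : ℝ}
  {r : ℕ} {um up : Fin d → ℝ} {Φ : ℝ →ᵇ (Fin d → ℝ)}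

/-- The functional `p ↦ ∫ q ⬝ p` given by an integrable function `q`. -/
def pairCLM {𝕜 : Type} [RCLike 𝕜] (q : ℝ → Fin d → 𝕜) (hq : Integrable q) (hc : Continuous q) :
    (ℝ →ᵇ (Fin d → 𝕜)) →L[𝕜] 𝕜 :=
  LinearMap.mkContinuous
    { toFun := fun p => ∫ x, q x ⬝ᵥ p x
      map_add' := fun p p' => by
        rw [← integral_add (integrable_dotProduct hq hc p.continuous p.norm_coe_le_norm)
          (integrable_dotProduct hq hc p'.continuous p'.norm_coe_le_norm)]
        exact integral_congr_ae (Eventually.of_forall fun x => dotProduct_add _ _ _)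
      map_smul' := fun t p => by
        rw [RingHom.id_apply, ← integral_smul]
        exact integral_congr_ae (Eventually.of_forall fun x => dotProduct_smul t (q x) (p x)) }
    (d * ∫ x, ‖q x‖) fun p => by
      have h1 : ∀ x, ‖q x ⬝ᵥ p x‖ ≤ ‖q x‖ * (d * ‖p‖) := fun x => by
        refine (norm_dotProduct_le _ _).trans ?_
        rw [mul_left_comm]
        exact mul_le_mul_of_nonneg_left (mul_le_mul_of_nonneg_left (p.norm_coe_le_norm x)
          (Nat.cast_nonneg _)) (norm_nonneg _)
      refine (norm_integral_le_of_norm_le (hq.norm.mul_const _)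
        (Eventually.of_forall h1)).trans_eq ?_
      rw [integral_mul_const]
      ring

theorem star_cvec (w : Fin d → ℝ) : star (cvec w) = cvec w :=
  funext fun _ => Complex.conj_ofReal _

theorem star_dotProduct_eq (w w' : Fin d → ℂ) : star (w ⬝ᵥ w') = star w ⬝ᵥ star w' := by
  simp only [dotProduct, star_sum, star_mul', Pi.star_apply]

theorem cvec_dotProduct (w w' : Fin d → ℝ) : cvec w ⬝ᵥ cvec w' = ((w ⬝ᵥ w' : ℝ) : ℂ) := by
  simp only [dotProduct, cvec]
  push_cast
  rfl

theorem integrable_cplx {q : ℝ → Fin d → ℝ} (hq : Integrable q) : Integrable (cplx q) :=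
  Integrable.mono hq (continuous_cvec.comp_aestronglyMeasurable hq.aestronglyMeasurable)
    (Eventually.of_forall fun x => (norm_cvec (q x)).le)

theorem trMat_coefB_zero (hf : Continuous (fderiv ℝ f)) (j : Fin 5) (x : ℝ) (w : Fin d → ℂ) :
    trMat ℂ d (coefB hf σA σB Φ 0 j x) w = (coefA f σA σB Φ 0 j x)ᴴ *ᵥ w := by
  funext k
  rw [trMat_apply, coefB_eq_mulVec]
  simp only [mulVec, dotProduct, conjTranspose_apply, coefA, zero_mul, Complex.exp_zero, one_smul,
    map_apply]
  refine Finset.sum_congr rfl fun b _ => ?_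
  rw [Finset.sum_eq_single k (fun i _ hi => by rw [Pi.single_eq_of_ne hi, mul_zero])
    (fun hk => absurd (Finset.mem_univ k) hk), Pi.single_eq_same, mul_one, mul_comm]
  congr 1
  exact (Complex.conj_ofReal _).symm

theorem genL_adj_ae (hf : Continuous (fderiv ℝ f)) (q : W1inf ℂ d) :
    genL (-(cs : ℂ)) (-rN σA σB) (adjCoef (rN σA σB) (coefB hf σA σB Φ 0)) q =ᵐ[volume]
      opLadj f σA σB cs Φ 0 q.fn q.der := by
  refine (coe_genL _ _ _ q).trans (Eventually.of_forall fun x => ?_)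
  simp only [adjCoef_apply, trMat_coefB_zero]
  simp only [opLadj, neg_smul, neg_neg, Pi.neg_apply, ← sub_eq_add_neg]
  rfl

namespace IsWave

/-- The normalized real element `ψ` of the kernel of the adjoint, its integrability, and its
orthogonality to the continuous functions in the range of the operator. -/
theorem exists_psi (h : IsWave r f um up σA σB cs Φ) : ∃ ψ : W1inf ℝ d,
    IsPsiStar f σA σB cs Φ ψ ∧ Integrable ψ.fn ∧
      (∀ (p : W1inf ℂ d) (g : ℝ →ᵇ (Fin d → ℝ)), Lz h.hf σA σB cs Φ 0 p =ᵐ[volume] cplx g →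
        ∫ x, ψ.fn x ⬝ᵥ g x = 0) := by
  obtain ⟨v, hv, hker⟩ := h.exists_kernel
  obtain ⟨s, hsc, ⟨M, hM⟩, hsi, hs, hsv⟩ := hker.exists_adjoint
  have hvstar : ∀ x, star (v.fn x) = v.fn x := fun x => by rw [hv, cplx_apply, star_cvec]
  -- the coefficients are real, so the conjugate is another solution
  have hstar : ∀ x, star (s x) = s x := by
    have hc' : Continuous fun x => star (s x) := continuous_star.comp hsc
    have hsol : IsSol (-(cs : ℂ)) (-rN σA σB)
        (fun j => adjCoef (rN σA σB) (coefB h.hf σA σB Φ 0) j) 0 fun x => star (s x) := by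
      intro a b
      have h1 := congrArg star (hs a b)
      have hc1 : star (-(cs : ℂ)) = -(cs : ℂ) := by
        rw [star_neg]
        exact congrArg _ (Complex.conj_ofReal cs)
      rw [star_smul, star_sub, hc1] at h1
      rw [h1]
      have h2 := ((starL' ℝ : (Fin d → ℂ) ≃L[ℝ] (Fin d → ℂ)) :
        (Fin d → ℂ) →L[ℝ] (Fin d → ℂ)).intervalIntegral_comp_comm (μ := volume) (a := a) (b := b)
        (((continuous_sum_apply (-rN σA σB) (fun j =>
          (adjCoef (rN σA σB) (coefB h.hf σA σB Φ 0) j).continuous) hsc).sub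
          (continuous_const (y := (0 : Fin d → ℂ)))).intervalIntegrable a b)
      refine h2.symm.trans (intervalIntegral.integral_congr fun x _ => ?_)
      change star (∑ j, adjCoef (rN σA σB) (coefB h.hf σA σB Φ 0) j x (s (x + (-rN σA σB) j)) -
        0) = ∑ j, adjCoef (rN σA σB) (coefB h.hf σA σB Φ 0) j x (star (s (x + (-rN σA σB) j))) - 0
      rw [sub_zero, sub_zero, star_sum]
      refine Finset.sum_congr rfl fun j _ => ?_
      funext k
      rw [adjCoef_apply, Pi.star_apply, trMat_apply, trMat_apply, star_dotProduct_eq,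
        coefB_zero_apply, conj_cxMat, ← Pi.single_star, star_one]
    have hint : ∫ x, star (s x) ⬝ᵥ v.fn x = 1 := by
      have h1 : ∀ x, star (s x) ⬝ᵥ v.fn x = (starRingEnd ℂ) (s x ⬝ᵥ v.fn x) := fun x => by
        conv_lhs => rw [← hvstar x, ← star_dotProduct_eq]
        rfl
      simp only [h1]
      rw [integral_conj, hsv, map_one]
    have h2 := hker.adjoint_unique hsc hM hs hsv hc' (N := M)
      (fun x => by rw [norm_star]; exact hM x) hsol
    rw [hint, one_smul] at h2
    exact fun x => congrFun h2 x
  obtain ⟨S, hS, hS0⟩ := exists_genL_eq (neg_ne_zero.2 h.cs_ne')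
    (a := adjCoef (rN σA σB) (coefB h.hf σA σB Φ 0)) hsc hM (h := 0) (by
      intro a b
      rw [hs a b]
      refine intervalIntegral.integral_congr_ae ?_
      filter_upwards [Lp.coeFn_zero (Fin d → ℂ) ∞ (volume : Measure ℝ)] with x hx _
      rw [hx])
  obtain ⟨ψ, hψ, -⟩ := W1inf.exists_re S
  have hψs : cplx ψ.fn = s := by
    funext x k
    rw [hψ, ← hS]
    have h1 := congrFun (hstar x) k
    rw [← hS] at h1
    exact Complex.conj_eq_iff_re.1 h1
  have hψi : Integrable ψ.fn := by
    refine hsi.mono (W1inf.continuous_fn ψ).aestronglyMeasurable (Eventually.of_forall fun x => ?_)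
    rw [← hψs, cplx_apply, norm_cvec]
  refine ⟨ψ, ⟨fun q => ?_, ?_⟩, hψi, fun p g hp => ?_⟩
  · have hq0 : opLadj f σA σB cs Φ 0 q.fn q.der =ᵐ[volume] 0 ↔
        genL (-(cs : ℂ)) (-rN σA σB) (adjCoef (rN σA σB) (coefB h.hf σA σB Φ 0)) q = 0 := by
      constructor
      · intro h0
        exact Lp.ext (((genL_adj_ae h.hf q).trans h0).trans (Lp.coeFn_zero _ _ _).symm)
      · intro h0
        refine (genL_adj_ae h.hf q).symm.trans ?_
        rw [h0]
        exact Lp.coeFn_zero _ _ _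
    rw [hq0, hψs]
    constructor
    · intro h0
      exact ⟨_, hker.adjoint_unique hsc hM hs hsv (W1inf.continuous_fn q) (W1inf.norm_fn_le q)
        (isSol_of_genL_eq_zero h0)⟩
    · rintro ⟨k, hk⟩
      have : q = k • S := W1inf.ext_fn (by rw [hk, ← hS]; rfl)
      rw [this, map_smul, hS0, smul_zero]
  · rw [pairing, h.deriv_eq]
    have h1 : ∀ x, s x ⬝ᵥ v.fn x = ((star (ψ.fn x) ⬝ᵥ h.dPhi x : ℝ) : ℂ) := fun x => by
      rw [← hψs, hv, cplx_apply, cplx_apply, cvec_dotProduct, star_trivial]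
    simp only [h1] at hsv
    rw [integral_complex_ofReal] at hsv
    exact_mod_cast hsv
  · have h1 := integral_dotProduct_eq_zero h.asympHyp hsc hM hs (p := p) (h := cplx g)
      (continuous_cvec.comp g.continuous) (H := ‖g‖)
      (fun x => by rw [cplx_apply, norm_cvec]; exact g.norm_coe_le_norm x) hp
    have h2 : ∀ x, s x ⬝ᵥ cplx g x = ((ψ.fn x ⬝ᵥ g x : ℝ) : ℂ) := fun x => by
      rw [← hψs, cplx_apply, cplx_apply, cvec_dotProduct]
    simp only [h2] at h1
    rw [integral_complex_ofReal] at h1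
    exact_mod_cast h1

end IsWave

/-! ### Bordered operators -/

section Bordered

variable {𝕜 X Y : Type*} [RCLike 𝕜] [NormedAddCommGroup X] [NormedSpace 𝕜 X]
  [NormedAddCommGroup Y] [NormedSpace 𝕜 Y]

/-- The bordered operator `(w, μ) ↦ (T w - μ g, l(w))`. -/
def bordOp (T : X →L[𝕜] Y) (g : Y) (l : X →L[𝕜] 𝕜) : X × 𝕜 →L[𝕜] Y × 𝕜 :=
  (T.comp (ContinuousLinearMap.fst 𝕜 X 𝕜) -
    (ContinuousLinearMap.snd 𝕜 X 𝕜).smulRight g).prod (l.comp (ContinuousLinearMap.fst 𝕜 X 𝕜))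

theorem bordOp_apply (T : X →L[𝕜] Y) (g : Y) (l : X →L[𝕜] 𝕜) (x : X × 𝕜) :
    bordOp T g l x = (T x.1 - x.2 • g, l x.1) := rfl

theorem bordOp_bijective {T : X →L[𝕜] Y} {g : Y} {l : X →L[𝕜] 𝕜} {v : X} (hv : T v = 0)
    (hlv : l v = 1) (hker : ∀ p, T p = 0 → ∃ k : 𝕜, p = k • v) (hg : ∀ p, T p ≠ g)
    (hrange : ∀ y, ∃ p, ∃ μ : 𝕜, T p = y + μ • g) : Function.Bijective (bordOp T g l) := by
  constructor
  · rw [injective_iff_map_eq_zero]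
    rintro ⟨p, μ⟩ h0
    rw [bordOp_apply, Prod.mk_eq_zero] at h0
    obtain ⟨h1, h2⟩ := h0
    simp only at h1 h2
    have hμ : μ = 0 := by
      by_contra hμ
      refine hg (μ⁻¹ • p) ?_
      rw [map_smul, sub_eq_zero.1 h1, smul_smul, inv_mul_cancel₀ hμ, one_smul]
    rw [hμ, zero_smul, sub_zero] at h1
    obtain ⟨k, rfl⟩ := hker p h1
    rw [map_smul, hlv, smul_eq_mul, mul_one] at h2
    rw [h2, hμ, zero_smul]; rfl
  · rintro ⟨y, s⟩
    obtain ⟨p, μ, hp⟩ := hrange y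
    refine ⟨(p + (s - l p) • v, μ), ?_⟩
    rw [bordOp_apply]
    simp only [map_add, map_smul, hv, hlv, smul_zero, add_zero, hp, add_sub_cancel_right,
      smul_eq_mul, mul_one, add_sub_cancel]

/-- If the bordered operator is injective, then a kernel element normalized by the bordering
functional spans the kernel. -/
theorem ker_of_bordOp_injective {T : X →L[𝕜] Y} {g : Y} {l : X →L[𝕜] 𝕜} {v : X} (hv : T v = 0)
    (hlv : l v = 1) (hinj : Function.Injective (bordOp T g l)) (p : X) :
    T p = 0 ↔ ∃ k : 𝕜, p = k • v := by
  constructor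
  · intro hp
    have h1 : bordOp T g l (p - l p • v, 0) = bordOp T g l 0 := by
      rw [map_zero, bordOp_apply]
      simp [hp, hv, hlv]
    exact ⟨l p, sub_eq_zero.1 (Prod.mk.inj (hinj h1)).1⟩
  · rintro ⟨k, rfl⟩
    rw [map_smul, hv, smul_zero]

theorem notRange_of_bordOp_injective {T : X →L[𝕜] Y} {g : Y} {l : X →L[𝕜] 𝕜} {v : X}
    (hv : T v = 0) (hlv : l v = 1) (hinj : Function.Injective (bordOp T g l)) (p : X) :
    T p ≠ g := by
  intro hp
  have h1 : bordOp T g l (p - l p • v, 1) = bordOp T g l 0 := by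
    rw [map_zero, bordOp_apply]
    simp [hp, hv, hlv]
  exact one_ne_zero (Prod.mk.inj (hinj h1)).2

theorem continuous_bordOp {Z : Type*} [TopologicalSpace Z] {T : Z → X →L[𝕜] Y} {g : Z → Y}
    {z : Z} (l : X →L[𝕜] 𝕜) (hT : ContinuousAt T z) (hg : ContinuousAt g z) :
    ContinuousAt (fun z => bordOp (T z) (g z) l) z := by
  have h1 : ContinuousAt (fun z => (ContinuousLinearMap.snd 𝕜 X 𝕜).smulRight (g z)) z := by
    have : Continuous fun g : Y => (ContinuousLinearMap.snd 𝕜 X 𝕜).smulRight g :=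
      ((ContinuousLinearMap.smulRightL 𝕜 (X × 𝕜) Y) (ContinuousLinearMap.snd 𝕜 X 𝕜)).continuous
    exact this.continuousAt.comp hg
  have h2 : ContinuousAt (fun z => (T z).comp (ContinuousLinearMap.fst 𝕜 X 𝕜)) z :=
    hT.clm_comp continuousAt_const
  have h3 : ContinuousAt (fun z => ((T z).comp (ContinuousLinearMap.fst 𝕜 X 𝕜) -
      (ContinuousLinearMap.snd 𝕜 X 𝕜).smulRight (g z), l.comp (ContinuousLinearMap.fst 𝕜 X 𝕜))) z :=
    (h2.sub h1).prodMk continuousAt_const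
  have h4 : Continuous fun q : (X × 𝕜 →L[𝕜] Y) × (X × 𝕜 →L[𝕜] 𝕜) => q.1.prod q.2 :=
    (ContinuousLinearMap.prodₗᵢ (𝕜 := 𝕜) (E := X × 𝕜) (F := Y) (G := 𝕜) 𝕜).continuous
  exact h4.continuousAt.comp h3

/-- A bijective operator between Banach spaces, as an isomorphism. -/
def equivOfBij [CompleteSpace X] [CompleteSpace Y] (B : X →L[𝕜] Y) (hB : Function.Bijective B) :
    X ≃L[𝕜] Y :=
  ContinuousLinearEquiv.ofBijective B (LinearMap.ker_eq_bot.2 hB.1) (LinearMap.range_eq_top.2 hB.2)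

theorem coe_equivOfBij [CompleteSpace X] [CompleteSpace Y] (B : X →L[𝕜] Y)
    (hB : Function.Bijective B) : (equivOfBij B hB : X →L[𝕜] Y) = B := rfl

/-- Bijective operators are an open set. -/
theorem eventually_bijective [CompleteSpace X] {B : X →L[𝕜] Y} [CompleteSpace Y]
    (hB : Function.Bijective B) : ∀ᶠ S : X →L[𝕜] Y in 𝓝 B, Function.Bijective S := by
  have h1 := ContinuousLinearEquiv.nhds (equivOfBij B hB)
  rw [coe_equivOfBij] at h1
  filter_upwards [h1] with S hS
  obtain ⟨e, rfl⟩ := hS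
  exact e.bijective

end Bordered

end LatticeWave

namespace LatticeWave

/-! ### The branch of eigenvalues -/

variable {d : ℕ} {f : (Fin 5 → Fin d → ℝ) → Fin d → ℝ} {σA σB : ℤ} {cs : ℝ}
  {r : ℕ} {um up : Fin d → ℝ} {Φ : ℝ →ᵇ (Fin d → ℝ)}

theorem isLittleO_of_le_mul {α E F : Type*} [NormedAddCommGroup E] [NormedAddCommGroup F]
    {l : Filter α} {g : α → E} {Δ : α → F} {κ : α → ℝ} (hκ : Tendsto κ l (𝓝 0))
    (h : ∀ q, ‖g q‖ ≤ κ q * ‖Δ q‖) : g =o[l] Δ := by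
  rw [Asymptotics.isLittleO_iff]
  intro ε hε
  filter_upwards [hκ.eventually (gt_mem_nhds hε)] with q hq
  exact (h q).trans (mul_le_mul_of_nonneg_right hq.le (norm_nonneg _))

/-- The functional `⟨ψ, ·⟩` on real functions. -/
def ellR (ψ : W1inf ℝ d) (hψ : Integrable ψ.fn) : W1inf ℝ d →L[ℝ] ℝ :=
  (pairCLM ψ.fn hψ (W1inf.continuous_fn ψ)).comp toBCF

/-- The functional `⟨ψ, ·⟩` on complex functions. -/
def ellC (ψ : W1inf ℝ d) (hψ : Integrable ψ.fn) : W1inf ℂ d →L[ℂ] ℂ :=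
  (pairCLM (cplx ψ.fn) (integrable_cplx hψ)
    (continuous_cvec.comp (W1inf.continuous_fn ψ))).comp toBCF

theorem ellR_apply (ψ : W1inf ℝ d) (hψ : Integrable ψ.fn) (p : W1inf ℝ d) :
    ellR ψ hψ p = pairing ψ.fn p.fn :=
  integral_congr_ae (Eventually.of_forall fun x => by simp only [star_trivial]; rfl)

theorem ellC_apply (ψ : W1inf ℝ d) (hψ : Integrable ψ.fn) (p : W1inf ℂ d) :
    ellC ψ hψ p = pairing (cplx ψ.fn) p.fn :=
  integral_congr_ae (Eventually.of_forall fun x => by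
    simp only [cplx_apply, star_cvec]; rfl)

theorem pairing_cplx (q p : ℝ → Fin d → ℝ) :
    pairing (cplx q) (cplx p) = ((pairing q p : ℝ) : ℂ) := by
  rw [pairing, pairing, ← integral_complex_ofReal]
  refine integral_congr_ae (Eventually.of_forall fun x => ?_)
  simp only [cplx_apply, star_cvec, cvec_dotProduct, star_trivial]

/-- The embedding of `W^{1,∞}` into `L^∞`. -/
def emb {𝕜 : Type} [RCLike 𝕜] : W1inf 𝕜 d →L[𝕜] Linf 𝕜 d := bcfToLinf.comp toBCF

theorem coe_emb {𝕜 : Type} [RCLike 𝕜] (p : W1inf 𝕜 d) : emb p =ᵐ[volume] p.fn :=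
  coe_bcfToLinf (toBCF p)

/-- The equation for eigenfunctions `p` with eigenvalue `λ` and normalization `⟨ψ, p⟩ = 1`. -/
def eigF (hf : Continuous (fderiv ℝ f)) (σA σB : ℤ) (cs : ℝ) (Φ : ℝ →ᵇ (Fin d → ℝ))
    (l : W1inf ℂ d →L[ℂ] ℂ) (q : ℂ × W1inf ℂ d × ℂ) : Linf ℂ d × ℂ :=
  (Lz hf σA σB cs Φ q.1 q.2.1 - q.2.2 • emb q.2.1, l q.2.1 - 1)

/-- The derivative of `eigF` with respect to the eigenfunction and the eigenvalue. -/
def eigB (hf : Continuous (fderiv ℝ f)) (σA σB : ℤ) (cs : ℝ) (Φ : ℝ →ᵇ (Fin d → ℝ))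
    (l : W1inf ℂ d →L[ℂ] ℂ) (q : ℂ × W1inf ℂ d × ℂ) : W1inf ℂ d × ℂ →L[ℂ] Linf ℂ d × ℂ :=
  bordOp (Lz hf σA σB cs Φ q.1 - q.2.2 • emb) (emb q.2.1) l

theorem continuous_Lz (hf : Continuous (fderiv ℝ f)) : Continuous (Lz hf σA σB cs Φ) :=
  continuous_iff_continuousAt.2 fun z => (hasDerivAt_Lz hf Φ z).continuousAt

theorem partialStrict_eigF (hf : Continuous (fderiv ℝ f)) (l : W1inf ℂ d →L[ℂ] ℂ) (z : ℂ)
    (y : W1inf ℂ d × ℂ) :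
    PartialStrict (eigF hf σA σB cs Φ l) (eigB hf σA σB cs Φ l (z, y)) z y := by
  let κ : ℂ × (W1inf ℂ d × ℂ) × (W1inf ℂ d × ℂ) → ℝ := fun q =>
    ‖Lz hf σA σB cs Φ q.1 - Lz hf σA σB cs Φ z‖ + ‖q.2.1.2 - y.2‖ * ‖emb (𝕜 := ℂ) (d := d)‖ +
      ‖emb (𝕜 := ℂ) (d := d)‖ * ‖q.2.2.1 - y.1‖
  refine isLittleO_of_le_mul (κ := κ) ?_ ?_
  · have hc : Continuous κ := by
      have := continuous_Lz (σA := σA) (σB := σB) (cs := cs) (Φ := Φ) hf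
      fun_prop
    have := hc.tendsto (z, y, y)
    rwa [show κ (z, y, y) = 0 by
      simp only [κ, sub_self, norm_zero, zero_mul, mul_zero, add_zero]] at this
  · rintro ⟨w, ⟨p1, l1⟩, ⟨p2, l2⟩⟩
    have h1 : eigF hf σA σB cs Φ l (w, (p1, l1)) - eigF hf σA σB cs Φ l (w, (p2, l2)) -
        eigB hf σA σB cs Φ l (z, y) ((p1, l1) - (p2, l2)) =
        ((Lz hf σA σB cs Φ w - Lz hf σA σB cs Φ z) (p1 - p2) - (l1 - y.2) • emb (p1 - p2) -
          (l1 - l2) • emb (p2 - y.1), 0) := by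
      rw [eigB, bordOp_apply, eigF, eigF]
      refine Prod.ext ?_ ?_
      · simp only [Prod.mk_sub_mk, _root_.sub_apply, _root_.smul_apply,
          map_sub]
        module
      · simp only [Prod.snd_sub, Prod.fst_sub, map_sub]
        ring
    rw [h1]
    have hΔ1 : ‖p1 - p2‖ ≤ ‖((p1, l1) - (p2, l2) : W1inf ℂ d × ℂ)‖ := le_max_left _ _
    have hΔ2 : ‖l1 - l2‖ ≤ ‖((p1, l1) - (p2, l2) : W1inf ℂ d × ℂ)‖ := le_max_right _ _
    set D := ‖((p1, l1) - (p2, l2) : W1inf ℂ d × ℂ)‖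
    rw [Prod.norm_mk, norm_zero, max_eq_left (norm_nonneg _)]
    have t1 : ‖(Lz hf σA σB cs Φ w - Lz hf σA σB cs Φ z) (p1 - p2)‖ ≤
        ‖Lz hf σA σB cs Φ w - Lz hf σA σB cs Φ z‖ * D :=
      ContinuousLinearMap.le_opNorm_of_le _ hΔ1
    have t2 : ‖emb (p1 - p2)‖ ≤ ‖emb (𝕜 := ℂ) (d := d)‖ * D :=
      ContinuousLinearMap.le_opNorm_of_le (emb (𝕜 := ℂ) (d := d)) hΔ1
    have t3 : ‖emb (p2 - y.1)‖ ≤ ‖emb (𝕜 := ℂ) (d := d)‖ * ‖p2 - y.1‖ :=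
      ContinuousLinearMap.le_opNorm (emb (𝕜 := ℂ) (d := d)) _
    have t4 : ‖(l1 - y.2) • emb (p1 - p2)‖ ≤ ‖l1 - y.2‖ * (‖emb (𝕜 := ℂ) (d := d)‖ * D) := by
      rw [norm_smul]
      exact mul_le_mul_of_nonneg_left t2 (norm_nonneg _)
    have t5 : ‖(l1 - l2) • emb (p2 - y.1)‖ ≤ D * (‖emb (𝕜 := ℂ) (d := d)‖ * ‖p2 - y.1‖) := by
      rw [norm_smul]
      exact mul_le_mul hΔ2 t3 (norm_nonneg _) (norm_nonneg _)
    refine ((norm_sub_le _ _).trans (add_le_add ((norm_sub_le _ _).trans (add_le_add t1 t4))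
      t5)).trans_eq ?_
    simp only [κ]
    ring

theorem continuous_eigB (hf : Continuous (fderiv ℝ f)) (l : W1inf ℂ d →L[ℂ] ℂ) :
    Continuous (eigB hf σA σB cs Φ l) := by
  rw [continuous_iff_continuousAt]
  intro q
  refine continuous_bordOp l (Continuous.continuousAt ?_) (Continuous.continuousAt ?_)
  · have := continuous_Lz (σA := σA) (σB := σB) (cs := cs) (Φ := Φ) hf
    fun_prop
  · fun_prop

namespace IsWave

theorem bijective_complex (h : IsWave r f um up σA σB cs Φ) {ψ : W1inf ℝ d}
    (hψi : Integrable ψ.fn) (hψ : pairing ψ.fn (deriv Φ) = 1) {v : W1inf ℂ d}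
    (hv : v.fn = cplx h.dPhi)
    (hker : SimpleKer (cs : ℂ) (rN σA σB) (coefB h.hf σA σB Φ 0) v) :
    Function.Bijective (bordOp (Lz h.hf σA σB cs Φ 0) (emb v) (ellC ψ hψi)) := by
  obtain ⟨m, -, -, hm⟩ := hker.exists_functional
  refine bordOp_bijective (v := v) hker.genL_self ?_ (fun p hp => (hker.ker p).1 hp)
    (fun p hp => hker.notRange ⟨p, hp⟩) fun y => ?_
  · rw [ellC_apply, hv, pairing_cplx, ← h.deriv_eq, hψ, Complex.ofReal_one]
  · obtain ⟨p, hp⟩ := hm y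
    exact ⟨p, -m y, hp.trans (by rw [neg_smul, sub_eq_add_neg]; rfl)⟩

theorem exists_eigenBranch (h : IsWave r f um up σA σB cs Φ) {ψ : W1inf ℝ d}
    (hψi : Integrable ψ.fn) (hψ : pairing ψ.fn (deriv Φ) = 1) :
    ∃ (δ : ℝ) (lam : ℂ → ℂ) (ph : ℂ → W1inf ℂ d), IsEigenBranch f σA σB cs Φ ψ δ lam ph := by
  obtain ⟨v, hv, hker⟩ := h.exists_kernel
  set l := ellC ψ hψi with hl
  have hlv : l v = 1 := by
    rw [hl, ellC_apply, hv, pairing_cplx, ← h.deriv_eq, hψ, Complex.ofReal_one]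
  have hLv : Lz h.hf σA σB cs Φ 0 v = 0 := hker.genL_self
  have hbij : Function.Bijective (eigB h.hf σA σB cs Φ l (0, (v, 0))) := by
    have := h.bijective_complex hψi hψ hv hker
    rw [eigB]
    simpa only [zero_smul, sub_zero] using this
  let e : (W1inf ℂ d × ℂ) ≃L[ℂ] (Linf ℂ d × ℂ) :=
    equivOfBij (eigB h.hf σA σB cs Φ l (0, (v, 0))) hbij
  have hF0 : eigF h.hf σA σB cs Φ l (0, (v, 0)) = 0 := by
    rw [eigF]
    simp only [hLv, zero_smul, hlv, sub_self]
    rfl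
  have hFz : ∀ y : W1inf ℂ d × ℂ, ∀ z, HasDerivAt (fun z => eigF h.hf σA σB cs Φ l (z, y))
      ((∑ j, ((shiftL σA σB j : ℂ) * Complex.exp (z * (shiftL σA σB j : ℂ))) •
        partL h.hf σA σB Φ j) y.1, 0) z := by
    intro y z
    have h1 := (hasDerivAt_Lz (σA := σA) (σB := σB) (cs := cs) h.hf Φ z).clm_apply
      (hasDerivAt_const z y.1)
    simp only [map_zero, add_zero] at h1
    exact (h1.sub_const (y.2 • emb y.1)).prodMk (hasDerivAt_const z (l y.1 - 1))
  obtain ⟨y, hy0, hy⟩ := PartialStrict.exists_implicit (Y := W1inf ℂ d × ℂ) (B := e)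
    (z₀ := (0 : ℂ)) (y₀ := (v, (0 : ℂ))) (partialStrict_eigF h.hf l 0 (v, 0)) hF0 fun y =>
      continuous_iff_continuousAt.2 fun z => (hFz y z).continuousAt
  have hyc : ContinuousAt y 0 := hy.self_of_nhds.2
  have hbij' : ∀ᶠ z in 𝓝 (0 : ℂ), Function.Bijective (eigB h.hf σA σB cs Φ l (z, y z)) := by
    have h1 : ContinuousAt (fun z => eigB h.hf σA σB cs Φ l (z, y z)) 0 :=
      (continuous_eigB h.hf l).continuousAt.comp (continuousAt_id.prodMk hyc)
    refine h1.eventually (eventually_bijective (X := W1inf ℂ d × ℂ) (Y := Linf ℂ d × ℂ)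
      (B := eigB h.hf σA σB cs Φ l (0, y 0)) ?_)
    rwa [hy0]
  obtain ⟨δ, hδ, hball⟩ := Metric.eventually_nhds_iff_ball.1 (hy.and hbij')
  have hderiv : ∀ z ∈ Metric.ball (0 : ℂ) δ, DifferentiableAt ℂ y z := by
    intro z hz
    obtain ⟨⟨-, hcont⟩, hb⟩ := hball z hz
    let ez : (W1inf ℂ d × ℂ) ≃L[ℂ] (Linf ℂ d × ℂ) :=
      equivOfBij (eigB h.hf σA σB cs Φ l (z, y z)) hb
    have h0 : ∀ᶠ w in 𝓝 z, eigF h.hf σA σB cs Φ l (w, y w) = 0 := by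
      filter_upwards [Metric.isOpen_ball.mem_nhds hz] with w hw using (hball w hw).1.1
    exact (PartialStrict.hasDerivAt (Y := W1inf ℂ d × ℂ) (G := Linf ℂ d × ℂ) (B := ez)
      (partialStrict_eigF h.hf l z (y z)) hcont h0 (hFz (y z) z)).differentiableAt
  have hon : DifferentiableOn ℂ y (Metric.ball 0 δ) := fun z hz =>
    (hderiv z hz).differentiableWithinAt
  have han := hon.analyticOnNhd Metric.isOpen_ball
  refine ⟨δ, fun z => (y z).2, fun z => (y z).1, hδ, fun z hz => ?_, by simp only [hy0],
    by simp only [hy0, hv, h.deriv_eq], fun z hz =>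
      (analyticAt_snd (E := W1inf ℂ d) (F := ℂ)).comp (han z hz),
    fun z hz => (analyticAt_fst (E := W1inf ℂ d) (F := ℂ)).comp (han z hz)⟩
  obtain ⟨⟨hF, -⟩, hb⟩ := hball z (mem_ball_zero_iff.2 hz)
  rw [eigF, Prod.mk_eq_zero] at hF
  simp only at hF
  set T := Lz h.hf σA σB cs Φ z - (y z).2 • emb with hT
  have hTae : ∀ p, T p =ᵐ[volume] opL f σA σB cs Φ z p.fn p.der - (y z).2 • p.fn := by
    intro p
    filter_upwards [Lp.coeFn_sub (Lz h.hf σA σB cs Φ z p) ((y z).2 • emb p),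
      Lp.coeFn_smul (y z).2 (emb p : Linf ℂ d), coe_Lz h.hf Φ z p, coe_emb p] with x h1 h2 h3 h4
    rw [hT, _root_.sub_apply, _root_.smul_apply, h1, Pi.sub_apply, h2, Pi.smul_apply, h3, h4]
    rfl
  have hTv : T (y z).1 = 0 := hF.1
  have hl1 : l (y z).1 = 1 := sub_eq_zero.1 hF.2
  refine ⟨fun p => ?_, ?_, ?_⟩
  · rw [← ker_of_bordOp_injective hTv hl1 hb.1 p]
    constructor
    · intro h0
      exact Lp.ext (((hTae p).trans h0).trans (Lp.coeFn_zero _ _ _).symm)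
    · intro h0
      refine (hTae p).symm.trans ?_
      rw [h0]
      exact Lp.coeFn_zero _ _ _
  · rintro ⟨p, hp⟩
    exact notRange_of_bordOp_injective hTv hl1 hb.1 p
      (Lp.ext (((hTae p).trans hp).trans (coe_emb _).symm))
  · rw [← ellC_apply ψ hψi]
    exact hl1

/-! ### The real linearization -/

theorem coe_genL_cplx (h : IsWave r f um up σA σB cs Φ) {p : W1inf ℝ d} {P : W1inf ℂ d}
    (h1 : P.fn = cplx p.fn) (h2 : P.der =ᵐ[volume] cplx p.der) :
    Lz h.hf σA σB cs Φ 0 P =ᵐ[volume]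
      cplx (genL cs (rN σA σB) (jacB h.hf (rN σA σB) Φ) p) := by
  filter_upwards [coe_genL (cs : ℂ) (rN σA σB) (coefB h.hf σA σB Φ 0) P, h2,
    coe_genL cs (rN σA σB) (jacB h.hf (rN σA σB) Φ) p] with x h3 h4 h5
  rw [Lz, h3, h4, h1, cplx_apply, cplx_apply, h5]
  simp only [coefB_zero_apply, cplx_apply, cxMat_cvec]
  funext k
  simp [cvec]

theorem coe_genL_re (h : IsWave r f um up σA σB cs Φ) {p : W1inf ℝ d} {P : W1inf ℂ d}
    (h1 : p.fn = fun x k => (P.fn x k).re)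
    (h2 : p.der =ᵐ[volume] fun x k => (P.der x k).re) :
    genL cs (rN σA σB) (jacB h.hf (rN σA σB) Φ) p =ᵐ[volume]
      fun x k => (Lz h.hf σA σB cs Φ 0 P x k).re := by
  filter_upwards [coe_genL (cs : ℂ) (rN σA σB) (coefB h.hf σA σB Φ 0) P, h2,
    coe_genL cs (rN σA σB) (jacB h.hf (rN σA σB) Φ) p] with x h3 h4 h5
  rw [h5, h4, h1]
  funext k
  rw [Lz, h3]
  simp only [coefB_zero_apply, ← re_cxMat]
  simp

/-- The real bordered operator inherits bijectivity from the complex one: a real solution is the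
real part of a complex solution. -/
theorem bijective_real (h : IsWave r f um up σA σB cs Φ) {ψ : W1inf ℝ d}
    (hψi : Integrable ψ.fn) (hψ : pairing ψ.fn (deriv Φ) = 1) :
    Function.Bijective (bordOp (genL cs (rN σA σB) (jacB h.hf (rN σA σB) Φ))
      (bcfToLinf h.dPhi) (ellR ψ hψi)) := by
  obtain ⟨v, hv, hker⟩ := h.exists_kernel
  obtain ⟨m, -, -, hm⟩ := hker.exists_functional
  obtain ⟨w, hw, hwd⟩ := h.exists_dwave
  obtain ⟨W, hW, hWd⟩ := W1inf.exists_cplx w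
  have hWv : W = v := W1inf.ext_fn (by rw [hW, hw, hv])
  have hcx : ∀ (g : Linf ℝ d) (x : ℝ), cplx g x = 0 ↔ g x = 0 := fun g x => by
    rw [cplx_apply]
    exact ⟨fun e => cvec_injective (e.trans (funext fun k => Complex.ofReal_zero.symm)),
      fun e => by rw [e]; exact funext fun k => Complex.ofReal_zero⟩
  have hvae : (toBCF v : ℝ → Fin d → ℂ) = cplx h.dPhi := hv
  refine bordOp_bijective (v := w) ?_ ?_ (fun p hp => ?_) (fun p hp => ?_) fun y => ?_
  · refine Lp.ext (EventuallyEq.trans ?_ (Lp.coeFn_zero _ _ _).symm)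
    have h1 := h.coe_genL_cplx hW hWd
    rw [hWv, show Lz h.hf σA σB cs Φ 0 v = 0 from hker.genL_self] at h1
    filter_upwards [h1, Lp.coeFn_zero (Fin d → ℂ) ∞ (volume : Measure ℝ)] with x h2 h3
    exact (hcx _ _).1 (h2.symm.trans h3)
  · rw [ellR_apply, hw, ← h.deriv_eq, hψ]
  · obtain ⟨P, hP, hPd⟩ := W1inf.exists_cplx p
    have h1 := h.coe_genL_cplx hP hPd
    have h2 : Lz h.hf σA σB cs Φ 0 P = 0 := by
      refine Lp.ext (h1.trans ?_)
      filter_upwards [Lp.coeFn_zero (Fin d → ℂ) ∞ (volume : Measure ℝ),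
        Lp.coeFn_zero (Fin d → ℝ) ∞ (volume : Measure ℝ)] with x h3 h4
      rw [h3]
      exact (hcx _ _).2 (by rw [hp]; exact h4)
    obtain ⟨k, hk⟩ := (hker.ker P).1 h2
    refine ⟨k.re, W1inf.ext_fn (funext fun x => funext fun i => ?_)⟩
    have h3 : P.fn x i = k * v.fn x i := by rw [hk]; rfl
    rw [hP, hv] at h3
    have h4 := congrArg Complex.re h3
    simp only [cplx, Complex.ofReal_re, Complex.re_mul_ofReal] at h4
    rw [h4, ← hw]
    rfl
  · obtain ⟨P, hP, hPd⟩ := W1inf.exists_cplx p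
    refine hker.notRange ⟨P, Lp.ext (((h.coe_genL_cplx hP hPd).trans ?_).trans
      (coe_bcfToLinf _).symm)⟩
    rw [hvae, hp]
    filter_upwards [coe_bcfToLinf h.dPhi] with x h3
    rw [cplx_apply, h3, cplx_apply]
  · have hmem : MemLp (cplx y) ∞ volume :=
      memLp_top_of_bound (continuous_cvec.comp_aestronglyMeasurable
        (Lp.stronglyMeasurable y).aestronglyMeasurable) ‖y‖
        ((Linf.ae_norm_le y).mono fun x hx => by rw [cplx_apply, norm_cvec]; exact hx)
    obtain ⟨P, hP⟩ := hm (toLinf (cplx y))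
    obtain ⟨p, hp, hpd⟩ := W1inf.exists_re P
    refine ⟨p, -(m (toLinf (cplx y))).re, Lp.ext ((h.coe_genL_re hp hpd).trans ?_)⟩
    rw [show Lz h.hf σA σB cs Φ 0 P = _ from hP]
    filter_upwards [Lp.coeFn_sub (toLinf (cplx y)) (m (toLinf (cplx y)) • bcfToLinf (toBCF v)),
      Lp.coeFn_smul (m (toLinf (cplx y))) (bcfToLinf (toBCF v) : Linf ℂ d), coe_toLinf hmem,
      coe_bcfToLinf (toBCF v), Lp.coeFn_add y (-(m (toLinf (cplx y))).re • bcfToLinf h.dPhi),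
      Lp.coeFn_smul (-(m (toLinf (cplx y))).re) (bcfToLinf h.dPhi : Linf ℝ d),
      coe_bcfToLinf h.dPhi] with x h1 h2 h3 h4 h5 h6 h7
    rw [h5, Pi.add_apply, h6, Pi.smul_apply, h7]
    funext k
    rw [h1, Pi.sub_apply, h2, Pi.smul_apply, h3, h4, hvae]
    simp [cplx, sub_eq_add_neg]

end IsWave

end LatticeWave

namespace LatticeWave

/-! ### Smoothness of superposition operators -/

section Nemytskii

theorem continuous_nem {X Y : Type*} [NormedAddCommGroup X] [ProperSpace X] [NormedAddCommGroup Y]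
    {G : X → Y} (hG : Continuous G) : Continuous (nem G hG) := by
  rw [Metric.continuous_iff]
  intro U ε hε
  have hK := isCompact_closedBall (0 : X) (‖U‖ + 1)
  obtain ⟨δ, hδ, h⟩ := Metric.uniformContinuousOn_iff.1
    (hK.uniformContinuousOn_of_continuous hG.continuousOn) (ε / 2) (half_pos hε)
  refine ⟨min δ 1, by positivity, fun V hV => ?_⟩
  refine lt_of_le_of_lt ((BoundedContinuousFunction.dist_le (half_pos hε).le).2 fun x => ?_)
    (half_lt_self hε)
  have h1 : dist (V x) (U x) < min δ 1 := (BoundedContinuousFunction.dist_coe_le_dist x).trans_lt hV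
  have h2 := U.norm_coe_le_norm x
  refine (h (V x) ?_ (U x) ?_ (h1.trans_le (min_le_left _ _))).le
  · rw [mem_closedBall_zero_iff]
    have h3 := (h1.trans_le (min_le_right _ _)).le
    rw [dist_eq_norm] at h3
    have h4 := norm_le_insert' (V x) (U x)
    linarith
  · rw [mem_closedBall_zero_iff]
    linarith

variable {X Y : Type} [NormedAddCommGroup X] [NormedSpace ℝ X] [ProperSpace X]
  [NormedAddCommGroup Y] [NormedSpace ℝ Y]

/-- The derivative of a superposition operator: multiplication by the derivative of the function. -/
def nemD (G : X → Y) (hG : Continuous (fderiv ℝ G)) (U : ℝ →ᵇ X) : (ℝ →ᵇ X) →L[ℝ] (ℝ →ᵇ Y) :=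
  bilinBCF (ContinuousLinearMap.id ℝ (X →L[ℝ] Y)) (nem (fderiv ℝ G) hG U)

theorem nemD_apply (G : X → Y) (hG : Continuous (fderiv ℝ G)) (U V : ℝ →ᵇ X) (x : ℝ) :
    nemD G hG U V x = fderiv ℝ G (U x) (V x) := rfl

theorem hasFDerivAt_nem {G : X → Y} (hd : Differentiable ℝ G) (hG : Continuous (fderiv ℝ G))
    (U : ℝ →ᵇ X) : HasFDerivAt (nem G hd.continuous) (nemD G hG U) U := by
  rw [hasFDerivAt_iff_isLittleO, Asymptotics.isLittleO_iff]
  intro ε hε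
  have hK := isCompact_closedBall (0 : X) (‖U‖ + 1)
  obtain ⟨δ, hδ, h⟩ := Metric.uniformContinuousOn_iff.1
    (hK.uniformContinuousOn_of_continuous hG.continuousOn) ε hε
  filter_upwards [Metric.ball_mem_nhds U (show 0 < min δ 1 by positivity)] with V hV
  refine (BoundedContinuousFunction.norm_le (by positivity)).2 fun x => ?_
  have hUx := U.norm_coe_le_norm x
  have h1 : dist (V x) (U x) < min δ 1 := (BoundedContinuousFunction.dist_coe_le_dist x).trans_lt hV
  have h2 := Convex.norm_image_sub_le_of_norm_fderiv_le' (𝕜 := ℝ) (f := G) (C := ε)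
    (s := Metric.ball (U x) (min δ 1)) (x := U x) (y := V x) (φ := fderiv ℝ G (U x))
    (fun y _ => hd y) (fun y hy => by
      have hy' := Metric.mem_ball.1 hy
      rw [← dist_eq_norm]
      refine (h y ?_ (U x) ?_ (hy'.trans_le (min_le_left _ _))).le
      · rw [mem_closedBall_zero_iff]
        have h3 := (hy'.trans_le (min_le_right _ _)).le
        rw [dist_eq_norm] at h3
        have h4 := norm_le_insert' y (U x)
        linarith
      · rw [mem_closedBall_zero_iff]; linarith)
    (convex_ball _ _) (Metric.mem_ball_self (by positivity)) (Metric.mem_ball.2 h1)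
  exact h2.trans (mul_le_mul_of_nonneg_left ((V - U).norm_coe_le_norm x) hε.le)

theorem continuous_nemD {G : X → Y} (hG : Continuous (fderiv ℝ G)) : Continuous (nemD G hG) :=
  (bilinBCF (ContinuousLinearMap.id ℝ (X →L[ℝ] Y))).continuous.comp (continuous_nem hG)

theorem hasStrictFDerivAt_nem {G : X → Y} (hd : Differentiable ℝ G) (hG : Continuous (fderiv ℝ G))
    (U : ℝ →ᵇ X) : HasStrictFDerivAt (nem G hd.continuous) (nemD G hG U) U :=
  hasStrictFDerivAt_of_hasFDerivAt_of_continuousAt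
    (Eventually.of_forall fun V => hasFDerivAt_nem hd hG V) (continuous_nemD hG).continuousAt

theorem contDiff_nem (n : ℕ) : ∀ {Y : Type} [NormedAddCommGroup Y] [NormedSpace ℝ Y] {G : X → Y}
    (hG : ContDiff ℝ n G), ContDiff ℝ n (nem G hG.continuous) := by
  induction n with
  | zero =>
    intro Y _ _ G hG
    exact contDiff_zero.2 (continuous_nem hG.continuous)
  | succ n ih =>
    intro Y _ _ G hG
    have hG' : ContDiff ℝ ((n : WithTop ℕ∞) + 1) G := by exact_mod_cast hG
    have h1 := contDiff_succ_iff_fderiv.1 hG'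
    have h2 : ContDiff ℝ n (fderiv ℝ G) := h1.2.2
    have key : ContDiff ℝ ((n : WithTop ℕ∞) + 1) (nem G hG.continuous) := by
      refine contDiff_succ_iff_fderiv.2 ⟨fun U =>
        (hasFDerivAt_nem h1.1 h2.continuous U).differentiableAt, fun h => absurd h (by simp), ?_⟩
      have h3 : fderiv ℝ (nem G hG.continuous) = fun U =>
          bilinBCF (ContinuousLinearMap.id ℝ (X →L[ℝ] Y)) (nem (fderiv ℝ G) h2.continuous U) :=
        funext fun U => (hasFDerivAt_nem h1.1 h2.continuous U).fderiv
      rw [h3]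
      exact (bilinBCF (ContinuousLinearMap.id ℝ (X →L[ℝ] Y))).contDiff.comp (ih h2)
    exact_mod_cast key

end Nemytskii

/-! ### Families that depend smoothly on a parameter and on the translation -/

section SmoothTr

variable {E F G : Type*} [NormedAddCommGroup E] [NormedSpace ℝ E] [NormedAddCommGroup F]
  [NormedSpace ℝ F] [NormedAddCommGroup G] [NormedSpace ℝ G] {I : Set ℝ} {k : ℕ}

theorem shift_shift (s t : ℝ) (p : ℝ →ᵇ E) : shift ℝ s (shift ℝ t p) = shift ℝ (s + t) p := by
  ext x
  simp only [shift_apply, add_assoc]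

theorem shift_zero (p : ℝ →ᵇ E) : shift ℝ 0 p = p := by
  ext x
  rw [shift_apply, add_zero]

/-- The translates of the family `V` of bounded functions are of class `C^k`, jointly in the
parameter `φ ∈ I` and in the translation. Unlike plain smoothness in `φ`, this is stable under
translations by `φ`-dependent amounts. -/
def SmoothTr (k : ℕ) (I : Set ℝ) (V : ℝ → ℝ →ᵇ E) : Prop :=
  ContDiffOn ℝ k (fun q : ℝ × ℝ => shift ℝ q.2 (V q.1)) (I ×ˢ Set.univ)

theorem SmoothTr.of_le {V : ℝ → ℝ →ᵇ E} {l : ℕ} (h : SmoothTr k I V) (hl : l ≤ k) :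
    SmoothTr l I V := ContDiffOn.of_le h (by exact_mod_cast hl)

theorem contDiffOn_pair {V : ℝ → E} (h : ContDiffOn ℝ k V I) :
    ContDiffOn ℝ k (fun q : ℝ × ℝ => V q.1) (I ×ˢ Set.univ) :=
  h.comp contDiff_fst.contDiffOn fun _ hq => hq.1

theorem SmoothTr.contDiffOn {V : ℝ → ℝ →ᵇ E} (h : SmoothTr k I V) : ContDiffOn ℝ k V I := by
  have h1 : ContDiffOn ℝ k (fun φ : ℝ => ((φ, 0) : ℝ × ℝ)) I :=
    (contDiff_id.prodMk contDiff_const).contDiffOn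
  refine (ContDiffOn.comp h h1 fun φ hφ => ⟨hφ, trivial⟩).congr fun φ _ => ?_
  simp only [Function.comp, shift_zero]

theorem SmoothTr.continuous_shift {V : ℝ → ℝ →ᵇ E} (h : SmoothTr k I V) {φ : ℝ} (hφ : φ ∈ I) :
    Continuous fun t => shift ℝ t (V φ) := by
  rw [← continuousOn_univ]
  exact ContinuousOn.comp (ContDiffOn.continuousOn h)
    (continuous_const.prodMk continuous_id).continuousOn fun t _ => ⟨hφ, trivial⟩

theorem SmoothTr.shift {V : ℝ → ℝ →ᵇ E} (h : SmoothTr k I V) {ρ : ℝ → ℝ}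
    (hρ : ContDiffOn ℝ k ρ I) : SmoothTr k I fun φ => shift ℝ (ρ φ) (V φ) := by
  have h1 : ContDiffOn ℝ k (fun q : ℝ × ℝ => (q.1, q.2 + ρ q.1)) (I ×ˢ Set.univ) :=
    contDiff_fst.contDiffOn.prodMk (contDiff_snd.contDiffOn.add (contDiffOn_pair hρ))
  refine (ContDiffOn.comp h h1 fun q hq => ⟨hq.1, trivial⟩).congr fun q _ => ?_
  simp only [Function.comp, shift_shift]

theorem SmoothTr.add {V W : ℝ → ℝ →ᵇ E} (h : SmoothTr k I V) (h' : SmoothTr k I W) :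
    SmoothTr k I fun φ => V φ + W φ :=
  (ContDiffOn.add h h').congr fun _ _ => map_add _ _ _

theorem SmoothTr.neg {V : ℝ → ℝ →ᵇ E} (h : SmoothTr k I V) : SmoothTr k I fun φ => -V φ :=
  (ContDiffOn.neg h).congr fun _ _ => map_neg _ _

theorem SmoothTr.smul {V : ℝ → ℝ →ᵇ E} (h : SmoothTr k I V) {c : ℝ → ℝ} (hc : ContDiffOn ℝ k c I) :
    SmoothTr k I fun φ => c φ • V φ :=
  (ContDiffOn.smul (contDiffOn_pair hc) h).congr fun _ _ => map_smul _ _ _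

theorem SmoothTr.sum {ι : Type*} (s : Finset ι) {V : ι → ℝ → ℝ →ᵇ E}
    (h : ∀ i, SmoothTr k I (V i)) : SmoothTr k I fun φ => ∑ i ∈ s, V i φ :=
  (ContDiffOn.sum (s := s) fun i _ => h i).congr fun _ _ => map_sum _ _ _

theorem SmoothTr.bilin (B : E →L[ℝ] F →L[ℝ] G) {V : ℝ → ℝ →ᵇ E} {W : ℝ → ℝ →ᵇ F}
    (h : SmoothTr k I V) (h' : SmoothTr k I W) : SmoothTr k I fun φ => bilinBCF B (V φ) (W φ) :=
  (((bilinBCF B).contDiff.comp_contDiffOn h).clm_apply h').congr fun _ _ => rfl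

theorem SmoothTr.mulOp {d : ℕ} {a : ℝ → ℝ →ᵇ Mat ℝ d} {V : ℝ → ℝ →ᵇ (Fin d → ℝ)}
    (h : SmoothTr k I a) (h' : SmoothTr k I V) : SmoothTr k I fun φ => mulOp ℝ d (a φ) (V φ) :=
  SmoothTr.bilin _ h h'

theorem SmoothTr.stencilB {ρ : ℝ → Fin 5 → ℝ} (hρ : ∀ j, ContDiffOn ℝ k (fun φ => ρ φ j) I)
    {V : ℝ → ℝ →ᵇ E} (h : SmoothTr k I V) : SmoothTr k I fun φ => stencilB (ρ φ) (V φ) := by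
  have h1 : ContDiffOn ℝ k (fun q : ℝ × ℝ => fun j => LatticeWave.shift ℝ q.2
      (LatticeWave.shift ℝ (ρ q.1 j) (V q.1))) (I ×ˢ Set.univ) :=
    contDiffOn_pi.2 fun j => h.shift (hρ j)
  refine ((piBCF (E := E)).contDiff.comp_contDiffOn h1).congr fun q _ => ?_
  ext x j
  simp only [Function.comp, shift_apply, piBCF_apply, stencilB_apply]

theorem SmoothTr.nem {X Y : Type} [NormedAddCommGroup X] [NormedSpace ℝ X] [ProperSpace X]
    [NormedAddCommGroup Y] [NormedSpace ℝ Y] {g : X → Y} (hg : ContDiff ℝ k g)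
    {V : ℝ → ℝ →ᵇ X} (h : SmoothTr k I V) : SmoothTr k I fun φ => nem g hg.continuous (V φ) :=
  ((contDiff_nem k hg).comp_contDiffOn h).congr fun _ _ => rfl

theorem hasDerivAt_shift {V W : ℝ →ᵇ E} (hd : ∀ x, HasDerivAt V (W x) x)
    (hW : Continuous fun t => shift ℝ t W) (t : ℝ) :
    HasDerivAt (fun t => shift ℝ t V) (shift ℝ t W) t := by
  rw [hasDerivAt_iff_isLittleO, Asymptotics.isLittleO_iff]
  intro ε hε
  obtain ⟨δ, hδ, h⟩ := Metric.continuous_iff.1 hW t ε hε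
  filter_upwards [Metric.ball_mem_nhds t hδ] with s hs
  refine (BoundedContinuousFunction.norm_le (by positivity)).2 fun x => ?_
  have h1 : ∀ y : ℝ, HasDerivAt (fun s => V (x + s) - s • W (x + t)) (W (x + y) - W (x + t)) y := by
    intro y
    have h2 : HasDerivAt (fun s => V (x + s)) (W (x + y)) y := (hd (x + y)).comp_const_add x y
    have h3 := (hasDerivAt_id y).smul_const (W (x + t))
    rw [one_smul] at h3
    exact h2.sub h3
  have h2 := Convex.norm_image_sub_le_of_norm_hasDerivWithin_le (C := ε)
    (s := Metric.ball t δ) (x := t) (y := s) (fun y _ => (h1 y).hasDerivWithinAt) (fun y hy => by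
      have h3 := (BoundedContinuousFunction.dist_coe_le_dist (f := shift ℝ y W)
        (g := shift ℝ t W) x).trans_lt (h y hy)
      rw [dist_eq_norm] at h3
      exact h3.le) (convex_ball _ _) (Metric.mem_ball_self hδ) hs
  refine le_of_eq_of_le ?_ h2
  congr 1
  change V (x + s) - V (x + t) - (s - t) • W (x + t) =
    V (x + s) - s • W (x + t) - (V (x + t) - t • W (x + t))
  rw [sub_smul]
  abel

/-- The linear map `(x, y) ↦ x • a + y • b`. -/
def comb (a b : E) : ℝ × ℝ →L[ℝ] E :=
  (ContinuousLinearMap.fst ℝ ℝ ℝ).smulRight a + (ContinuousLinearMap.snd ℝ ℝ ℝ).smulRight b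

theorem comb_apply (a b : E) (q : ℝ × ℝ) : comb a b q = q.1 • a + q.2 • b := rfl

theorem contDiff_comb {n : WithTop ℕ∞} : ContDiff ℝ n fun q : E × E => comb q.1 q.2 := by
  have h1 := (ContinuousLinearMap.smulRightL ℝ (ℝ × ℝ) E (ContinuousLinearMap.fst ℝ ℝ ℝ)).contDiff
    (n := n)
  have h2 := (ContinuousLinearMap.smulRightL ℝ (ℝ × ℝ) E (ContinuousLinearMap.snd ℝ ℝ ℝ)).contDiff
    (n := n)
  exact (h1.comp contDiff_fst).add (h2.comp contDiff_snd)

/-- The joint derivative in the parameter and the translation. -/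
theorem hasFDerivAt_shift_pair (hI : IsOpen I) {V V' W : ℝ → ℝ →ᵇ E}
    (hV : ∀ φ ∈ I, HasDerivAt V (V' φ) φ) (hW : ∀ φ ∈ I, ∀ x, HasDerivAt (V φ) (W φ x) x)
    (hV' : SmoothTr 0 I V') (hW' : SmoothTr 0 I W) {q : ℝ × ℝ} (hq : q.1 ∈ I) :
    HasFDerivAt (fun q : ℝ × ℝ => shift ℝ q.2 (V q.1))
      (comb (shift ℝ q.2 (V' q.1)) (shift ℝ q.2 (W q.1))) q := by
  have hU : I ×ˢ Set.univ ∈ 𝓝 q := (hI.prod isOpen_univ).mem_nhds ⟨hq, trivial⟩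
  have hts : Continuous fun v : ℝ →ᵇ E => ContinuousLinearMap.toSpanSingleton ℝ v :=
    (ContinuousLinearMap.smulRightL ℝ ℝ (ℝ →ᵇ E) (ContinuousLinearMap.id ℝ ℝ)).continuous
  have h1 := hasStrictFDerivAt_uncurry_coprod (𝕜 := ℝ) (u := q)
    (f := fun φ t => shift ℝ t (V φ))
    (f₁ := fun φ t => ContinuousLinearMap.toSpanSingleton ℝ (shift ℝ t (V' φ)))
    (f₂ := fun φ t => ContinuousLinearMap.toSpanSingleton ℝ (shift ℝ t (W φ)))
    (by
      filter_upwards [hU] with v hv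
      exact ((shift ℝ v.2).hasFDerivAt.comp_hasDerivAt v.1 (hV v.1 hv.1)).hasFDerivAt)
    (by
      filter_upwards [hU] with v hv
      exact (hasDerivAt_shift (hW v.1 hv.1) (hW'.continuous_shift hv.1) v.2).hasFDerivAt)
    (hts.continuousAt.comp ((ContDiffOn.continuousOn hV').continuousAt hU))
    (hts.continuousAt.comp ((ContDiffOn.continuousOn hW').continuousAt hU))
  refine h1.hasFDerivAt.congr_fderiv ?_
  refine ContinuousLinearMap.ext fun v => ?_
  rw [comb_apply, ContinuousLinearMap.coprod_apply]
  rfl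

theorem SmoothTr.succ (hI : IsOpen I) {V V' W : ℝ → ℝ →ᵇ E}
    (hV : ∀ φ ∈ I, HasDerivAt V (V' φ) φ) (hW : ∀ φ ∈ I, ∀ x, HasDerivAt (V φ) (W φ x) x)
    (hV' : SmoothTr k I V') (hW' : SmoothTr k I W) : SmoothTr (k + 1) I V := by
  have hder : ∀ q ∈ I ×ˢ (Set.univ : Set ℝ),
      HasFDerivAt (fun q : ℝ × ℝ => LatticeWave.shift ℝ q.2 (V q.1))
      (comb (LatticeWave.shift ℝ q.2 (V' q.1)) (LatticeWave.shift ℝ q.2 (W q.1))) q := fun q hq =>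
    hasFDerivAt_shift_pair hI hV hW (hV'.of_le k.zero_le) (hW'.of_le k.zero_le) hq.1
  have key : ContDiffOn ℝ ((k : WithTop ℕ∞) + 1)
      (fun q : ℝ × ℝ => LatticeWave.shift ℝ q.2 (V q.1)) (I ×ˢ Set.univ) := by
    refine (contDiffOn_succ_iff_fderiv_of_isOpen (hI.prod isOpen_univ)).2
      ⟨fun q hq => (hder q hq).differentiableAt.differentiableWithinAt,
        fun h => absurd h (by simp), ?_⟩
    exact (contDiff_comb.comp_contDiffOn (ContDiffOn.prodMk hV' hW')).congr fun q hq =>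
      (hder q hq).fderiv
  exact_mod_cast key

theorem hasDerivAt_shift_comp (hI : IsOpen I) {V V' W : ℝ → ℝ →ᵇ E}
    (hV : ∀ φ ∈ I, HasDerivAt V (V' φ) φ) (hW : ∀ φ ∈ I, ∀ x, HasDerivAt (V φ) (W φ x) x)
    (hV' : SmoothTr 0 I V') (hW' : SmoothTr 0 I W) {ρ : ℝ → ℝ} {ρ' φ : ℝ} (hφ : φ ∈ I)
    (hρ : HasDerivAt ρ ρ' φ) : HasDerivAt (fun φ => shift ℝ (ρ φ) (V φ))
      (shift ℝ (ρ φ) (V' φ) + ρ' • shift ℝ (ρ φ) (W φ)) φ := by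
  have h1 := hasFDerivAt_shift_pair hI hV hW hV' hW' (q := (φ, ρ φ)) hφ
  have h2 := h1.comp_hasDerivAt φ ((hasDerivAt_id φ).prodMk hρ)
  refine h2.congr_deriv ?_
  rw [comb_apply, one_smul]

/-- The parameter derivative of a smooth family. -/
theorem SmoothTr.exists_deriv (hI : IsOpen I) {V : ℝ → ℝ →ᵇ E} (h : SmoothTr (k + 1) I V) :
    SmoothTr k I (deriv V) ∧ ∀ φ ∈ I, HasDerivAt V (deriv V φ) φ := by
  have hV : ∀ φ ∈ I, HasDerivAt V (deriv V φ) φ := fun φ hφ =>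
    ((h.contDiffOn.differentiableOn (by simp)).differentiableAt (hI.mem_nhds hφ)).hasDerivAt
  refine ⟨?_, hV⟩
  have h0 : ContDiffOn ℝ ((k : WithTop ℕ∞) + 1)
      (fun q : ℝ × ℝ => LatticeWave.shift ℝ q.2 (V q.1)) (I ×ˢ Set.univ) := by exact_mod_cast h
  have h1 := (contDiffOn_succ_iff_fderiv_of_isOpen (hI.prod isOpen_univ)).1 h0
  have h2 : ContDiffOn ℝ k (fun q : ℝ × ℝ => fderiv ℝ
      (fun q : ℝ × ℝ => LatticeWave.shift ℝ q.2 (V q.1)) q ((1, 0) : ℝ × ℝ)) (I ×ˢ Set.univ) :=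
    h1.2.2.clm_apply contDiffOn_const
  refine ContDiffOn.congr h2 fun q hq => ?_
  have h3 : DifferentiableAt ℝ (fun q : ℝ × ℝ => LatticeWave.shift ℝ q.2 (V q.1)) q :=
    (h1.1 q hq).differentiableAt ((hI.prod isOpen_univ).mem_nhds hq)
  have h4 : HasDerivAt (fun φ : ℝ => ((φ, q.2) : ℝ × ℝ)) ((1, 0) : ℝ × ℝ) q.1 :=
    (hasDerivAt_id q.1).prodMk (hasDerivAt_const _ _)
  have h5 := h3.hasFDerivAt.comp_hasDerivAt q.1 h4
  have h6 := (LatticeWave.shift ℝ q.2).hasFDerivAt.comp_hasDerivAt q.1 (hV q.1 hq.1)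
  exact h6.unique h5

/-- A continuous family in `W^{1,∞}` consists of Lipschitz functions, so that its translates are
jointly continuous in the norm of bounded functions. -/
theorem smoothTr_zero_of_continuous {d : ℕ} {y : ℝ → W1inf ℝ d} (hy : ContinuousOn y I) :
    SmoothTr 0 I fun φ => toBCF (y φ) := by
  have key : ContinuousOn (fun q : ℝ × ℝ => LatticeWave.shift ℝ q.2 (toBCF (y q.1)))
      (I ×ˢ Set.univ) := by
    intro q hq
    rw [ContinuousWithinAt, tendsto_iff_norm_sub_tendsto_zero]
    have hb : ∀ q' : ℝ × ℝ, ‖LatticeWave.shift ℝ q'.2 (toBCF (y q'.1)) -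
        LatticeWave.shift ℝ q.2 (toBCF (y q.1))‖ ≤ ‖y q'.1 - y q.1‖ + ‖y q.1‖ * |q'.2 - q.2| := by
      intro q'
      refine (BoundedContinuousFunction.norm_le (by positivity)).2 fun x => ?_
      have e : (LatticeWave.shift ℝ q'.2 (toBCF (y q'.1)) -
          LatticeWave.shift ℝ q.2 (toBCF (y q.1))) x = (y q'.1 - y q.1 : W1inf ℝ d).fn (x + q'.2) +
          ((y q.1).fn (x + q'.2) - (y q.1).fn (x + q.2)) := by
        change (y q'.1).fn (x + q'.2) - (y q.1).fn (x + q.2) =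
          ((y q'.1).fn (x + q'.2) - (y q.1).fn (x + q'.2)) + _
        abel
      rw [e]
      refine (norm_add_le _ _).trans (add_le_add (W1inf.norm_fn_le _ _) ?_)
      refine (W1inf.norm_fn_sub_le _ _ _).trans_eq ?_
      rw [add_sub_add_left_eq_sub]
    refine squeeze_zero (fun _ => norm_nonneg _) hb ?_
    have h1 : Tendsto (fun q' : ℝ × ℝ => ‖y q'.1 - y q.1‖) (𝓝[I ×ˢ Set.univ] q) (𝓝 0) := by
      have h2 : ContinuousWithinAt (fun q' : ℝ × ℝ => y q'.1) (I ×ˢ Set.univ) q :=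
        (hy q.1 hq.1).comp continuousWithinAt_fst fun _ h => h.1
      exact tendsto_iff_norm_sub_tendsto_zero.1 h2
    have h3 : Tendsto (fun q' : ℝ × ℝ => ‖y q.1‖ * |q'.2 - q.2|) (𝓝[I ×ˢ Set.univ] q) (𝓝 0) := by
      have h4 : Continuous fun q' : ℝ × ℝ => ‖y q.1‖ * |q'.2 - q.2| := by fun_prop
      have := h4.tendsto q
      rw [sub_self, abs_zero, mul_zero] at this
      exact this.mono_left nhdsWithin_le_nhds
    have h5 := h1.add h3
    rw [add_zero] at h5
    exact h5
  exact contDiffOn_zero.2 key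

end SmoothTr

end LatticeWave

namespace LatticeWave

/-! ### Smooth families of linear equations -/

section Linear

variable {d : ℕ}

/-- Elements of `W^{1,∞}` are Lipschitz, so translations, as operators from `W^{1,∞}` to bounded
functions, depend continuously on the amount of translation in operator norm. -/
theorem continuous_shift_comp_toBCF :
    Continuous fun t : ℝ => (shift ℝ t).comp (toBCF (𝕜 := ℝ) (d := d)) := by
  refine continuous_iff_continuousAt.2 fun t => ?_
  rw [ContinuousAt, tendsto_iff_norm_sub_tendsto_zero]
  refine squeeze_zero (fun _ => norm_nonneg _) (g := fun s => |s - t|) (fun s => ?_) ?_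
  · refine ContinuousLinearMap.opNorm_le_bound _ (abs_nonneg _) fun p => ?_
    refine (BoundedContinuousFunction.norm_le (by positivity)).2 fun x => ?_
    have h := W1inf.norm_fn_sub_le p (x + t) (x + s)
    rw [add_sub_add_left_eq_sub, mul_comm] at h
    exact h
  · have h : Continuous fun s : ℝ => |s - t| := by fun_prop
    have := h.tendsto t
    rwa [sub_self, abs_zero] at this

theorem continuousAt_sum_comp {X Y Y' : Type*} [NormedAddCommGroup X] [NormedSpace ℝ X]
    [NormedAddCommGroup Y] [NormedSpace ℝ Y] [NormedAddCommGroup Y'] [NormedSpace ℝ Y'] {ι : Type*}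
    (s : Finset ι) {S : ι → ℝ → Y →L[ℝ] Y'} {T : ι → ℝ → X →L[ℝ] Y} {φ : ℝ}
    (hS : ∀ i, ContinuousAt (S i) φ) (hT : ∀ i, ContinuousAt (T i) φ) :
    ContinuousAt (fun φ => ∑ i ∈ s, (S i φ).comp (T i φ)) φ :=
  tendsto_finsetSum _ fun i _ => (hS i).clm_comp (hT i)

theorem continuousAt_genL {c : ℝ → ℝ} {ρ : ℝ → Fin 5 → ℝ} {a : ℝ → Fin 5 → ℝ →ᵇ Mat ℝ d} {φ : ℝ}
    (hc : ContinuousAt c φ) (hρ : ∀ j, ContinuousAt (fun φ => ρ φ j) φ)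
    (ha : ∀ j, ContinuousAt (fun φ => a φ j) φ) :
    ContinuousAt (fun φ => genL (c φ) (ρ φ) (a φ)) φ := by
  have e : ∀ φ, genL (c φ) (ρ φ) (a φ) = -(c φ • derCLM) +
      bcfToLinf.comp (∑ j, (mulOp ℝ d (a φ j)).comp ((shift ℝ (ρ φ j)).comp toBCF)) := by
    intro φ
    ext1 p
    simp only [genL, lowL, _root_.add_apply, ContinuousLinearMap.comp_apply, _root_.sum_apply]
  simp only [e]
  have h2 := continuousAt_sum_comp (X := W1inf ℝ d) Finset.univ
    (S := fun j φ => mulOp ℝ d (a φ j)) (T := fun j φ => (shift ℝ (ρ φ j)).comp toBCF) (φ := φ)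
    (fun j => (mulOp ℝ d).continuous.continuousAt.comp (ha j)) fun j =>
    continuous_shift_comp_toBCF.continuousAt.comp (f := fun φ => ρ φ j) (hρ j)
  exact (hc.smul continuousAt_const).neg.add (continuousAt_const.clm_comp h2)

/-- An affine equation whose linear part depends continuously on the parameter. -/
theorem partialStrict_affine {Z Y G : Type*} [TopologicalSpace Z] [NormedAddCommGroup Y]
    [NormedSpace ℝ Y] [NormedAddCommGroup G] [NormedSpace ℝ G] {B : Z → Y →L[ℝ] G} {z₀ : Z}
    (hB : ContinuousAt B z₀) (h : Z → G) (y₀ : Y) :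
    PartialStrict (fun q : Z × Y => B q.1 q.2 - h q.1) (B z₀) z₀ y₀ := by
  refine isLittleO_of_le_mul (κ := fun q => ‖B q.1 - B z₀‖) ?_ fun q => ?_
  · have h1 : ContinuousAt (fun q : Z × Y × Y => ‖B q.1 - B z₀‖) (z₀, y₀, y₀) :=
      ((hB.comp (f := Prod.fst) (x := (z₀, y₀, y₀)) continuousAt_fst).sub continuousAt_const).norm
    have h2 := h1.tendsto
    rwa [sub_self, norm_zero] at h2
  · have e : B q.1 q.2.1 - h q.1 - (B q.1 q.2.2 - h q.1) - B z₀ (q.2.1 - q.2.2) =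
        (B q.1 - B z₀) (q.2.1 - q.2.2) := by
      rw [_root_.sub_apply, map_sub, map_sub]
      abel
    simp only [e]
    exact (B q.1 - B z₀).le_opNorm _

/-- Solutions of an equation with continuous coefficients are continuous in the parameter. -/
theorem continuousAt_of_affine {Y G : Type*} [NormedAddCommGroup Y] [NormedSpace ℝ Y]
    [CompleteSpace Y] [NormedAddCommGroup G] [NormedSpace ℝ G] [CompleteSpace G]
    {B : ℝ → Y →L[ℝ] G} {z₀ : ℝ} (hB : ContinuousAt B z₀) (hb : Function.Bijective (B z₀))
    {h : ℝ → G} (hh : ContinuousAt h z₀) {y : ℝ → Y} (hy : ∀ᶠ z in 𝓝 z₀, B z (y z) = h z) :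
    ContinuousAt y z₀ := by
  have h1 : ContinuousAt (ContinuousLinearMap.inverse : (Y →L[ℝ] G) → (G →L[ℝ] Y)) (B z₀) :=
    (contDiffAt_map_inverse (𝕜 := ℝ) (n := 0) (equivOfBij (B z₀) hb)).continuousAt
  have h2 : ContinuousAt (fun z => ContinuousLinearMap.inverse (B z) (h z)) z₀ :=
    (h1.comp hB).clm_apply hh
  refine h2.congr ?_
  filter_upwards [hy, hB.eventually (eventually_bijective hb)] with z hz hz'
  have e : ContinuousLinearMap.inverse (B z) = ((equivOfBij (B z) hz').symm : G →L[ℝ] Y) :=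
    ContinuousLinearMap.inverse_equiv (equivOfBij (B z) hz')
  rw [← hz, e]
  exact (equivOfBij (B z) hz').symm_apply_apply (y z)

theorem hasDerivAt_bilinBCF {E F G : Type*} [NormedAddCommGroup E] [NormedSpace ℝ E]
    [NormedAddCommGroup F] [NormedSpace ℝ F] [NormedAddCommGroup G] [NormedSpace ℝ G]
    (B : E →L[ℝ] F →L[ℝ] G) {u : ℝ → ℝ →ᵇ E} {v : ℝ → ℝ →ᵇ F} {u' : ℝ →ᵇ E} {v' : ℝ →ᵇ F} {φ s : ℝ}
    (hu : HasDerivAt u u' φ) (hv : HasDerivAt v (s • v') φ) :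
    HasDerivAt (fun φ => bilinBCF B (u φ) (v φ))
      (bilinBCF B u' (v φ) + s • bilinBCF B (u φ) v') φ := by
  have h := ((bilinBCF B).hasFDerivAt.comp_hasDerivAt φ hu).clm_apply hv
  rw [map_smul] at h
  exact h

theorem hasDerivAt_mulOp {a : ℝ → ℝ →ᵇ Mat ℝ d} {v : ℝ → ℝ →ᵇ (Fin d → ℝ)} {a' : ℝ →ᵇ Mat ℝ d}
    {v' : ℝ →ᵇ (Fin d → ℝ)} {φ s : ℝ} (ha : HasDerivAt a a' φ) (hv : HasDerivAt v (s • v') φ) :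
    HasDerivAt (fun φ => mulOp ℝ d (a φ) (v φ))
      (mulOp ℝ d a' (v φ) + s • mulOp ℝ d (a φ) v') φ :=
  hasDerivAt_bilinBCF _ ha hv

theorem hasDerivAt_bordered {E Y : Type*} [NormedAddCommGroup E] [NormedSpace ℝ E]
    [NormedAddCommGroup Y] [NormedSpace ℝ Y] (J : E →L[ℝ] Y) (x : Y) (γ m : ℝ)
    {c : ℝ → ℝ} {P g h : ℝ → E} {c' φ : ℝ} {P' g' h' : E} (hc : HasDerivAt c c' φ)
    (hP : HasDerivAt P P' φ) (hg : HasDerivAt g g' φ) (hh : HasDerivAt h h' φ) :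
    HasDerivAt (fun φ => ((-(c φ • x) + J (P φ) - γ • J (g φ), m) - (J (h φ), 0) : Y × ℝ))
      (-(c' • x) + J P' - γ • J g' - J h', 0) φ := by
  have h1 := ((((hc.smul_const x).neg.add (J.hasFDerivAt.comp_hasDerivAt φ hP)).sub
    ((J.hasFDerivAt.comp_hasDerivAt φ hg).const_smul γ)).prodMk (hasDerivAt_const φ m)).sub
    ((J.hasFDerivAt.comp_hasDerivAt φ hh).prodMk (hasDerivAt_const φ (0 : ℝ)))
  rw [Prod.mk_sub_mk, sub_zero] at h1
  exact h1

/-- `y = (w, γ)` solves the bordered equation `-c w' + ∑ j, a_j w(· + ρ_j) - γ g = h`,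
`ℓ w = 0`. -/
def BordSol (c : ℝ) (ρ : Fin 5 → ℝ) (a : Fin 5 → ℝ →ᵇ Mat ℝ d) (g : ℝ →ᵇ (Fin d → ℝ))
    (l : W1inf ℝ d →L[ℝ] ℝ) (h : ℝ →ᵇ (Fin d → ℝ)) (y : W1inf ℝ d × ℝ) : Prop :=
  bordOp (genL c ρ a) (bcfToLinf g) l y = (bcfToLinf h, 0)

/-- A family of bordered linear operators with data of class `C^k` in `φ ∈ I`, bijective for every
`φ ∈ I`. -/
structure LinFam (k : ℕ) (I : Set ℝ) (c : ℝ → ℝ) (ρ : ℝ → Fin 5 → ℝ)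
    (a : ℝ → Fin 5 → ℝ →ᵇ Mat ℝ d) (g : ℝ → ℝ →ᵇ (Fin d → ℝ)) (l : W1inf ℝ d →L[ℝ] ℝ) :
    Prop where
  isOpen : IsOpen I
  speed : ContDiffOn ℝ k c I
  speed_ne : ∀ φ ∈ I, c φ ≠ 0
  shifts : ∀ j, ContDiffOn ℝ k (fun φ => ρ φ j) I
  coeff : ∀ j, SmoothTr k I fun φ => a φ j
  border : SmoothTr k I g
  bij : ∀ φ ∈ I, Function.Bijective (bordOp (genL (c φ) (ρ φ) (a φ)) (bcfToLinf (g φ)) l)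

/-- The spatial derivative of the solution `y = (w, γ)`, obtained by solving the equation for
`w'`. -/
def spaceDer (c : ℝ) (ρ : Fin 5 → ℝ) (a : Fin 5 → ℝ →ᵇ Mat ℝ d) (g h : ℝ →ᵇ (Fin d → ℝ))
    (y : W1inf ℝ d × ℝ) : ℝ →ᵇ (Fin d → ℝ) :=
  c⁻¹ • (∑ j, mulOp ℝ d (a j) (shift ℝ (ρ j) (toBCF y.1)) + -(y.2 • g) + -h)

theorem lowL_eq (ρ : Fin 5 → ℝ) (a : Fin 5 → ℝ →ᵇ Mat ℝ d) (p : ℝ →ᵇ (Fin d → ℝ)) :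
    lowL ρ a p = ∑ j, mulOp ℝ d (a j) (shift ℝ (ρ j) p) := by
  rw [lowL, _root_.sum_apply]
  rfl

theorem derCLM_eq_spaceDer {c : ℝ} (hc : c ≠ 0) {ρ : Fin 5 → ℝ} {a : Fin 5 → ℝ →ᵇ Mat ℝ d}
    {g h : ℝ →ᵇ (Fin d → ℝ)} {l : W1inf ℝ d →L[ℝ] ℝ} {y : W1inf ℝ d × ℝ}
    (hy : BordSol c ρ a g l h y) :
    derCLM y.1 = bcfToLinf (spaceDer c ρ a g h y) := by
  rw [BordSol, bordOp_apply] at hy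
  have h1 : -(c • derCLM y.1) + bcfToLinf (lowL ρ a (toBCF y.1)) - y.2 • bcfToLinf g =
      bcfToLinf h := (Prod.mk.inj hy).1
  rw [spaceDer, map_smul, map_add, map_add, map_neg, map_neg, map_smul, ← lowL_eq, ← h1,
    eq_inv_smul_iff₀ hc]
  abel

theorem hasDerivAt_spaceDer {c : ℝ} (hc : c ≠ 0) {ρ : Fin 5 → ℝ} {a : Fin 5 → ℝ →ᵇ Mat ℝ d}
    {g h : ℝ →ᵇ (Fin d → ℝ)} {l : W1inf ℝ d →L[ℝ] ℝ} {y : W1inf ℝ d × ℝ}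
    (hy : BordSol c ρ a g l h y) (x : ℝ) :
    HasDerivAt (toBCF y.1) (spaceDer c ρ a g h y x) x := by
  refine W1inf.hasDerivAt_of_der (spaceDer c ρ a g h y).continuous ?_ x
  have h1 := coe_bcfToLinf (spaceDer c ρ a g h y)
  rwa [← derCLM_eq_spaceDer hc hy] at h1

/-- The right-hand side of the equation solved by the `φ`-derivative of the solution `y`, when `X`
is the spatial derivative of `y` and `c'`, `ρ'`, `a'`, `g'`, `h'` are those of the data. -/
def derRhs (ρ : Fin 5 → ℝ) (a : Fin 5 → ℝ →ᵇ Mat ℝ d) (c' : ℝ) (ρ' : Fin 5 → ℝ)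
    (a' : Fin 5 → ℝ →ᵇ Mat ℝ d) (g' h' : ℝ →ᵇ (Fin d → ℝ)) (y : W1inf ℝ d × ℝ)
    (X : ℝ →ᵇ (Fin d → ℝ)) : ℝ →ᵇ (Fin d → ℝ) :=
  c' • X + -(∑ j, (mulOp ℝ d (a' j) (shift ℝ (ρ j) (toBCF y.1)) +
    ρ' j • mulOp ℝ d (a j) (shift ℝ (ρ j) X))) + y.2 • g' + h'

variable {k : ℕ} {I : Set ℝ} {c : ℝ → ℝ} {ρ : ℝ → Fin 5 → ℝ}
    {a : ℝ → Fin 5 → ℝ →ᵇ Mat ℝ d} {g h : ℝ → ℝ →ᵇ (Fin d → ℝ)} {l : W1inf ℝ d →L[ℝ] ℝ}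
    {y : ℝ → W1inf ℝ d × ℝ}

theorem LinFam.of_le {k' : ℕ} (H : LinFam k I c ρ a g l) (hk : k' ≤ k) :
    LinFam k' I c ρ a g l where
  isOpen := H.isOpen
  speed := H.speed.of_le (by exact_mod_cast hk)
  speed_ne := H.speed_ne
  shifts := fun j => (H.shifts j).of_le (by exact_mod_cast hk)
  coeff := fun j => (H.coeff j).of_le hk
  border := H.border.of_le hk
  bij := H.bij

theorem LinFam.continuousAt_op (H : LinFam k I c ρ a g l) {φ : ℝ} (hφ : φ ∈ I) :
    ContinuousAt (fun φ => bordOp (genL (c φ) (ρ φ) (a φ)) (bcfToLinf (g φ)) l) φ := by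
  have hn := H.isOpen.mem_nhds hφ
  refine continuous_bordOp l (continuousAt_genL (H.speed.continuousOn.continuousAt hn)
    (fun j => (H.shifts j).continuousOn.continuousAt hn)
    (fun j => (H.coeff j).contDiffOn.continuousOn.continuousAt hn)) ?_
  exact bcfToLinf.continuous.continuousAt.comp (H.border.contDiffOn.continuousOn.continuousAt hn)

theorem LinFam.continuousAt (H : LinFam k I c ρ a g l) (hh : SmoothTr k I h)
    (hy : ∀ φ ∈ I, BordSol (c φ) (ρ φ) (a φ) (g φ) l (h φ) (y φ))
    {φ : ℝ} (hφ : φ ∈ I) : ContinuousAt y φ := by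
  have hn := H.isOpen.mem_nhds hφ
  refine continuousAt_of_affine (Y := W1inf ℝ d × ℝ) (G := Linf ℝ d × ℝ) (H.continuousAt_op hφ)
    (H.bij φ hφ) (h := fun φ => (bcfToLinf (h φ), 0)) ?_
    ((H.isOpen.eventually_mem hφ).mono fun φ hφ => hy φ hφ)
  exact (bcfToLinf.continuous.continuousAt.comp
    (hh.contDiffOn.continuousOn.continuousAt hn)).prodMk continuousAt_const

theorem SmoothTr.const_of_mem {E : Type*} [NormedAddCommGroup E] [NormedSpace ℝ E]
    {V : ℝ → ℝ →ᵇ E} (hV : SmoothTr 0 I V) {φ : ℝ} (hφ : φ ∈ I) {J : Set ℝ} :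
    SmoothTr 0 J fun _ => V φ :=
  contDiffOn_zero.2 ((hV.continuous_shift hφ).comp continuous_snd).continuousOn

theorem smoothTr_spaceDer (H : LinFam k I c ρ a g l) (hh : SmoothTr k I h)
    (hV : SmoothTr k I fun φ => toBCF (y φ).1) (hγ : ContDiffOn ℝ k (fun φ => (y φ).2) I) :
    SmoothTr k I fun φ => spaceDer (c φ) (ρ φ) (a φ) (g φ) (h φ) (y φ) :=
  (((SmoothTr.sum Finset.univ fun j => (H.coeff j).mulOp (hV.shift (H.shifts j))).add
    (H.border.smul hγ).neg).add hh.neg).smul (H.speed.inv H.speed_ne)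

/-- The parameter derivative of the solution solves the formally differentiated equation. The
translations may be differentiated because the solution has a uniformly continuous derivative, which
is read off from the equation. -/
theorem LinFam.hasDerivAt (H : LinFam (k + 1) I c ρ a g l) (hh : SmoothTr (k + 1) I h)
    (hy : ∀ φ ∈ I, BordSol (c φ) (ρ φ) (a φ) (g φ) l (h φ) (y φ))
    {φ : ℝ} (hφ : φ ∈ I) {c' : ℝ} {ρ' : Fin 5 → ℝ} {a' : Fin 5 → ℝ →ᵇ Mat ℝ d}
    {g' h' : ℝ →ᵇ (Fin d → ℝ)} (hc' : HasDerivAt c c' φ)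
    (hρ' : ∀ j, HasDerivAt (fun φ => ρ φ j) (ρ' j) φ)
    (ha' : ∀ j, HasDerivAt (fun φ => a φ j) (a' j) φ) (hg' : HasDerivAt g g' φ)
    (hh' : HasDerivAt h h' φ) :
    ∃ y' : W1inf ℝ d × ℝ, HasDerivAt y y' φ ∧
      BordSol (c φ) (ρ φ) (a φ) (g φ) l (derRhs (ρ φ) (a φ) c' ρ' a' g' h' (y φ)
        (spaceDer (c φ) (ρ φ) (a φ) (g φ) (h φ) (y φ))) y' := by
  set X := spaceDer (c φ) (ρ φ) (a φ) (g φ) (h φ) (y φ) with hX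
  have hyc : ContinuousOn y I := fun φ hφ => (H.continuousAt hh hy hφ).continuousWithinAt
  have hX0 : SmoothTr 0 I fun φ => spaceDer (c φ) (ρ φ) (a φ) (g φ) (h φ) (y φ) := by
    refine smoothTr_spaceDer (H.of_le (Nat.zero_le _)) (hh.of_le (Nat.zero_le _))
      (smoothTr_zero_of_continuous (continuous_fst.comp_continuousOn hyc)) ?_
    exact contDiffOn_zero.2 (continuous_snd.comp_continuousOn hyc)
  have hs : ∀ j, HasDerivAt (fun ψ => shift ℝ (ρ ψ j) (toBCF (y φ).1))
      (ρ' j • shift ℝ (ρ φ j) X) φ := by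
    intro j
    have h1 := hasDerivAt_shift_comp (I := Set.univ) isOpen_univ (V := fun _ => toBCF (y φ).1)
      (V' := fun _ => 0) (W := fun _ => X) (fun ψ _ => hasDerivAt_const _ _)
      (fun _ _ => hasDerivAt_spaceDer (H.speed_ne φ hφ) (hy φ hφ))
      (contDiffOn_const.congr fun q _ => map_zero _) (hX0.const_of_mem hφ) (φ := φ) trivial (hρ' j)
    rwa [map_zero, zero_add] at h1
  have hm : ∀ j, HasDerivAt (fun ψ => mulOp ℝ d (a ψ j) (shift ℝ (ρ ψ j) (toBCF (y φ).1)))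
      (mulOp ℝ d (a' j) (shift ℝ (ρ φ j) (toBCF (y φ).1)) +
        ρ' j • mulOp ℝ d (a φ j) (shift ℝ (ρ φ j) X)) φ :=
    fun j => hasDerivAt_mulOp (ha' j) (hs j)
  have hsum := HasDerivAt.fun_sum (u := Finset.univ) fun j _ => hm j
  have hD : HasDerivAt (fun ψ => bordOp (genL (c ψ) (ρ ψ) (a ψ)) (bcfToLinf (g ψ)) l (y φ) -
      (bcfToLinf (h ψ), 0)) (-(bcfToLinf (derRhs (ρ φ) (a φ) c' ρ' a' g' h' (y φ) X), 0)) φ := by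
    have h1 := hasDerivAt_bordered bcfToLinf (derCLM (y φ).1) (y φ).2 (l (y φ).1) hc' hsum hg' hh'
    have e : (-(bcfToLinf (derRhs (ρ φ) (a φ) c' ρ' a' g' h' (y φ) X), 0) : Linf ℝ d × ℝ) =
        (-(c' • derCLM (y φ).1) + bcfToLinf (∑ j, (mulOp ℝ d (a' j) (shift ℝ (ρ φ j)
          (toBCF (y φ).1)) + ρ' j • mulOp ℝ d (a φ j) (shift ℝ (ρ φ j) X))) -
          (y φ).2 • bcfToLinf g' - bcfToLinf h', 0) := by
      rw [derCLM_eq_spaceDer (H.speed_ne φ hφ) (hy φ hφ), ← hX, derRhs, Prod.neg_mk, neg_zero,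
        map_add, map_add, map_add, map_neg, map_smul, map_smul]
      congr 1
      abel
    rw [e]
    refine h1.congr_of_eventuallyEq (Eventually.of_forall fun ψ => ?_)
    simp only [← lowL_eq]
    rfl
  have hP := partialStrict_affine (Y := W1inf ℝ d × ℝ) (G := Linf ℝ d × ℝ) (H.continuousAt_op hφ)
    (fun ψ => (bcfToLinf (h ψ), 0)) (y φ)
  rw [← coe_equivOfBij _ (H.bij φ hφ)] at hP
  have hfin := PartialStrict.hasDerivAt (Y := W1inf ℝ d × ℝ) (G := Linf ℝ d × ℝ) hP
    (H.continuousAt hh hy hφ)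
    ((H.isOpen.eventually_mem hφ).mono fun ψ hψ => sub_eq_zero.2 (hy ψ hψ)) hD
  refine ⟨_, hfin, ?_⟩
  rw [map_neg, neg_neg]
  exact (equivOfBij _ (H.bij φ hφ)).apply_symm_apply _

/-- Solutions of a bordered linear equation with data of class `C^k` are of class `C^k`, by
induction: the `φ`-derivative solves an equation of the same kind, whose data involve only the solution
and its spatial derivative and are thus of class `C^{k-1}`. -/
theorem LinFam.smooth (k : ℕ) : ∀ {h : ℝ → ℝ →ᵇ (Fin d → ℝ)} {y : ℝ → W1inf ℝ d × ℝ},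
    LinFam k I c ρ a g l → SmoothTr k I h →
    (∀ φ ∈ I, BordSol (c φ) (ρ φ) (a φ) (g φ) l (h φ) (y φ)) →
    ContDiffOn ℝ k y I ∧ SmoothTr k I fun φ => toBCF (y φ).1 := by
  induction k with
  | zero =>
    intro h y H hh hy
    have hyc : ContinuousOn y I := fun φ hφ => (H.continuousAt hh hy hφ).continuousWithinAt
    exact ⟨contDiffOn_zero.2 hyc,
      smoothTr_zero_of_continuous (continuous_fst.comp_continuousOn hyc)⟩
  | succ k ih =>
    intro h y H hh hy
    have H' := H.of_le k.le_succ
    obtain ⟨h1, h2⟩ := ih H' (hh.of_le k.le_succ) hy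
    have hc' : ContDiffOn ℝ k (deriv c) I := by
      have := H.speed
      push_cast at this
      exact ((contDiffOn_succ_iff_deriv_of_isOpen H.isOpen).1 this).2.2
    have hρ' : ∀ j, ContDiffOn ℝ k (deriv fun φ => ρ φ j) I := fun j => by
      have := H.shifts j
      push_cast at this
      exact ((contDiffOn_succ_iff_deriv_of_isOpen H.isOpen).1 this).2.2
    have hX := smoothTr_spaceDer H' (hh.of_le k.le_succ) h2 (contDiff_snd.comp_contDiffOn h1)
    have ha' := fun j => (H.coeff j).exists_deriv H.isOpen
    have hg' := H.border.exists_deriv H.isOpen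
    have hh' := hh.exists_deriv H.isOpen
    have hd : ∀ {u : ℝ → ℝ}, ContDiffOn ℝ ((k + 1 : ℕ) : WithTop ℕ∞) u I → ∀ φ ∈ I,
        HasDerivAt u (deriv u φ) φ := fun hu φ hφ =>
      ((hu.differentiableOn (by simp)).differentiableAt (H.isOpen.mem_nhds hφ)).hasDerivAt
    have key : ∀ φ ∈ I, HasDerivAt y (deriv y φ) φ ∧
        BordSol (c φ) (ρ φ) (a φ) (g φ) l (derRhs (ρ φ) (a φ) (deriv c φ)
          (fun j => deriv (fun φ => ρ φ j) φ) (fun j => deriv (fun φ => a φ j) φ) (deriv g φ)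
          (deriv h φ) (y φ) (spaceDer (c φ) (ρ φ) (a φ) (g φ) (h φ) (y φ))) (deriv y φ) := by
      intro φ hφ
      obtain ⟨y', hy1, hy2⟩ := H.hasDerivAt hh hy hφ (hd H.speed φ hφ)
        (fun j => hd (H.shifts j) φ hφ) (fun j => (ha' j).2 φ hφ) (hg'.2 φ hφ) (hh'.2 φ hφ)
      rw [hy1.deriv]
      exact ⟨hy1, hy2⟩
    have hrhs : SmoothTr k I fun φ => derRhs (ρ φ) (a φ) (deriv c φ)
        (fun j => deriv (fun φ => ρ φ j) φ) (fun j => deriv (fun φ => a φ j) φ) (deriv g φ)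
        (deriv h φ) (y φ) (spaceDer (c φ) (ρ φ) (a φ) (g φ) (h φ) (y φ)) :=
      (((hX.smul hc').add (SmoothTr.sum Finset.univ fun j =>
        ((ha' j).1.mulOp (h2.shift (H'.shifts j))).add
          (((H'.coeff j).mulOp (hX.shift (H'.shifts j))).smul (hρ' j))).neg).add
        (hg'.1.smul (contDiff_snd.comp_contDiffOn h1))).add hh'.1
    obtain ⟨h3, h4⟩ := ih H' hrhs fun φ hφ => (key φ hφ).2
    constructor
    · push_cast
      exact (contDiffOn_succ_iff_deriv_of_isOpen H.isOpen).2
        ⟨fun φ hφ => (key φ hφ).1.differentiableAt.differentiableWithinAt, by simp, h3⟩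
    · refine SmoothTr.succ H.isOpen (V' := fun φ => toBCF (deriv y φ).1) (fun φ hφ => ?_)
        (fun φ hφ x => hasDerivAt_spaceDer (H.speed_ne φ hφ) (hy φ hφ) x) h4 hX
      exact ((toBCF (𝕜 := ℝ) (d := d)).comp
        (ContinuousLinearMap.fst ℝ (W1inf ℝ d) ℝ)).hasFDerivAt.comp_hasDerivAt φ (key φ hφ).1

end Linear

end LatticeWave

namespace LatticeWave

/-! ### Families of travelling waves -/

/-- Strict differentiability, in the unknowns `(p, c)`, of `-c D p + J N(S_φ p)` and `ℓ p`, when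
the operators `S_φ` depend continuously on `φ`. -/
theorem partialStrict_wave {X Y E E' : Type*} [NormedAddCommGroup X] [NormedSpace ℝ X]
    [NormedAddCommGroup Y] [NormedSpace ℝ Y] [NormedAddCommGroup E] [NormedSpace ℝ E]
    [NormedAddCommGroup E'] [NormedSpace ℝ E'] (D : X →L[ℝ] Y) (J : E' →L[ℝ] Y)
    (l : X →L[ℝ] ℝ) (m : ℝ) {S : ℝ → X →L[ℝ] E} {N : E → E'} {DN : E →L[ℝ] E'} {φ₀ c₀ : ℝ} {p₀ : X}
    (hS : ContinuousAt S φ₀) (hN : HasStrictFDerivAt N DN (S φ₀ p₀)) :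
    PartialStrict (fun q : ℝ × X × ℝ => (-(q.2.2 • D q.2.1) + J (N (S q.1 q.2.1)), l q.2.1 - m))
      (bordOp (-(c₀ • D) + J.comp (DN.comp (S φ₀))) (D p₀) l) φ₀ (p₀, c₀) := by
  have hfst : (fun q : ℝ × (X × ℝ) × (X × ℝ) => q.2.1.1 - q.2.2.1)
      =O[𝓝 (φ₀, (p₀, c₀), (p₀, c₀))] fun q => q.2.1 - q.2.2 :=
    Asymptotics.IsBigO.of_bound 1 (Eventually.of_forall fun q => by
      rw [one_mul]; exact norm_fst_le (q.2.1 - q.2.2))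
  have hSc : ContinuousAt (fun q : ℝ × (X × ℝ) × (X × ℝ) => S q.1) (φ₀, (p₀, c₀), (p₀, c₀)) :=
    hS.comp (f := Prod.fst) (x := (φ₀, (p₀, c₀), (p₀, c₀))) continuousAt_fst
  have t1 : (fun q : ℝ × (X × ℝ) × (X × ℝ) => (q.2.1.2 - c₀) • D (q.2.1.1 - q.2.2.1))
      =o[𝓝 (φ₀, (p₀, c₀), (p₀, c₀))] fun q => q.2.1 - q.2.2 := by
    refine (isLittleO_of_le_mul (Δ := fun q : ℝ × (X × ℝ) × (X × ℝ) => q.2.1.1 - q.2.2.1)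
      (κ := fun q => |q.2.1.2 - c₀| * ‖D‖) ?_ fun q => ?_).trans_isBigO hfst
    · have h : Continuous fun q : ℝ × (X × ℝ) × (X × ℝ) => |q.2.1.2 - c₀| * ‖D‖ := by fun_prop
      have h2 := h.tendsto (φ₀, (p₀, c₀), (p₀, c₀))
      rwa [sub_self, abs_zero, zero_mul] at h2
    · rw [norm_smul, Real.norm_eq_abs, mul_assoc]
      exact mul_le_mul_of_nonneg_left (D.le_opNorm _) (abs_nonneg _)
  have t2 : (fun q : ℝ × (X × ℝ) × (X × ℝ) => (q.2.1.2 - q.2.2.2) • D (q.2.2.1 - p₀))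
      =o[𝓝 (φ₀, (p₀, c₀), (p₀, c₀))] fun q => q.2.1 - q.2.2 := by
    refine isLittleO_of_le_mul (κ := fun q => ‖D (q.2.2.1 - p₀)‖) ?_ fun q => ?_
    · have h : Continuous fun q : ℝ × (X × ℝ) × (X × ℝ) => ‖D (q.2.2.1 - p₀)‖ := by fun_prop
      have h2 := h.tendsto (φ₀, (p₀, c₀), (p₀, c₀))
      rwa [sub_self, map_zero, norm_zero] at h2
    · rw [norm_smul, mul_comm]
      exact mul_le_mul_of_nonneg_left (norm_snd_le (q.2.1 - q.2.2)) (norm_nonneg _)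
  have t3 : (fun q : ℝ × (X × ℝ) × (X × ℝ) => N (S q.1 q.2.1.1) - N (S q.1 q.2.2.1) -
      DN (S q.1 q.2.1.1 - S q.1 q.2.2.1)) =o[𝓝 (φ₀, (p₀, c₀), (p₀, c₀))]
      fun q => q.2.1 - q.2.2 := by
    have hp1 : Continuous fun q : ℝ × (X × ℝ) × (X × ℝ) => q.2.1.1 := by fun_prop
    have hp2 : Continuous fun q : ℝ × (X × ℝ) × (X × ℝ) => q.2.2.1 := by fun_prop
    have h1 := hN.isLittleO.comp_tendsto ((hSc.clm_apply hp1.continuousAt).tendsto.prodMk_nhds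
      (hSc.clm_apply hp2.continuousAt).tendsto)
    refine h1.trans_isBigO (Asymptotics.IsBigO.trans ?_ hfst)
    have hb := hSc.norm.tendsto.eventually (gt_mem_nhds (lt_add_one ‖S φ₀‖))
    refine Asymptotics.IsBigO.of_bound (‖S φ₀‖ + 1) (hb.mono fun q hq => ?_)
    simp only [Function.comp]
    rw [← map_sub]
    exact (S q.1).le_of_opNorm_le hq.le _
  have t4 : (fun q : ℝ × (X × ℝ) × (X × ℝ) => (DN.comp (S q.1 - S φ₀)) (q.2.1.1 - q.2.2.1))
      =o[𝓝 (φ₀, (p₀, c₀), (p₀, c₀))] fun q => q.2.1 - q.2.2 := by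
    refine (isLittleO_of_le_mul (Δ := fun q : ℝ × (X × ℝ) × (X × ℝ) => q.2.1.1 - q.2.2.1)
      (κ := fun q => ‖DN.comp (S q.1 - S φ₀)‖) ?_
      fun q => ContinuousLinearMap.le_opNorm _ _).trans_isBigO hfst
    have h2 := ((continuousAt_const (y := DN)).clm_comp
      (hSc.sub (continuousAt_const (y := S φ₀)))).norm.tendsto
    simp only [Pi.sub_apply, sub_self, ContinuousLinearMap.comp_zero, norm_zero] at h2
    exact h2
  have t5 := ((J.isBigO_comp _ _).trans_isLittleO (t3.add t4)).sub (t1.add t2)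
  refine (t5.prod_left (Asymptotics.isLittleO_zero (E' := ℝ) _ _)).congr_left fun q => ?_
  simp only [bordOp_apply, _root_.add_apply, _root_.neg_apply, _root_.smul_apply,
    ContinuousLinearMap.comp_apply, _root_.sub_apply, map_sub, map_add,
    Prod.mk_sub_mk, Prod.mk.injEq]
  constructor
  · module
  · ring

variable {d : ℕ} {f : (Fin 5 → Fin d → ℝ) → Fin d → ℝ}

/-- The operator `p ↦ τ p` from `W^{1,∞}` to bounded functions. -/
def stencilL (ρ : Fin 5 → ℝ) : W1inf ℝ d →L[ℝ] (ℝ →ᵇ (Fin 5 → Fin d → ℝ)) :=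
  piBCF.comp (ContinuousLinearMap.pi fun j => (shift ℝ (ρ j)).comp toBCF)

theorem stencilL_apply (ρ : Fin 5 → ℝ) (p : W1inf ℝ d) :
    stencilL ρ p = stencilB ρ (toBCF p) := rfl

theorem continuousAt_pi_clm {X E : Type*} [NormedAddCommGroup X] [NormedSpace ℝ X]
    [NormedAddCommGroup E] [NormedSpace ℝ E] {T : ℝ → Fin 5 → X →L[ℝ] E} {φ : ℝ}
    (hT : ∀ j, ContinuousAt (fun φ => T φ j) φ) :
    ContinuousAt (fun φ => ContinuousLinearMap.pi (T φ)) φ := by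
  have e : ∀ φ, ContinuousLinearMap.pi (T φ) =
      ∑ j, (ContinuousLinearMap.single ℝ (fun _ : Fin 5 => E) j).comp (T φ j) := by
    intro φ
    ext x i
    simp [_root_.sum_apply, Finset.sum_apply, Pi.single_apply]
  simp only [e]
  exact tendsto_finsetSum _ fun j _ => continuousAt_const.clm_comp (hT j)

theorem continuous_stencilL {ρ : ℝ → Fin 5 → ℝ} (hρ : ∀ j, Continuous fun φ => ρ φ j) :
    Continuous fun φ => stencilL (d := d) (ρ φ) := by
  refine continuous_iff_continuousAt.2 fun φ => ?_
  exact ContinuousAt.clm_comp (E := W1inf ℝ d) continuousAt_const (continuousAt_pi_clm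
    (X := W1inf ℝ d) fun j =>
      continuous_shift_comp_toBCF.continuousAt.comp (f := fun φ => ρ φ j) (hρ j).continuousAt)

theorem nemD_stencilB (hf : Continuous (fderiv ℝ f)) (ρ : Fin 5 → ℝ) (V : ℝ →ᵇ (Fin d → ℝ))
    (W : Fin 5 → ℝ →ᵇ (Fin d → ℝ)) :
    nemD f hf (stencilB ρ V) (piBCF W) = ∑ j, mulOp ℝ d (jacB hf ρ V j) (W j) := by
  ext1 x
  rw [nemD_apply, BoundedContinuousFunction.sum_apply, fderiv_eq_sum_pderiv]
  refine Finset.sum_congr rfl fun j _ => ?_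
  rw [mulOp_apply, jacB_apply, stencilB_apply, piBCF_apply]

theorem genL_jacB (hf : Continuous (fderiv ℝ f)) (c : ℝ) (ρ : Fin 5 → ℝ) (p : W1inf ℝ d) :
    genL c ρ (jacB hf ρ (toBCF p)) = -(c • derCLM) +
      bcfToLinf.comp ((nemD f hf (stencilL ρ p)).comp (stencilL ρ)) := by
  ext1 q
  have h : lowL ρ (jacB hf ρ (toBCF p)) (toBCF q) =
      nemD f hf (stencilL ρ p) (stencilL ρ q) := by
    rw [lowL_eq]
    exact (nemD_stencilB hf ρ (toBCF p) _).symm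
  change -(c • derCLM q) + bcfToLinf (lowL ρ (jacB hf ρ (toBCF p)) (toBCF q)) = _
  rw [h]
  rfl

/-- The travelling wave equation for the unknown `(p, c)`, with shifts `ρ_j(φ)` and the
normalization `ℓ p = m`. -/
def waveF (hc : Continuous f) (ρ : ℝ → Fin 5 → ℝ) (l : W1inf ℝ d →L[ℝ] ℝ) (m : ℝ)
    (q : ℝ × W1inf ℝ d × ℝ) : Linf ℝ d × ℝ :=
  (-(q.2.2 • derCLM q.2.1) + bcfToLinf (nem f hc (stencilL (ρ q.1) q.2.1)), l q.2.1 - m)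

/-- The derivative of `waveF` with respect to `y = (p, c)`. -/
def waveB (hf : Continuous (fderiv ℝ f)) (ρ : Fin 5 → ℝ) (l : W1inf ℝ d →L[ℝ] ℝ)
    (y : W1inf ℝ d × ℝ) : W1inf ℝ d × ℝ →L[ℝ] Linf ℝ d × ℝ :=
  bordOp (genL y.2 ρ (jacB hf ρ (toBCF y.1))) (derCLM y.1) l

theorem partialStrict_waveF (hd : Differentiable ℝ f) (hf : Continuous (fderiv ℝ f))
    {ρ : ℝ → Fin 5 → ℝ} (hρ : ∀ j, Continuous fun φ => ρ φ j) (l : W1inf ℝ d →L[ℝ] ℝ) (m : ℝ)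
    (φ : ℝ) (y : W1inf ℝ d × ℝ) :
    PartialStrict (waveF hd.continuous ρ l m) (waveB hf (ρ φ) l y) φ y := by
  rw [waveB, genL_jacB]
  have hS : ContinuousAt (fun φ => stencilL (d := d) (ρ φ)) φ :=
    (continuous_stencilL hρ).continuousAt
  have hN := hasStrictFDerivAt_nem hd hf (stencilL (ρ φ) y.1)
  have h := partialStrict_wave (X := W1inf ℝ d) (Y := Linf ℝ d)
    (E := ℝ →ᵇ (Fin 5 → Fin d → ℝ)) (E' := ℝ →ᵇ (Fin d → ℝ)) derCLM bcfToLinf l m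
    (c₀ := y.2) hS hN
  exact h

theorem continuous_waveF (hc : Continuous f) {ρ : ℝ → Fin 5 → ℝ}
    (hρ : ∀ j, Continuous fun φ => ρ φ j) (l : W1inf ℝ d →L[ℝ] ℝ) (m : ℝ) (y : W1inf ℝ d × ℝ) :
    Continuous fun φ => waveF hc ρ l m (φ, y) := by
  have h1 : Continuous fun φ => stencilL (ρ φ) y.1 :=
    (ContinuousLinearMap.apply ℝ _ y.1).continuous.comp (continuous_stencilL hρ)
  have h2 : Continuous fun φ => -(y.2 • derCLM y.1) +
      bcfToLinf (nem f hc (stencilL (ρ φ) y.1)) :=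
    continuous_const.add (bcfToLinf.continuous.comp ((continuous_nem hc).comp h1))
  exact h2.prodMk (continuous_const (y := l y.1 - m))

theorem continuousAt_waveB (hf : Continuous (fderiv ℝ f)) {ρ : ℝ → Fin 5 → ℝ}
    (hρ : ∀ j, Continuous fun φ => ρ φ j) (l : W1inf ℝ d →L[ℝ] ℝ) {y : ℝ → W1inf ℝ d × ℝ} {φ : ℝ}
    (hy : ContinuousAt y φ) : ContinuousAt (fun φ => waveB hf (ρ φ) l (y φ)) φ := by
  have h1 : ContinuousAt (fun φ => (y φ).1) φ := continuous_fst.continuousAt.comp hy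
  have h2 : ContinuousAt (fun φ => stencilL (ρ φ) (y φ).1) φ :=
    ContinuousAt.clm_apply (E := W1inf ℝ d) (continuous_stencilL hρ).continuousAt h1
  exact continuous_bordOp l (continuousAt_genL (continuous_snd.continuousAt.comp hy)
    (fun j => (hρ j).continuousAt) fun j =>
      (continuous_nem (continuous_pderiv hf j)).continuousAt.comp h2)
    (derCLM.continuous.continuousAt.comp h1)

/-- A continuous family `y(φ) = (p, c)`, `φ ∈ I`, of normalized travelling waves at which the
linearization is bijective. -/
structure WaveFam (hd : Differentiable ℝ f) (hf : Continuous (fderiv ℝ f)) (ρ : ℝ → Fin 5 → ℝ)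
    (I : Set ℝ) (l : W1inf ℝ d →L[ℝ] ℝ) (m : ℝ) (y : ℝ → W1inf ℝ d × ℝ) : Prop where
  isOpen : IsOpen I
  shifts : ∀ j, Continuous fun φ => ρ φ j
  cont : ∀ φ ∈ I, ContinuousAt y φ
  eq : ∀ φ ∈ I, waveF hd.continuous ρ l m (φ, y φ) = 0
  speed_ne : ∀ φ ∈ I, (y φ).2 ≠ 0
  bij : ∀ φ ∈ I, Function.Bijective (waveB hf (ρ φ) l (y φ))

/-- Continuation of a wave with bijective linearization. The implicit function theorem is applied
in `W^{1,∞}`, where translation is only continuous in the shift, as an operator to bounded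
functions. -/
theorem exists_waveFam (hd : Differentiable ℝ f) (hf : Continuous (fderiv ℝ f))
    {ρ : ℝ → Fin 5 → ℝ} (hρ : ∀ j, Continuous fun φ => ρ φ j) {l : W1inf ℝ d →L[ℝ] ℝ} {m : ℝ}
    {y₀ : W1inf ℝ d × ℝ} (h0 : waveF hd.continuous ρ l m (0, y₀) = 0) (hc : y₀.2 ≠ 0)
    (hb : Function.Bijective (waveB hf (ρ 0) l y₀)) :
    ∃ δ > 0, ∃ y, y 0 = y₀ ∧ WaveFam hd hf ρ (Set.Ioo (-δ) δ) l m y := by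
  have hP := partialStrict_waveF hd hf hρ l m 0 y₀
  rw [← coe_equivOfBij _ hb] at hP
  obtain ⟨y, hy0, hy⟩ := PartialStrict.exists_implicit (Y := W1inf ℝ d × ℝ) (G := Linf ℝ d × ℝ) hP
    h0 (continuous_waveF hd.continuous hρ l m)
  have hy1 := hy.self_of_nhds.2
  have hne : ∀ᶠ φ in 𝓝 0, (y φ).2 ≠ 0 :=
    (continuous_snd.continuousAt.comp hy1).eventually_ne (by rw [Function.comp, hy0]; exact hc)
  have hb' : Function.Bijective (waveB hf (ρ 0) l (y 0)) := by rwa [hy0]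
  have hbe : ∀ᶠ φ in 𝓝 0, Function.Bijective (waveB hf (ρ φ) l (y φ)) :=
    (continuousAt_waveB hf hρ l hy1).eventually
      (eventually_bijective (X := W1inf ℝ d × ℝ) (Y := Linf ℝ d × ℝ) hb')
  obtain ⟨δ, hδ, hball⟩ := Metric.eventually_nhds_iff_ball.1 (hy.and (hne.and hbe))
  rw [Real.ball_eq_Ioo, zero_sub, zero_add] at hball
  exact ⟨δ, hδ, y, hy0, isOpen_Ioo, hρ, fun φ hφ => (hball φ hφ).1.2,
    fun φ hφ => (hball φ hφ).1.1, fun φ hφ => (hball φ hφ).2.1, fun φ hφ => (hball φ hφ).2.2⟩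

/-- The spatial derivative of a travelling wave, obtained by solving the wave equation for it. -/
def waveDer (hc : Continuous f) (ρ : Fin 5 → ℝ) (y : W1inf ℝ d × ℝ) : ℝ →ᵇ (Fin d → ℝ) :=
  y.2⁻¹ • nem f hc (stencilB ρ (toBCF y.1))

/-- The inhomogeneity in the equation for the `φ`-derivative of a family of waves. -/
def waveRhs (hc : Continuous f) (hf : Continuous (fderiv ℝ f)) (ρ ρ' : Fin 5 → ℝ)
    (y : W1inf ℝ d × ℝ) : ℝ →ᵇ (Fin d → ℝ) :=
  -∑ j, ρ' j • mulOp ℝ d (jacB hf ρ (toBCF y.1) j) (shift ℝ (ρ j) (waveDer hc ρ y))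

variable {hd : Differentiable ℝ f} {hf : Continuous (fderiv ℝ f)} {ρ : ℝ → Fin 5 → ℝ}
  {I : Set ℝ} {l : W1inf ℝ d →L[ℝ] ℝ} {m : ℝ} {y : ℝ → W1inf ℝ d × ℝ} {φ : ℝ}

theorem WaveFam.normalized (H : WaveFam hd hf ρ I l m y) (hφ : φ ∈ I) : l (y φ).1 = m :=
  sub_eq_zero.1 (Prod.mk.inj (H.eq φ hφ)).2

theorem WaveFam.derCLM_eq (H : WaveFam hd hf ρ I l m y) (hφ : φ ∈ I) :
    derCLM (y φ).1 = bcfToLinf (waveDer hd.continuous (ρ φ) (y φ)) := by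
  have h1 := (Prod.mk.inj (H.eq φ hφ)).1
  rw [waveDer, map_smul, eq_inv_smul_iff₀ (H.speed_ne φ hφ)]
  exact neg_add_eq_zero.1 h1

theorem WaveFam.hasDerivAt_space (H : WaveFam hd hf ρ I l m y) (hφ : φ ∈ I) (x : ℝ) :
    HasDerivAt (toBCF (y φ).1) (waveDer hd.continuous (ρ φ) (y φ) x) x := by
  refine W1inf.hasDerivAt_of_der (waveDer hd.continuous (ρ φ) (y φ)).continuous ?_ x
  have h1 := coe_bcfToLinf (waveDer hd.continuous (ρ φ) (y φ))
  rwa [← H.derCLM_eq hφ] at h1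

theorem smoothTr_waveDer {k : ℕ} (hk : ContDiff ℝ k f) (hρ : ∀ j, ContDiffOn ℝ k (fun φ => ρ φ j) I)
    (hne : ∀ φ ∈ I, (y φ).2 ≠ 0) (hy : ContDiffOn ℝ k (fun φ => (y φ).2) I)
    (hV : SmoothTr k I fun φ => toBCF (y φ).1) :
    SmoothTr k I fun φ => waveDer hk.continuous (ρ φ) (y φ) :=
  ((hV.stencilB hρ).nem hk).smul (hy.inv hne)

theorem WaveFam.smoothTr_zero (H : WaveFam hd hf ρ I l m y) :
    ContDiffOn ℝ (0 : ℕ) y I ∧ SmoothTr 0 I fun φ => toBCF (y φ).1 := by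
  have hyc : ContinuousOn y I := fun φ hφ => (H.cont φ hφ).continuousWithinAt
  exact ⟨contDiffOn_zero.2 hyc, smoothTr_zero_of_continuous (continuous_fst.comp_continuousOn hyc)⟩

theorem WaveFam.smoothTr_waveDer_zero (H : WaveFam hd hf ρ I l m y) :
    SmoothTr 0 I fun φ => waveDer hd.continuous (ρ φ) (y φ) :=
  smoothTr_waveDer (contDiff_zero.2 hd.continuous)
    (fun j => contDiffOn_zero.2 (H.shifts j).continuousOn) H.speed_ne
    (contDiff_snd.comp_contDiffOn H.smoothTr_zero.1) H.smoothTr_zero.2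

theorem hasDerivAt_piBCF {E : Type*} [NormedAddCommGroup E] [NormedSpace ℝ E]
    {V : ℝ → Fin 5 → ℝ →ᵇ E} {V' : Fin 5 → ℝ →ᵇ E}
    (hV : ∀ j, HasDerivAt (fun φ => V φ j) (V' j) φ) :
    HasDerivAt (fun φ => piBCF (V φ)) (piBCF V') φ :=
  (piBCF (E := E)).hasFDerivAt.comp_hasDerivAt φ (hasDerivAt_pi.2 hV)

theorem hasDerivAt_nem_comp (hd : Differentiable ℝ f) (hf : Continuous (fderiv ℝ f))
    {U : ℝ → ℝ →ᵇ (Fin 5 → Fin d → ℝ)} {U' : ℝ →ᵇ (Fin 5 → Fin d → ℝ)} (hU : HasDerivAt U U' φ) :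
    HasDerivAt (fun φ => nem f hd.continuous (U φ)) (nemD f hf (U φ) U') φ :=
  (hasFDerivAt_nem hd hf (U φ)).comp_hasDerivAt φ hU

theorem hasDerivAt_affine {E Y : Type*} [NormedAddCommGroup E] [NormedSpace ℝ E]
    [NormedAddCommGroup Y] [NormedSpace ℝ Y] (J : E →L[ℝ] Y) (x : Y) (m : ℝ)
    {P : ℝ → E} {P' : E} (hP : HasDerivAt P P' φ) :
    HasDerivAt (fun φ => ((x + J (P φ), m) : Y × ℝ)) (J P', 0) φ :=
  ((J.hasFDerivAt.comp_hasDerivAt φ hP).const_add x).prodMk (hasDerivAt_const φ m)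

/-- The parameter derivative of a family of waves solves a bordered linear equation. -/
theorem WaveFam.hasDerivAt (H : WaveFam hd hf ρ I l m y) (hφ : φ ∈ I) {ρ' : Fin 5 → ℝ}
    (hρ' : ∀ j, HasDerivAt (fun φ => ρ φ j) (ρ' j) φ) :
    ∃ y' : W1inf ℝ d × ℝ, HasDerivAt y y' φ ∧
      BordSol (y φ).2 (ρ φ) (jacB hf (ρ φ) (toBCF (y φ).1)) (waveDer hd.continuous (ρ φ) (y φ)) l
        (waveRhs hd.continuous hf (ρ φ) ρ' (y φ)) y' := by
  set X := waveDer hd.continuous (ρ φ) (y φ) with hX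
  have hs : ∀ j, HasDerivAt (fun ψ => shift ℝ (ρ ψ j) (toBCF (y φ).1))
      (ρ' j • shift ℝ (ρ φ j) X) φ := by
    intro j
    have h1 := hasDerivAt_shift_comp (I := Set.univ) isOpen_univ (V := fun _ => toBCF (y φ).1)
      (V' := fun _ => 0) (W := fun _ => X) (fun ψ _ => hasDerivAt_const _ _)
      (fun _ _ => H.hasDerivAt_space hφ)
      (contDiffOn_const.congr fun q _ => map_zero _) (H.smoothTr_waveDer_zero.const_of_mem hφ)
      (φ := φ) trivial (hρ' j)
    rwa [map_zero, zero_add] at h1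
  have hN := hasDerivAt_nem_comp hd hf (hasDerivAt_piBCF hs)
  have e : nemD f hf (piBCF fun j => shift ℝ (ρ φ j) (toBCF (y φ).1))
      (piBCF fun j => ρ' j • shift ℝ (ρ φ j) X) =
      -waveRhs hd.continuous hf (ρ φ) ρ' (y φ) := by
    rw [waveRhs, neg_neg]
    refine (nemD_stencilB hf (ρ φ) _ _).trans (Finset.sum_congr rfl fun j _ => ?_)
    rw [map_smul]
  rw [e] at hN
  have hD : HasDerivAt (fun ψ => waveF hd.continuous ρ l m (ψ, y φ))
      (bcfToLinf (-waveRhs hd.continuous hf (ρ φ) ρ' (y φ)), 0) φ :=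
    hasDerivAt_affine bcfToLinf (-((y φ).2 • derCLM (y φ).1)) (l (y φ).1 - m) hN
  have hP := partialStrict_waveF hd hf H.shifts l m φ (y φ)
  rw [← coe_equivOfBij _ (H.bij φ hφ)] at hP
  have hfin := PartialStrict.hasDerivAt (Y := W1inf ℝ d × ℝ) (G := Linf ℝ d × ℝ) hP
    (H.cont φ hφ) ((H.isOpen.eventually_mem hφ).mono fun ψ hψ => H.eq ψ hψ) hD
  refine ⟨_, hfin, ?_⟩
  rw [BordSol, hX, ← H.derCLM_eq hφ, map_neg]
  have h2 := (equivOfBij _ (H.bij φ hφ)).apply_symm_apply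
    (bcfToLinf (-waveRhs hd.continuous hf (ρ φ) ρ' (y φ)), 0)
  refine (congrArg Neg.neg h2).trans ?_
  rw [Prod.neg_mk, map_neg, neg_neg, neg_zero]

theorem contDiff_pderiv {k : ℕ} (hk : ContDiff ℝ (k + 1 : ℕ) f) (j : Fin 5) :
    ContDiff ℝ k (pderiv f j) := by
  have h1 : ContDiff ℝ k (fderiv ℝ f) := hk.fderiv_right (by push_cast; exact le_rfl)
  exact h1.clm_comp contDiff_const

/-- The linear equation for the parameter derivative of a family of waves of class `C^k` has data
of class `C^k`. -/
theorem WaveFam.linFam {k : ℕ} (H : WaveFam hd hf ρ I l m y) (hk : ContDiff ℝ (k + 1 : ℕ) f)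
    (hρ : ∀ j, ContDiffOn ℝ k (fun φ => ρ φ j) I) (hy : ContDiffOn ℝ k y I)
    (hV : SmoothTr k I fun φ => toBCF (y φ).1) :
    LinFam k I (fun φ => (y φ).2) ρ (fun φ => jacB hf (ρ φ) (toBCF (y φ).1))
      (fun φ => waveDer hd.continuous (ρ φ) (y φ)) l where
  isOpen := H.isOpen
  speed := contDiff_snd.comp_contDiffOn hy
  speed_ne := H.speed_ne
  shifts := hρ
  coeff := fun j => (hV.stencilB hρ).nem (contDiff_pderiv hk j)
  border := smoothTr_waveDer (hk.of_le (by exact_mod_cast k.le_succ)) hρ H.speed_ne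
    (contDiff_snd.comp_contDiffOn hy) hV
  bij := fun φ hφ => by
    rw [← H.derCLM_eq hφ]
    exact H.bij φ hφ

theorem LinFam.smoothTr_waveRhs {k : ℕ} (L : LinFam k I (fun φ => (y φ).2) ρ
    (fun φ => jacB hf (ρ φ) (toBCF (y φ).1)) (fun φ => waveDer hd.continuous (ρ φ) (y φ)) l)
    {ρ' : ℝ → Fin 5 → ℝ} (hρ' : ∀ j, ContDiffOn ℝ k (fun φ => ρ' φ j) I) :
    SmoothTr k I fun φ => waveRhs hd.continuous hf (ρ φ) (ρ' φ) (y φ) :=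
  (SmoothTr.sum Finset.univ fun j =>
    ((L.coeff j).mulOp (L.border.shift (L.shifts j))).smul (hρ' j)).neg

/-- A family of waves of a `C^k` equation is of class `C^k`. -/
theorem WaveFam.smooth (H : WaveFam hd hf ρ I l m y) {ρ' : ℝ → Fin 5 → ℝ}
    (hρ' : ∀ φ j, HasDerivAt (fun φ => ρ φ j) (ρ' φ j) φ)
    (hρ'' : ∀ (k : ℕ) j, ContDiff ℝ k fun φ => ρ' φ j) (k : ℕ) : ContDiff ℝ k f →
    ContDiffOn ℝ k y I ∧ SmoothTr k I fun φ => toBCF (y φ).1 := by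
  have hρ : ∀ (k : ℕ) j, ContDiff ℝ k fun φ => ρ φ j := by
    intro k j
    refine ContDiff.of_le (n := (k + 1 : ℕ)) ?_ (by exact_mod_cast k.le_succ)
    push_cast
    refine contDiff_succ_iff_deriv.2 ⟨fun φ => (hρ' φ j).differentiableAt, by simp, ?_⟩
    rw [show (deriv fun φ => ρ φ j) = fun φ => ρ' φ j from funext fun φ => (hρ' φ j).deriv]
    exact hρ'' k j
  induction k with
  | zero => exact fun _ => H.smoothTr_zero
  | succ k ih =>
    intro hk
    obtain ⟨h1, h2⟩ := ih (hk.of_le (by exact_mod_cast k.le_succ))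
    have L := H.linFam hk (fun j => (hρ k j).contDiffOn) h1 h2
    have key : ∀ φ ∈ I, HasDerivAt y (deriv y φ) φ ∧ BordSol (y φ).2 (ρ φ)
        (jacB hf (ρ φ) (toBCF (y φ).1)) (waveDer hd.continuous (ρ φ) (y φ)) l
        (waveRhs hd.continuous hf (ρ φ) (ρ' φ) (y φ)) (deriv y φ) := by
      intro φ hφ
      obtain ⟨y', hy1, hy2⟩ := H.hasDerivAt hφ (hρ' φ)
      rw [hy1.deriv]
      exact ⟨hy1, hy2⟩
    obtain ⟨h3, h4⟩ := LinFam.smooth k L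
      (LinFam.smoothTr_waveRhs (hd := hd) L fun j => (hρ'' k j).contDiffOn) fun φ hφ => (key φ hφ).2
    constructor
    · push_cast
      exact (contDiffOn_succ_iff_deriv_of_isOpen H.isOpen).2
        ⟨fun φ hφ => (key φ hφ).1.differentiableAt.differentiableWithinAt, by simp, h3⟩
    · refine SmoothTr.succ H.isOpen (V' := fun φ => toBCF (deriv y φ).1) (fun φ hφ => ?_)
        (fun φ hφ x => H.hasDerivAt_space hφ x) h4 L.border
      exact ((toBCF (𝕜 := ℝ) (d := d)).comp
        (ContinuousLinearMap.fst ℝ (W1inf ℝ d) ℝ)).hasFDerivAt.comp_hasDerivAt φ (key φ hφ).1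

end LatticeWave

namespace LatticeWave

/-! ### The second derivative of a family of travelling waves -/

section Second

variable {E : Type*} [NormedAddCommGroup E] [NormedSpace ℝ E] {I : Set ℝ}

/-- The chain rule for translations by parameter-dependent amounts. -/
theorem SmoothTr.hasDerivAt_shift (hI : IsOpen I) {V : ℝ → ℝ →ᵇ E} (h : SmoothTr 1 I V) {φ : ℝ}
    (hφ : φ ∈ I) {V' W : ℝ →ᵇ E} (hV : HasDerivAt V V' φ) (hW : ∀ x, HasDerivAt (V φ) (W x) x)
    {ρ : ℝ → ℝ} {ρ' : ℝ} (hρ : HasDerivAt ρ ρ' φ) :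
    HasDerivAt (fun φ => LatticeWave.shift ℝ (ρ φ) (V φ))
      (LatticeWave.shift ℝ (ρ φ) V' + ρ' • LatticeWave.shift ℝ (ρ φ) W) φ := by
  have hn : I ×ˢ (Set.univ : Set ℝ) ∈ 𝓝 (φ, ρ φ) :=
    (hI.prod isOpen_univ).mem_nhds ⟨hφ, trivial⟩
  have hF := ((ContDiffOn.differentiableOn h (by simp)).differentiableAt hn).hasFDerivAt
  set L := fderiv ℝ (fun q : ℝ × ℝ => LatticeWave.shift ℝ q.2 (V q.1)) (φ, ρ φ) with hL
  have h1 := hF.comp_hasDerivAt φ ((hasDerivAt_id φ).prodMk hρ)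
  have h2 := hF.comp_hasDerivAt φ ((hasDerivAt_id φ).prodMk (hasDerivAt_const φ (ρ φ)))
  have h3 := hF.comp_hasDerivAt (ρ φ) ((hasDerivAt_const (ρ φ) φ).prodMk (hasDerivAt_id (ρ φ)))
  have e2 : L (1, 0) = LatticeWave.shift ℝ (ρ φ) V' :=
    h2.unique ((LatticeWave.shift ℝ (ρ φ)).hasFDerivAt.comp_hasDerivAt φ hV)
  have e3 : L (0, 1) = LatticeWave.shift ℝ (ρ φ) W := by
    ext1 x
    have h4 := ((BoundedContinuousFunction.evalCLM ℝ x).hasFDerivAt.comp_hasDerivAt (ρ φ) h3)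
    exact h4.unique ((hW (x + ρ φ)).comp_const_add x (ρ φ))
  have e : L (1, ρ') = LatticeWave.shift ℝ (ρ φ) V' + ρ' • LatticeWave.shift ℝ (ρ φ) W := by
    rw [← e2, ← e3, ← map_smul, ← map_add, Prod.smul_mk, smul_zero, smul_eq_mul, mul_one,
      Prod.mk_add_mk, add_zero, zero_add]
  rw [← e]
  exact h1

variable {d : ℕ} {f : (Fin 5 → Fin d → ℝ) → Fin d → ℝ}

/-- The weighted sum `∑ j, s_j a_j(ξ) p(ξ + ρ_j)`. -/
def wtL (s ρ : Fin 5 → ℝ) (a : Fin 5 → ℝ →ᵇ Mat ℝ d) (p : ℝ →ᵇ (Fin d → ℝ)) : ℝ →ᵇ (Fin d → ℝ) :=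
  ∑ j, s j • mulOp ℝ d (a j) (shift ℝ (ρ j) p)

theorem wtL_apply (s ρ : Fin 5 → ℝ) (a : Fin 5 → ℝ →ᵇ Mat ℝ d) (p : ℝ →ᵇ (Fin d → ℝ)) (x : ℝ) :
    wtL s ρ a p x = ∑ j, s j • a j x (p (x + ρ j)) := by
  rw [wtL, BoundedContinuousFunction.sum_apply]
  rfl

/-- The function `D²f(U)[V, V]`. -/
def quadB (h2 : Continuous (fderiv ℝ (fderiv ℝ f))) (U V : ℝ →ᵇ (Fin 5 → Fin d → ℝ)) :
    ℝ →ᵇ (Fin d → ℝ) :=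
  bilinBCF (ContinuousLinearMap.id ℝ ((Fin 5 → Fin d → ℝ) →L[ℝ] (Fin d → ℝ)))
    (nemD (fderiv ℝ f) h2 U V) V

theorem quadB_apply (h2 : Continuous (fderiv ℝ (fderiv ℝ f))) (U V : ℝ →ᵇ (Fin 5 → Fin d → ℝ))
    (x : ℝ) : quadB h2 U V x = fderiv ℝ (fderiv ℝ f) (U x) (V x) (V x) := rfl

theorem hasFDerivAt_pderiv (h2 : Differentiable ℝ (fderiv ℝ f)) (j : Fin 5)
    (U : Fin 5 → Fin d → ℝ) : HasFDerivAt (pderiv f j)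
      ((ContinuousLinearMap.precomp (Fin d → ℝ)
        (ContinuousLinearMap.single ℝ (fun _ : Fin 5 => Fin d → ℝ) j)).comp
          (fderiv ℝ (fderiv ℝ f) U)) U := by
  have h := (ContinuousLinearMap.precomp (Fin d → ℝ)
    (ContinuousLinearMap.single ℝ (fun _ : Fin 5 => Fin d → ℝ) j)).hasFDerivAt.comp U
    (h2 U).hasFDerivAt
  exact h

theorem fderiv_pderiv_apply (h2 : Differentiable ℝ (fderiv ℝ f)) (j : Fin 5)
    (U V : Fin 5 → Fin d → ℝ) (w : Fin d → ℝ) :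
    fderiv ℝ (pderiv f j) U V w = fderiv ℝ (fderiv ℝ f) U V (Pi.single j w) := by
  rw [(hasFDerivAt_pderiv h2 j U).fderiv]
  rfl

theorem continuous_fderiv_pderiv (h2 : ContDiff ℝ 2 f) (j : Fin 5) :
    Continuous (fderiv ℝ (pderiv f j)) :=
  (contDiff_pderiv (k := 1) h2 j).continuous_fderiv (by simp)

theorem hasDerivAt_smul_mulOp {s : ℝ → ℝ} {a : ℝ → ℝ →ᵇ Mat ℝ d} {v : ℝ → ℝ →ᵇ (Fin d → ℝ)}
    {s' φ : ℝ} {a' : ℝ →ᵇ Mat ℝ d} {v' : ℝ →ᵇ (Fin d → ℝ)} (hs : HasDerivAt s s' φ)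
    (ha : HasDerivAt a a' φ) (hv : HasDerivAt v v' φ) :
    HasDerivAt (fun φ => s φ • mulOp ℝ d (a φ) (v φ))
      (s φ • (mulOp ℝ d a' (v φ) + mulOp ℝ d (a φ) v') + s' • mulOp ℝ d (a φ) (v φ)) φ := by
  have h1 := hasDerivAt_mulOp (s := 1) (v' := v') ha (by rwa [one_smul])
  rw [one_smul] at h1
  exact hs.smul h1

variable {hd : Differentiable ℝ f} {hf : Continuous (fderiv ℝ f)} {ρ : ℝ → Fin 5 → ℝ}
  {l : W1inf ℝ d →L[ℝ] ℝ} {m : ℝ} {y : ℝ → W1inf ℝ d × ℝ} {φ : ℝ}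

/-- The inhomogeneity in the equation for the second derivative of a family of waves. Here `c'`
and `V'` are the first derivatives of the speed and of the wave, `X` is the spatial derivative of
`V'`, `W` is the second spatial derivative of the wave, and `ρ'`, `ρ''` are the derivatives of the
shifts. -/
def waveRhs₂ (hd : Differentiable ℝ f) (hf : Continuous (fderiv ℝ f))
    (h2 : Continuous (fderiv ℝ (fderiv ℝ f))) (ρ ρ' ρ'' : Fin 5 → ℝ) (y : W1inf ℝ d × ℝ) (c' : ℝ)
    (V' X W : ℝ →ᵇ (Fin d → ℝ)) : ℝ →ᵇ (Fin d → ℝ) :=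
  (2 * c') • X - quadB h2 (stencilB ρ (toBCF y.1))
      (piBCF fun j => shift ℝ (ρ j) V' + ρ' j • shift ℝ (ρ j) (waveDer hd.continuous ρ y))
    - wtL (fun j => ρ' j ^ 2) ρ (jacB hf ρ (toBCF y.1)) W
    - wtL ρ'' ρ (jacB hf ρ (toBCF y.1)) (waveDer hd.continuous ρ y)
    - (2 : ℝ) • wtL ρ' ρ (jacB hf ρ (toBCF y.1)) X

theorem derRhs_eq_waveRhs₂ (h2 : ContDiff ℝ 2 f) (h2c : Continuous (fderiv ℝ (fderiv ℝ f)))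
    (ρ ρ' ρ'' : Fin 5 → ℝ) (y y' : W1inf ℝ d × ℝ) (X W : ℝ →ᵇ (Fin d → ℝ))
    {a' : Fin 5 → ℝ →ᵇ Mat ℝ d}
    (ha' : ∀ j, a' j = nemD (pderiv f j) (continuous_fderiv_pderiv h2 j) (stencilB ρ (toBCF y.1))
      (piBCF fun j => shift ℝ (ρ j) (toBCF y'.1) +
        ρ' j • shift ℝ (ρ j) (waveDer hd.continuous ρ y))) :
    derRhs ρ (jacB hf ρ (toBCF y.1)) y'.2 ρ' a' X
      (-∑ j, (ρ' j • (mulOp ℝ d (a' j) (shift ℝ (ρ j) (waveDer hd.continuous ρ y)) +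
        mulOp ℝ d (jacB hf ρ (toBCF y.1) j) (shift ℝ (ρ j) X + ρ' j • shift ℝ (ρ j) W)) +
        ρ'' j • mulOp ℝ d (jacB hf ρ (toBCF y.1) j) (shift ℝ (ρ j) (waveDer hd.continuous ρ y))))
      y' X = waveRhs₂ hd hf h2c ρ ρ' ρ'' y y'.2 (toBCF y'.1) X W := by
  have hd2 : Differentiable ℝ (fderiv ℝ f) :=
    (h2.fderiv_right (m := 1) (by norm_num)).differentiable (by simp)
  set g := waveDer hd.continuous ρ y with hg
  set U' := piBCF fun j => shift ℝ (ρ j) (toBCF y'.1) + ρ' j • shift ℝ (ρ j) g with hU'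
  ext1 x
  have hq : quadB h2c (stencilB ρ (toBCF y.1)) U' x =
      ∑ j, a' j x (y'.1.fn (x + ρ j) + ρ' j • g (x + ρ j)) := by
    have hs : ∀ j, U' x j = y'.1.fn (x + ρ j) + ρ' j • g (x + ρ j) := fun j => by
      rw [hU', piBCF_apply]
      rfl
    rw [quadB_apply]
    conv_lhs => rw [← Finset.univ_sum_single (U' x)]
    rw [map_sum]
    refine Finset.sum_congr rfl fun j _ => ?_
    rw [ha' j, nemD_apply, fderiv_pderiv_apply hd2, hs]
    rw [Finset.univ_sum_single (U' x)]
  set A := jacB hf ρ (toBCF y.1) with hA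
  have hl : derRhs ρ A y'.2 ρ' a' X
      (-∑ j, (ρ' j • (mulOp ℝ d (a' j) (shift ℝ (ρ j) g) +
        mulOp ℝ d (A j) (shift ℝ (ρ j) X + ρ' j • shift ℝ (ρ j) W)) +
        ρ'' j • mulOp ℝ d (A j) (shift ℝ (ρ j) g))) y' X x =
      y'.2 • X x + -(∑ j, (a' j x (y'.1.fn (x + ρ j)) + ρ' j • A j x (X (x + ρ j)))) + y'.2 • X x +
      -∑ j, (ρ' j • (a' j x (g (x + ρ j)) + A j x (X (x + ρ j) + ρ' j • W (x + ρ j))) +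
        ρ'' j • A j x (g (x + ρ j))) := by
    rw [derRhs, BoundedContinuousFunction.add_apply, BoundedContinuousFunction.add_apply,
      BoundedContinuousFunction.add_apply, BoundedContinuousFunction.neg_apply,
      BoundedContinuousFunction.neg_apply, BoundedContinuousFunction.sum_apply,
      BoundedContinuousFunction.sum_apply]
    rfl
  have hr : waveRhs₂ hd hf h2c ρ ρ' ρ'' y y'.2 (toBCF y'.1) X W x =
      (2 * y'.2) • X x - ∑ j, a' j x (y'.1.fn (x + ρ j) + ρ' j • g (x + ρ j))
      - ∑ j, ρ' j ^ 2 • A j x (W (x + ρ j)) - ∑ j, ρ'' j • A j x (g (x + ρ j))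
      - (2 : ℝ) • ∑ j, ρ' j • A j x (X (x + ρ j)) := by
    rw [← hq, ← wtL_apply, ← wtL_apply, ← wtL_apply]
    rfl
  rw [hl, hr, Finset.smul_sum]
  have key : ∑ j, (a' j x (y'.1.fn (x + ρ j)) + ρ' j • A j x (X (x + ρ j))) +
      ∑ j, (ρ' j • (a' j x (g (x + ρ j)) + A j x (X (x + ρ j) + ρ' j • W (x + ρ j))) +
        ρ'' j • A j x (g (x + ρ j))) =
      ∑ j, a' j x (y'.1.fn (x + ρ j) + ρ' j • g (x + ρ j)) +
      ∑ j, ρ' j ^ 2 • A j x (W (x + ρ j)) + ∑ j, ρ'' j • A j x (g (x + ρ j)) +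
      ∑ j, (2 : ℝ) • ρ' j • A j x (X (x + ρ j)) := by
    simp only [← Finset.sum_add_distrib]
    refine Finset.sum_congr rfl fun j _ => ?_
    simp only [map_add, map_smul]
    module
  linear_combination (norm := module) -key

/-- The second parameter derivative of a family of waves solves a bordered linear equation. -/
theorem WaveFam.hasDerivAt_deriv (H : WaveFam hd hf ρ I l m y) (h2 : ContDiff ℝ 2 f)
    (h2c : Continuous (fderiv ℝ (fderiv ℝ f))) {ρ' : ℝ → Fin 5 → ℝ}
    (hρ' : ∀ φ j, HasDerivAt (fun φ => ρ φ j) (ρ' φ j) φ)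
    (hρk : ∀ (k : ℕ) j, ContDiff ℝ k fun φ => ρ' φ j) (hφ : φ ∈ I) {ρ'' : Fin 5 → ℝ}
    (hρ'' : ∀ j, HasDerivAt (fun φ => ρ' φ j) (ρ'' j) φ) {W : ℝ →ᵇ (Fin d → ℝ)}
    (hW : ∀ x, HasDerivAt (waveDer hd.continuous (ρ φ) (y φ)) (W x) x) {y' : W1inf ℝ d × ℝ}
    (hy' : HasDerivAt y y' φ) :
    ∃ (y'' : W1inf ℝ d × ℝ) (X : ℝ →ᵇ (Fin d → ℝ)), HasDerivAt (deriv y) y'' φ ∧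
      derCLM y'.1 = bcfToLinf X ∧
      BordSol (y φ).2 (ρ φ) (jacB hf (ρ φ) (toBCF (y φ).1)) (waveDer hd.continuous (ρ φ) (y φ)) l
        (waveRhs₂ hd hf h2c (ρ φ) (ρ' φ) ρ'' (y φ) y'.2 (toBCF y'.1) X W) y'' := by
  obtain ⟨h1, hV⟩ := H.smooth hρ' hρk 1 (h2.of_le (by norm_num))
  have hρ1 : ∀ j, ContDiffOn ℝ (1 : ℕ) (fun φ => ρ φ j) I := fun j => by
    have : ContDiff ℝ (1 : ℕ) (fun φ => ρ φ j) := by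
      push_cast
      refine contDiff_one_iff_deriv.2 ⟨fun φ => (hρ' φ j).differentiableAt, ?_⟩
      rw [show (deriv fun φ => ρ φ j) = fun φ => ρ' φ j from funext fun φ => (hρ' φ j).deriv]
      exact (hρk 0 j).continuous
    exact this.contDiffOn
  have L := H.linFam (k := 1) h2 hρ1 h1 hV
  have key : ∀ φ ∈ I, BordSol (y φ).2 (ρ φ)
      (jacB hf (ρ φ) (toBCF (y φ).1)) (waveDer hd.continuous (ρ φ) (y φ)) l
      (waveRhs hd.continuous hf (ρ φ) (ρ' φ) (y φ)) (deriv y φ) := by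
    intro φ hφ
    obtain ⟨y', hy1, hy2⟩ := H.hasDerivAt hφ (hρ' φ)
    rw [hy1.deriv]
    exact hy2
  have hy1 : deriv y φ = y' := hy'.deriv
  have hV' : HasDerivAt (fun φ => toBCF (y φ).1) (toBCF y'.1) φ :=
    ((toBCF (𝕜 := ℝ) (d := d)).comp
      (ContinuousLinearMap.fst ℝ (W1inf ℝ d) ℝ)).hasFDerivAt.comp_hasDerivAt φ hy'
  have hs : ∀ j, HasDerivAt (fun φ => shift ℝ (ρ φ j) (toBCF (y φ).1))
      (shift ℝ (ρ φ j) (toBCF y'.1) +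
        ρ' φ j • shift ℝ (ρ φ j) (waveDer hd.continuous (ρ φ) (y φ))) φ := fun j =>
    hV.hasDerivAt_shift H.isOpen hφ hV' (H.hasDerivAt_space hφ) (hρ' φ j)
  have ha : ∀ j, HasDerivAt (fun φ => jacB hf (ρ φ) (toBCF (y φ).1) j)
      (nemD (pderiv f j) (continuous_fderiv_pderiv h2 j) (stencilB (ρ φ) (toBCF (y φ).1))
        (piBCF fun j => shift ℝ (ρ φ j) (toBCF y'.1) +
          ρ' φ j • shift ℝ (ρ φ j) (waveDer hd.continuous (ρ φ) (y φ)))) φ := fun j =>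
    (hasFDerivAt_nem ((contDiff_pderiv (k := 1) h2 j).differentiable (by simp))
      (continuous_fderiv_pderiv h2 j) _).comp_hasDerivAt φ (hasDerivAt_piBCF hs)
  -- the spatial derivative of `∂_φ V` is the `φ`-derivative of the spatial derivative of `V`
  obtain ⟨-, hg⟩ := L.border.exists_deriv H.isOpen
  have hX : derCLM y'.1 = bcfToLinf (deriv (fun φ => waveDer hd.continuous (ρ φ) (y φ)) φ) := by
    have h3 : HasDerivAt (fun φ => derCLM (y φ).1) (derCLM y'.1) φ :=
      ((derCLM (𝕜 := ℝ) (d := d)).comp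
        (ContinuousLinearMap.fst ℝ (W1inf ℝ d) ℝ)).hasFDerivAt.comp_hasDerivAt φ hy'
    have h4 := bcfToLinf.hasFDerivAt.comp_hasDerivAt φ (hg φ hφ)
    refine h3.unique (h4.congr_of_eventuallyEq ?_)
    exact (H.isOpen.eventually_mem hφ).mono fun ψ hψ => H.derCLM_eq hψ
  set X := deriv (fun φ => waveDer hd.continuous (ρ φ) (y φ)) φ with hXdef
  have hXs : spaceDer (y φ).2 (ρ φ) (jacB hf (ρ φ) (toBCF (y φ).1))
      (waveDer hd.continuous (ρ φ) (y φ)) (waveRhs hd.continuous hf (ρ φ) (ρ' φ) (y φ))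
      (deriv y φ) = X := by
    refine bcfToLinf_injective ?_
    rw [← derCLM_eq_spaceDer (H.speed_ne φ hφ) (key φ hφ), hy1, hX]
  have hgs : ∀ j, HasDerivAt (fun φ => shift ℝ (ρ φ j) (waveDer hd.continuous (ρ φ) (y φ)))
      (shift ℝ (ρ φ j) X + ρ' φ j • shift ℝ (ρ φ j) W) φ := fun j =>
    L.border.hasDerivAt_shift H.isOpen hφ (hg φ hφ) hW (hρ' φ j)
  have hh := (HasDerivAt.fun_sum (u := Finset.univ) fun j _ =>
    hasDerivAt_smul_mulOp (hρ'' j) (ha j) (hgs j)).neg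
  have hc : HasDerivAt (fun φ => (y φ).2) y'.2 φ :=
    (ContinuousLinearMap.snd ℝ (W1inf ℝ d) ℝ).hasFDerivAt.comp_hasDerivAt φ hy'
  obtain ⟨y'', h5, h6⟩ := LinFam.hasDerivAt (k := 0) L
    (LinFam.smoothTr_waveRhs (hd := hd) L fun j => (hρk 1 j).contDiffOn) key hφ hc (hρ' φ) ha
    (hg φ hφ) hh
  refine ⟨y'', X, h5, hX, ?_⟩
  rw [hXs, hy1] at h6
  rwa [derRhs_eq_waveRhs₂ (hd := hd) (hf := hf) h2 h2c (ρ φ) (ρ' φ) ρ'' (y φ) y' X W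
    fun j => rfl] at h6

end Second

end LatticeWave

namespace LatticeWave

/-! ### Rotated waves -/

variable {d : ℕ} {f : (Fin 5 → Fin d → ℝ) → Fin d → ℝ} {σA σB : ℤ} {cs : ℝ}
  {r : ℕ} {um up : Fin d → ℝ} {Φ : ℝ →ᵇ (Fin d → ℝ)}

/-- The shifts of the stencil `τ_φ`: the lattice vectors `(r_j, s_j)` in the direction of
propagation `(cos φ, sin φ)`. -/
def rotS (σA σB : ℤ) (φ : ℝ) (j : Fin 5) : ℝ :=
  shiftN σA σB j * Real.cos φ + shiftL σA σB j * Real.sin φ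

/-- The derivative of `rotS` with respect to the angle. -/
def rotS' (σA σB : ℤ) (φ : ℝ) (j : Fin 5) : ℝ :=
  -(shiftN σA σB j * Real.sin φ) + shiftL σA σB j * Real.cos φ

theorem rotS_zero : rotS σA σB 0 = rN σA σB := by
  funext j
  simp [rotS, rN]

theorem rotS'_zero : rotS' σA σB 0 = fun j => (shiftL σA σB j : ℝ) := by
  funext j
  simp [rotS']

theorem hasDerivAt_rotS (φ : ℝ) (j : Fin 5) :
    HasDerivAt (fun φ => rotS σA σB φ j) (rotS' σA σB φ j) φ := by
  have h := ((Real.hasDerivAt_cos φ).const_mul (shiftN σA σB j : ℝ)).add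
    ((Real.hasDerivAt_sin φ).const_mul (shiftL σA σB j : ℝ))
  refine h.congr_deriv ?_
  rw [rotS']
  ring

theorem hasDerivAt_rotS' (φ : ℝ) (j : Fin 5) :
    HasDerivAt (fun φ => rotS' σA σB φ j) (-rotS σA σB φ j) φ := by
  have h := ((Real.hasDerivAt_sin φ).const_mul (shiftN σA σB j : ℝ)).neg.add
    ((Real.hasDerivAt_cos φ).const_mul (shiftL σA σB j : ℝ))
  refine h.congr_deriv ?_
  rw [rotS]
  ring

theorem contDiff_rotS' (k : ℕ) (j : Fin 5) : ContDiff ℝ k fun φ => rotS' σA σB φ j := by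
  unfold rotS'
  exact (contDiff_const.mul Real.contDiff_sin).neg.add (contDiff_const.mul Real.contDiff_cos)

theorem rotStencil_eq (φ : ℝ) (p : ℝ → Fin d → ℝ) (ξ : ℝ) :
    rotStencil σA σB φ p ξ = fun j => p (ξ + rotS σA σB φ j) := by
  have h1 : sigmaStar σA σB * Real.cos (φ + zetaStar σA σB) =
      σA * Real.cos φ - σB * Real.sin φ := by
    rw [Real.cos_add, ← sigmaStar_mul_cos σA σB, ← sigmaStar_mul_sin σA σB]
    ring
  have h2 : sigmaStar σA σB * Real.sin (φ + zetaStar σA σB) =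
      σB * Real.cos φ + σA * Real.sin φ := by
    rw [Real.sin_add, ← sigmaStar_mul_cos σA σB, ← sigmaStar_mul_sin σA σB]
    ring
  rw [rotStencil, h1, h2]
  funext j
  fin_cases j <;> simp [rotS, shiftN, shiftL] <;> ring_nf

theorem solvesCrossLDE_of_solvesMFDE {φ c : ℝ} {p : ℝ → Fin d → ℝ}
    (hp : SolvesMFDE f σA σB φ c p) : SolvesCrossLDE f σA σB
      (fun t n l => p (n * Real.cos φ + l * Real.sin φ + c * t)) := by
  intro t n l
  set ξ := (n : ℝ) * Real.cos φ + l * Real.sin φ + c * t with hξ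
  have h1 : HasDerivAt (fun s : ℝ => (n : ℝ) * Real.cos φ + l * Real.sin φ + c * s) c t := by
    simpa using ((hasDerivAt_id t).const_mul c).const_add ((n : ℝ) * Real.cos φ + l * Real.sin φ)
  have h2 := HasDerivAt.scomp (h := fun s : ℝ => (n : ℝ) * Real.cos φ + l * Real.sin φ + c * s) t
    (hp ξ).1.hasDerivAt h1
  rw [(hp ξ).2, rotStencil_eq] at h2
  refine h2.congr_deriv (congrArg f ?_)
  funext j
  fin_cases j <;> simp [rotS, shiftN, shiftL, hξ] <;> ring_nf

theorem WaveFam.solvesMFDE {hd : Differentiable ℝ f} {hf : Continuous (fderiv ℝ f)} {I : Set ℝ}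
    {l : W1inf ℝ d →L[ℝ] ℝ} {m : ℝ} {y : ℝ → W1inf ℝ d × ℝ} {φ : ℝ}
    (H : WaveFam hd hf (rotS σA σB) I l m y) (hφ : φ ∈ I) :
    SolvesMFDE f σA σB φ (y φ).2 (y φ).1.fn := by
  intro ξ
  have h1 := H.hasDerivAt_space hφ ξ
  refine ⟨h1.differentiableAt, ?_⟩
  rw [show deriv (y φ).1.fn ξ = _ from h1.deriv, waveDer, rotStencil_eq]
  change (y φ).2 • (y φ).2⁻¹ • f (stencilB (rotS σA σB φ) (toBCF (y φ).1) ξ) = _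
  rw [smul_inv_smul₀ (H.speed_ne φ hφ), stencilB_apply]
  rfl

theorem ae_eq_shift {p q : ℝ → Fin d → ℝ} (h : p =ᵐ[volume] q) (t : ℝ) :
    ∀ᵐ x, p (x + t) = q (x + t) :=
  (measurePreserving_add_right volume t).quasiMeasurePreserving.ae h

theorem opA_eq_wtL (hf : Continuous (fderiv ℝ f)) (k : ℕ) (p : ℝ →ᵇ (Fin d → ℝ)) :
    opA f σA σB Φ k p = wtL (fun j => (shiftL σA σB j : ℝ) ^ k) (rN σA σB)
      (jacB hf (rN σA σB) Φ) p := by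
  funext x
  rw [wtL_apply, opA]
  refine Finset.sum_congr rfl fun j _ => ?_
  rw [jacB_apply, pderiv_apply]
  rfl

theorem opA_ae_eq {k : ℕ} {p q : ℝ → Fin d → ℝ} (h : p =ᵐ[volume] q) :
    opA f σA σB Φ k p =ᵐ[volume] opA f σA σB Φ k q := by
  filter_upwards [ae_all_iff.2 fun j => ae_eq_shift h (shiftN σA σB j)] with x hx
  simp only [opA, hx]

theorem opB_eq_wtL (hf : Continuous (fderiv ℝ f)) (p : ℝ →ᵇ (Fin d → ℝ)) :
    opB f σA σB Φ p = wtL (fun j => -rN σA σB j) (rN σA σB) (jacB hf (rN σA σB) Φ) p := by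
  funext x
  rw [wtL_apply, opB]
  refine Finset.sum_congr rfl fun j _ => ?_
  rw [jacB_apply, pderiv_apply]
  congr 1
  fin_cases j <;> simp [rN, shiftN]

theorem pairing_congr_ae {ψ p q : ℝ → Fin d → ℝ} (h : p =ᵐ[volume] q) :
    pairing ψ p = pairing ψ q :=
  integral_congr_ae (h.mono fun x hx => by simp only [hx])

theorem pairing_bcf (ψ : W1inf ℝ d) (hψ : Integrable ψ.fn) (g : ℝ →ᵇ (Fin d → ℝ)) :
    pairing ψ.fn g = pairCLM ψ.fn hψ (W1inf.continuous_fn ψ) g :=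
  integral_congr_ae (Eventually.of_forall fun x => by simp only [star_trivial])

theorem BordSol.genL_eq {c : ℝ} {ρ : Fin 5 → ℝ} {a : Fin 5 → ℝ →ᵇ Mat ℝ d}
    {g h : ℝ →ᵇ (Fin d → ℝ)} {l : W1inf ℝ d →L[ℝ] ℝ} {y : W1inf ℝ d × ℝ}
    (hy : BordSol c ρ a g l h y) : genL c ρ a y.1 = bcfToLinf (h + y.2 • g) ∧ l y.1 = 0 := by
  rw [BordSol, bordOp_apply] at hy
  obtain ⟨h1, h2⟩ := Prod.mk.inj hy
  refine ⟨?_, h2⟩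
  rw [map_add, map_smul, ← h1]
  abel

theorem hasDerivAt_fst {X Y : Type*} [NormedAddCommGroup X] [NormedSpace ℝ X]
    [NormedAddCommGroup Y] [NormedSpace ℝ Y] {u : ℝ → X × Y} {u' : X × Y} {φ : ℝ}
    (hu : HasDerivAt u u' φ) : HasDerivAt (fun φ => (u φ).1) u'.1 φ :=
  (ContinuousLinearMap.fst ℝ X Y).hasFDerivAt.comp_hasDerivAt φ hu

theorem hasDerivAt_snd {X Y : Type*} [NormedAddCommGroup X] [NormedSpace ℝ X]
    [NormedAddCommGroup Y] [NormedSpace ℝ Y] {u : ℝ → X × Y} {u' : X × Y} {φ : ℝ}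
    (hu : HasDerivAt u u' φ) : HasDerivAt (fun φ => (u φ).2) u'.2 φ :=
  (ContinuousLinearMap.snd ℝ X Y).hasFDerivAt.comp_hasDerivAt φ hu

theorem hasDerivAt_eigen {X Y : Type*} [NormedAddCommGroup X] [NormedSpace ℂ X]
    [NormedAddCommGroup Y] [NormedSpace ℂ Y] {T : ℂ → X →L[ℂ] Y} {T' J : X →L[ℂ] Y} {lam : ℂ → ℂ}
    {u : ℂ → X} {lam' : ℂ} {u' : X} {z : ℂ} (hT : HasDerivAt T T' z) (hl : HasDerivAt lam lam' z)
    (hu : HasDerivAt u u' z) : HasDerivAt (fun z => T z (u z) - lam z • J (u z))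
      (T' (u z) + T z u' - (lam z • J u' + lam' • J (u z))) z :=
  (hT.clm_apply hu).sub (hl.smul (J.hasFDerivAt.comp_hasDerivAt z hu))

namespace IsWave

theorem opL_cplx_ae (h : IsWave r f um up σA σB cs Φ) {p : W1inf ℝ d} {G : ℝ →ᵇ (Fin d → ℝ)}
    (hp : genL cs (rN σA σB) (jacB h.hf (rN σA σB) Φ) p = bcfToLinf G) :
    opL f σA σB cs Φ 0 (cplx p.fn) (cplx p.der) =ᵐ[volume] cplx G := by
  obtain ⟨P, hP, hPd⟩ := W1inf.exists_cplx p
  have h1 := h.coe_genL_cplx hP hPd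
  rw [hp] at h1
  filter_upwards [h1, coe_Lz (σA := σA) (σB := σB) (cs := cs) h.hf Φ 0 P, hPd,
    coe_bcfToLinf G] with x h2 h3 h4 h5
  rw [h2, cplx_apply, h5] at h3
  rw [cplx_apply, h3]
  simp only [opL, h4, hP]

theorem pairCLM_eq_zero (h : IsWave r f um up σA σB cs Φ) {ψ : W1inf ℝ d}
    (hψi : Integrable ψ.fn)
    (hort : ∀ (p : W1inf ℂ d) (g : ℝ →ᵇ (Fin d → ℝ)), Lz h.hf σA σB cs Φ 0 p =ᵐ[volume] cplx g →
      ∫ x, ψ.fn x ⬝ᵥ g x = 0) {p : W1inf ℝ d} {G : ℝ →ᵇ (Fin d → ℝ)}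
    (hp : genL cs (rN σA σB) (jacB h.hf (rN σA σB) Φ) p = bcfToLinf G) :
    pairCLM ψ.fn hψi (W1inf.continuous_fn ψ) G = 0 := by
  obtain ⟨P, hP, hPd⟩ := W1inf.exists_cplx p
  refine hort P G ((h.coe_genL_cplx hP hPd).trans ?_)
  rw [hp]
  exact (coe_bcfToLinf G).mono fun x hx => by rw [cplx_apply, hx, cplx_apply]

/-- The first derivatives of the branch of waves and of any branch of eigenvalues agree: both solve
the same uniquely solvable bordered equation. -/
theorem eigenBranch_deriv (h : IsWave r f um up σA σB cs Φ) {ψ : W1inf ℝ d}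
    (hψi : Integrable ψ.fn) (hψ : pairing ψ.fn (deriv Φ) = 1) {δz : ℝ} {lam : ℂ → ℂ}
    {ph : ℂ → W1inf ℂ d} (hb : IsEigenBranch f σA σB cs Φ ψ δz lam ph) {p : W1inf ℝ d} {c₁ : ℝ}
    (hp : genL cs (rN σA σB) (jacB h.hf (rN σA σB) Φ) p = bcfToLinf
      (-wtL (fun j => (shiftL σA σB j : ℝ)) (rN σA σB) (jacB h.hf (rN σA σB) Φ) h.dPhi +
        c₁ • h.dPhi)) (hl : pairing ψ.fn p.fn = 0) :
    (c₁ : ℂ) = deriv lam 0 ∧ cplx p.fn = (deriv ph 0).fn := by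
  obtain ⟨hδ, hbr, hlam0, hph0, hlam, hph⟩ := hb
  obtain ⟨v, hv, hker⟩ := h.exists_kernel
  have hv0 : ph 0 = v := W1inf.ext_fn (by rw [hph0, hv, h.deriv_eq])
  have hbij := h.bijective_complex hψi hψ hv hker
  obtain ⟨P, hP, hPd⟩ := W1inf.exists_cplx p
  have h0 : (0 : ℂ) ∈ Metric.ball (0 : ℂ) δz := Metric.mem_ball_self hδ
  have hlam' := (hlam 0 h0).differentiableAt.hasDerivAt
  have hph' := (hph 0 h0).differentiableAt.hasDerivAt
  set T' : W1inf ℂ d →L[ℂ] Linf ℂ d := ∑ j, ((shiftL σA σB j : ℂ) *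
      Complex.exp (0 * (shiftL σA σB j : ℂ))) • partL h.hf σA σB Φ j with hT'
  have hball : ∀ᶠ z in 𝓝 (0 : ℂ), ‖z‖ < δz :=
    (Metric.isOpen_ball.eventually_mem h0).mono fun z hz => mem_ball_zero_iff.1 hz
  have hz : (fun z => Lz h.hf σA σB cs Φ z (ph z) - lam z • emb (ph z)) =ᶠ[𝓝 0] fun _ => 0 := by
    filter_upwards [hball] with z hz
    refine Lp.ext (EventuallyEq.trans ?_ (((hbr z hz).1 (ph z)).2 ⟨1, (one_smul _ _).symm⟩ |>.trans
      (Lp.coeFn_zero _ _ _).symm))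
    filter_upwards [Lp.coeFn_sub (Lz h.hf σA σB cs Φ z (ph z)) (lam z • emb (ph z)),
      Lp.coeFn_smul (lam z) (emb (ph z) : Linf ℂ d), coe_Lz (cs := cs) h.hf Φ z (ph z),
      coe_emb (ph z)] with x h1 h2 h3 h4
    rw [h1, Pi.sub_apply, h2, Pi.smul_apply, h3, h4]
    rfl
  have h1 := hasDerivAt_eigen (X := W1inf ℂ d) (J := emb)
    (hasDerivAt_Lz (σA := σA) (σB := σB) (cs := cs) h.hf Φ 0) hlam' hph'
  have h2 := h1.unique ((hasDerivAt_const (0 : ℂ) (0 : Linf ℂ d)).congr_of_eventuallyEq hz)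
  rw [← hT', hlam0, zero_smul, zero_add, hv0] at h2
  have hLP : Lz h.hf σA σB cs Φ 0 P = -T' v + (c₁ : ℂ) • emb v := by
    have e : T' v = bcfToLinf (∑ j, (shiftL σA σB j : ℂ) • mulOp ℂ d
        ((cxMat d).compLeftContinuousBounded ℝ (jacB h.hf (rN σA σB) Φ j))
        (shift ℂ (rN σA σB j) (toBCF v))) := by
      rw [hT', _root_.sum_apply, map_sum]
      refine Finset.sum_congr rfl fun j _ => ?_
      rw [zero_mul, Complex.exp_zero, mul_one, map_smul]
      rfl
    have e2 : -T' v + (c₁ : ℂ) • emb v = bcfToLinf (-(∑ j, (shiftL σA σB j : ℂ) • mulOp ℂ d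
        ((cxMat d).compLeftContinuousBounded ℝ (jacB h.hf (rN σA σB) Φ j))
        (shift ℂ (rN σA σB j) (toBCF v))) + (c₁ : ℂ) • toBCF v) := by
      rw [map_add, map_neg, map_smul, e]
      rfl
    rw [e2]
    refine Lp.ext ((h.coe_genL_cplx hP hPd).trans (EventuallyEq.trans ?_ (coe_bcfToLinf _).symm))
    rw [hp]
    filter_upwards [coe_bcfToLinf (-wtL (fun j => (shiftL σA σB j : ℝ)) (rN σA σB)
      (jacB h.hf (rN σA σB) Φ) h.dPhi + c₁ • h.dPhi)] with x hx
    have hvx : ∀ x : ℝ, (toBCF v : ℝ →ᵇ (Fin d → ℂ)) x = cvec (h.dPhi x) := fun x => by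
      rw [toBCF_apply, hv, cplx_apply]
    rw [cplx_apply, hx, BoundedContinuousFunction.add_apply, BoundedContinuousFunction.add_apply,
      BoundedContinuousFunction.neg_apply, BoundedContinuousFunction.neg_apply,
      BoundedContinuousFunction.sum_apply, wtL_apply]
    have e3 : ∀ j, ((shiftL σA σB j : ℂ) • mulOp ℂ d
        ((cxMat d).compLeftContinuousBounded ℝ (jacB h.hf (rN σA σB) Φ j))
        (shift ℂ (rN σA σB j) (toBCF v))) x =
        (shiftL σA σB j : ℂ) • cvec (jacB h.hf (rN σA σB) Φ j x (h.dPhi (x + rN σA σB j))) := by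
      intro j
      rw [← cxMat_cvec, ← hvx]
      rfl
    simp only [e3]
    rw [BoundedContinuousFunction.smul_apply, BoundedContinuousFunction.smul_apply, hvx]
    funext k
    simp [cvec]
  have hker0 : bordOp (Lz h.hf σA σB cs Φ 0) (emb v) (ellC ψ hψi)
      (P - deriv ph 0, (c₁ : ℂ) - deriv lam 0) = 0 := by
    have hlP : ellC ψ hψi P = 0 := by
      rw [ellC_apply, hP, pairing_cplx, hl, Complex.ofReal_zero]
    have hlph : ellC ψ hψi (deriv ph 0) = 0 := by
      have h3 : HasDerivAt (fun z => ellC ψ hψi (ph z)) (ellC ψ hψi (deriv ph 0)) 0 :=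
        (ellC ψ hψi).hasFDerivAt.comp_hasDerivAt (0 : ℂ) hph'
      refine h3.unique ((hasDerivAt_const (0 : ℂ) (1 : ℂ)).congr_of_eventuallyEq ?_)
      filter_upwards [hball] with z hz
      rw [ellC_apply, (hbr z hz).2.2]
    rw [bordOp_apply, map_sub, map_sub, hlP, hlph, sub_zero, hLP, sub_smul]
    refine Prod.ext ?_ rfl
    rw [Prod.fst_zero, ← sub_eq_zero.1 h2]
    simp only [neg_add_eq_sub, sub_sub, sub_self]
  have h4 := hbij.1 (hker0.trans (map_zero _).symm)
  obtain ⟨h5, h6⟩ := Prod.mk.inj h4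
  exact ⟨sub_eq_zero.1 h6, by rw [← hP, sub_eq_zero.1 h5]⟩

theorem waveDer_eq (h : IsWave r f um up σA σB cs Φ) {y : W1inf ℝ d × ℝ} (h1 : toBCF y.1 = Φ)
    (h2 : y.2 = cs) : waveDer h.fdiff.continuous (rN σA σB) y = h.dPhi := by
  rw [waveDer, h1, h2]
  rfl

theorem exists_rotated (h : IsWave r f um up σA σB cs Φ) {ψ : W1inf ℝ d}
    (hψi : Integrable ψ.fn) (hψ : pairing ψ.fn (deriv Φ) = 1) :
    ∃ δ > 0, ∃ y, WaveFam h.fdiff h.hf (rotS σA σB) (Set.Ioo (-δ) δ) (ellR ψ hψi)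
      (pairing ψ.fn Φ) y ∧ toBCF (y 0).1 = Φ ∧ (y 0).2 = cs := by
  obtain ⟨w, hw, hwd⟩ := h.exists_wave
  have hwB : toBCF w = Φ := DFunLike.coe_injective hw
  have h0 : waveF h.fdiff.continuous (rotS σA σB) (ellR ψ hψi) (pairing ψ.fn Φ)
      (0, (w, cs)) = 0 := by
    rw [waveF, stencilL_apply, hwB, rotS_zero, ellR_apply, hw, sub_self, hwd, dPhi, map_smul,
      smul_inv_smul₀ h.cs_ne, neg_add_cancel]
    rfl
  have hb : Function.Bijective (waveB h.hf (rotS σA σB 0) (ellR ψ hψi) (w, cs)) := by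
    have := h.bijective_real hψi hψ
    rwa [waveB, rotS_zero, hwB, hwd]
  obtain ⟨δ, hδ, y, hy0, hy⟩ := exists_waveFam h.fdiff h.hf
    (fun j => continuous_iff_continuousAt.2 fun φ => (hasDerivAt_rotS φ j).continuousAt) h0
    h.cs_ne hb
  exact ⟨δ, hδ, y, hy, by rw [hy0, hwB], by rw [hy0]⟩

end IsWave

end LatticeWave

namespace LatticeWave

/-! ### Expansion of the rotated waves -/

namespace IsWave

variable {d : ℕ} {f : (Fin 5 → Fin d → ℝ) → Fin d → ℝ} {σA σB : ℤ} {cs : ℝ}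
  {r : ℕ} {um up : Fin d → ℝ} {Φ : ℝ →ᵇ (Fin d → ℝ)}

theorem contDiff_two (h : IsWave r f um up σA σB cs Φ) : ContDiff ℝ 2 f :=
  h.contDiff.of_le (by exact_mod_cast h.hypF.1)

theorem continuous_fderiv_fderiv (h : IsWave r f um up σA σB cs Φ) :
    Continuous (fderiv ℝ (fderiv ℝ f)) :=
  (h.contDiff_two.fderiv_right (m := 1) (by norm_num)).continuous_fderiv (by simp)

/-- The inhomogeneity `-A₁ Φ'` in the equation for the first derivative of the rotated waves. -/
def rhs₁ (h : IsWave r f um up σA σB cs Φ) : ℝ →ᵇ (Fin d → ℝ) :=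
  -wtL (fun j => (shiftL σA σB j : ℝ)) (rN σA σB) (jacB h.hf (rN σA σB) Φ) h.dPhi

/-- The components `s_j Φ'(ξ + r_j) + V(ξ + r_j)`, with `V` the first derivative of the rotated
waves. -/
def quadArg (h : IsWave r f um up σA σB cs Φ) (V : ℝ →ᵇ (Fin d → ℝ)) :
    ℝ →ᵇ (Fin 5 → Fin d → ℝ) :=
  piBCF fun j => shift ℝ (rN σA σB j) V + (shiftL σA σB j : ℝ) • shift ℝ (rN σA σB j) h.dPhi

/-- The inhomogeneity in the equation for the second derivative of the rotated waves; `c'` and `V`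
are the first derivatives of the speed and of the wave, and `X` is the spatial derivative of
`V`. -/
def rhs₂ (h : IsWave r f um up σA σB cs Φ) (c' : ℝ) (V X : ℝ →ᵇ (Fin d → ℝ)) : ℝ →ᵇ (Fin d → ℝ) :=
  (2 * c') • X - quadB h.continuous_fderiv_fderiv (stencilB (rN σA σB) Φ) (h.quadArg V)
    - wtL (fun j => (shiftL σA σB j : ℝ) ^ 2) (rN σA σB) (jacB h.hf (rN σA σB) Φ) h.ddPhi
    - wtL (fun j => -rN σA σB j) (rN σA σB) (jacB h.hf (rN σA σB) Φ) h.dPhi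
    - (2 : ℝ) • wtL (fun j => (shiftL σA σB j : ℝ)) (rN σA σB) (jacB h.hf (rN σA σB) Φ) X

theorem opA_one (h : IsWave r f um up σA σB cs Φ) (p : ℝ →ᵇ (Fin d → ℝ)) :
    opA f σA σB Φ 1 p =
      wtL (fun j => (shiftL σA σB j : ℝ)) (rN σA σB) (jacB h.hf (rN σA σB) Φ) p := by
  rw [opA_eq_wtL h.hf]
  simp only [pow_one]

theorem quadTerm_eq (h : IsWave r f um up σA σB cs Φ) (p : W1inf ℝ d) :
    quadTerm f σA σB Φ p.fn =
      quadB h.continuous_fderiv_fderiv (stencilB (rN σA σB) Φ) (h.quadArg (toBCF p)) := by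
  funext x
  have h1 : h.quadArg (toBCF p) x =
      fun j => (shiftL σA σB j : ℝ) • stencil σA σB (deriv Φ) x j + stencil σA σB p.fn x j := by
    funext j
    rw [quadArg, piBCF_apply, add_comm, h.deriv_eq]
    rfl
  rw [quadTerm, quadB_apply, h1, stencilB_apply]
  rfl

variable {ψ : W1inf ℝ d} {I : Set ℝ} {l : W1inf ℝ d →L[ℝ] ℝ} {m : ℝ} {y : ℝ → W1inf ℝ d × ℝ}

theorem bordSol_one (h : IsWave r f um up σA σB cs Φ)
    (H : WaveFam h.fdiff h.hf (rotS σA σB) I l m y) (h0 : (0 : ℝ) ∈ I) (hV : toBCF (y 0).1 = Φ)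
    (hc : (y 0).2 = cs) : ∃ y' : W1inf ℝ d × ℝ, HasDerivAt y y' 0 ∧
      BordSol cs (rN σA σB) (jacB h.hf (rN σA σB) Φ) h.dPhi l h.rhs₁ y' := by
  obtain ⟨y', h1, h2⟩ := H.hasDerivAt h0 (hasDerivAt_rotS 0)
  refine ⟨y', h1, ?_⟩
  have e : waveRhs h.fdiff.continuous h.hf (rN σA σB) (fun j => (shiftL σA σB j : ℝ)) (y 0) =
      h.rhs₁ := by
    rw [waveRhs, h.waveDer_eq hV hc, hV]
    rfl
  rwa [rotS_zero, rotS'_zero, e, h.waveDer_eq hV hc, hV, hc] at h2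

theorem bordSol_two (h : IsWave r f um up σA σB cs Φ)
    (H : WaveFam h.fdiff h.hf (rotS σA σB) I l m y) (h0 : (0 : ℝ) ∈ I) (hV : toBCF (y 0).1 = Φ)
    (hc : (y 0).2 = cs) {y' : W1inf ℝ d × ℝ} (hy' : HasDerivAt y y' 0) :
    ∃ (y'' : W1inf ℝ d × ℝ) (X : ℝ →ᵇ (Fin d → ℝ)), HasDerivAt (deriv y) y'' 0 ∧
      derCLM y'.1 = bcfToLinf X ∧
      BordSol cs (rN σA σB) (jacB h.hf (rN σA σB) Φ) h.dPhi l
        (h.rhs₂ y'.2 (toBCF y'.1) X) y'' := by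
  have hW : ∀ x, HasDerivAt (waveDer h.fdiff.continuous (rotS σA σB 0) (y 0)) (h.ddPhi x) x := by
    rw [rotS_zero, h.waveDer_eq hV hc]
    exact h.hasDerivAt_dPhi
  obtain ⟨y'', X, h1, h2, h3⟩ := H.hasDerivAt_deriv h.contDiff_two h.continuous_fderiv_fderiv
    hasDerivAt_rotS contDiff_rotS' h0 (hasDerivAt_rotS' 0) hW hy'
  refine ⟨y'', X, h1, h2, ?_⟩
  have e : waveRhs₂ h.fdiff h.hf h.continuous_fderiv_fderiv (rN σA σB)
      (fun j => (shiftL σA σB j : ℝ)) (fun j => -rN σA σB j) (y 0) y'.2 (toBCF y'.1) X h.ddPhi =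
      h.rhs₂ y'.2 (toBCF y'.1) X := by
    rw [waveRhs₂, h.waveDer_eq hV hc, hV]
    rfl
  rwa [rotS_zero, rotS'_zero, e, h.waveDer_eq hV hc, hV, hc] at h3

/-- The solvability condition: pairing the equation `𝓛_0 p = h + γ Φ'` with `ψ` determines `γ`. -/
theorem eq_neg_pairing (h : IsWave r f um up σA σB cs Φ) (hψi : Integrable ψ.fn)
    (hψ : pairing ψ.fn (deriv Φ) = 1)
    (hort : ∀ (p : W1inf ℂ d) (g : ℝ →ᵇ (Fin d → ℝ)), Lz h.hf σA σB cs Φ 0 p =ᵐ[volume] cplx g →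
      ∫ x, ψ.fn x ⬝ᵥ g x = 0) {y : W1inf ℝ d × ℝ} {g : ℝ →ᵇ (Fin d → ℝ)}
    (hy : BordSol cs (rN σA σB) (jacB h.hf (rN σA σB) Φ) h.dPhi l g y) :
    y.2 = -pairCLM ψ.fn hψi (W1inf.continuous_fn ψ) g := by
  have h1 := h.pairCLM_eq_zero hψi hort hy.genL_eq.1
  rw [map_add, map_smul, ← pairing_bcf ψ hψi h.dPhi, ← h.deriv_eq, hψ, smul_eq_mul, mul_one] at h1
  linarith

end IsWave

end LatticeWave

end

theorem mainTheorem9 (d r : ℕ) (f : (Fin 5 → Fin d → ℝ) → Fin d → ℝ) (um up : Fin d → ℝ)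
    (σA σB : ℤ) (hσ : Int.gcd σA σB = 1) (cs : ℝ) (Φs : ℝ → Fin d → ℝ)
    (hf : HypF r f um up) (hΦ : HypPhi r f um up σA σB cs Φs)
    (hS1 : HypS1 f um up σA σB cs) (hS2 : HypS2 f σA σB cs Φs) (hS3 : HypS3 f σA σB cs Φs) :
    ∃ ψ : W1inf ℝ d, IsPsiStar f σA σB cs Φs ψ ∧ Integrable ψ.fn ∧
      (∃ (δz : ℝ) (lam : ℂ → ℂ) (ph : ℂ → W1inf ℂ d),
        IsEigenBranch f σA σB cs Φs ψ δz lam ph) ∧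
      ∃ δ : ℝ, 0 < δ ∧ ∃ (c : ℝ → ℝ) (Φ : ℝ → W1inf ℝ d),
        -- the waves
        (∀ φ ∈ Set.Ioo (-δ) δ,
          SolvesMFDE f σA σB φ (c φ) (Φ φ).fn ∧
          SolvesCrossLDE f σA σB
            (fun t n l => (Φ φ).fn (n * Real.cos φ + l * Real.sin φ + c φ * t))) ∧
        -- smoothness
        ContDiffOn ℝ (r - 1 : ℕ) c (Set.Ioo (-δ) δ) ∧
        ContDiffOn ℝ (r - 1 : ℕ) Φ (Set.Ioo (-δ) δ) ∧
        c 0 = cs ∧ (Φ 0).fn = Φs ∧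
        -- normalization
        (∀ φ ∈ Set.Ioo (-δ) δ, pairing ψ.fn (Φ φ).fn = pairing ψ.fn Φs) ∧
        -- first and second derivatives at `φ = 0`
        ∃ (c₁ c₂ : ℝ) (Φ₁ Φ₂ : W1inf ℝ d),
          HasDerivAt c c₁ 0 ∧ HasDerivAt Φ Φ₁ 0 ∧
          HasDerivAt (deriv c) c₂ 0 ∧ HasDerivAt (deriv Φ) Φ₂ 0 ∧
          (∀ (δz : ℝ) (lam : ℂ → ℂ) (ph : ℂ → W1inf ℂ d),
            IsEigenBranch f σA σB cs Φs ψ δz lam ph →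
              (c₁ : ℂ) = deriv lam 0 ∧ cplx Φ₁.fn = (deriv ph 0).fn) ∧
          opL f σA σB cs Φs 0 (cplx Φ₁.fn) (cplx Φ₁.der) =ᵐ[volume]
            cplx (-opA f σA σB Φs 1 (deriv Φs) + c₁ • deriv Φs) ∧
          opL f σA σB cs Φs 0 (cplx Φ₂.fn) (cplx Φ₂.der) =ᵐ[volume]
            cplx (c₂ • deriv Φs + (2 * c₁) • Φ₁.der
              - quadTerm f σA σB Φs Φ₁.fn
              - opA f σA σB Φs 2 (deriv (deriv Φs))
              - opB f σA σB Φs (deriv Φs)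
              - (2 : ℝ) • opA f σA σB Φs 1 Φ₁.der) ∧
          c₁ = pairing ψ.fn (opA f σA σB Φs 1 (deriv Φs)) ∧
          c₂ = pairing ψ.fn (quadTerm f σA σB Φs Φ₁.fn)
            + pairing ψ.fn (opA f σA σB Φs 2 (deriv (deriv Φs)))
            + pairing ψ.fn (opB f σA σB Φs (deriv Φs))
            + 2 * pairing ψ.fn (opA f σA σB Φs 1 Φ₁.der)
            - 2 * c₁ * pairing ψ.fn Φ₁.der := by
  obtain ⟨Φ, rfl⟩ := LatticeWave.exists_bcf_of_tendsto hΦ.2.1.continuous hΦ.2.2.2.1 hΦ.2.2.2.2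
  have h : LatticeWave.IsWave r f um up σA σB cs Φ := ⟨hf, hΦ, hS1, hS2, hS3⟩
  obtain ⟨ψ, hψs, hψi, hort⟩ := h.exists_psi
  have hψ := hψs.2
  refine ⟨ψ, hψs, hψi, h.exists_eigenBranch hψi hψ, ?_⟩
  obtain ⟨δ, hδ, y, H, hV0, hc0⟩ := h.exists_rotated hψi hψ
  have h0 : (0 : ℝ) ∈ Set.Ioo (-δ) δ := ⟨neg_lt_zero.2 hδ, hδ⟩
  have hsm := (H.smooth LatticeWave.hasDerivAt_rotS LatticeWave.contDiff_rotS' r h.contDiff).1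
  have hsm' : ContDiffOn ℝ (r - 1 : ℕ) y (Set.Ioo (-δ) δ) :=
    hsm.of_le (by exact_mod_cast r.sub_le 1)
  have hyd : ∀ φ ∈ Set.Ioo (-δ) δ, HasDerivAt y (deriv y φ) φ := fun φ hφ =>
    ((hsm.differentiableOn (by
      have := hf.1
      exact_mod_cast (by omega : r ≠ 0))).differentiableAt (isOpen_Ioo.mem_nhds hφ)).hasDerivAt
  have hfst := fun {u u' φ} =>
    LatticeWave.hasDerivAt_fst (X := W1inf ℝ d) (Y := ℝ) (u := u) (u' := u') (φ := φ)
  have hsnd := fun {u u' φ} =>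
    LatticeWave.hasDerivAt_snd (X := W1inf ℝ d) (Y := ℝ) (u := u) (u' := u') (φ := φ)
  obtain ⟨y', hy', hb'⟩ := h.bordSol_one H h0 hV0 hc0
  obtain ⟨y'', X, hy'', hX, hb''⟩ := h.bordSol_two H h0 hV0 hc0 hy'
  have hl' : pairing ψ.fn y'.1.fn = 0 := by
    rw [← LatticeWave.ellR_apply ψ hψi]
    exact hb'.genL_eq.2
  have hder : y'.1.der =ᵐ[volume] X := by
    have h1 := LatticeWave.coe_bcfToLinf X
    rwa [← hX] at h1
  refine ⟨δ, hδ, fun φ => (y φ).2, fun φ => (y φ).1, fun φ hφ =>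
    ⟨H.solvesMFDE hφ, LatticeWave.solvesCrossLDE_of_solvesMFDE (H.solvesMFDE hφ)⟩,
    contDiff_snd.comp_contDiffOn hsm', contDiff_fst.comp_contDiffOn hsm', hc0,
    congrArg DFunLike.coe hV0, fun φ hφ => ?_, y'.2, y''.2, y'.1, y''.1, hsnd hy', hfst hy',
    (hsnd hy'').congr_of_eventuallyEq ?_, (hfst hy'').congr_of_eventuallyEq ?_,
    fun δz lam ph hbr => h.eigenBranch_deriv hψi hψ hbr hb'.genL_eq.1 hl', ?_, ?_, ?_, ?_⟩
  · rw [← LatticeWave.ellR_apply ψ hψi]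
    exact H.normalized hφ
  · exact (isOpen_Ioo.eventually_mem h0).mono fun φ hφ => (hsnd (hyd φ hφ)).deriv
  · exact (isOpen_Ioo.eventually_mem h0).mono fun φ hφ => (hfst (hyd φ hφ)).deriv
  · refine (h.opL_cplx_ae hb'.genL_eq.1).trans (Eventually.of_forall fun x => ?_)
    rw [h.deriv_eq, h.opA_one]
    rfl
  · refine (h.opL_cplx_ae hb''.genL_eq.1).trans ?_
    filter_upwards [hder, LatticeWave.opA_ae_eq (f := f) (σA := σA) (σB := σB) (Φ := Φ) (k := 1)
      hder] with x hx hx'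
    rw [h.deriv_eq, h.deriv_dPhi, h.quadTerm_eq, LatticeWave.opA_eq_wtL h.hf,
      LatticeWave.opB_eq_wtL h.hf, LatticeWave.cplx_apply, LatticeWave.cplx_apply]
    simp only [Pi.add_apply, Pi.sub_apply, Pi.smul_apply]
    rw [hx, hx', h.opA_one, add_comm, LatticeWave.IsWave.rhs₂]
    congr 1
    simp only [BoundedContinuousFunction.add_apply, BoundedContinuousFunction.sub_apply,
      BoundedContinuousFunction.smul_apply]
    abel
  · have h1 := h.eq_neg_pairing hψi hψ hort hb'
    rw [LatticeWave.IsWave.rhs₁, map_neg, neg_neg] at h1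
    rw [h.deriv_eq, h.opA_one, LatticeWave.pairing_bcf ψ hψi]
    exact h1
  · have h1 := h.eq_neg_pairing hψi hψ hort hb''
    rw [LatticeWave.IsWave.rhs₂, map_sub, map_sub, map_sub, map_sub, map_smul, map_smul,
      smul_eq_mul, smul_eq_mul] at h1
    rw [LatticeWave.pairing_congr_ae (LatticeWave.opA_ae_eq (f := f) (σA := σA) (σB := σB) (Φ := Φ)
      (k := 1) hder), LatticeWave.pairing_congr_ae hder, h.deriv_eq, h.deriv_dPhi, h.quadTerm_eq,
      h.opA_one, LatticeWave.opA_eq_wtL h.hf, LatticeWave.opB_eq_wtL h.hf]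
    simp only [LatticeWave.pairing_bcf ψ hψi]
    rw [h1]
    ring
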